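/- Let $(G\rightrightarrows M,\omega)$ be a symplectic groupoid: a Lie groupoid with source $s$ and target $t$ (finite-dimensional second countable manifolds, $M$ Hausdorff) and a symplectic form $\omega$ on $G$ with $m^*\omega=\mathrm{pr}_1^*\omega+\mathrm{pr}_2^*\omega$ on composable pairs; a product $gh$ is defined if $s(g)=t(h)$. Give $M$ the induced Poisson structure $\Pi$, for which $t$ is a Poisson map. The symplectic leaves of $M$ are the classes of points that can be joined by finitely many trajectories of Hamiltonian vector fields; a leaf $L$ of dimension $2n$ carries its symplectic form $\omega_L$ and the measure $\mathrm{vol}_L$ of the volume form $\omega_L^n$. A (positive) Casimir function is a function $c:M\to(0,\infty)$ that is constant on every symplectic leaf. A right Haar measure on $G$ is a family $(\mu_m)_{m\in M}$ of measures $\mu_m$ on the source fibres $s^{-1}(m)$, each with smooth strictly positive density in local coordinates of the fibre, which is invariant under right translations, i.e. $(h\mapsto hg)_*\mu_{t(g)}=\mu_{s(g)}$ for all $g\in G$, and smooth along the orbits of $G$: for $f\in C_c^\infty(G)$ and $m\in M$, the function $g\mapsto\int f\,d\mu_{t(g)}$ is smooth on $s^{-1}(m)$. (No regularity transverse to the leaves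 is required.) Left Haar measures are the mirror images of these, on the target fibres. Assume that all isotropy groups $G_x=s^{-1}(x)\cap t^{-1}(x)$ are unimodular. Consider choices $\eta=(\eta_x)_{x\in M}$ of bi-invariant Haar measures $\eta_x$ on $G_x$ such that $(k\mapsto gkg^{-1})_*\eta_{s(g)}=\eta_{t(g)}$ for every arrow $g$ whose end points lie in the same symplectic leaf. For $m\in M$ and $y$ in the orbit of $m$, let $\eta_{m,y}$ be the image of $\eta_y$ under $G_y\to s^{-1}(m)\cap t^{-1}(y)$, $k\mapsto kh$, for any arrow $h$ from $m$ to $y$, and $\eta_{m,y}=0$ if $y$ is not in the orbit of $m$. Call a family $(\mu_m)$ of measures on the source fibres canonical if, for some such $\eta$, $$\mu_m(A)=\int_L \eta_{m,y}(A)\,d\mathrm{vol}_L(y)$$ for all $m\in M$, all symplectic leaves $L$ and all Borel sets $A\subseteq t^{-1}(L)$. Define canonical families $(\nu_m)$ on the target fibres in the same way, with $s$ and $t$ interchanged and $k\mapsto hk$ for $h$ from $y$ to $m$. Then: 1. A canonical family $(\mu_m)$ on the source fibres exists, and every canonical family is a right Haar measure on $G$. 2. It is unique up to a Casimir function: if $\mu$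 is canonical, then the canonical families are exactly the families $\mu'_m=(c\circ t)\,\mu_m$ with $c$ a positive Casimir function. (If the source fibres are connected, this reads $\mu'_m=c(m)\,\mu_m$.) 3. Likewise, a canonical family on the target fibres exists, every one is a left Haar measure on $G$, and, $\nu$ being canonical, the canonical families are exactly the families $\nu'_m=(c\circ s)\,\nu_m$ with $c$ a positive Casimir function. Inversion $g\mapsto g^{-1}$ takes each canonical right Haar measure to a canonical left Haar measure. -/

import Mathlib

open MeasureTheory
open scoped Manifold ContDiff

section Patches

variable {E : Type*} [NormedAddCommGroup E] [NormedSpace ℝ E]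
  {N : Type*} [TopologicalSpace N] [ChartedSpace E N]

/-- A smooth injective immersion `φ : U → N` of an open set `U ⊆ ℝᵏ`, with image in `S`, whose
tangent spaces are given by `D`.  If `S` is an (immersed) submanifold of `N` with tangent spaces
`D`, then this is a local parametrisation of an open piece of `S`. -/
structure IsPatch (S : Set N) (D : (x : N) → Set (TangentSpace 𝓘(ℝ, E) x)) (k : ℕ)
    (U : Set (Fin k → ℝ)) (φ : (Fin k → ℝ) → N) : Prop where
  isOpen : IsOpen U
  contMDiffOn : ContMDiffOn 𝓘(ℝ, Fin k → ℝ) 𝓘(ℝ, E) ∞ φ U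
  injOn : Set.InjOn φ U
  mem : ∀ u ∈ U, φ u ∈ S
  injective_mfderiv : ∀ u ∈ U, Function.Injective (mfderiv 𝓘(ℝ, Fin k → ℝ) 𝓘(ℝ, E) φ u)
  range_mfderiv : ∀ u ∈ U, Set.range (mfderiv 𝓘(ℝ, Fin k → ℝ) 𝓘(ℝ, E) φ u) = D (φ u)

/-- The expression of a 2-form on a manifold in the preferred chart at `x₀`, i.e. its pullback
under the inverse of the chart. -/
noncomputable def chartForm (σ : (x : N) → (TangentSpace 𝓘(ℝ, E) x) [⋀^Fin 2]→L[ℝ] ℝ) (x₀ : N) :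
    E → E [⋀^Fin 2]→L[ℝ] ℝ := fun y =>
  (σ ((extChartAt 𝓘(ℝ, E) x₀).symm y)).compContinuousLinearMap
    (mfderiv 𝓘(ℝ, E) 𝓘(ℝ, E) (extChartAt 𝓘(ℝ, E) x₀).symm y)

/-- A nondegenerate 2-form on a finite-dimensional space identifies the space with its dual. -/
theorem existsUnique_dual_of_nondegenerate [FiniteDimensional ℝ E] (σ : E [⋀^Fin 2]→L[ℝ] ℝ)
    (h : ∀ X, (∀ Y, σ ![X, Y] = 0) → X = 0) (α : E →L[ℝ] ℝ) :
    ∃! X, ∀ Y, σ ![X, Y] = α Y := by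
  have add_left : ∀ X X' Y, σ ![X + X', Y] = σ ![X, Y] + σ ![X', Y] := fun X X' Y => by
    simpa using σ.toMultilinearMap.cons_add ![Y] X X'
  have smul_left : ∀ (c : ℝ) X Y, σ ![c • X, Y] = c * σ ![X, Y] := fun c X Y => by
    simpa using σ.toMultilinearMap.cons_smul ![Y] c X
  have swap : ∀ X Y, σ ![X, Y] = - σ ![Y, X] := fun X Y => by
    have := σ.toAlternatingMap.map_swap ![Y, X] (i := 0) (j := 1) (by simp)
    have e : ![Y, X] ∘ Equiv.swap (0 : Fin 2) 1 = ![X, Y] := by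
      funext i; fin_cases i <;> simp
    rw [e] at this
    simpa using this
  let B : E →ₗ[ℝ] Module.Dual ℝ E := LinearMap.mk₂ ℝ (fun X Y => σ ![X, Y]) add_left
    (fun c X Y => by simp [smul_left])
    (fun X Y Y' => by rw [swap, add_left, swap Y, swap Y']; ring)
    (fun c X Y => by rw [swap, smul_left, swap Y]; simp)
  have hB : Function.Injective B := by
    rw [injective_iff_map_eq_zero]
    exact fun X hX => h X fun Y => by simpa [B] using LinearMap.congr_fun hX Y
  have hs : Function.Surjective B :=
    (LinearMap.injective_iff_surjective_of_finrank_eq_finrank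
      (Subspace.dual_finrank_eq (K := ℝ) (V := E)).symm).1 hB
  obtain ⟨X, hX⟩ := hs α.toLinearMap
  refine ⟨X, fun Y => by simpa [B] using LinearMap.congr_fun hX Y, fun X' hX' => hB ?_⟩
  rw [hX]
  ext Y
  simpa [B] using hX' Y

end Patches

/-- A Lie groupoid `G ⇉ M` (`G` modelled on `E`, `M` modelled on `F`).  The product `mul g h`
(first `h`, then `g`) is meaningful when `src g = tgt h`, and its values elsewhere are never
used. -/
structure LieGroupoid (E F G M : Type*) [NormedAddCommGroup E] [NormedSpace ℝ E]
    [NormedAddCommGroup F] [NormedSpace ℝ F] [TopologicalSpace G] [ChartedSpace E G]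
    [TopologicalSpace M] [ChartedSpace F M] where
  src : G → M
  tgt : G → M
  unit : M → G
  inv : G → G
  mul : G → G → G
  src_unit : ∀ x, src (unit x) = x
  tgt_unit : ∀ x, tgt (unit x) = x
  src_inv : ∀ g, src (inv g) = tgt g
  tgt_inv : ∀ g, tgt (inv g) = src g
  src_mul : ∀ g h, src g = tgt h → src (mul g h) = src h
  tgt_mul : ∀ g h, src g = tgt h → tgt (mul g h) = tgt g
  mul_assoc : ∀ g h k, src g = tgt h → src h = tgt k → mul (mul g h) k = mul g (mul h k)
  unit_mul : ∀ g, mul (unit (tgt g)) g = g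
  mul_unit : ∀ g, mul g (unit (src g)) = g
  inv_mul : ∀ g, mul (inv g) g = unit (src g)
  mul_inv : ∀ g, mul g (inv g) = unit (tgt g)
  isSubmersion_src : Manifold.IsSubmersion 𝓘(ℝ, E) 𝓘(ℝ, F) ∞ src
  isSubmersion_tgt : Manifold.IsSubmersion 𝓘(ℝ, E) 𝓘(ℝ, F) ∞ tgt
  contMDiff_unit : ContMDiff 𝓘(ℝ, F) 𝓘(ℝ, E) ∞ unit
  contMDiff_inv : ContMDiff 𝓘(ℝ, E) 𝓘(ℝ, E) ∞ inv
  contMDiffOn_mul : ContMDiffOn (𝓘(ℝ, E).prod 𝓘(ℝ, E)) 𝓘(ℝ, E) ∞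
    (fun p : G × G => mul p.1 p.2) {p : G × G | src p.1 = tgt p.2}

/-- A symplectic groupoid: a Lie groupoid `G ⇉ M` with a symplectic form `ω` on `G` which is
multiplicative, i.e. `m^* ω = pr₁^* ω + pr₂^* ω` on the manifold of composable pairs.  (The
derivative `L` of the product within the set of composable pairs is uniquely determined on the
vectors tangent to that set, the pairs `(v, w)` with `ds v = dt w`.) -/
structure SymplecticGroupoid (E F G M : Type*) [NormedAddCommGroup E] [NormedSpace ℝ E]
    [NormedAddCommGroup F] [NormedSpace ℝ F] [TopologicalSpace G] [ChartedSpace E G]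
    [TopologicalSpace M] [ChartedSpace F M] extends LieGroupoid E F G M where
  form : (g : G) → (TangentSpace 𝓘(ℝ, E) g) [⋀^Fin 2]→L[ℝ] ℝ
  contDiffOn_form : ∀ g₀ : G,
    ContDiffOn ℝ ∞ (chartForm form g₀) (extChartAt 𝓘(ℝ, E) g₀).target
  closed_form : ∀ g₀ : G, ∀ y ∈ (extChartAt 𝓘(ℝ, E) g₀).target, extDeriv (chartForm form g₀) y = 0
  nondegenerate_form : ∀ (g : G) (X : TangentSpace 𝓘(ℝ, E) g),
    (∀ Y : TangentSpace 𝓘(ℝ, E) g, form g ![X, Y] = 0) → X = 0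
  multiplicative_form : ∀ g h : G, src g = tgt h →
    ∀ L : TangentSpace (𝓘(ℝ, E).prod 𝓘(ℝ, E)) (g, h) →L[ℝ] TangentSpace 𝓘(ℝ, E) (mul g h),
      HasMFDerivWithinAt (𝓘(ℝ, E).prod 𝓘(ℝ, E)) 𝓘(ℝ, E) (fun p : G × G => mul p.1 p.2)
        {p : G × G | src p.1 = tgt p.2} (g, h) L →
      ∀ (v v' : TangentSpace 𝓘(ℝ, E) g) (w w' : TangentSpace 𝓘(ℝ, E) h),
        (mfderiv 𝓘(ℝ, E) 𝓘(ℝ, F) src g v : F) = mfderiv 𝓘(ℝ, E) 𝓘(ℝ, F) tgt h w →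
        (mfderiv 𝓘(ℝ, E) 𝓘(ℝ, F) src g v' : F) = mfderiv 𝓘(ℝ, E) 𝓘(ℝ, F) tgt h w' →
        form (mul g h) ![L (v, w), L (v', w')] = form g ![v, v'] + form h ![w, w']

namespace LieGroupoid

variable {E F G M : Type*} [NormedAddCommGroup E] [NormedSpace ℝ E]
  [NormedAddCommGroup F] [NormedSpace ℝ F] [TopologicalSpace G] [ChartedSpace E G]
  [TopologicalSpace M] [ChartedSpace F M] (𝒢 : LieGroupoid E F G M)

/-- The isotropy group at `x`, with the topology and the Borel structure induced from `G`. -/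
def Isotropy (x : M) : Type _ := {g : G // 𝒢.src g = x ∧ 𝒢.tgt g = x}

instance (x : M) : TopologicalSpace (𝒢.Isotropy x) :=
  inferInstanceAs (TopologicalSpace {g : G // 𝒢.src g = x ∧ 𝒢.tgt g = x})

instance [MeasurableSpace G] (x : M) : MeasurableSpace (𝒢.Isotropy x) :=
  inferInstanceAs (MeasurableSpace {g : G // 𝒢.src g = x ∧ 𝒢.tgt g = x})

instance [MeasurableSpace G] [BorelSpace G] (x : M) : BorelSpace (𝒢.Isotropy x) :=
  inferInstanceAs (BorelSpace {g : G // 𝒢.src g = x ∧ 𝒢.tgt g = x})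

instance (x : M) : Group (𝒢.Isotropy x) where
  mul a b := ⟨𝒢.mul a.1 b.1,
    (𝒢.src_mul _ _ (a.2.1.trans b.2.2.symm)).trans b.2.1,
    (𝒢.tgt_mul _ _ (a.2.1.trans b.2.2.symm)).trans a.2.2⟩
  one := ⟨𝒢.unit x, 𝒢.src_unit x, 𝒢.tgt_unit x⟩
  inv a := ⟨𝒢.inv a.1, (𝒢.src_inv _).trans a.2.2, (𝒢.tgt_inv _).trans a.2.1⟩
  mul_assoc a b c := Subtype.ext
    (𝒢.mul_assoc _ _ _ (a.2.1.trans b.2.2.symm) (b.2.1.trans c.2.2.symm))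
  one_mul a := Subtype.ext (by
    have h := 𝒢.unit_mul a.1
    rw [a.2.2] at h
    exact h)
  mul_one a := Subtype.ext (by
    have h := 𝒢.mul_unit a.1
    rw [a.2.1] at h
    exact h)
  inv_mul_cancel a := Subtype.ext (by
    have h := 𝒢.inv_mul a.1
    rw [a.2.1] at h
    exact h)

/-- The isomorphism `k ↦ g k g⁻¹` of isotropy groups defined by an arrow `g`. -/
def conj (g : G) (k : 𝒢.Isotropy (𝒢.src g)) : 𝒢.Isotropy (𝒢.tgt g) :=
  ⟨𝒢.mul (𝒢.mul g k.1) (𝒢.inv g), by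
    have h₁ : 𝒢.src g = 𝒢.tgt k.1 := k.2.2.symm
    have h₂ : 𝒢.src (𝒢.mul g k.1) = 𝒢.tgt (𝒢.inv g) := by
      rw [𝒢.src_mul _ _ h₁, 𝒢.tgt_inv, k.2.1]
    exact ⟨by rw [𝒢.src_mul _ _ h₂, 𝒢.src_inv], by rw [𝒢.tgt_mul _ _ h₂, 𝒢.tgt_mul _ _ h₁]⟩⟩

/-- All isotropy groups are unimodular: left Haar measures are right invariant. -/
def IsotropyUnimodular [MeasurableSpace G] : Prop :=
  ∀ (x : M) (η : Measure (𝒢.Isotropy x)), η.IsHaarMeasure → η.IsMulRightInvariant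

/-- `μ m` is carried by the fibre `p⁻¹(m)` of the submersion `p`, and it is a smooth measure there:
in every local parametrisation of the fibre it has a smooth, strictly positive density with respect
to Lebesgue measure. -/
structure IsSmoothOnFibres [MeasurableSpace G] (p : G → M) (μ : M → Measure G) : Prop where
  support : ∀ m, μ m {g | p g ≠ m} = 0
  density : ∀ (m : M) (k : ℕ) (U : Set (Fin k → ℝ)) (φ : (Fin k → ℝ) → G),
    IsPatch (E := E) (p ⁻¹' {m}) (fun g => {v | mfderiv 𝓘(ℝ, E) 𝓘(ℝ, F) p g v = 0}) k U φ →
    ∃ ρ : (Fin k → ℝ) → ℝ, ContDiffOn ℝ ∞ ρ U ∧ (∀ u ∈ U, 0 < ρ u) ∧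
      ∀ A ⊆ U, MeasurableSet A → μ m (φ '' A) = ∫⁻ u in A, ENNReal.ofReal (ρ u)

/-- A right Haar measure (system): smooth measures on the source fibres, invariant under all right
translations `s⁻¹(t(g)) → s⁻¹(s(g))`, `h ↦ h g`, and varying smoothly along the orbits of `G`
(for a test function `f`, the function `x ↦ ∫ f dμ_x` on the orbit of `m` is smooth when pulled back
by the submersion `t` from `s⁻¹(m)` onto the orbit). -/
structure IsRightHaar [MeasurableSpace G] (μ : M → Measure G) : Prop where
  smooth_fibres : IsSmoothOnFibres (E := E) (F := F) 𝒢.src μ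
  invariant : ∀ (g : G) (A : Set G), MeasurableSet A →
    μ (𝒢.tgt g) {h | 𝒢.src h = 𝒢.tgt g ∧ 𝒢.mul h g ∈ A} = μ (𝒢.src g) A
  smooth_along : ∀ f : G → ℝ, ContMDiff 𝓘(ℝ, E) 𝓘(ℝ, ℝ) ∞ f → HasCompactSupport f → ∀ m : M,
    ContMDiffOn 𝓘(ℝ, E) 𝓘(ℝ, ℝ) ∞ (fun g => ∫ h, f h ∂(μ (𝒢.tgt g))) (𝒢.src ⁻¹' {m})

/-- A left Haar measure (system): the mirror image of `IsRightHaar`, on the target fibres. -/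
structure IsLeftHaar [MeasurableSpace G] (ν : M → Measure G) : Prop where
  smooth_fibres : IsSmoothOnFibres (E := E) (F := F) 𝒢.tgt ν
  invariant : ∀ (g : G) (A : Set G), MeasurableSet A →
    ν (𝒢.src g) {h | 𝒢.tgt h = 𝒢.src g ∧ 𝒢.mul g h ∈ A} = ν (𝒢.tgt g) A
  smooth_along : ∀ f : G → ℝ, ContMDiff 𝓘(ℝ, E) 𝓘(ℝ, ℝ) ∞ f → HasCompactSupport f → ∀ m : M,
    ContMDiffOn 𝓘(ℝ, E) 𝓘(ℝ, ℝ) ∞ (fun g => ∫ h, f h ∂(ν (𝒢.src g))) (𝒢.tgt ⁻¹' {m})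

open Classical in
/-- The measure induced by a bi-invariant measure `η y` on the isotropy group at `y` on the fibre
over `y` of `t : s⁻¹(m) → M`, on which that group acts freely and transitively by left
multiplication: the image of `η y` under `k ↦ k h`, for any arrow `h` from `m` to `y`.
It is zero if the fibre is empty. -/
noncomputable def rightTorsorMeasure [MeasurableSpace G]
    (η : (x : M) → Measure (𝒢.Isotropy x)) (m y : M) : Measure G :=
  if H : ∃ h, 𝒢.src h = m ∧ 𝒢.tgt h = y then (η y).map (fun k => 𝒢.mul k.1 H.choose) else 0

open Classical in
/-- The mirror image of `rightTorsorMeasure`: the image of `η y` under `k ↦ h k`, for any arrow `h`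
from `y` to `m`, on the fibre over `y` of `s : t⁻¹(m) → M`. -/
noncomputable def leftTorsorMeasure [MeasurableSpace G]
    (η : (x : M) → Measure (𝒢.Isotropy x)) (m y : M) : Measure G :=
  if H : ∃ h, 𝒢.src h = y ∧ 𝒢.tgt h = m then (η y).map (fun k => 𝒢.mul H.choose k.1) else 0

end LieGroupoid

namespace SymplecticGroupoid

variable {E F G M : Type*} [NormedAddCommGroup E] [NormedSpace ℝ E] [FiniteDimensional ℝ E]
  [NormedAddCommGroup F] [NormedSpace ℝ F] [TopologicalSpace G] [ChartedSpace E G]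
  [TopologicalSpace M] [ChartedSpace F M] (𝒢 : SymplecticGroupoid E F G M)

/-- The Poisson structure on `M` for which `t` is a Poisson map, as the bundle map
`Π^♯ : T^*M → TM`, `Π^♯ = dt ∘ ω⁻¹ ∘ t^*`, computed at the unit arrow. -/
noncomputable def sharp (x : M) (α : TangentSpace 𝓘(ℝ, F) x →L[ℝ] ℝ) : TangentSpace 𝓘(ℝ, F) x :=
  mfderiv 𝓘(ℝ, E) 𝓘(ℝ, F) 𝒢.tgt (𝒢.unit x)
    (existsUnique_dual_of_nondegenerate (E := E) (𝒢.form (𝒢.unit x))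
      (𝒢.nondegenerate_form (𝒢.unit x))
      ((α : F →L[ℝ] ℝ).comp
        (mfderiv 𝓘(ℝ, E) 𝓘(ℝ, F) 𝒢.tgt (𝒢.unit x) : E →L[ℝ] F))).choose

/-- The Hamiltonian vector field `Π^♯(df)` on `M`. -/
noncomputable def hamiltonianField (f : M → ℝ) (x : M) : TangentSpace 𝓘(ℝ, F) x :=
  𝒢.sharp x (mfderiv 𝓘(ℝ, F) 𝓘(ℝ, ℝ) f x)

/-- Two points are in the same symplectic leaf if they can be joined by finitely many trajectories
of Hamiltonian vector fields. -/
def SameLeaf : M → M → Prop :=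
  Relation.EqvGen fun x y => ∃ (f : M → ℝ) (γ : ℝ → M), ContMDiff 𝓘(ℝ, F) 𝓘(ℝ, ℝ) ∞ f ∧
    IsMIntegralCurveOn γ (𝒢.hamiltonianField f) (Set.Icc 0 1) ∧ γ 0 = x ∧ γ 1 = y

/-- The symplectic leaf through `x`. -/
def leaf (x : M) : Set M := {y | 𝒢.SameLeaf x y}

/-- The symplectic form of the leaf through `x`, `ω_L(Π^♯ α, Π^♯ β) = α(Π^♯ β)`, on vectors of
`T_x L = im Π^♯_x`.  (The opposite sign convention gives the same volume measure.) -/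
noncomputable def leafForm (x : M) (v w : TangentSpace 𝓘(ℝ, F) x) : ℝ :=
  Function.invFun (𝒢.sharp x) v w

/-- `ν` is the Liouville measure of the symplectic leaf `L` through `x` (as a measure on `M` carried
by `L`), i.e. the measure of the volume form `ω_L^n`, where `dim L = 2n`.  In local coordinates
this form is `± n! √(det Ω)` times the Lebesgue volume form, `Ω` being the matrix of `ω_L`. -/
structure IsLiouvilleMeasure [MeasurableSpace M] (ν : Measure M) (x : M) : Prop where
  support : ν (𝒢.leaf x)ᶜ = 0
  density : ∀ (n : ℕ) (U : Set (Fin (2 * n) → ℝ)) (φ : (Fin (2 * n) → ℝ) → M),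
    IsPatch (E := F) (𝒢.leaf x) (fun y => Set.range (𝒢.sharp y)) (2 * n) U φ →
    ∀ A ⊆ U, MeasurableSet A → ν (φ '' A) = ∫⁻ u in A, ENNReal.ofReal (n.factorial * Real.sqrt
      (Matrix.det (Matrix.of fun i j : Fin (2 * n) => 𝒢.leafForm (φ u)
        (mfderiv 𝓘(ℝ, Fin (2 * n) → ℝ) 𝓘(ℝ, F) φ u (Pi.single i (1 : ℝ) : Fin (2 * n) → ℝ))
        (mfderiv 𝓘(ℝ, Fin (2 * n) → ℝ) 𝓘(ℝ, F) φ u (Pi.single j (1 : ℝ) : Fin (2 * n) → ℝ)))))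

/-- A (strictly positive) Casimir function: a function which is constant on symplectic leaves. -/
structure IsPosCasimir (c : M → ℝ) : Prop where
  pos : ∀ x, 0 < c x
  const : ∀ x y, 𝒢.SameLeaf x y → c x = c y

/-- A choice of a bi-invariant Haar measure on every isotropy group, such that along each leaf the
measures correspond to each other under the isomorphisms of isotropy groups given by arrows. -/
structure IsIsotropyHaar [MeasurableSpace G]
    (η : (x : M) → Measure (𝒢.toLieGroupoid.Isotropy x)) : Prop where
  haar : ∀ x, (η x).IsHaarMeasure
  right_invariant : ∀ x, (η x).IsMulRightInvariant
  map_conj : ∀ g : G, 𝒢.SameLeaf (𝒢.src g) (𝒢.tgt g) →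
    (η (𝒢.src g)).map (𝒢.toLieGroupoid.conj g) = η (𝒢.tgt g)

/-- `μ` is a canonical right measure system: for some choice `η` of bi-invariant Haar measures on
the isotropy groups as above, the measure `μ m` on `s⁻¹(m)` is obtained by integrating the measures
induced by `η` on the fibres of `t : s⁻¹(m) → M` against the Liouville measures of the leaves. -/
def IsCanonicalRight [MeasurableSpace G] [MeasurableSpace M] (μ : M → Measure G) : Prop :=
  ∃ (η : (x : M) → Measure (𝒢.toLieGroupoid.Isotropy x)) (vol : M → Measure M),
    𝒢.IsIsotropyHaar η ∧ (∀ x, 𝒢.IsLiouvilleMeasure (vol x) x) ∧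
    ∀ m, μ m {g | 𝒢.src g ≠ m} = 0 ∧
      ∀ (x : M) (A : Set G), MeasurableSet A → A ⊆ 𝒢.tgt ⁻¹' (𝒢.leaf x) →
        μ m A = ∫⁻ y, 𝒢.toLieGroupoid.rightTorsorMeasure η m y A ∂(vol x)

/-- The mirror image of `IsCanonicalRight`, on the target fibres. -/
def IsCanonicalLeft [MeasurableSpace G] [MeasurableSpace M] (ν : M → Measure G) : Prop :=
  ∃ (η : (x : M) → Measure (𝒢.toLieGroupoid.Isotropy x)) (vol : M → Measure M),
    𝒢.IsIsotropyHaar η ∧ (∀ x, 𝒢.IsLiouvilleMeasure (vol x) x) ∧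
    ∀ m, ν m {g | 𝒢.tgt g ≠ m} = 0 ∧
      ∀ (x : M) (A : Set G), MeasurableSet A → A ⊆ 𝒢.src ⁻¹' (𝒢.leaf x) →
        ν m A = ∫⁻ y, 𝒢.toLieGroupoid.leftTorsorMeasure η m y A ∂(vol x)

end SymplecticGroupoid

/-! At a unit, multiplicativity of ω makes ker ds and ker dt orthogonal and the unit section
isotropic. Hence dim G = 2 dim M, each kernel is the ω-complement of the other, and the image of Π♯
= dt ∘ ω⁻¹ ∘ t* is dt(ker ds), the tangent space of the orbit (`mem_range_sharpModel_iff`). So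
leaves are pieces of orbits: a Hamiltonian trajectory cannot leave an orbit, by a Gronwall estimate
(`exists_arrow_of_sameLeaf`), and small pieces of an orbit are swept out by such trajectories
(`sameLeaf_θ`).

On a source fibre the map t has constant rank, so the fibre is covered by countably many product
boxes Ψ(a, b) on which t depends only on a (`exists_box`). Each box lies over a single leaf.
Therefore an orbit has only countably many leaves, their Liouville measures glue to one measure on
the orbit (`exists_orbitMeasure`), and a canonical family is exactly a family of integrals of the
η_{m,y} against that measure (`isCanonicalRight_iff`).

Choices of η exist: a Haar measure at one point of each leaf is carried along arrows, and
unimodularity makes the result independent of the arrow. Right invariance of η_y makes η_{m,y} well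
defined. Right translation by g sends kh to khg and does not move y, so μ is right invariant.
Compatibility under conjugation says that the η_{m,y}, for y in one leaf, are left translates of a
single Haar measure on G_m (`IsIsotropyHaar.exists_haar`). Haar measure has a smooth density, so in
a box μ_m has the density of Liouville times Haar (`canonicalMeasure_image_Ψ`). Smoothness along
orbits follows from invariance: ∫ f dμ_{t(g)} is the integral of f(hg⁻¹) against μ_{s(g)}, over a
fixed fibre, with g as a smooth parameter.

Two choices of η differ at each point by a positive factor, and conjugation along arrows forces the
factor to be constant on leaves; this is the Casimir function. The left-handed statements follow by
inversion, because bi-invariant Haar measures are inversion invariant. -/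

open scoped Topology

set_option linter.unusedSectionVars false

/-! ### Fibres of submersions and the constant rank theorem -/

section LocalParametrisations

variable {E F N M P Q : Type*} [NormedAddCommGroup E] [NormedSpace ℝ E]
  [NormedAddCommGroup F] [NormedSpace ℝ F] [NormedAddCommGroup P] [NormedSpace ℝ P]
  [NormedAddCommGroup Q] [NormedSpace ℝ Q]
  [TopologicalSpace N] [ChartedSpace E N] [TopologicalSpace M] [ChartedSpace F M]

/-- `ψ` restricts to a diffeomorphism of the open set `U` of a normed space with the piece `S ∩ W`
of the subset `S` of a manifold, whose inverse is the restriction of the smooth map `r` on the open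
set `W`. -/
structure IsLocalParam (S : Set N) (U : Set P) (ψ : P → N) (W : Set N) (r : N → P) : Prop where
  isOpen_dom : IsOpen U
  isOpen_nhd : IsOpen W
  contMDiffOn : ContMDiffOn 𝓘(ℝ, P) 𝓘(ℝ, E) ∞ ψ U
  contMDiffOn_ret : ContMDiffOn 𝓘(ℝ, E) 𝓘(ℝ, P) ∞ r W
  mem_nhd : ∀ u ∈ U, ψ u ∈ W
  mem : ∀ u ∈ U, ψ u ∈ S
  ret_param : ∀ u ∈ U, r (ψ u) = u
  ret_mem : ∀ h ∈ W, h ∈ S → r h ∈ U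
  param_ret : ∀ h ∈ W, h ∈ S → ψ (r h) = h

/-- In submersion charts `p` is the projection F × F' → F, so the fibre is a slice {c} × F', and
forgetting the first coordinate gives a retraction defined on an open set of the ambient manifold.
-/
theorem exists_isLocalParam_fibre [FiniteDimensional ℝ E] [FiniteDimensional ℝ F] {p : N → M}
    (hp : Manifold.IsSubmersion 𝓘(ℝ, E) 𝓘(ℝ, F) ∞ p) (g : N) :
    ∃ (U : Set (Fin (Module.finrank ℝ E - Module.finrank ℝ F) → ℝ))
      (ψ : (Fin (Module.finrank ℝ E - Module.finrank ℝ F) → ℝ) → N) (W : Set N)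
      (r : N → (Fin (Module.finrank ℝ E - Module.finrank ℝ F) → ℝ)),
      IsLocalParam (E := E) (p ⁻¹' {p g}) U ψ W r ∧ g ∈ W := by
  obtain ⟨F', i1, i2, hF⟩ := hp
  have h := hF g
  set eq := h.equiv
  set φ := h.domChart
  set χ := h.codChart
  have hφm := h.domChart_mem_maximalAtlas
  have hw := h.writtenInCharts
  have : FiniteDimensional ℝ (F × F') := Module.Finite.equiv eq.toLinearEquiv
  have : FiniteDimensional ℝ F' :=
    Module.Finite.of_surjective (LinearMap.snd ℝ F F') LinearMap.snd_surjective
  have hk : Module.finrank ℝ F' =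
      Module.finrank ℝ (Fin (Module.finrank ℝ E - Module.finrank ℝ F) → ℝ) := by
    have := eq.toLinearEquiv.finrank_eq
    rw [Module.finrank_prod] at this
    simp [this]
  have e : F' ≃L[ℝ] (Fin (Module.finrank ℝ E - Module.finrank ℝ F) → ℝ) :=
    ContinuousLinearEquiv.ofFinrankEq hk
  have hw' : ∀ z ∈ φ.target, χ (p (φ.symm z)) = (eq z).1 := fun z hz => by
    have := hw (x := z) (by simpa using hz)
    simpa using this
  have hinj : ∀ y ∈ φ.source, p y ∈ χ.source := fun y hy => h.source_subset_preimage_source hy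
  set c := χ (p g) with hc
  have hgs : g ∈ φ.source := h.mem_domChart_source
  let A : (Fin (Module.finrank ℝ E - Module.finrank ℝ F) → ℝ) → E := fun v => eq.symm (c, e.symm v)
  have hA : ContDiff ℝ ∞ A :=
    eq.symm.contDiff.comp (contDiff_const.prodMk e.symm.contDiff)
  refine ⟨A ⁻¹' φ.target, fun v => φ.symm (A v), φ.source, fun y => e (eq (φ y)).2, ?_, hgs⟩
  refine ⟨φ.open_target.preimage hA.continuous, φ.open_source, ?_, ?_, ?_, ?_, ?_, ?_, ?_⟩
  · exact (contMDiffOn_symm_of_mem_maximalAtlas hφm).comp hA.contMDiff.contMDiffOn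
      (fun v hv => hv)
  · refine ContMDiff.comp_contMDiffOn (I' := 𝓘(ℝ, E)) (g := fun z => e (eq z).2) ?_
      (contMDiffOn_of_mem_maximalAtlas hφm)
    exact (e.contDiff.comp (contDiff_snd.comp eq.contDiff)).contMDiff
  · exact fun u hu => φ.map_target hu
  · intro u hu
    have h1 := hw' _ hu
    have h2 : (eq (A u)).1 = c := by simp [A]
    exact χ.injOn (hinj _ (φ.map_target hu)) (hinj _ hgs) (h1.trans h2)
  · intro u hu
    rw [φ.right_inv hu]
    simp [A]
  · intro y hy hS
    have h1 := hw' _ (φ.map_source hy)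
    rw [φ.left_inv hy, hS] at h1
    change A _ ∈ φ.target
    have : A (e (eq (φ y)).2) = φ y := by
      simp only [A, ContinuousLinearEquiv.symm_apply_apply]
      rw [← hc] at h1
      rw [h1]; simp
    rw [this]
    exact φ.map_source hy
  · intro y hy hS
    have h1 := hw' _ (φ.map_source hy)
    rw [φ.left_inv hy, hS] at h1
    have : A (e (eq (φ y)).2) = φ y := by
      simp only [A, ContinuousLinearEquiv.symm_apply_apply]
      rw [← hc] at h1
      rw [h1]; simp
    change φ.symm (A _) = _
    rw [this, φ.left_inv hy]

/-- Freezing the second coordinate in submersion charts gives a smooth local section σ of `p`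
through `g`; differentiate p ∘ σ = id. -/
theorem surjective_mfderiv_of_isSubmersion [IsManifold 𝓘(ℝ, F) ∞ M] {p : N → M}
    (hp : Manifold.IsSubmersion 𝓘(ℝ, E) 𝓘(ℝ, F) ∞ p) (g : N) :
    Function.Surjective (mfderiv 𝓘(ℝ, E) 𝓘(ℝ, F) p g) := by
  have hps := hp.contMDiff
  obtain ⟨F', i1, i2, hF⟩ := hp
  have h := hF g
  set eq := h.equiv
  set φ := h.domChart
  set χ := h.codChart
  have hφm := h.domChart_mem_maximalAtlas
  have hχm := h.codChart_mem_maximalAtlas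
  have hw := h.writtenInCharts
  have hw' : ∀ z ∈ φ.target, χ (p (φ.symm z)) = (eq z).1 := fun z hz => by
    have := hw (x := z) (by simpa using hz)
    simpa using this
  have hinj : ∀ y ∈ φ.source, p y ∈ χ.source := fun y hy => h.source_subset_preimage_source hy
  have hgs : g ∈ φ.source := h.mem_domChart_source
  have hpg : p g ∈ χ.source := h.mem_codChart_source
  let A : F → E := fun z => eq.symm (z, (eq (φ g)).2)
  have hA : ContDiff ℝ ∞ A := eq.symm.contDiff.comp (contDiff_id.prodMk contDiff_const)
  have hAg : A (χ (p g)) = φ g := by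
    have := hw' _ (φ.map_source hgs)
    rw [φ.left_inv hgs] at this
    simp only [A, this]; simp
  let σ : M → N := fun y => φ.symm (A (χ y))
  have hσg : σ (p g) = g := by simp only [σ, hAg]; exact φ.left_inv hgs
  have hσ : ContMDiffAt 𝓘(ℝ, F) 𝓘(ℝ, E) ∞ σ (p g) := by
    have h1 : ContMDiffAt 𝓘(ℝ, F) 𝓘(ℝ, F) ∞ χ (p g) :=
      (contMDiffOn_of_mem_maximalAtlas hχm).contMDiffAt (χ.open_source.mem_nhds hpg)
    have h2 : ContMDiffAt 𝓘(ℝ, E) 𝓘(ℝ, E) ∞ φ.symm (A (χ (p g))) :=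
      (contMDiffOn_symm_of_mem_maximalAtlas hφm).contMDiffAt
        (φ.open_target.mem_nhds (by rw [hAg]; exact φ.map_source hgs))
    exact ContMDiffAt.comp (g := φ.symm) (f := A ∘ χ) (p g) h2
      (ContMDiffAt.comp (g := A) (p g) hA.contMDiff.contMDiffAt h1)
  have hev : p ∘ σ =ᶠ[𝓝 (p g)] id := by
    have h1 : ∀ᶠ y in 𝓝 (p g), y ∈ χ.source := χ.open_source.mem_nhds hpg
    have h2 : ContinuousAt (fun y => A (χ y)) (p g) :=
      hA.continuous.continuousAt.comp (χ.continuousAt hpg)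
    have h3 : ∀ᶠ y in 𝓝 (p g), A (χ y) ∈ φ.target := h2.eventually
      (φ.open_target.mem_nhds (by simp only [hAg]; exact φ.map_source hgs))
    filter_upwards [h1, h3] with y hy hy'
    apply χ.injOn (hinj _ (φ.map_target hy')) hy
    simpa [A] using hw' _ hy'
  intro w
  have hpd : MDifferentiableAt 𝓘(ℝ, E) 𝓘(ℝ, F) p (σ (p g)) :=
    (hps _).mdifferentiableAt (by simp)
  have hcomp := mfderiv_comp (p g) hpd (hσ.mdifferentiableAt (by simp))
  rw [hev.mfderiv_eq, mfderiv_id] at hcomp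
  rw [hσg] at hcomp
  exact ⟨mfderiv 𝓘(ℝ, F) 𝓘(ℝ, E) σ (p g) w, (congrArg (fun L => L w) hcomp).symm⟩

/-- The constant rank theorem: `f` depends in suitable coordinates `(a, b)` only on `a`, and `a` is
a linear function of the value of `f`. -/
theorem exists_coord_of_constant_rank [FiniteDimensional ℝ P] [FiniteDimensional ℝ F] {f : P → F}
    {U : Set P} {v₀ : P} {l j : ℕ} (hj : j = Module.finrank ℝ P - l) (hU : IsOpen U) (hv₀ : v₀ ∈ U) (hf : ContDiffOn ℝ ∞ f U)
    (hr : ∀ v ∈ U, Module.finrank ℝ (fderiv ℝ f v).range = l) :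
    ∃ (R : F →L[ℝ] (Fin l → ℝ)) (A : Set (Fin l → ℝ)) (B : Set (Fin j → ℝ))
      (Φ : (Fin l → ℝ) × (Fin j → ℝ) → P) (V : Set P)
      (q : P → (Fin l → ℝ) × (Fin j → ℝ)),
      IsOpen A ∧ Convex ℝ A ∧ IsOpen B ∧ Convex ℝ B ∧ IsOpen V ∧ V ⊆ U ∧ v₀ ∈ V ∧
      ContDiffOn ℝ ∞ Φ (A ×ˢ B) ∧ ContDiffOn ℝ ∞ q V ∧ Set.MapsTo Φ (A ×ˢ B) V ∧
      Set.MapsTo q V (A ×ˢ B) ∧ (∀ c ∈ A ×ˢ B, q (Φ c) = c) ∧ (∀ v ∈ V, Φ (q v) = v) ∧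
      (∀ a ∈ A, ∀ b ∈ B, ∀ b' ∈ B, f (Φ (a, b)) = f (Φ (a, b'))) ∧
      (∀ a ∈ A, ∀ b ∈ B, R (f (Φ (a, b))) = a) := by
  subst hj
  set D := fderiv ℝ f v₀ with hD
  have hk : Module.finrank ℝ D.toLinearMap.ker =
      Module.finrank ℝ (Fin (Module.finrank ℝ P - l) → ℝ) := by
    have := LinearMap.finrank_range_add_finrank_ker D.toLinearMap
    rw [show Module.finrank ℝ D.toLinearMap.range = l from hr v₀ hv₀] at this
    simp; omega
  have hl : Module.finrank ℝ D.toLinearMap.range = Module.finrank ℝ (Fin l → ℝ) := by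
    rw [show Module.finrank ℝ D.toLinearMap.range = l from hr v₀ hv₀]; simp
  let e₁ := LinearEquiv.ofFinrankEq _ _ hl
  let e₂ := LinearEquiv.ofFinrankEq _ _ hk
  obtain ⟨R', hR'⟩ := LinearMap.exists_extend e₁.toLinearMap
  obtain ⟨S', hS'⟩ := LinearMap.exists_extend e₂.toLinearMap
  let R : F →L[ℝ] (Fin l → ℝ) := LinearMap.toContinuousLinearMap R'
  let S : P →L[ℝ] (Fin (Module.finrank ℝ P - l) → ℝ) := LinearMap.toContinuousLinearMap S'
  have hR : ∀ w, R (D w) = 0 → D w = 0 := by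
    intro w hw
    have h1 : R (D w) = e₁ ⟨D w, ⟨w, rfl⟩⟩ := LinearMap.congr_fun hR' ⟨D w, ⟨w, rfl⟩⟩
    rw [hw] at h1
    have h2 := e₁.map_eq_zero_iff.1 h1.symm
    exact congrArg Subtype.val h2
  have hS : ∀ w, D w = 0 → S w = 0 → w = 0 := by
    intro w hw hw'
    have h1 : S w = e₂ ⟨w, hw⟩ := LinearMap.congr_fun hS' ⟨w, hw⟩
    rw [hw'] at h1
    exact congrArg Subtype.val (e₂.map_eq_zero_iff.1 h1.symm)
  -- `R` is injective on the range of the differential at `v₀` and `S` is injective on its kernel,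
  -- so `q` has an invertible differential there. Its local inverse is the map Φ sought.
  let q : P → (Fin l → ℝ) × (Fin (Module.finrank ℝ P - l) → ℝ) := fun v => (R (f v), S v)
  have hq : ContDiffOn ℝ ∞ q U := (R.contDiff.comp_contDiffOn hf).prodMk S.contDiff.contDiffOn
  have hqd : ∀ v ∈ U, HasFDerivAt q ((R.comp (fderiv ℝ f v)).prod S) v := fun v hv =>
    (R.hasFDerivAt.comp v ((hf.contDiffAt (hU.mem_nhds hv)).differentiableAt
      (by simp)).hasFDerivAt).prodMk S.hasFDerivAt
  have hdim : Module.finrank ℝ P =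
      Module.finrank ℝ ((Fin l → ℝ) × (Fin (Module.finrank ℝ P - l) → ℝ)) := by
    have := LinearMap.finrank_range_add_finrank_ker D.toLinearMap
    rw [hk, hl] at this
    rw [Module.finrank_prod]; omega
  have hinj : Function.Injective ((R.comp D).prod S) := by
    rw [injective_iff_map_eq_zero]
    intro w hw
    have h1 := congrArg Prod.fst hw
    have h2 := congrArg Prod.snd hw
    exact hS w (hR w h1) h2
  let q' : P ≃L[ℝ] (Fin l → ℝ) × (Fin (Module.finrank ℝ P - l) → ℝ) :=
    (LinearEquiv.ofInjectiveOfFinrankEq ((R.comp D).prod S).toLinearMap hinj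
      hdim).toContinuousLinearEquiv
  have hq' : HasFDerivAt q (q' : P →L[ℝ] _) v₀ := by
    convert hqd v₀ hv₀ using 1
    ext1 w
    rfl
  have hqc : ContDiffAt ℝ ∞ q v₀ := hq.contDiffAt (hU.mem_nhds hv₀)
  let χ := hqc.toOpenPartialHomeomorph q hq' (by simp)
  have hχ : ∀ v, χ v = q v := fun v => rfl
  have hv₀χ : v₀ ∈ χ.source := hqc.mem_toOpenPartialHomeomorph_source hq' (by simp)
  -- the open set where the derivative of `q` is invertible
  have hinv : ∀ᶠ v in 𝓝 v₀, v ∈ U ∧ fderiv ℝ q v ∈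
      Set.range ((↑) : (P ≃L[ℝ] (Fin l → ℝ) × (Fin (Module.finrank ℝ P - l) → ℝ)) → _) := by
    refine Filter.Eventually.and (hU.mem_nhds hv₀) ?_
    have : ContinuousAt (fderiv ℝ q) v₀ :=
      (hqc.fderiv_right (m := 0) (by norm_num)).continuousAt
    apply this.eventually
    rw [hq'.fderiv]
    exact ContinuousLinearEquiv.nhds q'
  obtain ⟨O, hO, hOo, hvO⟩ := eventually_nhds_iff.1 hinv
  have hT : IsOpen (χ.target ∩ χ.symm ⁻¹' O) := χ.isOpen_inter_preimage_symm hOo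
  have hmem : q v₀ ∈ χ.target ∩ χ.symm ⁻¹' O := by
    refine ⟨χ.map_source hv₀χ, ?_⟩
    have := χ.left_inv hv₀χ
    rw [hχ] at this
    simpa [this] using hvO
  obtain ⟨ε, hε, hball⟩ := Metric.isOpen_iff.1 hT _ hmem
  rw [show q v₀ = ((q v₀).1, (q v₀).2) from rfl, ← ball_prod_same] at hball
  set A := Metric.ball (q v₀).1 ε
  set B := Metric.ball (q v₀).2 ε
  have hΦ : ContDiffOn ℝ ∞ χ.symm (A ×ˢ B) := by
    intro c hc
    obtain ⟨hc1, hc2⟩ := hball hc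
    obtain ⟨hcU, e, he⟩ := hO _ hc2
    apply ContDiffAt.contDiffWithinAt
    refine χ.contDiffAt_symm (f₀' := e) hc1 ?_ (hq.contDiffAt (hU.mem_nhds hcU))
    rw [he]
    exact ((hq.contDiffAt (hU.mem_nhds hcU)).differentiableAt (by simp)).hasFDerivAt
  have hqΦ : ∀ c ∈ A ×ˢ B, q (χ.symm c) = c := fun c hc => χ.right_inv (hball hc).1
  have hfΦ : ∀ c ∈ A ×ˢ B, R (f (χ.symm c)) = c.1 := fun c hc => congrArg Prod.fst (hqΦ c hc)
  refine ⟨R, A, B, χ.symm, χ.source ∩ (χ ⁻¹' (A ×ˢ B)), q, Metric.isOpen_ball, convex_ball _ _,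
    Metric.isOpen_ball, convex_ball _ _, χ.isOpen_inter_preimage
    (Metric.isOpen_ball.prod Metric.isOpen_ball), ?_, ?_, hΦ, ?_, ?_, fun v hv => hv.2, hqΦ,
    fun v hv => χ.left_inv hv.1, ?_, fun a ha b hb => hfΦ (a, b) ⟨ha, hb⟩⟩
  · rintro v ⟨hv, hv'⟩
    have := (hO _ (hball hv').2).1
    rwa [χ.left_inv hv] at this
  · exact ⟨hv₀χ, Metric.mem_ball_self hε, Metric.mem_ball_self hε⟩
  · apply hq.mono
    rintro v ⟨hv, hv'⟩
    have := (hO _ (hball hv').2).1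
    rwa [χ.left_inv hv] at this
  · intro c hc
    exact ⟨χ.map_target (hball hc).1, by rw [Set.mem_preimage, χ.right_inv (hball hc).1]; exact hc⟩
  · intro a ha b hb b' hb'
    have hd : ∀ b ∈ B, HasFDerivAt (fun b => f (χ.symm (a, b)))
        ((fderiv ℝ f (χ.symm (a, b))).comp ((fderiv ℝ χ.symm (a, b)).comp
          (ContinuousLinearMap.inr ℝ _ _))) b := by
      intro b hb
      have hab : (a, b) ∈ A ×ˢ B := ⟨ha, hb⟩
      have hvU := (hO _ (hball hab).2).1
      have h1 : HasFDerivAt (fun b : (Fin (Module.finrank ℝ P - l) → ℝ) => (a, b))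
        (ContinuousLinearMap.inr ℝ _ _) b := (hasFDerivAt_prodMk_right a b)
      have h2 := ((hΦ.contDiffAt ((Metric.isOpen_ball.prod Metric.isOpen_ball).mem_nhds
        hab)).differentiableAt (by simp)).hasFDerivAt
      have h3 := ((hf.contDiffAt (hU.mem_nhds hvU)).differentiableAt (by simp)).hasFDerivAt
      exact h3.comp b (h2.comp b h1)
    have h0 : ∀ b ∈ B, fderiv ℝ (fun b => f (χ.symm (a, b))) b = 0 := by
      intro b hb
      have hab : (a, b) ∈ A ×ˢ B := ⟨ha, hb⟩
      obtain ⟨hvU, e, he⟩ := hO _ (hball hab).2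
      set v := χ.symm (a, b)
      rw [(hqd v hvU).fderiv] at he
      rw [(hd b hb).fderiv]
      ext1 w
      set x := (fderiv ℝ χ.symm (a, b)).comp (ContinuousLinearMap.inr ℝ _ _) w with hx
      change fderiv ℝ f v x = 0
      have hRx : R (fderiv ℝ f v x) = 0 := by
        have h5 : HasFDerivAt (fun b => R (f (χ.symm (a, b)))) _ b := R.hasFDerivAt.comp b (hd b hb)
        have h6 : (fun b => R (f (χ.symm (a, b)))) =ᶠ[𝓝 b] fun _ => a := by
          filter_upwards [Metric.isOpen_ball.mem_nhds hb] with b' hb'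
          exact hfΦ (a, b') ⟨ha, hb'⟩
        have h7 := h5.unique ((hasFDerivAt_const a b).congr_of_eventuallyEq h6)
        exact congrArg (fun L => L w) h7
      -- `R` is injective on the range of the derivative
      let g : (fderiv ℝ f v).range →ₗ[ℝ] (Fin l → ℝ) := R.toLinearMap.domRestrict _
      have hg : Function.Surjective g := by
        intro y
        refine ⟨⟨fderiv ℝ f v (e.symm (y, 0)), ⟨_, rfl⟩⟩, ?_⟩
        have h8 : ((R.comp (fderiv ℝ f v)).prod S) (e.symm (y, 0)) = (y, 0) := by
          rw [← he]; simp
        exact congrArg Prod.fst h8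
      -- Constancy of the rank enters here: a surjection from a space of dimension `l` onto ℝˡ is
      -- injective. As R ∘ f does not change with `b`, neither does f.
      have hgi : Function.Injective g := by
        refine (LinearMap.injective_iff_surjective_of_finrank_eq_finrank ?_).2 hg
        rw [hr v hvU]; simp
      have h9 : (⟨fderiv ℝ f v x, ⟨x, rfl⟩⟩ : (fderiv ℝ f v).range) = 0 := by
        apply hgi
        rw [map_zero]
        exact hRx
      exact congrArg Subtype.val h9
    exact Metric.isOpen_ball.is_const_of_fderiv_eq_zero (convex_ball _ _).isPreconnected
      (fun b hb => (hd b hb).differentiableAt.differentiableWithinAt) h0 hb hb'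

end LocalParametrisations

/-! ### Gluing measures, Borel images, smooth densities, integrals with parameters -/

section MeasureLemmas

/-- Make the cover disjoint and add up the restrictions of the given measures to the disjoint
pieces; on a subset of `S i` compatibility lets every summand be computed by `ν i`. -/
theorem exists_measure_glue {X ι : Type*} [MeasurableSpace X] [Countable ι] (S : ι → Set X)
    (hS : ∀ i, MeasurableSet (S i)) (ν : ι → Measure X)
    (h : ∀ i j C, MeasurableSet C → C ⊆ S i → C ⊆ S j → ν i C = ν j C) :
    ∃ μ : Measure X, μ (⋃ i, S i)ᶜ = 0 ∧ ∀ i C, MeasurableSet C → C ⊆ S i → μ C = ν i C := by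
  rcases isEmpty_or_nonempty ι with hι | hι
  · exact ⟨0, by simp, fun i => (hι.false i).elim⟩
  obtain ⟨e, he⟩ := exists_surjective_nat ι
  let T : ℕ → Set X := disjointed (fun n => S (e n))
  have hT : ∀ n, MeasurableSet (T n) := fun n => MeasurableSet.disjointed (fun n => hS (e n)) n
  have hTS : ∀ n, T n ⊆ S (e n) := fun n => disjointed_subset _ n
  have hU : ⋃ n, T n = ⋃ i, S i := by
    rw [iUnion_disjointed]
    exact he.iUnion_comp S
  have hUm : MeasurableSet (⋃ i, S i) := MeasurableSet.iUnion hS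
  refine ⟨Measure.sum fun n => (ν (e n)).restrict (T n), ?_, ?_⟩
  · rw [Measure.sum_apply _ hUm.compl, ENNReal.tsum_eq_zero]
    intro n
    rw [Measure.restrict_apply hUm.compl, ← hU]
    convert measure_empty (μ := ν (e n))
    exact Set.disjoint_iff_inter_eq_empty.1
      (Set.disjoint_compl_left_iff_subset.2 (Set.subset_iUnion T n))
  · intro i C hC hCS
    rw [Measure.sum_apply _ hC]
    have : ∀ n, (ν (e n)).restrict (T n) C = ν i (C ∩ T n) := fun n => by
      rw [Measure.restrict_apply hC]
      exact h _ _ _ (hC.inter (hT n)) (Set.inter_subset_right.trans (hTS n))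
        (Set.inter_subset_left.trans hCS)
    simp_rw [this]
    rw [← measure_iUnion (fun m n hmn => (disjoint_disjointed _ hmn).mono
      Set.inter_subset_right Set.inter_subset_right) (fun n => hC.inter (hT n)), ← Set.inter_iUnion,
      hU, Set.inter_eq_left.2 (hCS.trans (Set.subset_iUnion S i))]

/-- Two measures agree if they do so on the subsets of the members of a countable cover. -/
theorem measure_eq_of_forall_subset_cover {X ι : Type*} [MeasurableSpace X] [Countable ι]
    {μ ν : Measure X} (S : ι → Set X) (hS : ∀ i, MeasurableSet (S i)) {A : Set X}
    (hA : MeasurableSet A) (hAS : A ⊆ ⋃ i, S i)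
    (h : ∀ i C, MeasurableSet C → C ⊆ S i → C ⊆ A → μ C = ν C) : μ A = ν A := by
  rcases isEmpty_or_nonempty ι with hι | hι
  · rw [Set.iUnion_of_empty, Set.subset_empty_iff] at hAS
    simp [hAS]
  obtain ⟨e, he⟩ := exists_surjective_nat ι
  let T : ℕ → Set X := disjointed (fun n => S (e n))
  have hT : ∀ n, MeasurableSet (T n) := fun n => MeasurableSet.disjointed (fun n => hS (e n)) n
  have hTS : ∀ n, T n ⊆ S (e n) := fun n => disjointed_subset _ n
  have hU : A = ⋃ n, A ∩ T n := by
    rw [← Set.inter_iUnion, iUnion_disjointed, he.iUnion_comp S, Set.inter_eq_left.2 hAS]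
  rw [hU, measure_iUnion (fun m n hmn => (disjoint_disjointed _ hmn).mono
      Set.inter_subset_right Set.inter_subset_right) (fun n => hA.inter (hT n)),
    measure_iUnion (fun m n hmn => (disjoint_disjointed _ hmn).mono
      Set.inter_subset_right Set.inter_subset_right) (fun n => hA.inter (hT n))]
  exact tsum_congr fun n => h _ _ (hA.inter (hT n)) (Set.inter_subset_right.trans (hTS n))
    Set.inter_subset_left

theorem measurableSet_inter_preimage_of_continuousOn {X Y : Type*} [TopologicalSpace X]
    [MeasurableSpace X] [OpensMeasurableSpace X] [TopologicalSpace Y] [MeasurableSpace Y]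
    [BorelSpace Y] {f : X → Y} {S : Set X} (hf : ContinuousOn f S) (hS : MeasurableSet S)
    {C : Set Y} (hC : MeasurableSet C) : MeasurableSet (S ∩ f ⁻¹' C) := by
  have h1 : Measurable (S.domRestrict f) :=
    (continuousOn_iff_continuous_domRestrict.1 hf).measurable
  have h2 := (MeasurableEmbedding.subtype_coe hS).measurableSet_image.2 (h1 hC)
  convert h2 using 1
  ext x
  simp [Set.mem_image, Set.domRestrict, and_comm]

/-- Injective continuous images of Borel sets in a (not necessarily Hausdorff) second countable
manifold are Borel sets. -/
theorem measurableSet_image_of_injOn {E N P : Type*} [NormedAddCommGroup E] [NormedSpace ℝ E]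
    [TopologicalSpace N] [ChartedSpace E N] [SecondCountableTopology N] [MeasurableSpace N]
    [BorelSpace N] [FiniteDimensional ℝ E] [TopologicalSpace P] [PolishSpace P] [MeasurableSpace P]
    [BorelSpace P] {φ : P → N} {U A : Set P} (hU : ContinuousOn φ U) (hi : Set.InjOn φ U)
    (hA : MeasurableSet A) (hAU : A ⊆ U) : MeasurableSet (φ '' A) := by
  borelize E
  obtain ⟨s, hs, hsU⟩ := TopologicalSpace.countable_cover_nhds
    (fun x : N => chart_source_mem_nhds E x)
  have hA' : φ '' A = ⋃ x ∈ s, φ '' (A ∩ φ ⁻¹' (chartAt E x).source) := by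
    rw [← Set.image_iUnion₂, ← Set.inter_iUnion₂, ← Set.preimage_iUnion₂, hsU]
    simp
  rw [hA']
  refine MeasurableSet.biUnion hs fun x _ => ?_
  have hm : MeasurableSet (A ∩ φ ⁻¹' (chartAt E x).source) :=
    measurableSet_inter_preimage_of_continuousOn (hU.mono hAU) hA
      (chartAt E x).open_source.measurableSet
  have hc : ContinuousOn (chartAt E x ∘ φ) (A ∩ φ ⁻¹' (chartAt E x).source) :=
    (chartAt E x).continuousOn.comp (hU.mono (Set.inter_subset_left.trans hAU)) fun a ha => ha.2
  have hi' : Set.InjOn (chartAt E x ∘ φ) (A ∩ φ ⁻¹' (chartAt E x).source) :=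
    (chartAt E x).injOn.comp (hi.mono (Set.inter_subset_left.trans hAU)) fun a ha => ha.2
  -- The Lusin–Souslin theorem is applied in the model space, one chart domain at a time, because
  -- `N` itself may fail to be Hausdorff.
  have h1 := hm.image_of_continuousOn_injOn hc hi'
  have h2 := measurableSet_inter_preimage_of_continuousOn (chartAt E x).continuousOn
    (chartAt E x).open_source.measurableSet h1
  convert h2 using 1
  ext y
  constructor
  · rintro ⟨a, ha, rfl⟩
    exact ⟨ha.2, a, ha, rfl⟩
  · rintro ⟨hy, a, ha, hay⟩
    exact ⟨a, ha, (chartAt E x).injOn ha.2 hy hay⟩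

/-- Moves a measure on the image of a parametrisation to ℝᵏ, where local statements about densities
can be patched together. -/
theorem exists_pullback_measure {X P : Type*} [MeasurableSpace X] [MeasurableSpace P]
    (μ : Measure X) {φ : P → X} {U : Set P} (hU : MeasurableSet U) (hi : Set.InjOn φ U)
    (hm : ∀ A ⊆ U, MeasurableSet A → MeasurableSet (φ '' A)) :
    ∃ lam : Measure P, ∀ A ⊆ U, MeasurableSet A → lam A = μ (φ '' A) := by
  refine ⟨(μ.comap (U.domRestrict φ)).map Subtype.val, fun A hA hAm => ?_⟩
  rw [Measure.map_apply measurable_subtype_coe hAm, Measure.comap_apply _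
    (Set.injOn_iff_injective.1 hi) ?_ _ (measurable_subtype_coe hAm)]
  · congr 1
    rw [Set.domRestrict_eq, Set.image_comp, Subtype.image_preimage_coe, Set.inter_eq_right.2 hA]
  · intro B hB
    rw [Set.domRestrict_eq, Set.image_comp]
    exact hm _ (by simp) ((MeasurableEmbedding.subtype_coe hU).measurableSet_image.2 hB)

/-- If the inequality failed at `v`, constants c < d would separate the two functions on a small
ball, contradicting equality of the integrals over it. Taking `c` above max(ρ₁ v, 0) keeps the
separation after passing to `ENNReal`. Only one inequality is concluded; it is used in both
directions. -/
theorem eqOn_of_lintegral_eq {k : ℕ} {V : Set (Fin k → ℝ)} (hV : IsOpen V)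
    {ρ₁ ρ₂ : (Fin k → ℝ) → ℝ} (h₁ : ContinuousOn ρ₁ V) (h₂ : ContinuousOn ρ₂ V)
    (hp : ∀ v ∈ V, 0 < ρ₂ v)
    (h : ∀ A ⊆ V, MeasurableSet A →
      ∫⁻ u in A, ENNReal.ofReal (ρ₁ u) = ∫⁻ u in A, ENNReal.ofReal (ρ₂ u)) :
    ∀ v ∈ V, ρ₂ v ≤ ρ₁ v := by
  intro v hv
  by_contra! hlt
  obtain ⟨c, hc1, hc2⟩ := exists_between (max_lt hlt (hp v hv))
  obtain ⟨d, hd1, hd2⟩ := exists_between hc2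
  have e1 : ∀ᶠ u in 𝓝 v, u ∈ V := hV.mem_nhds hv
  have e2 : ∀ᶠ u in 𝓝 v, ρ₁ u < c :=
    (h₁.continuousAt (hV.mem_nhds hv)).eventually_lt_const ((le_max_left _ _).trans_lt hc1)
  have e3 : ∀ᶠ u in 𝓝 v, d < ρ₂ u :=
    (h₂.continuousAt (hV.mem_nhds hv)).eventually_const_lt hd2
  obtain ⟨ε, hε, hb⟩ := Metric.eventually_nhds_iff_ball.1 (e1.and (e2.and e3))
  have hm : MeasurableSet (Metric.ball v ε) := Metric.isOpen_ball.measurableSet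
  have hh := h (Metric.ball v ε) (fun u hu => (hb u hu).1) hm
  have h4 : ∫⁻ u in Metric.ball v ε, ENNReal.ofReal (ρ₁ u) ≤
      ENNReal.ofReal c * volume (Metric.ball v ε) := by
    rw [← setLIntegral_const]
    exact setLIntegral_mono measurable_const fun u hu =>
      ENNReal.ofReal_le_ofReal (hb u hu).2.1.le
  have h5 : ENNReal.ofReal d * volume (Metric.ball v ε) ≤
      ∫⁻ u in Metric.ball v ε, ENNReal.ofReal (ρ₂ u) := by
    rw [← setLIntegral_const]
    exact setLIntegral_mono' hm fun u hu => ENNReal.ofReal_le_ofReal (hb u hu).2.2.le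
  have h6 := (h5.trans hh.ge).trans h4
  have h7 := (ENNReal.mul_le_mul_iff_left (Metric.measure_ball_pos volume v hε).ne'
    measure_ball_lt_top.ne).1 h6
  have hc0 : 0 < c := (le_max_right _ _).trans_lt hc1
  exact absurd ((ENNReal.ofReal_le_ofReal_iff hc0.le).1 h7) (not_le.2 hd1)

/-- A measure with local smooth positive densities has a global one. -/
theorem exists_smooth_density {k : ℕ} (lam : Measure (Fin k → ℝ)) {U : Set (Fin k → ℝ)}
    (h : ∀ u ∈ U, ∃ V, IsOpen V ∧ u ∈ V ∧ ∃ ρ : (Fin k → ℝ) → ℝ,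
      ContDiffOn ℝ ∞ ρ V ∧ (∀ v ∈ V, 0 < ρ v) ∧
      ∀ A ⊆ V, MeasurableSet A → lam A = ∫⁻ u in A, ENNReal.ofReal (ρ u)) :
    ∃ ρ : (Fin k → ℝ) → ℝ, ContDiffOn ℝ ∞ ρ U ∧ (∀ u ∈ U, 0 < ρ u) ∧
      ∀ A ⊆ U, MeasurableSet A → lam A = ∫⁻ u in A, ENNReal.ofReal (ρ u) := by
  classical
  choose! V hV huV ρ hρ hpos hint using h
  have hloc : ∀ u ∈ U, ∀ v ∈ U, v ∈ V u → ρ v v = ρ u v := by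
    intro u hu v hv hvu
    have hO : IsOpen (V u ∩ V v) := (hV u hu).inter (hV v hv)
    have key : ∀ A ⊆ V u ∩ V v, MeasurableSet A →
        ∫⁻ x in A, ENNReal.ofReal (ρ u x) = ∫⁻ x in A, ENNReal.ofReal (ρ v x) := by
      intro A hA hAm
      rw [← hint u hu A (hA.trans Set.inter_subset_left) hAm,
        ← hint v hv A (hA.trans Set.inter_subset_right) hAm]
    have c1 := (hρ u hu).continuousOn.mono (Set.inter_subset_left (t := V v))
    have c2 := (hρ v hv).continuousOn.mono (Set.inter_subset_right (s := V u))
    apply le_antisymm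
    · exact eqOn_of_lintegral_eq hO c1 c2 (fun x hx => hpos v hv x hx.2) key v ⟨hvu, huV v hv⟩
    · exact eqOn_of_lintegral_eq hO c2 c1 (fun x hx => hpos u hu x hx.1)
        (fun A hA hAm => (key A hA hAm).symm) v ⟨hvu, huV v hv⟩
  -- Each local density is evaluated at its own centre; by uniqueness of continuous densities this
  -- agrees on `V u` with `ρ u`, hence is smooth.
  refine ⟨fun u => ρ u u, ?_, fun u hu => hpos u hu u (huV u hu), ?_⟩
  · intro u hu
    have h1 : ContDiffWithinAt ℝ ∞ (ρ u) U u :=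
      ((hρ u hu).contDiffAt ((hV u hu).mem_nhds (huV u hu))).contDiffWithinAt
    refine h1.congr_of_eventuallyEq ?_ rfl
    filter_upwards [self_mem_nhdsWithin, mem_nhdsWithin_of_mem_nhds
      ((hV u hu).mem_nhds (huV u hu))] with v hv hv'
    exact hloc u hu v hv hv'
  · intro A hA hAm
    obtain ⟨s, hsU, hs, hAs⟩ := TopologicalSpace.countable_cover_nhdsWithin (s := U) (f := V)
      (fun u hu => mem_nhdsWithin_of_mem_nhds ((hV u hu).mem_nhds (huV u hu)))
    have := hs.to_subtype
    rw [← withDensity_apply _ hAm]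
    refine measure_eq_of_forall_subset_cover (fun i : s => V i)
      (fun i => (hV i (hsU i.2)).measurableSet) hAm ?_ ?_
    · rw [Set.iUnion_subtype]; exact hA.trans hAs
    · intro i C hC hCV hCA
      rw [withDensity_apply _ hC, hint i (hsU i.2) C hCV hC]
      exact setLIntegral_congr_fun hC fun u hu => by
        simp only [hloc i (hsU i.2) u (hA (hCA hu)) (hCV hu)]

/-- Smoothness of integrals depending on a parameter. -/
theorem contDiffOn_integral_param {P : Type*} [NormedAddCommGroup P] [NormedSpace ℝ P] {d : ℕ}
    {s : Set P} (hs : IsOpen s) {K V : Set (Fin d → ℝ)} (hK : IsCompact K) (hV : IsOpen V)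
    (hKV : K ⊆ V) (ν : Measure (Fin d → ℝ)) [IsLocallyFiniteMeasure ν] (hν : ν Kᶜ = 0)
    {f : P × (Fin d → ℝ) → ℝ} (hf : ContDiffOn ℝ ∞ f (s ×ˢ V)) :
    ContDiffOn ℝ ∞ (fun p => ∫ x, f (p, x) ∂ν) s := by
  obtain ⟨K', hK', hKK', hK'V⟩ := exists_compact_between hK hV hKV
  obtain ⟨χ, hχ1, hχ0, -⟩ := exists_contMDiffMap_one_nhds_of_subset_interior (n := ⊤)
    𝓘(ℝ, Fin d → ℝ) hK.isClosed hKK'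
  have hχ : ContDiff ℝ ∞ χ := χ.contMDiff.contDiff
  -- The sign is chosen so that the convolution of the constant 1 with `g p`, evaluated at 0, is ∫
  -- χ(x) f(p, x) dν(x). The cut-off χ is 1 on `K`, which carries ν, so this is the wanted integral,
  -- and smoothness of convolutions with a parameter applies.
  let g : P → (Fin d → ℝ) → ℝ := fun p y => χ (-y) * f (p, -y)
  have hg : ContDiffOn ℝ ∞ ↿g (s ×ˢ Set.univ) := by
    rintro ⟨p, y⟩ ⟨hp, -⟩
    by_cases hy : -y ∈ V
    · have h1 : ContDiffAt ℝ ∞ f (p, -y) := hf.contDiffAt ((hs.prod hV).mem_nhds ⟨hp, hy⟩)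
      have h2 : ContDiffAt ℝ ∞ (fun q : P × (Fin d → ℝ) => χ (-q.2)) (p, y) :=
        (hχ.comp contDiff_snd.neg).contDiffAt
      have h3 : ContDiffAt ℝ ∞ (fun q : P × (Fin d → ℝ) => f (q.1, -q.2)) (p, y) :=
        ContDiffAt.comp (g := f) (f := fun q : P × (Fin d → ℝ) => (q.1, -q.2)) (p, y) h1
          (contDiff_fst.prodMk contDiff_snd.neg).contDiffAt
      exact (h2.mul h3).contDiffWithinAt
    · have hy' : -y ∉ K' := fun h => hy (hK'V h)
      apply ContDiffAt.contDiffWithinAt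
      apply contDiffAt_const (c := (0 : ℝ)) |>.congr_of_eventuallyEq
      have : ∀ᶠ q : P × (Fin d → ℝ) in 𝓝 (p, y), -q.2 ∈ K'ᶜ :=
        (continuous_snd.neg.continuousAt (x := (p, y))).eventually
          (hK'.isClosed.isOpen_compl.mem_nhds hy')
      filter_upwards [this] with q hq
      change χ (-q.2) * _ = 0
      rw [hχ0 _ hq, zero_mul]
  have hgs : ∀ p x, p ∈ s → x ∉ (-K') → g p x = 0 := by
    intro p x _ hx
    change χ (-x) * _ = 0
    rw [hχ0 _ (fun h => hx (by simpa using h)), zero_mul]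
  have key := contDiffOn_convolution_right_with_param_comp (n := ⊤) (μ := ν)
    (ContinuousLinearMap.mul ℝ ℝ) (v := fun _ : P => (0 : Fin d → ℝ)) contDiffOn_const
    (f := fun _ => (1 : ℝ)) hs hK'.neg hgs (locallyIntegrable_const 1) hg
  refine key.congr fun p hp => ?_
  simp only [convolution, zero_sub, ContinuousLinearMap.mul_apply', one_mul, g, neg_neg]
  apply integral_congr_ae
  have : ∀ᵐ x ∂ν, x ∈ K := by
    rw [ae_iff]; exact hν
  filter_upwards [this] with x hx
  rw [(hχ1.self_of_nhdsSet x hx : χ x = 1), one_mul]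

/-- For skew A one has x·(A + c)x = c|x|², so A + c is invertible for c > 0. Hence the determinant
does not vanish on the segment from A to the identity and keeps the sign it has at the identity. In
odd size, det A = −det A. -/
theorem det_pos_of_transpose_eq_neg {n : ℕ} {A : Matrix (Fin n) (Fin n) ℝ}
    (hA : A.transpose = -A) (hd : A.det ≠ 0) : Even n ∧ 0 < A.det := by
  have hn : Even n := by
    by_contra hn
    have h1 := A.det_transpose
    rw [hA, Matrix.det_neg, Fintype.card_fin, (Nat.not_even_iff_odd.1 hn).neg_one_pow] at h1
    apply hd
    linarith
  refine ⟨hn, lt_of_le_of_ne ?_ hd.symm⟩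
  have hq : ∀ x : Fin n → ℝ, x ⬝ᵥ A.mulVec x = 0 := by
    intro x
    have h1 : x ⬝ᵥ A.mulVec x = x ⬝ᵥ A.transpose.mulVec x := by
      rw [Matrix.mulVec_transpose, Matrix.dotProduct_mulVec, dotProduct_comm]
    rw [hA, Matrix.neg_mulVec, dotProduct_neg] at h1
    linarith
  have hinv : ∀ c : ℝ, 0 < c → (A + c • 1).det ≠ 0 := by
    intro c hc h0
    obtain ⟨x, hx, hx0⟩ := Matrix.exists_mulVec_eq_zero_iff.2 h0
    have h2 : x ⬝ᵥ (A + c • (1 : Matrix (Fin n) (Fin n) ℝ)).mulVec x = 0 := by rw [hx0]; simp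
    rw [Matrix.add_mulVec, dotProduct_add, hq, zero_add, Matrix.smul_mulVec, Matrix.one_mulVec,
      dotProduct_smul, smul_eq_mul, mul_eq_zero] at h2
    exact hx (dotProduct_self_eq_zero.1 (h2.resolve_left hc.ne'))
  by_contra! hneg
  -- interpolate between `A` and the identity
  have hcont : ContinuousOn (fun r : ℝ => ((1 - r) • A + r • (1 : Matrix (Fin n) (Fin n) ℝ)).det)
      (Set.Icc 0 1) := by fun_prop
  have := intermediate_value_Icc zero_le_one hcont
  obtain ⟨r, hr, hr0⟩ := this (show (0 : ℝ) ∈ _ by simp [hneg.le])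
  rcases hr.2.eq_or_lt with h1 | h1
  · simp [h1] at hr0
  rcases hr.1.eq_or_lt with h0 | h0
  · rw [← h0] at hr0
    simp at hr0
    exact hd hr0
  · have hpos : 0 < 1 - r := by linarith
    apply hinv (r / (1 - r)) (by positivity)
    have : (1 - r) • A + r • (1 : Matrix (Fin n) (Fin n) ℝ) =
        (1 - r) • (A + (r / (1 - r)) • (1 : Matrix (Fin n) (Fin n) ℝ)) := by
      rw [smul_add, smul_smul, mul_div_cancel₀ _ hpos.ne']
    simp only [this, Matrix.det_smul, mul_eq_zero] at hr0
    exact hr0.resolve_left (pow_ne_zero _ hpos.ne')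

end MeasureLemmas

/-! ### Tangent spaces of fibres -/

section LocalParamTangent

variable {E F N M P : Type*} [NormedAddCommGroup E] [NormedSpace ℝ E]
  [NormedAddCommGroup F] [NormedSpace ℝ F] [NormedAddCommGroup P] [NormedSpace ℝ P]
  [TopologicalSpace N] [ChartedSpace E N] [TopologicalSpace M] [ChartedSpace F M]

namespace IsLocalParam

variable {S : Set N} {U : Set P} {ψ : P → N} {W : Set N} {r : N → P}

theorem mdifferentiableAt (h : IsLocalParam (E := E) S U ψ W r) {u : P} (hu : u ∈ U) :
    MDifferentiableAt 𝓘(ℝ, P) 𝓘(ℝ, E) ψ u :=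
  (h.contMDiffOn.contMDiffAt (h.isOpen_dom.mem_nhds hu)).mdifferentiableAt (by simp)

theorem mdifferentiableAt_ret (h : IsLocalParam (E := E) S U ψ W r) {g : N} (hg : g ∈ W) :
    MDifferentiableAt 𝓘(ℝ, E) 𝓘(ℝ, P) r g :=
  (h.contMDiffOn_ret.contMDiffAt (h.isOpen_nhd.mem_nhds hg)).mdifferentiableAt (by simp)

theorem mfderiv_ret_mfderiv (h : IsLocalParam (E := E) S U ψ W r) {u : P} (hu : u ∈ U) (w : P) :
    (mfderiv 𝓘(ℝ, E) 𝓘(ℝ, P) r (ψ u) (mfderiv 𝓘(ℝ, P) 𝓘(ℝ, E) ψ u w) : P) = w := by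
  have h1 := mfderiv_comp u (h.mdifferentiableAt_ret (h.mem_nhd u hu)) (h.mdifferentiableAt hu)
  have h2 : r ∘ ψ =ᶠ[𝓝 u] id := by
    filter_upwards [h.isOpen_dom.mem_nhds hu] with v hv using h.ret_param v hv
  rw [h2.mfderiv_eq, mfderiv_id] at h1
  exact (congrArg (fun L => L w) h1).symm

theorem injective_mfderiv (h : IsLocalParam (E := E) S U ψ W r) {u : P} (hu : u ∈ U) :
    Function.Injective (mfderiv 𝓘(ℝ, P) 𝓘(ℝ, E) ψ u) := fun v w hvw => by
  rw [← h.mfderiv_ret_mfderiv hu v, ← h.mfderiv_ret_mfderiv hu w, hvw]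

theorem injOn (h : IsLocalParam (E := E) S U ψ W r) : Set.InjOn ψ U := fun u hu v hv huv => by
  rw [← h.ret_param u hu, huv, h.ret_param v hv]

theorem continuousOn (h : IsLocalParam (E := E) S U ψ W r) : ContinuousOn ψ U :=
  h.contMDiffOn.continuousOn

end IsLocalParam

theorem mfderiv_comp_eq_zero {p : N → M} {ψ : P → N} {U : Set P} {u : P} {x : M} (hU : IsOpen U)
    (hu : u ∈ U) (hp : MDifferentiableAt 𝓘(ℝ, E) 𝓘(ℝ, F) p (ψ u))
    (hψ : MDifferentiableAt 𝓘(ℝ, P) 𝓘(ℝ, E) ψ u) (hx : ∀ v ∈ U, p (ψ v) = x) (w : P) :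
    mfderiv 𝓘(ℝ, E) 𝓘(ℝ, F) p (ψ u) (mfderiv 𝓘(ℝ, P) 𝓘(ℝ, E) ψ u w) = 0 := by
  have h1 := mfderiv_comp u hp hψ
  have h2 : p ∘ ψ =ᶠ[𝓝 u] fun _ => x := by
    filter_upwards [hU.mem_nhds hu] with v hv using hx v hv
  rw [h2.mfderiv_eq, mfderiv_const] at h1
  exact (congrArg (fun L => L w) h1).symm

theorem finrank_ker_mfderiv_of_isSubmersion [FiniteDimensional ℝ E] [FiniteDimensional ℝ F]
    [IsManifold 𝓘(ℝ, F) ∞ M] {p : N → M}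
    (hp : Manifold.IsSubmersion 𝓘(ℝ, E) 𝓘(ℝ, F) ∞ p) (g : N) :
    Module.finrank ℝ (mfderiv 𝓘(ℝ, E) 𝓘(ℝ, F) p g : E →L[ℝ] F).ker =
      Module.finrank ℝ E - Module.finrank ℝ F := by
  have hs : Function.Surjective (mfderiv 𝓘(ℝ, E) 𝓘(ℝ, F) p g : E →L[ℝ] F) :=
    surjective_mfderiv_of_isSubmersion hp g
  suffices ∀ D : E →L[ℝ] F, Function.Surjective D →
      Module.finrank ℝ D.ker = Module.finrank ℝ E - Module.finrank ℝ F from this _ hs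
  intro D hs
  have h1 := LinearMap.finrank_range_add_finrank_ker D.toLinearMap
  rw [LinearMap.range_eq_top.2 hs, finrank_top] at h1
  exact Nat.eq_sub_of_add_eq' h1

/-- The tangent spaces of the fibres of a submersion are the kernels of its differential. -/
theorem range_mfderiv_of_isLocalParam_fibre [FiniteDimensional ℝ E] [FiniteDimensional ℝ F]
    [FiniteDimensional ℝ P] [IsManifold 𝓘(ℝ, F) ∞ M] {p : N → M} {x : M} {U : Set P} {ψ : P → N}
    {W : Set N} {r : N → P}
    (hp : Manifold.IsSubmersion 𝓘(ℝ, E) 𝓘(ℝ, F) ∞ p)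
    (h : IsLocalParam (E := E) (p ⁻¹' {x}) U ψ W r)
    (hP : Module.finrank ℝ P = Module.finrank ℝ E - Module.finrank ℝ F) {u : P} (hu : u ∈ U) :
    (mfderiv 𝓘(ℝ, P) 𝓘(ℝ, E) ψ u : P →L[ℝ] E).range =
      (mfderiv 𝓘(ℝ, E) 𝓘(ℝ, F) p (ψ u) : E →L[ℝ] F).ker := by
  have hk := finrank_ker_mfderiv_of_isSubmersion hp (ψ u)
  have hi : Function.Injective (mfderiv 𝓘(ℝ, P) 𝓘(ℝ, E) ψ u : P →L[ℝ] E) := h.injective_mfderiv hu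
  have h0 : ∀ w, (mfderiv 𝓘(ℝ, E) 𝓘(ℝ, F) p (ψ u) : E →L[ℝ] F)
      ((mfderiv 𝓘(ℝ, P) 𝓘(ℝ, E) ψ u : P →L[ℝ] E) w) = 0 := fun w => mfderiv_comp_eq_zero
    h.isOpen_dom hu ((hp.contMDiff _).mdifferentiableAt (by simp)) (h.mdifferentiableAt hu) h.mem w
  suffices ∀ (D : P →L[ℝ] E) (D' : E →L[ℝ] F), Function.Injective D → (∀ w, D' (D w) = 0) →
      Module.finrank ℝ D'.ker = Module.finrank ℝ E - Module.finrank ℝ F → D.range = D'.ker from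
    this _ _ hi h0 hk
  intro D D' hi h0 hk
  apply Submodule.eq_of_le_of_finrank_eq
  · rintro _ ⟨w, rfl⟩
    exact h0 w
  · rw [hk, ← hP]
    exact LinearMap.finrank_range_of_inj hi

/-- Both sides equal the common dimension of the kernels minus dim(ker S ∩ ker T). -/
theorem finrank_map_ker_comm {E F : Type*} [NormedAddCommGroup E] [NormedSpace ℝ E]
    [NormedAddCommGroup F] [NormedSpace ℝ F] [FiniteDimensional ℝ E] (S T : E →L[ℝ] F)
    (h : Module.finrank ℝ S.ker = Module.finrank ℝ T.ker) :
    Module.finrank ℝ (S.ker.map T.toLinearMap) = Module.finrank ℝ (T.ker.map S.toLinearMap) := by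
  have key : ∀ S T : E →L[ℝ] F, Module.finrank ℝ (S.ker.map T.toLinearMap) +
      Module.finrank ℝ (S.ker ⊓ T.ker : Submodule ℝ E) = Module.finrank ℝ S.ker := by
    intro S T
    have h1 := LinearMap.finrank_range_add_finrank_ker (T.toLinearMap.domRestrict S.ker)
    rw [LinearMap.range_domRestrict] at h1
    rw [← h1, LinearMap.ker_domRestrict]
    congr 1
    have h2 := Submodule.finrank_map_subtype_eq S.ker (T.ker.comap S.ker.subtype)
    rw [Submodule.map_comap_subtype] at h2
    exact h2
  have h1 := key S T
  have h2 := key T S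
  rw [inf_comm] at h2
  omega

end LocalParamTangent

/-! ### The opposite groupoid, and tangent spaces of orbits -/

namespace LieGroupoid

variable {E F G M : Type*} [NormedAddCommGroup E] [NormedSpace ℝ E]
  [NormedAddCommGroup F] [NormedSpace ℝ F] [TopologicalSpace G] [ChartedSpace E G]
  [TopologicalSpace M] [ChartedSpace F M] (𝒢 : LieGroupoid E F G M)

/-- The opposite groupoid. -/
def op : LieGroupoid E F G M where
  src := 𝒢.tgt
  tgt := 𝒢.src
  unit := 𝒢.unit
  inv := 𝒢.inv
  mul g h := 𝒢.mul h g
  src_unit := 𝒢.tgt_unit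
  tgt_unit := 𝒢.src_unit
  src_inv := 𝒢.tgt_inv
  tgt_inv := 𝒢.src_inv
  src_mul g h H := 𝒢.tgt_mul h g H.symm
  tgt_mul g h H := 𝒢.src_mul h g H.symm
  mul_assoc g h k H H' := (𝒢.mul_assoc k h g H'.symm H.symm).symm
  unit_mul := 𝒢.mul_unit
  mul_unit := 𝒢.unit_mul
  inv_mul := 𝒢.mul_inv
  mul_inv := 𝒢.inv_mul
  isSubmersion_src := 𝒢.isSubmersion_tgt
  isSubmersion_tgt := 𝒢.isSubmersion_src
  contMDiff_unit := 𝒢.contMDiff_unit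
  contMDiff_inv := 𝒢.contMDiff_inv
  contMDiffOn_mul := 𝒢.contMDiffOn_mul.comp
    (contMDiff_snd.prodMk contMDiff_fst).contMDiffOn fun _ hp => Eq.symm hp

/-- The differential of the source map, as a linear map between the model spaces. -/
noncomputable def dsrc (g : G) : E →L[ℝ] F := mfderiv 𝓘(ℝ, E) 𝓘(ℝ, F) 𝒢.src g

/-- The differential of the target map, as a linear map between the model spaces. -/
noncomputable def dtgt (g : G) : E →L[ℝ] F := mfderiv 𝓘(ℝ, E) 𝓘(ℝ, F) 𝒢.tgt g

/-- The tangent space at `y` of the orbit through `y`. -/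
noncomputable def orbitSpace (y : M) : Submodule ℝ F :=
  (𝒢.dsrc (𝒢.unit y)).ker.map (𝒢.dtgt (𝒢.unit y)).toLinearMap

theorem contMDiff_src : ContMDiff 𝓘(ℝ, E) 𝓘(ℝ, F) ∞ 𝒢.src := 𝒢.isSubmersion_src.contMDiff

theorem contMDiff_tgt : ContMDiff 𝓘(ℝ, E) 𝓘(ℝ, F) ∞ 𝒢.tgt := 𝒢.isSubmersion_tgt.contMDiff

theorem mdifferentiableAt_src (g : G) : MDifferentiableAt 𝓘(ℝ, E) 𝓘(ℝ, F) 𝒢.src g :=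
  (𝒢.contMDiff_src g).mdifferentiableAt (by simp)

theorem mdifferentiableAt_tgt (g : G) : MDifferentiableAt 𝓘(ℝ, E) 𝓘(ℝ, F) 𝒢.tgt g :=
  (𝒢.contMDiff_tgt g).mdifferentiableAt (by simp)

theorem contMDiffOn_mul_comp {P : Type*} [NormedAddCommGroup P] [NormedSpace ℝ P] {U : Set P}
    {φ ψ : P → G} (hφ : ContMDiffOn 𝓘(ℝ, P) 𝓘(ℝ, E) ∞ φ U)
    (hψ : ContMDiffOn 𝓘(ℝ, P) 𝓘(ℝ, E) ∞ ψ U) (h : ∀ u ∈ U, 𝒢.src (φ u) = 𝒢.tgt (ψ u)) :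
    ContMDiffOn 𝓘(ℝ, P) 𝓘(ℝ, E) ∞ (fun u => 𝒢.mul (φ u) (ψ u)) U :=
  𝒢.contMDiffOn_mul.comp (hφ.prodMk hψ) h

theorem continuousOn_mul_comp {P : Type*} [TopologicalSpace P] {U : Set P}
    {φ ψ : P → G} (hφ : ContinuousOn φ U)
    (hψ : ContinuousOn ψ U) (h : ∀ u ∈ U, 𝒢.src (φ u) = 𝒢.tgt (ψ u)) :
    ContinuousOn (fun u => 𝒢.mul (φ u) (ψ u)) U :=
  𝒢.contMDiffOn_mul.continuousOn.comp (hφ.prodMk hψ) h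

theorem mul_inv_mul (g h : G) (H : 𝒢.src g = 𝒢.src h) : 𝒢.mul (𝒢.mul g (𝒢.inv h)) h = g := by
  rw [𝒢.mul_assoc _ _ _ (by rw [H, 𝒢.tgt_inv]) (𝒢.src_inv h), 𝒢.inv_mul, ← H, 𝒢.mul_unit]

theorem mul_mul_inv (g h : G) (H : 𝒢.src g = 𝒢.tgt h) : 𝒢.mul (𝒢.mul g h) (𝒢.inv h) = g := by
  rw [𝒢.mul_assoc _ _ _ H (𝒢.tgt_inv h).symm, 𝒢.mul_inv, ← H, 𝒢.mul_unit]

theorem inv_mul_mul (g h : G) (H : 𝒢.src g = 𝒢.tgt h) : 𝒢.mul (𝒢.inv g) (𝒢.mul g h) = h :=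
  𝒢.op.mul_mul_inv h g H.symm

theorem mul_mul_inv' (g h : G) (H : 𝒢.tgt g = 𝒢.tgt h) : 𝒢.mul g (𝒢.mul (𝒢.inv g) h) = h :=
  𝒢.op.mul_inv_mul h g H.symm

theorem inv_inv (g : G) : 𝒢.inv (𝒢.inv g) = g := by
  have h := 𝒢.mul_mul_inv g (𝒢.inv g) (𝒢.tgt_inv g).symm
  rw [𝒢.mul_inv] at h
  have h2 := 𝒢.unit_mul (𝒢.inv (𝒢.inv g))
  rw [𝒢.tgt_inv, 𝒢.src_inv, h] at h2
  exact h2.symm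

theorem inv_mul_rev (g h : G) (H : 𝒢.src g = 𝒢.tgt h) :
    𝒢.inv (𝒢.mul g h) = 𝒢.mul (𝒢.inv h) (𝒢.inv g) := by
  have h1 := 𝒢.mul_mul_inv g h H
  have h2 := 𝒢.inv_mul_mul (𝒢.mul g h) (𝒢.inv h) (by rw [𝒢.src_mul _ _ H, 𝒢.tgt_inv])
  rw [h1] at h2
  have h3 := 𝒢.mul_mul_inv (𝒢.inv (𝒢.mul g h)) g (by rw [𝒢.src_inv, 𝒢.tgt_mul _ _ H])
  rw [h2] at h3
  exact h3.symm

variable [FiniteDimensional ℝ E] [FiniteDimensional ℝ F] [IsManifold 𝓘(ℝ, F) ∞ M]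

/-- Right translation by `h` maps one source fibre to another and preserves targets; `v'` is the
image of `v` under its differential. The translation is only defined on the fibre, so it is
differentiated through a parametrisation of the fibre. -/
theorem exists_mem_ker_dsrc_mul (g h : G) (H : 𝒢.src g = 𝒢.tgt h) (v : E) (hv : 𝒢.dsrc g v = 0) :
    ∃ v' : E, 𝒢.dsrc (𝒢.mul g h) v' = 0 ∧ 𝒢.dtgt (𝒢.mul g h) v' = 𝒢.dtgt g v := by
  obtain ⟨U, ψ, W, r, hψ, hgW⟩ := exists_isLocalParam_fibre 𝒢.isSubmersion_src g
  have hu := hψ.ret_mem g hgW rfl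
  have hgu := hψ.param_ret g hgW rfl
  set u := r g
  have hs : ∀ w ∈ U, 𝒢.src (ψ w) = 𝒢.tgt h := fun w hw => (hψ.mem w hw).trans H
  have hm : ContMDiffOn 𝓘(ℝ, _) 𝓘(ℝ, E) ∞ (fun w => 𝒢.mul (ψ w) h) U :=
    𝒢.contMDiffOn_mul_comp hψ.contMDiffOn contMDiffOn_const hs
  have hmd : MDifferentiableAt 𝓘(ℝ, _) 𝓘(ℝ, E) (fun w => 𝒢.mul (ψ w) h) u :=
    (hm.contMDiffAt (hψ.isOpen_dom.mem_nhds hu)).mdifferentiableAt (by simp)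
  have hrange := range_mfderiv_of_isLocalParam_fibre 𝒢.isSubmersion_src hψ (by simp) hu
  obtain ⟨w, hw⟩ : v ∈ (mfderiv 𝓘(ℝ, _) 𝓘(ℝ, E) ψ u : _ →L[ℝ] E).range := by
    rw [hrange, hgu]; exact hv
  rw [← hgu]
  refine ⟨mfderiv 𝓘(ℝ, _) 𝓘(ℝ, E) (fun w => 𝒢.mul (ψ w) h) u w, ?_, ?_⟩
  · exact mfderiv_comp_eq_zero hψ.isOpen_dom hu (𝒢.mdifferentiableAt_src _) hmd
      (fun w hw => 𝒢.src_mul _ _ (hs w hw)) w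
  · have h1 := mfderiv_comp u (𝒢.mdifferentiableAt_tgt _) hmd
    have h2 := mfderiv_comp u (𝒢.mdifferentiableAt_tgt _) (hψ.mdifferentiableAt hu)
    have h3 : 𝒢.tgt ∘ (fun w => 𝒢.mul (ψ w) h) =ᶠ[𝓝 u] 𝒢.tgt ∘ ψ := by
      filter_upwards [hψ.isOpen_dom.mem_nhds hu] with w hw using 𝒢.tgt_mul _ _ (hs w hw)
    rw [h3.mfderiv_eq] at h1
    have h4 := congrArg (fun L => (L w : F)) (h1.symm.trans h2)
    rw [← hw]
    exact h4

theorem map_ker_dsrc (g : G) :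
    (𝒢.dsrc g).ker.map (𝒢.dtgt g).toLinearMap = 𝒢.orbitSpace (𝒢.tgt g) := by
  apply le_antisymm
  · rintro _ ⟨v, hv, rfl⟩
    obtain ⟨v', hv', h⟩ := 𝒢.exists_mem_ker_dsrc_mul g (𝒢.inv g) (𝒢.tgt_inv g).symm v hv
    rw [𝒢.mul_inv] at hv' h
    exact ⟨v', hv', h⟩
  · rintro _ ⟨v, hv, rfl⟩
    obtain ⟨v', hv', h⟩ := 𝒢.exists_mem_ker_dsrc_mul (𝒢.unit (𝒢.tgt g)) g (𝒢.src_unit _) v hv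
    rw [𝒢.unit_mul] at hv' h
    exact ⟨v', hv', h⟩

theorem finrank_ker_dsrc (g : G) :
    Module.finrank ℝ (𝒢.dsrc g).ker = Module.finrank ℝ E - Module.finrank ℝ F :=
  finrank_ker_mfderiv_of_isSubmersion 𝒢.isSubmersion_src g

theorem finrank_ker_dtgt (g : G) :
    Module.finrank ℝ (𝒢.dtgt g).ker = Module.finrank ℝ E - Module.finrank ℝ F :=
  finrank_ker_mfderiv_of_isSubmersion 𝒢.isSubmersion_tgt g

/-- At `g` the spaces dt(ker ds) and ds(ker dt) have the same dimension. The first is the orbit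
space at t(g), the second that of the opposite groupoid at s(g), and the same comparison at the unit
of s(g) identifies the dimensions for the two groupoids. This is what makes the rank of t on a
source fibre constant. -/
theorem finrank_orbitSpace (g : G) :
    Module.finrank ℝ (𝒢.orbitSpace (𝒢.tgt g)) = Module.finrank ℝ (𝒢.orbitSpace (𝒢.src g)) := by
  have key : ∀ g : G, Module.finrank ℝ (𝒢.orbitSpace (𝒢.tgt g)) =
      Module.finrank ℝ (𝒢.op.orbitSpace (𝒢.src g)) := by
    intro g
    rw [← 𝒢.map_ker_dsrc g]
    have h := 𝒢.op.map_ker_dsrc g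
    change _ = 𝒢.op.orbitSpace (𝒢.src g) at h
    rw [← h]
    exact finrank_map_ker_comm _ _ (by rw [finrank_ker_dsrc, finrank_ker_dtgt])
  rw [key]
  have h := key (𝒢.unit (𝒢.src g))
  rw [𝒢.tgt_unit, 𝒢.src_unit] at h
  exact h.symm

end LieGroupoid

/-! ### Linear algebra of 2-forms -/

section

variable {E : Type*} [NormedAddCommGroup E] [NormedSpace ℝ E] (σ : E [⋀^Fin 2]→L[ℝ] ℝ)

theorem form_add_left (X X' Y : E) : σ ![X + X', Y] = σ ![X, Y] + σ ![X', Y] := by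
  simpa using σ.toMultilinearMap.cons_add ![Y] X X'

theorem form_smul_left (c : ℝ) (X Y : E) : σ ![c • X, Y] = c * σ ![X, Y] := by
  simpa using σ.toMultilinearMap.cons_smul ![Y] c X

theorem form_swap (X Y : E) : σ ![X, Y] = - σ ![Y, X] := by
  have := σ.toAlternatingMap.map_swap ![Y, X] (i := 0) (j := 1) (by simp)
  have e : ![Y, X] ∘ Equiv.swap (0 : Fin 2) 1 = ![X, Y] := by
    funext i; fin_cases i <;> simp
  rw [e] at this
  simpa using this

theorem form_zero_left (Y : E) : σ ![0, Y] = 0 := by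
  simpa using form_smul_left σ 0 0 Y

/-- A 2-form as a bilinear form. -/
def formBilin : E →ₗ[ℝ] E →ₗ[ℝ] ℝ := LinearMap.mk₂ ℝ (fun X Y => σ ![X, Y]) (form_add_left σ)
    (form_smul_left σ)
    (fun X Y Y' => by rw [form_swap, form_add_left, form_swap σ Y, form_swap σ Y']; ring)
    (fun c X Y => by
      rw [form_swap, form_smul_left, form_swap σ Y, smul_eq_mul]; ring)

@[simp] theorem formBilin_apply (X Y : E) : formBilin σ X Y = σ ![X, Y] := rfl

/-- An isotropic pair of subspaces for a nondegenerate 2-form: if `A` and `B` are orthogonal, their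
dimensions add up to at most that of the space, and in the case of equality each one is the
orthogonal complement of the other. -/
theorem finrank_add_le_of_orthogonal [FiniteDimensional ℝ E]
    (h : ∀ X, (∀ Y, σ ![X, Y] = 0) → X = 0) (A B : Submodule ℝ E)
    (hAB : ∀ X ∈ A, ∀ Y ∈ B, σ ![X, Y] = 0) :
    Module.finrank ℝ A + Module.finrank ℝ B ≤ Module.finrank ℝ E ∧
    (Module.finrank ℝ A + Module.finrank ℝ B = Module.finrank ℝ E →
      ∀ X, (∀ Y ∈ B, σ ![X, Y] = 0) → X ∈ A) := by
  have hinj : Function.Injective (formBilin σ) := by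
    rw [injective_iff_map_eq_zero]
    exact fun X hX => h X fun Y => LinearMap.congr_fun hX Y
  let C : Submodule ℝ E := B.dualAnnihilator.comap (formBilin σ)
  have hAC : A ≤ C := fun X hX => by
    rw [Submodule.mem_comap, Submodule.mem_dualAnnihilator]
    exact hAB X hX
  have hC : Module.finrank ℝ C ≤ Module.finrank ℝ B.dualAnnihilator :=
    LinearMap.finrank_le_finrank_of_injective (f := (formBilin σ).restrict (p := C)
      (q := B.dualAnnihilator) fun x hx => hx) fun x y hxy => by
        apply Subtype.ext
        apply hinj
        exact congrArg Subtype.val hxy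
  have hB := Subspace.finrank_add_finrank_dualAnnihilator_eq B
  have hA := Submodule.finrank_mono hAC
  refine ⟨by omega, fun heq X hX => ?_⟩
  have : A = C := Submodule.eq_of_le_of_finrank_le hAC (by omega)
  rw [this, Submodule.mem_comap, Submodule.mem_dualAnnihilator]
  exact hX

end

namespace LieGroupoid

variable {E F G M : Type*} [NormedAddCommGroup E] [NormedSpace ℝ E]
  [NormedAddCommGroup F] [NormedSpace ℝ F] [TopologicalSpace G] [ChartedSpace E G]
  [TopologicalSpace M] [ChartedSpace F M] (𝒢 : LieGroupoid E F G M)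

theorem exists_hasMFDerivWithinAt_mul (g h : G) (H : 𝒢.src g = 𝒢.tgt h) :
    ∃ L : E × E →L[ℝ] E, HasMFDerivWithinAt (𝓘(ℝ, E).prod 𝓘(ℝ, E)) 𝓘(ℝ, E)
      (fun p : G × G => 𝒢.mul p.1 p.2) {p : G × G | 𝒢.src p.1 = 𝒢.tgt p.2} (g, h) L :=
  ⟨_, ((𝒢.contMDiffOn_mul (g, h) H).mdifferentiableWithinAt (by simp)).hasMFDerivWithinAt⟩

/-- Evaluates the differential `L` of the product on vectors tangent to the composable pairs: it
suffices to exhibit a family of composable pairs with these velocities whose products are known. -/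
theorem mfderiv_mul_comp {P : Type*} [NormedAddCommGroup P] [NormedSpace ℝ P] {g h : G}
    {L : E × E →L[ℝ] E} (hL : HasMFDerivWithinAt (𝓘(ℝ, E).prod 𝓘(ℝ, E)) 𝓘(ℝ, E)
      (fun p : G × G => 𝒢.mul p.1 p.2) {p : G × G | 𝒢.src p.1 = 𝒢.tgt p.2} (g, h) L)
    {U : Set P} {u : P} (hU : IsOpen U) (hu : u ∈ U) {φ ψ : P → G} {κ : P → G}
    (hg : φ u = g) (hh : ψ u = h) (hφ : MDifferentiableAt 𝓘(ℝ, P) 𝓘(ℝ, E) φ u)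
    (hψ : MDifferentiableAt 𝓘(ℝ, P) 𝓘(ℝ, E) ψ u) (hc : ∀ v ∈ U, 𝒢.src (φ v) = 𝒢.tgt (ψ v))
    (hκ : ∀ v ∈ U, 𝒢.mul (φ v) (ψ v) = κ v) (w : P) :
    L ((mfderiv 𝓘(ℝ, P) 𝓘(ℝ, E) φ u : P →L[ℝ] E) w, (mfderiv 𝓘(ℝ, P) 𝓘(ℝ, E) ψ u : P →L[ℝ] E) w) =
      (mfderiv 𝓘(ℝ, P) 𝓘(ℝ, E) κ u : P →L[ℝ] E) w := by
  subst hg hh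
  have h1 := (hφ.hasMFDerivAt.prodMk hψ.hasMFDerivAt).hasMFDerivWithinAt (s := U)
  have h2 := HasMFDerivWithinAt.comp (I' := 𝓘(ℝ, E).prod 𝓘(ℝ, E))
    (g := fun p : G × G => 𝒢.mul p.1 p.2) (f := fun v => (φ v, ψ v)) u hL h1 (fun v hv => hc v hv)
  have h3 := h2.hasMFDerivAt (hU.mem_nhds hu)
  have h4 : κ =ᶠ[𝓝 u] (fun p : G × G => 𝒢.mul p.1 p.2) ∘ fun v => (φ v, ψ v) := by
    filter_upwards [hU.mem_nhds hu] with v hv using (hκ v hv).symm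
  have h5 := (h3.congr_of_eventuallyEq h4).mfderiv
  rw [h5]
  rfl

end LieGroupoid

/-! ### The symplectic form at the units, and the image of Π♯ -/

namespace SymplecticGroupoid

variable {E F G M : Type*} [NormedAddCommGroup E] [NormedSpace ℝ E] [FiniteDimensional ℝ E]
  [NormedAddCommGroup F] [NormedSpace ℝ F] [FiniteDimensional ℝ F]
  [TopologicalSpace G] [ChartedSpace E G]
  [TopologicalSpace M] [ChartedSpace F M] [IsManifold 𝓘(ℝ, F) ∞ M] (𝒢 : SymplecticGroupoid E F G M)

/-- The symplectic form, as a function with values in the forms on the model space. -/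
def formModel (g : G) : E [⋀^Fin 2]→L[ℝ] ℝ := 𝒢.form g

theorem nondegenerate_formModel (g : G) (X : E) (h : ∀ Y, 𝒢.formModel g ![X, Y] = 0) : X = 0 :=
  𝒢.nondegenerate_form g X h

theorem mul_unit_unit (x : M) : 𝒢.mul (𝒢.unit x) (𝒢.unit x) = 𝒢.unit x := by
  have h := 𝒢.unit_mul (𝒢.unit x)
  rwa [𝒢.tgt_unit] at h

/-- The identities g·1 = g and 1·h = h give L(v, 0) = v and L(0, w) = w, so multiplicativity reads
ω(v, w) = ω(v, 0) + ω(0, w) = 0. -/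
theorem form_unit_orthogonal (x : M) (v w : E) (hv : 𝒢.dsrc (𝒢.unit x) v = 0)
    (hw : 𝒢.dtgt (𝒢.unit x) w = 0) : 𝒢.formModel (𝒢.unit x) ![v, w] = 0 := by
  have hsx := 𝒢.src_unit x
  have htx := 𝒢.tgt_unit x
  obtain ⟨L, hL⟩ := 𝒢.exists_hasMFDerivWithinAt_mul (𝒢.unit x) (𝒢.unit x) (hsx.trans htx.symm)
  have hLv : L (v, 0) = v := by
    obtain ⟨U, ψ, W, r, hψ, hgW⟩ := exists_isLocalParam_fibre 𝒢.isSubmersion_src (𝒢.unit x)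
    have hu := hψ.ret_mem _ hgW rfl
    have hgu := hψ.param_ret _ hgW rfl
    have hrange := range_mfderiv_of_isLocalParam_fibre 𝒢.isSubmersion_src hψ (by simp) hu
    obtain ⟨z, hz⟩ : v ∈ (mfderiv 𝓘(ℝ, _) 𝓘(ℝ, E) ψ (r (𝒢.unit x)) : _ →L[ℝ] E).range := by
      rw [hrange, hgu]; exact hv
    have := 𝒢.mfderiv_mul_comp hL hψ.isOpen_dom hu (φ := ψ) (ψ := fun _ => 𝒢.unit x) (κ := ψ) hgu
      rfl (hψ.mdifferentiableAt hu) mdifferentiableAt_const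
      (fun v hv => (hψ.mem v hv).trans (hsx.trans htx.symm)) (fun v hv => by
        have h := 𝒢.mul_unit (ψ v)
        rwa [show 𝒢.src (ψ v) = x from (hψ.mem v hv).trans hsx] at h) z
    rw [mfderiv_const] at this
    rw [← hz]
    exact this
  have hLw : L (0, w) = w := by
    obtain ⟨U, ψ, W, r, hψ, hgW⟩ := exists_isLocalParam_fibre 𝒢.isSubmersion_tgt (𝒢.unit x)
    have hu := hψ.ret_mem _ hgW rfl
    have hgu := hψ.param_ret _ hgW rfl
    have hrange := range_mfderiv_of_isLocalParam_fibre 𝒢.isSubmersion_tgt hψ (by simp) hu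
    obtain ⟨z, hz⟩ : w ∈ (mfderiv 𝓘(ℝ, _) 𝓘(ℝ, E) ψ (r (𝒢.unit x)) : _ →L[ℝ] E).range := by
      rw [hrange, hgu]; exact hw
    have := 𝒢.mfderiv_mul_comp hL hψ.isOpen_dom hu (φ := fun _ => 𝒢.unit x) (ψ := ψ) (κ := ψ) rfl
      hgu mdifferentiableAt_const (hψ.mdifferentiableAt hu)
      (fun v hv => ((hψ.mem v hv).trans (htx.trans hsx.symm)).symm) (fun v hv => by
        have h := 𝒢.unit_mul (ψ v)
        rwa [show 𝒢.tgt (ψ v) = x from (hψ.mem v hv).trans htx] at h) z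
    rw [mfderiv_const] at this
    rw [← hz]
    exact this
  have key := 𝒢.multiplicative_form (𝒢.unit x) (𝒢.unit x) (hsx.trans htx.symm) L hL v 0 0 w
    (by rw [map_zero]; exact hv) (by rw [map_zero]; exact hw.symm)
  change 𝒢.formModel (𝒢.mul (𝒢.unit x) (𝒢.unit x)) ![L (v, 0), L (0, w)] =
    𝒢.formModel (𝒢.unit x) ![v, 0] + 𝒢.formModel (𝒢.unit x) ![0, w] at key
  rwa [mul_unit_unit, hLv, hLw, form_swap _ v 0, form_zero_left, form_zero_left, neg_zero,
    add_zero] at key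

theorem mdifferentiableAt_unit (x : M) : MDifferentiableAt 𝓘(ℝ, F) 𝓘(ℝ, E) 𝒢.unit x :=
  (𝒢.contMDiff_unit x).mdifferentiableAt (by simp)

/-- The differential of the unit map, as a linear map between the model spaces. -/
noncomputable def dunit (x : M) : F →L[ℝ] E := mfderiv 𝓘(ℝ, F) 𝓘(ℝ, E) 𝒢.unit x

theorem dsrc_dunit (x : M) (v : F) : 𝒢.dsrc (𝒢.unit x) (𝒢.dunit x v) = v := by
  have h1 := mfderiv_comp x (𝒢.mdifferentiableAt_src (𝒢.unit x)) (𝒢.mdifferentiableAt_unit x)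
  rw [show 𝒢.src ∘ 𝒢.unit = id from funext 𝒢.src_unit, mfderiv_id] at h1
  exact (congrArg (fun L => (L v : F)) h1).symm

theorem dtgt_dunit (x : M) (v : F) : 𝒢.dtgt (𝒢.unit x) (𝒢.dunit x v) = v := by
  have h1 := mfderiv_comp x (𝒢.mdifferentiableAt_tgt (𝒢.unit x)) (𝒢.mdifferentiableAt_unit x)
  rw [show 𝒢.tgt ∘ 𝒢.unit = id from funext 𝒢.tgt_unit, mfderiv_id] at h1
  exact (congrArg (fun L => (L v : F)) h1).symm

/-- Along the pairs (1_y, 1_y), whose product is 1_y, multiplicativity reads ω = ω + ω. The family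
is written in a chart of `M` so that its parameter runs through a normed space. -/
theorem form_dunit_dunit (x : M) (v w : F) :
    𝒢.formModel (𝒢.unit x) ![𝒢.dunit x v, 𝒢.dunit x w] = 0 := by
  have hc : 𝒢.src (𝒢.unit x) = 𝒢.tgt (𝒢.unit x) := by rw [𝒢.src_unit, 𝒢.tgt_unit]
  obtain ⟨L, hL⟩ := 𝒢.exists_hasMFDerivWithinAt_mul (𝒢.unit x) (𝒢.unit x) hc
  have hLv : ∀ v : F, L (𝒢.dunit x v, 𝒢.dunit x v) = 𝒢.dunit x v := by
    set e := extChartAt 𝓘(ℝ, F) x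
    have hsymm : MDifferentiableAt 𝓘(ℝ, F) 𝓘(ℝ, F) e.symm (e x) :=
      ((contMDiffOn_extChartAt_symm (n := ∞) x).contMDiffAt
        (extChartAt_target_mem_nhds x)).mdifferentiableAt (by simp)
    have hex : e.symm (e x) = x := extChartAt_to_inv x
    have hψ : MDifferentiableAt 𝓘(ℝ, F) 𝓘(ℝ, E) (𝒢.unit ∘ e.symm) (e x) :=
      MDifferentiableAt.comp (e x) (𝒢.mdifferentiableAt_unit _) hsymm
    have hcomp := mfderiv_comp (e x) (𝒢.mdifferentiableAt_unit (e.symm (e x))) hsymm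
    intro v
    have key := 𝒢.mfderiv_mul_comp hL (isOpen_extChartAt_target x) (mem_extChartAt_target x)
      (φ := 𝒢.unit ∘ e.symm) (ψ := 𝒢.unit ∘ e.symm) (κ := 𝒢.unit ∘ e.symm)
      (by simp [e]) (by simp [e]) hψ hψ
      (fun z _ => by simp [𝒢.src_unit, 𝒢.tgt_unit]) (fun z _ => 𝒢.mul_unit_unit _)
      ((mfderiv 𝓘(ℝ, F) 𝓘(ℝ, F) e x : F →L[ℝ] F) v)
    have h2 : (mfderiv 𝓘(ℝ, F) 𝓘(ℝ, E) (𝒢.unit ∘ e.symm) (e x) : F →L[ℝ] E)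
        ((mfderiv 𝓘(ℝ, F) 𝓘(ℝ, F) e x : F →L[ℝ] F) v) = 𝒢.dunit x v := by
      have h3 : 𝒢.unit =ᶠ[𝓝 x] (𝒢.unit ∘ e.symm) ∘ e := by
        filter_upwards [extChartAt_source_mem_nhds (I := 𝓘(ℝ, F)) x] with y hy
        exact (congrArg 𝒢.unit (e.left_inv hy)).symm
      have h4 := mfderiv_comp x hψ ((contMDiffAt_extChartAt (n := ∞)).mdifferentiableAt (by simp))
      rw [← h3.mfderiv_eq] at h4
      exact (congrArg (fun L => (L v : E)) h4).symm
    erw [h2] at key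
    exact key
  have key := 𝒢.multiplicative_form (𝒢.unit x) (𝒢.unit x) hc L hL (𝒢.dunit x v) (𝒢.dunit x w)
    (𝒢.dunit x v) (𝒢.dunit x w) ((𝒢.dsrc_dunit x v).trans (𝒢.dtgt_dunit x v).symm)
    ((𝒢.dsrc_dunit x w).trans (𝒢.dtgt_dunit x w).symm)
  change 𝒢.formModel (𝒢.mul (𝒢.unit x) (𝒢.unit x)) ![L _, L _] =
    𝒢.formModel (𝒢.unit x) _ + 𝒢.formModel (𝒢.unit x) _ at key
  rw [mul_unit_unit, hLv, hLv] at key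
  exact left_eq_add.1 key

/-- Orthogonality of the kernels bounds 2(dim E − dim F) by dim E, and isotropy of the unit section
bounds 2 dim F by dim E. -/
theorem finrank_eq_two_mul (𝒢 : SymplecticGroupoid E F G M) (x : M) : Module.finrank ℝ E = 2 * Module.finrank ℝ F := by
  have h1 := (finrank_add_le_of_orthogonal (𝒢.formModel (𝒢.unit x)) (𝒢.nondegenerate_formModel _)
    (𝒢.dsrc (𝒢.unit x)).ker (𝒢.dtgt (𝒢.unit x)).ker
    (fun X hX Y hY => 𝒢.form_unit_orthogonal x X Y hX hY)).1
  have h2 := (finrank_add_le_of_orthogonal (𝒢.formModel (𝒢.unit x)) (𝒢.nondegenerate_formModel _)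
    (𝒢.dunit x).range (𝒢.dunit x).range (by
      rintro _ ⟨v, rfl⟩ _ ⟨w, rfl⟩; exact 𝒢.form_dunit_dunit x v w)).1
  have hi : Function.Injective (𝒢.dunit x) := fun v w h => by
    rw [← 𝒢.dsrc_dunit x v, h, 𝒢.dsrc_dunit]
  have h3 := LinearMap.finrank_range_of_inj (f := (𝒢.dunit x).toLinearMap) hi
  rw [h3] at h2
  rw [𝒢.finrank_ker_dsrc, 𝒢.finrank_ker_dtgt] at h1
  omega

/-- The two orthogonal kernels have dimensions adding up to dim E, so each is the full ω-complement
of the other. -/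
theorem mem_ker_dsrc_iff (x : M) (X : E) : 𝒢.dsrc (𝒢.unit x) X = 0 ↔
    ∀ Y, 𝒢.dtgt (𝒢.unit x) Y = 0 → 𝒢.formModel (𝒢.unit x) ![X, Y] = 0 := by
  refine ⟨fun h Y hY => 𝒢.form_unit_orthogonal x X Y h hY, fun h => ?_⟩
  have hE := 𝒢.finrank_eq_two_mul x
  exact (finrank_add_le_of_orthogonal (𝒢.formModel (𝒢.unit x)) (𝒢.nondegenerate_formModel _)
    (𝒢.dsrc (𝒢.unit x)).ker (𝒢.dtgt (𝒢.unit x)).ker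
    (fun X hX Y hY => 𝒢.form_unit_orthogonal x X Y hX hY)).2
    (by rw [𝒢.finrank_ker_dsrc, 𝒢.finrank_ker_dtgt]; omega) X h

/-- The bundle map `Π^♯` on the model spaces. -/
noncomputable def sharpModel (x : M) (α : F →L[ℝ] ℝ) : F := 𝒢.sharp x α

theorem exists_sharpModel_eq (x : M) (α : F →L[ℝ] ℝ) : ∃ X : E,
    (∀ Y, 𝒢.formModel (𝒢.unit x) ![X, Y] = α (𝒢.dtgt (𝒢.unit x) Y)) ∧
    𝒢.sharpModel x α = 𝒢.dtgt (𝒢.unit x) X := by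
  have h := (existsUnique_dual_of_nondegenerate (E := E) (𝒢.form (𝒢.unit x))
      (𝒢.nondegenerate_form (𝒢.unit x)) ((α : F →L[ℝ] ℝ).comp
        (mfderiv 𝓘(ℝ, E) 𝓘(ℝ, F) 𝒢.tgt (𝒢.unit x) : E →L[ℝ] F))).choose_spec.1
  exact ⟨_, h, rfl⟩

theorem sharpModel_eq (x : M) (α : F →L[ℝ] ℝ) (X : E)
    (hX : ∀ Y, 𝒢.formModel (𝒢.unit x) ![X, Y] = α (𝒢.dtgt (𝒢.unit x) Y)) :
    𝒢.sharpModel x α = 𝒢.dtgt (𝒢.unit x) X := by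
  obtain ⟨X', h, hs⟩ := 𝒢.exists_sharpModel_eq x α
  rw [hs]
  congr 1
  have hsub : X' + (-1 : ℝ) • X = 0 := 𝒢.nondegenerate_formModel (𝒢.unit x) _ fun Y => by
    rw [form_add_left, form_smul_left, h, hX]; ring
  rw [neg_one_smul, add_neg_eq_zero] at hsub
  exact hsub

theorem sharpModel_add (x : M) (α β : F →L[ℝ] ℝ) :
    𝒢.sharpModel x (α + β) = 𝒢.sharpModel x α + 𝒢.sharpModel x β := by
  obtain ⟨X, hX, hX'⟩ := 𝒢.exists_sharpModel_eq x α
  obtain ⟨Y, hY, hY'⟩ := 𝒢.exists_sharpModel_eq x β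
  rw [𝒢.sharpModel_eq x (α + β) (X + Y) fun Z => by rw [form_add_left, hX, hY]; rfl, map_add, hX',
    hY']

theorem sharpModel_smul (x : M) (c : ℝ) (α : F →L[ℝ] ℝ) :
    𝒢.sharpModel x (c • α) = c • 𝒢.sharpModel x α := by
  obtain ⟨X, hX, hX'⟩ := 𝒢.exists_sharpModel_eq x α
  rw [𝒢.sharpModel_eq x (c • α) (c • X) fun Z => by rw [form_smul_left, hX]; rfl, map_smul, hX']

theorem sharpModel_skew (x : M) (α β : F →L[ℝ] ℝ) :
    α (𝒢.sharpModel x β) = - β (𝒢.sharpModel x α) := by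
  obtain ⟨X, hX, hX'⟩ := 𝒢.exists_sharpModel_eq x α
  obtain ⟨Y, hY, hY'⟩ := 𝒢.exists_sharpModel_eq x β
  rw [hX', hY', ← hX, ← hY, form_swap]

/-- A vector X represents some covector t*α exactly when it is ω-orthogonal to ker dt, that is, when
it lies in ker ds. This identifies the tangent spaces of the symplectic leaves with those of the
orbits. -/
theorem mem_range_sharpModel_iff (x : M) (v : F) :
    v ∈ Set.range (𝒢.sharpModel x) ↔ v ∈ 𝒢.orbitSpace x := by
  constructor
  · rintro ⟨α, rfl⟩
    obtain ⟨X, hX, hX'⟩ := 𝒢.exists_sharpModel_eq x α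
    rw [hX']
    refine ⟨X, (𝒢.mem_ker_dsrc_iff x X).2 fun Y hY => ?_, rfl⟩
    rw [hX, hY, map_zero]
  · rintro ⟨X, hX, rfl⟩
    -- the covector `X ⌟ ω` factors through `dt`
    have h0 : ∀ Y, 𝒢.dtgt (𝒢.unit x) Y = 0 → 𝒢.formModel (𝒢.unit x) ![X, Y] = 0 :=
      (𝒢.mem_ker_dsrc_iff x X).1 hX
    -- Since the unit section splits dt, restricting X ⌟ ω to the units recovers the covector on
    -- `M`.
    let α : F →ₗ[ℝ] ℝ := (formBilin (𝒢.formModel (𝒢.unit x)) X).comp (𝒢.dunit x).toLinearMap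
    refine ⟨LinearMap.toContinuousLinearMap α, 𝒢.sharpModel_eq x _ X fun Y => ?_⟩
    change _ = 𝒢.formModel (𝒢.unit x) ![X, 𝒢.dunit x (𝒢.dtgt (𝒢.unit x) Y)]
    have h1 := h0 (Y + (-1 : ℝ) • 𝒢.dunit x (𝒢.dtgt (𝒢.unit x) Y)) (by
      rw [map_add, map_smul, 𝒢.dtgt_dunit]; simp)
    have h2 := (formBilin (𝒢.formModel (𝒢.unit x)) X).map_add Y
      ((-1 : ℝ) • 𝒢.dunit x (𝒢.dtgt (𝒢.unit x) Y))
    rw [map_smul] at h2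
    simp only [formBilin_apply, smul_eq_mul] at h2
    linarith

theorem range_sharp (x : M) : Set.range (𝒢.sharp x) = (𝒢.orbitSpace x : Set F) :=
  Set.ext fun v => 𝒢.mem_range_sharpModel_iff x v

/-- The leafwise symplectic form is computed by any covector representing the first vector. -/
theorem leafForm_eq (x : M) (α : F →L[ℝ] ℝ) (v w : F) (hv : 𝒢.sharpModel x α = v)
    (hw : w ∈ 𝒢.orbitSpace x) : 𝒢.leafForm x v w = α w := by
  obtain ⟨β, rfl⟩ := (𝒢.mem_range_sharpModel_iff x w).2 hw
  -- `leafForm` uses an arbitrary preimage of `v`. By skew-symmetry α(Π♯β) = −β(Π♯α) depends on α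
  -- only through Π♯α, so any preimage gives the same value.
  have h : 𝒢.sharpModel x (Function.invFun (𝒢.sharpModel x) v) = v :=
    Function.invFun_eq ⟨α, hv⟩
  change (Function.invFun (𝒢.sharpModel x) v : F →L[ℝ] ℝ) (𝒢.sharpModel x β) = _
  rw [sharpModel_skew, h, ← hv, sharpModel_skew, neg_neg]

end SymplecticGroupoid

/-! ### Maps and differentials read in charts -/

section Charts

variable {E N P F M : Type*} [NormedAddCommGroup E] [NormedSpace ℝ E]
  [NormedAddCommGroup P] [NormedSpace ℝ P] [NormedAddCommGroup F] [NormedSpace ℝ F]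
  [TopologicalSpace N] [ChartedSpace E N] [IsManifold 𝓘(ℝ, E) ∞ N]
  [TopologicalSpace M] [ChartedSpace F M] [IsManifold 𝓘(ℝ, F) ∞ M]

/-- The differential of a map from a normed space to a manifold, as a linear map between the model
spaces. -/
noncomputable def dparam (φ : P → N) (u : P) : P →L[ℝ] E := mfderiv 𝓘(ℝ, P) 𝓘(ℝ, E) φ u

/-- The differential of the preferred chart at `x₀`. -/
noncomputable def dchart (x₀ y : N) : E →L[ℝ] E := mfderiv 𝓘(ℝ, E) 𝓘(ℝ, E) (extChartAt 𝓘(ℝ, E) x₀) y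

/-- The differential of the inverse of the preferred chart at `x₀`. -/
noncomputable def dchartSymm (x₀ : N) (z : E) : E →L[ℝ] E :=
  mfderiv 𝓘(ℝ, E) 𝓘(ℝ, E) (extChartAt 𝓘(ℝ, E) x₀).symm z

theorem contMDiffAt_extChart (x₀ : N) {y : N} (hy : y ∈ (extChartAt 𝓘(ℝ, E) x₀).source) :
    ContMDiffAt 𝓘(ℝ, E) 𝓘(ℝ, E) ∞ (extChartAt 𝓘(ℝ, E) x₀) y :=
  contMDiffAt_extChartAt' (by simpa using hy)

theorem contMDiffAt_extChart_symm (x₀ : N) {z : E} (hz : z ∈ (extChartAt 𝓘(ℝ, E) x₀).target) :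
    ContMDiffAt 𝓘(ℝ, E) 𝓘(ℝ, E) ∞ (extChartAt 𝓘(ℝ, E) x₀).symm z :=
  (contMDiffOn_extChartAt_symm x₀).contMDiffAt ((isOpen_extChartAt_target x₀).mem_nhds hz)

theorem dchartSymm_dchart (x₀ : N) {y : N} (hy : y ∈ (extChartAt 𝓘(ℝ, E) x₀).source) (v : E) :
    dchartSymm x₀ (extChartAt 𝓘(ℝ, E) x₀ y) (dchart x₀ y v) = v := by
  have h1 := mfderiv_comp y ((contMDiffAt_extChart_symm x₀ ((extChartAt 𝓘(ℝ, E) x₀).map_source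
    hy)).mdifferentiableAt (by simp)) ((contMDiffAt_extChart x₀ hy).mdifferentiableAt (by simp))
  have h2 : (extChartAt 𝓘(ℝ, E) x₀).symm ∘ extChartAt 𝓘(ℝ, E) x₀ =ᶠ[𝓝 y] id := by
    filter_upwards [(isOpen_extChartAt_source x₀).mem_nhds hy] with z hz
    exact (extChartAt 𝓘(ℝ, E) x₀).left_inv hz
  rw [h2.mfderiv_eq, mfderiv_id] at h1
  exact (congrArg (fun L => (L v : E)) h1).symm

theorem dchart_dchartSymm (x₀ : N) {y : N} (hy : y ∈ (extChartAt 𝓘(ℝ, E) x₀).source) (v : E) :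
    dchart x₀ y (dchartSymm x₀ (extChartAt 𝓘(ℝ, E) x₀ y) v) = v := by
  have hz := (extChartAt 𝓘(ℝ, E) x₀).map_source hy
  have hy' := (extChartAt 𝓘(ℝ, E) x₀).left_inv hy
  have h1 := mfderiv_comp (extChartAt 𝓘(ℝ, E) x₀ y)
    ((contMDiffAt_extChart x₀ (by rwa [hy'])).mdifferentiableAt (by simp))
    ((contMDiffAt_extChart_symm x₀ hz).mdifferentiableAt (by simp))
  have h2 : extChartAt 𝓘(ℝ, E) x₀ ∘ (extChartAt 𝓘(ℝ, E) x₀).symm =ᶠ[𝓝 (extChartAt 𝓘(ℝ, E) x₀ y)]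
      id := by
    filter_upwards [(isOpen_extChartAt_target x₀).mem_nhds hz] with z hz
    exact (extChartAt 𝓘(ℝ, E) x₀).right_inv hz
  rw [h2.mfderiv_eq, mfderiv_id, hy'] at h1
  exact (congrArg (fun L => (L v : E)) h1).symm

theorem injective_dchart (x₀ : N) {y : N} (hy : y ∈ (extChartAt 𝓘(ℝ, E) x₀).source) :
    Function.Injective (dchart (E := E) x₀ y) := fun v w h => by
  rw [← dchartSymm_dchart x₀ hy v, h, dchartSymm_dchart x₀ hy w]

/-- A smooth map into a manifold, read in a chart. -/
theorem contDiffAt_chart_comp {φ : P → N} {u : P} (x₀ : N)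
    (hφ : ContMDiffAt 𝓘(ℝ, P) 𝓘(ℝ, E) ∞ φ u) (hu : φ u ∈ (extChartAt 𝓘(ℝ, E) x₀).source) :
    ContDiffAt ℝ ∞ (extChartAt 𝓘(ℝ, E) x₀ ∘ φ) u :=
  (ContMDiffAt.comp (I' := 𝓘(ℝ, E)) u (contMDiffAt_extChart x₀ hu) hφ).contDiffAt

theorem fderiv_chart_comp {φ : P → N} {u : P} (x₀ : N)
    (hφ : MDifferentiableAt 𝓘(ℝ, P) 𝓘(ℝ, E) φ u) (hu : φ u ∈ (extChartAt 𝓘(ℝ, E) x₀).source)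
    (w : P) : fderiv ℝ (extChartAt 𝓘(ℝ, E) x₀ ∘ φ) u w =
      dchart x₀ (φ u) (dparam φ u w) := by
  have h1 := mfderiv_comp u ((contMDiffAt_extChart x₀ hu).mdifferentiableAt (by simp)) hφ
  rw [← mfderiv_eq_fderiv, h1]
  rfl

theorem contDiffAt_comp_chart_symm {f : N → P} (x₀ : N) {z : E}
    (hz : z ∈ (extChartAt 𝓘(ℝ, E) x₀).target)
    (hf : ContMDiffAt 𝓘(ℝ, E) 𝓘(ℝ, P) ∞ f ((extChartAt 𝓘(ℝ, E) x₀).symm z)) :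
    ContDiffAt ℝ ∞ (f ∘ (extChartAt 𝓘(ℝ, E) x₀).symm) z :=
  (ContMDiffAt.comp z hf (contMDiffAt_extChart_symm x₀ hz)).contDiffAt

theorem mfderiv_eq_fderiv_comp_dchart {f : N → P} (x₀ : N) {y : N}
    (hy : y ∈ (extChartAt 𝓘(ℝ, E) x₀).source) (hf : MDifferentiableAt 𝓘(ℝ, E) 𝓘(ℝ, P) f y) (v : E) :
    (mfderiv 𝓘(ℝ, E) 𝓘(ℝ, P) f y : E →L[ℝ] P) v =
      fderiv ℝ (f ∘ (extChartAt 𝓘(ℝ, E) x₀).symm) (extChartAt 𝓘(ℝ, E) x₀ y) (dchart x₀ y v) := by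
  have hz := (extChartAt 𝓘(ℝ, E) x₀).map_source hy
  have hy' := (extChartAt 𝓘(ℝ, E) x₀).left_inv hy
  have h1 := mfderiv_comp (extChartAt 𝓘(ℝ, E) x₀ y) (g := f) (by rwa [hy'])
    ((contMDiffAt_extChart_symm x₀ hz).mdifferentiableAt (by simp))
  rw [← mfderiv_eq_fderiv, h1, hy']
  exact congrArg (mfderiv 𝓘(ℝ, E) 𝓘(ℝ, P) f y : E →L[ℝ] P) (dchartSymm_dchart x₀ hy v).symm

end Charts

/-! ### Smoothness of the Poisson structure -/

namespace SymplecticGroupoid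

variable {E F G M : Type*} [NormedAddCommGroup E] [NormedSpace ℝ E] [FiniteDimensional ℝ E]
  [NormedAddCommGroup F] [NormedSpace ℝ F] [FiniteDimensional ℝ F]
  [TopologicalSpace G] [ChartedSpace E G] [IsManifold 𝓘(ℝ, E) ∞ G]
  [TopologicalSpace M] [ChartedSpace F M] [IsManifold 𝓘(ℝ, F) ∞ M] (𝒢 : SymplecticGroupoid E F G M)

/-- The isomorphism with the dual space defined by the symplectic form in a chart of `G`. -/
noncomputable def chartFlat (g₀ : G) (w : E) : E →L[ℝ] E →L[ℝ] ℝ :=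
  LinearMap.toContinuousLinearMap
    ((LinearMap.toContinuousLinearMap (𝕜 := ℝ) (E := E) (F' := ℝ)).toLinearMap.comp
      (formBilin (chartForm 𝒢.form g₀ w)))

theorem contDiffOn_chartFlat (g₀ : G) :
    ContDiffOn ℝ ∞ (𝒢.chartFlat g₀) (extChartAt 𝓘(ℝ, E) g₀).target := by
  rw [contDiffOn_clm_apply]
  intro X
  rw [contDiffOn_clm_apply]
  intro Y
  exact (ContinuousAlternatingMap.apply ℝ E ℝ ![X, Y]).contDiff.comp_contDiffOn
    (𝒢.contDiffOn_form g₀)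

theorem chartFlat_dchart (g₀ g : G) (hg : g ∈ (extChartAt 𝓘(ℝ, E) g₀).source) (X Y : E) :
    𝒢.chartFlat g₀ (extChartAt 𝓘(ℝ, E) g₀ g) (dchart g₀ g X) Y =
      𝒢.formModel g ![X, dchartSymm g₀ (extChartAt 𝓘(ℝ, E) g₀ g) Y] := by
  have h1 : 𝒢.chartFlat g₀ (extChartAt 𝓘(ℝ, E) g₀ g) (dchart g₀ g X) Y =
      𝒢.formModel ((extChartAt 𝓘(ℝ, E) g₀).symm (extChartAt 𝓘(ℝ, E) g₀ g))
        (dchartSymm g₀ (extChartAt 𝓘(ℝ, E) g₀ g) ∘ ![dchart g₀ g X, Y]) := rfl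
  have h2 : dchartSymm g₀ (extChartAt 𝓘(ℝ, E) g₀ g) ∘ ![dchart g₀ g X, Y] =
      ![X, dchartSymm g₀ (extChartAt 𝓘(ℝ, E) g₀ g) Y] := by
    funext i
    fin_cases i
    · exact dchartSymm_dchart g₀ hg X
    · rfl
  rw [h1, h2, (extChartAt 𝓘(ℝ, E) g₀).left_inv hg]

theorem isInvertible_chartFlat (g₀ g : G) (hg : g ∈ (extChartAt 𝓘(ℝ, E) g₀).source) :
    (𝒢.chartFlat g₀ (extChartAt 𝓘(ℝ, E) g₀ g)).IsInvertible := by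
  have hinj : Function.Injective (𝒢.chartFlat g₀ (extChartAt 𝓘(ℝ, E) g₀ g)).toLinearMap := by
    rw [injective_iff_map_eq_zero]
    intro X hX
    have h1 : dchartSymm g₀ (extChartAt 𝓘(ℝ, E) g₀ g) X = 0 := by
      apply 𝒢.nondegenerate_formModel g
      intro Y
      have h2 := 𝒢.chartFlat_dchart g₀ g hg (dchartSymm g₀ (extChartAt 𝓘(ℝ, E) g₀ g) X)
        (dchart g₀ g Y)
      rw [dchart_dchartSymm g₀ hg, dchartSymm_dchart g₀ hg] at h2
      rw [← h2]
      exact congrArg (fun L : E →L[ℝ] ℝ => L (dchart g₀ g Y)) hX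
    rw [← dchart_dchartSymm g₀ hg X, h1, map_zero]
  have hdim : Module.finrank ℝ E = Module.finrank ℝ (E →L[ℝ] ℝ) := by
    rw [← (LinearMap.toContinuousLinearMap (𝕜 := ℝ) (E := E) (F' := ℝ)).finrank_eq]
    exact (Subspace.dual_finrank_eq (K := ℝ) (V := E)).symm
  exact ⟨(LinearEquiv.ofInjectiveOfFinrankEq _ hinj hdim).toContinuousLinearEquiv, by ext1; rfl⟩

/-- The Poisson structure is smooth. -/
theorem exists_smooth_sharp (x₀ : M) : ∃ (Z : Set F) (Sh : F → (F →L[ℝ] ℝ) →L[ℝ] F),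
    IsOpen Z ∧ extChartAt 𝓘(ℝ, F) x₀ x₀ ∈ Z ∧ Z ⊆ (extChartAt 𝓘(ℝ, F) x₀).target ∧
    ContDiffOn ℝ ∞ Sh Z ∧
    ∀ y ∈ (extChartAt 𝓘(ℝ, F) x₀).source, extChartAt 𝓘(ℝ, F) x₀ y ∈ Z → ∀ β : F →L[ℝ] ℝ,
      dchart x₀ y (𝒢.sharpModel y (β.comp (dchart x₀ y))) = Sh (extChartAt 𝓘(ℝ, F) x₀ y) β := by
  set e := extChartAt 𝓘(ℝ, F) x₀ with he
  set g₀ := 𝒢.unit x₀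
  set e' := extChartAt 𝓘(ℝ, E) g₀ with he'
  have hex : e.symm (e x₀) = x₀ := extChartAt_to_inv x₀
  have hcu : ContinuousOn (𝒢.unit ∘ e.symm) e.target :=
    𝒢.contMDiff_unit.continuous.comp_continuousOn (continuousOn_extChartAt_symm x₀)
  let Z : Set F := e.target ∩ (𝒢.unit ∘ e.symm) ⁻¹' e'.source
  have hZ : IsOpen Z := hcu.isOpen_inter_preimage (isOpen_extChartAt_target x₀)
    (isOpen_extChartAt_source g₀)
  let ε : F → E := fun z => e' (𝒢.unit (e.symm z))
  let T : E → F := e ∘ 𝒢.tgt ∘ e'.symm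
  have hε : ContDiffOn ℝ ∞ ε Z := by
    rintro z ⟨hz, hz'⟩
    apply ContDiffAt.contDiffWithinAt
    exact contDiffAt_chart_comp (φ := 𝒢.unit ∘ e.symm) g₀
      ((𝒢.contMDiff_unit _).comp z (contMDiffAt_extChart_symm x₀ hz)) hz'
  have hεt : ∀ z ∈ Z, ε z ∈ e'.target ∧ 𝒢.tgt (e'.symm (ε z)) = e.symm z ∧
      e.symm z ∈ e.source := by
    rintro z ⟨hz, hz'⟩
    refine ⟨e'.map_source hz', ?_, e.map_target hz⟩
    rw [show e'.symm (ε z) = 𝒢.unit (e.symm z) from e'.left_inv hz', 𝒢.tgt_unit]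
  have hT : ∀ z ∈ Z, ContDiffAt ℝ ∞ T (ε z) := by
    intro z hz
    obtain ⟨h1, h2, h3⟩ := hεt z hz
    apply contDiffAt_chart_comp (φ := 𝒢.tgt ∘ e'.symm) x₀
    · exact ContMDiffAt.comp _ (𝒢.contMDiff_tgt _) (contMDiffAt_extChart_symm g₀ h1)
    · simp only [Function.comp_apply]
      rw [h2]; exact h3
  have hDT : ContDiffOn ℝ ∞ (fun z => fderiv ℝ T (ε z)) Z := by
    intro z hz
    apply ContDiffAt.contDiffWithinAt
    exact ContDiffAt.comp z ((hT z hz).fderiv_right (m := ∞) (by simp))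
      (hε.contDiffAt (hZ.mem_nhds hz))
  have hflat : ContDiffOn ℝ ∞ (fun z => (𝒢.chartFlat g₀ (ε z)).inverse) Z := by
    intro z hz
    obtain ⟨h1, h2, h3⟩ := hεt z hz
    apply ContDiffAt.contDiffWithinAt
    refine ContDiffAt.comp z (g := ContinuousLinearMap.inverse) ?_ (ContDiffAt.comp (g := 𝒢.chartFlat g₀) z
      ((𝒢.contDiffOn_chartFlat g₀).contDiffAt ((isOpen_extChartAt_target g₀).mem_nhds h1))
      (hε.contDiffAt (hZ.mem_nhds hz)))
    exact (𝒢.isInvertible_chartFlat g₀ _ hz.2).contDiffAt_map_inverse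
  -- This is dt ∘ ω⁻¹ ∘ t* in charts: `T` is the target map, `ε` the unit section, and the flipped
  -- `compL` sends β to β ∘ dT. It is smooth because inversion of linear maps is smooth at
  -- invertible ones.
  refine ⟨Z, fun z => (fderiv ℝ T (ε z)).comp ((𝒢.chartFlat g₀ (ε z)).inverse.comp
    ((ContinuousLinearMap.compL ℝ E F ℝ).flip (fderiv ℝ T (ε z)))), hZ, ?_,
    Set.inter_subset_left, ?_, ?_⟩
  · refine ⟨mem_extChartAt_target x₀, ?_⟩
    simp only [Set.mem_preimage, Function.comp_apply, hex]
    exact mem_extChartAt_source g₀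
  · refine hDT.clm_comp (hflat.clm_comp (contDiffOn_clm_apply.2 fun β => ?_))
    exact contDiffOn_const.clm_comp hDT
  · intro y hy hyZ β
    obtain ⟨h1, h2, h3⟩ := hεt _ hyZ
    have hys : e.symm (e y) = y := e.left_inv hy
    have hg : 𝒢.unit y ∈ e'.source := by
      have := hyZ.2
      simpa only [Set.mem_preimage, Function.comp_apply, hys] using this
    have hεy : ε (e y) = e' (𝒢.unit y) := by simp only [ε, hys]
    have hDTy : ∀ Y : E, fderiv ℝ T (ε (e y)) Y =
        dchart x₀ y (𝒢.dtgt (𝒢.unit y) (dchartSymm g₀ (ε (e y)) Y)) := by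
      intro Y
      have hs : e'.symm (ε (e y)) = 𝒢.unit y := by rw [hεy]; exact e'.left_inv hg
      have hsd : MDifferentiableAt 𝓘(ℝ, E) 𝓘(ℝ, E) e'.symm (ε (e y)) :=
        (contMDiffAt_extChart_symm g₀ h1).mdifferentiableAt (by simp)
      have k1 := fderiv_chart_comp (φ := 𝒢.tgt ∘ e'.symm) (u := ε (e y)) x₀
        ((𝒢.mdifferentiableAt_tgt _).comp _ hsd) (by
          simp only [Function.comp_apply, hs, 𝒢.tgt_unit]; exact hy) Y
      have k2 : (dparam (𝒢.tgt ∘ e'.symm) (ε (e y)) : E →L[ℝ] F) =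
          (𝒢.dtgt (e'.symm (ε (e y)))).comp (dchartSymm g₀ (ε (e y))) := mfderiv_comp (ε (e y)) (𝒢.mdifferentiableAt_tgt (e'.symm (ε (e y)))) hsd
      rw [k2] at k1
      simp only [Function.comp_apply, ContinuousLinearMap.comp_apply] at k1
      rw [hs, 𝒢.tgt_unit] at k1
      exact k1
    obtain ⟨X, hX, hX'⟩ := 𝒢.exists_sharpModel_eq y (β.comp (dchart x₀ y))
    have hflatX : 𝒢.chartFlat g₀ (ε (e y)) (dchart g₀ (𝒢.unit y) X) =
        β.comp (fderiv ℝ T (ε (e y))) := by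
      ext1 Y
      rw [ContinuousLinearMap.comp_apply, hDTy]
      have := 𝒢.chartFlat_dchart g₀ (𝒢.unit y) hg X Y
      rw [← he', ← hεy] at this
      rw [this, hX]
      rfl
    obtain ⟨eq, heq⟩ := 𝒢.isInvertible_chartFlat g₀ _ hg
    rw [← he', ← hεy] at heq
    have hinv : (𝒢.chartFlat g₀ (ε (e y))).inverse (β.comp (fderiv ℝ T (ε (e y)))) =
        dchart g₀ (𝒢.unit y) X := by
      rw [← hflatX, ← heq, ContinuousLinearMap.inverse_equiv]
      exact eq.symm_apply_apply _
    rw [hX']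
    change _ = fderiv ℝ T (ε (e y)) ((𝒢.chartFlat g₀ (ε (e y))).inverse
      (β.comp (fderiv ℝ T (ε (e y)))))
    rw [hinv, hDTy, hεy]
    have := dchartSymm_dchart g₀ hg X
    rw [← he'] at this
    rw [this]

end SymplecticGroupoid

/-! ### Boxes: the local product structure of t on a source fibre -/

namespace LieGroupoid

variable {E F G M : Type*} [NormedAddCommGroup E] [NormedSpace ℝ E]
  [NormedAddCommGroup F] [NormedSpace ℝ F]
  [TopologicalSpace G] [ChartedSpace E G]
  [TopologicalSpace M] [ChartedSpace F M] (𝒢 : LieGroupoid E F G M)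

/-- A local parametrisation `Ψ(a, b)` of the source fibre of `m` by a product, such that
`t(Ψ(a, b)) = θ(a)` depends only on `a`, where `θ` is a parametrisation of a piece of the orbit
with a smooth local retraction `ρ`. -/
structure Box (m : M) (l j : ℕ) where
  A : Set (Fin l → ℝ)
  B : Set (Fin j → ℝ)
  Ψ : (Fin l → ℝ) × (Fin j → ℝ) → G
  W : Set G
  P : G → (Fin l → ℝ) × (Fin j → ℝ)
  θ : (Fin l → ℝ) → M
  WM : Set M
  ρ : M → (Fin l → ℝ)
  isOpen_A : IsOpen A
  isOpen_B : IsOpen B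
  convex_A : Convex ℝ A
  nonempty_B : B.Nonempty
  param : IsLocalParam (E := E) (𝒢.src ⁻¹' {m}) (A ×ˢ B) Ψ W P
  isOpen_WM : IsOpen WM
  contMDiffOn_θ : ContMDiffOn 𝓘(ℝ, Fin l → ℝ) 𝓘(ℝ, F) ∞ θ A
  contMDiffOn_ρ : ContMDiffOn 𝓘(ℝ, F) 𝓘(ℝ, Fin l → ℝ) ∞ ρ WM
  θ_mem : ∀ a ∈ A, θ a ∈ WM
  ρ_θ : ∀ a ∈ A, ρ (θ a) = a
  tgt_Ψ : ∀ a ∈ A, ∀ b ∈ B, 𝒢.tgt (Ψ (a, b)) = θ a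
  range_dθ : ∀ a ∈ A, (dparam θ a : (Fin l → ℝ) →L[ℝ] F).range = 𝒢.orbitSpace (θ a)

/-- On the source fibre the differential of t has the tangent space of the orbit as its image, whose
dimension is constant along an orbit. The constant rank theorem then provides coordinates (a, b) in
which t depends on `a` alone. The parametrisation θ freezes b = b₀, and ρ is the linear map `R`
after a chart of `M`. -/
theorem exists_box [FiniteDimensional ℝ E] [FiniteDimensional ℝ F] [IsManifold 𝓘(ℝ, F) ∞ M]
    (h₀ : G) :
    ∃ b : 𝒢.Box (𝒢.src h₀) (Module.finrank ℝ (𝒢.orbitSpace (𝒢.src h₀)))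
      (Module.finrank ℝ E - Module.finrank ℝ F - Module.finrank ℝ (𝒢.orbitSpace (𝒢.src h₀))),
      h₀ ∈ b.W := by
  have key := exists_isLocalParam_fibre 𝒢.isSubmersion_src h₀
  obtain ⟨k, hk⟩ : ∃ k, Module.finrank ℝ E - Module.finrank ℝ F = k := ⟨_, rfl⟩
  rw [hk] at key ⊢
  obtain ⟨U, ψ, W, r, hψ, hW⟩ := key
  set m := 𝒢.src h₀ with hm
  set l := Module.finrank ℝ (𝒢.orbitSpace m) with hl
  set y₀ := 𝒢.tgt h₀ with hy₀
  set e := extChartAt 𝓘(ℝ, F) y₀ with he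
  have hv₀ := hψ.ret_mem h₀ hW rfl
  have hψv₀ := hψ.param_ret h₀ hW rfl
  set v₀ := r h₀ with hv₀_def
  let U' : Set (Fin k → ℝ) := U ∩ (𝒢.tgt ∘ ψ) ⁻¹' e.source
  have hU' : IsOpen U' := (𝒢.contMDiff_tgt.continuous.comp_continuousOn
    hψ.continuousOn).isOpen_inter_preimage hψ.isOpen_dom (isOpen_extChartAt_source y₀)
  have hv₀' : v₀ ∈ U' := ⟨hv₀, by
    simp only [Set.mem_preimage, Function.comp_apply, hψv₀]
    exact mem_extChartAt_source y₀⟩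
  let f : (Fin k → ℝ) → F := e ∘ (𝒢.tgt ∘ ψ)
  have htψ : ∀ v ∈ U, ContMDiffAt 𝓘(ℝ, Fin k → ℝ) 𝓘(ℝ, F) ∞ (𝒢.tgt ∘ ψ) v := fun v hv =>
    (𝒢.contMDiff_tgt _).comp v (hψ.contMDiffOn.contMDiffAt (hψ.isOpen_dom.mem_nhds hv))
  have hf : ContDiffOn ℝ ∞ f U' := fun v hv =>
    (contDiffAt_chart_comp y₀ (htψ v hv.1) hv.2).contDiffWithinAt
  -- the differential of `t` on the source fibre
  have hdt : ∀ v ∈ U, (dparam (𝒢.tgt ∘ ψ) v :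
      (Fin k → ℝ) →L[ℝ] F).range = 𝒢.orbitSpace (𝒢.tgt (ψ v)) := by
    intro v hv
    have h1 := mfderiv_comp v (𝒢.mdifferentiableAt_tgt (ψ v)) (hψ.mdifferentiableAt hv)
    have h2 := range_mfderiv_of_isLocalParam_fibre 𝒢.isSubmersion_src hψ (by simp [hk]) hv
    rw [← 𝒢.map_ker_dsrc (ψ v)]
    have h3 : (dparam (𝒢.tgt ∘ ψ) v : (Fin k → ℝ) →L[ℝ] F) = (𝒢.dtgt (ψ v)).comp (dparam ψ v) := h1
    have h4 : (dparam ψ v : (Fin k → ℝ) →L[ℝ] E).range = (𝒢.dsrc (ψ v)).ker := h2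
    rw [h3, ← h4]
    exact LinearMap.range_comp _ _
  have hrank : ∀ v ∈ U', Module.finrank ℝ (fderiv ℝ f v).range = l := by
    rintro v ⟨hv, hv'⟩
    have h1 : (fderiv ℝ f v).range = (𝒢.orbitSpace (𝒢.tgt (ψ v))).map
        (dchart y₀ (𝒢.tgt (ψ v))).toLinearMap := by
      rw [← hdt v hv, ← LinearMap.range_comp]
      congr 1
      refine LinearMap.ext fun w => ?_
      exact fderiv_chart_comp y₀ ((htψ v hv).mdifferentiableAt (by simp)) hv' w
    rw [h1, hl, hm]
    have hinj : Function.Injective (dchart (E := F) y₀ (𝒢.tgt (ψ v))) := injective_dchart y₀ hv'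
    rw [← (Submodule.equivMapOfInjective _ hinj _).finrank_eq, 𝒢.finrank_orbitSpace,
      show 𝒢.src (ψ v) = 𝒢.src h₀ from hψ.mem v hv]
  obtain ⟨R, A, B, Φ, V, q, hA, hAc, hB, hBc, hV, hVU, hv₀V, hΦ, hq, hΦV, hqV, hqΦ, hΦq, hfΦ, hRf⟩ :=
    exists_coord_of_constant_rank (j := k - l) (by simp) hU' hv₀' hf hrank
  obtain ⟨-, hb₀⟩ := hqV hv₀V
  set b₀ := (q v₀).2
  have hab : ∀ a ∈ A, (a, b₀) ∈ A ×ˢ B := fun a ha => ⟨ha, hb₀⟩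
  have hψΦ : ContMDiffOn 𝓘(ℝ, (Fin l → ℝ) × (Fin (k - l) → ℝ)) 𝓘(ℝ, E) ∞ (ψ ∘ Φ) (A ×ˢ B) :=
    hψ.contMDiffOn.comp hΦ.contMDiffOn fun c hc => (hVU (hΦV hc)).1
  have htΨ : ∀ a ∈ A, ∀ b ∈ B, 𝒢.tgt (ψ (Φ (a, b))) = 𝒢.tgt (ψ (Φ (a, b₀))) := fun a ha b hb =>
    e.injOn (hVU (hΦV ⟨ha, hb⟩)).2 (hVU (hΦV (hab a ha))).2 (hfΦ a ha b hb b₀ hb₀)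
  have hθ : ContMDiffOn 𝓘(ℝ, Fin l → ℝ) 𝓘(ℝ, F) ∞ (fun a => 𝒢.tgt (ψ (Φ (a, b₀)))) A := by
    refine 𝒢.contMDiff_tgt.comp_contMDiffOn (hψΦ.comp (t := A ×ˢ B) ?_ hab)
    exact (contDiff_id.prodMk contDiff_const).contMDiff.contMDiffOn
  have hρθ : ∀ a ∈ A, R (e (𝒢.tgt (ψ (Φ (a, b₀))))) = a := fun a ha => hRf a ha b₀ hb₀
  have hρ : ContMDiffOn 𝓘(ℝ, F) 𝓘(ℝ, Fin l → ℝ) ∞ (fun y => R (e y)) e.source := by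
    intro y hy
    exact (R.contDiff.contMDiff.contMDiffAt.comp y (contMDiffAt_extChart y₀ hy)).contMDiffWithinAt
  refine ⟨⟨A, B, ψ ∘ Φ, W ∩ r ⁻¹' V, fun g => q (r g), fun a => 𝒢.tgt (ψ (Φ (a, b₀))), e.source,
    fun y => R (e y), hA, hB, hAc, ⟨b₀, hb₀⟩, ?_, isOpen_extChartAt_source y₀, hθ, hρ,
    fun a ha => (hVU (hΦV (hab a ha))).2, hρθ, htΨ, ?_⟩, hW, hv₀V⟩
  · refine ⟨hA.prod hB, ?_, hψΦ, ?_, ?_, ?_, ?_, ?_, ?_⟩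
    · exact hψ.contMDiffOn_ret.continuousOn.isOpen_inter_preimage hψ.isOpen_nhd hV
    · exact hq.contMDiffOn.comp (hψ.contMDiffOn_ret.mono Set.inter_subset_left) fun g hg => hg.2
    · intro c hc
      refine ⟨hψ.mem_nhd _ (hVU (hΦV hc)).1, ?_⟩
      simp only [Set.mem_preimage, Function.comp_apply, hψ.ret_param _ (hVU (hΦV hc)).1]
      exact hΦV hc
    · exact fun c hc => hψ.mem _ (hVU (hΦV hc)).1
    · intro c hc
      simp only [Function.comp_apply, hψ.ret_param _ (hVU (hΦV hc)).1]
      exact hqΦ c hc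
    · exact fun h hh _ => hqV hh.2
    · intro h hh hS
      simp only [Function.comp_apply, hΦq _ hh.2]
      exact hψ.param_ret h hh.1 hS
  · intro a ha
    have haV := hVU (hΦV (hab a ha))
    have hΦa : DifferentiableAt ℝ (fun a => Φ (a, b₀)) a :=
      ((hΦ.contDiffAt ((hA.prod hB).mem_nhds (hab a ha))).differentiableAt (by simp)).comp a
        (differentiableAt_id.prodMk (differentiableAt_const b₀))
    have hθd : MDifferentiableAt 𝓘(ℝ, Fin l → ℝ) 𝓘(ℝ, F) (fun a => 𝒢.tgt (ψ (Φ (a, b₀)))) a :=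
      (hθ.contMDiffAt (hA.mem_nhds ha)).mdifferentiableAt (by simp)
    set D : (Fin l → ℝ) →L[ℝ] F := dparam (fun a => 𝒢.tgt (ψ (Φ (a, b₀)))) a with hD
    have hle : D.range ≤ 𝒢.orbitSpace (𝒢.tgt (ψ (Φ (a, b₀)))) := by
      rw [← hdt _ haV.1]
      have h1 : D = (dparam (𝒢.tgt ∘ ψ) (Φ (a, b₀))).comp (dparam (fun a => Φ (a, b₀)) a) :=
        mfderiv_comp (g := 𝒢.tgt ∘ ψ) (f := fun a => Φ (a, b₀)) a
        ((htψ _ haV.1).mdifferentiableAt (by simp)) hΦa.mdifferentiableAt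
      rw [h1]
      exact LinearMap.range_comp_le_range _ _
    -- As ρ ∘ θ = id, the differential of θ is injective, so its range has the full dimension of the
    -- orbit.
    refine Submodule.eq_of_le_of_finrank_eq hle ?_
    have hinj : Function.Injective D := by
      have h1 := mfderiv_comp a ((hρ.contMDiffAt ((isOpen_extChartAt_source y₀).mem_nhds
        haV.2)).mdifferentiableAt (by simp)) hθd
      have h2 : (fun y => R (e y)) ∘ (fun a => 𝒢.tgt (ψ (Φ (a, b₀)))) =ᶠ[𝓝 a] id := by
        filter_upwards [hA.mem_nhds ha] with a ha using hρθ a ha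
      rw [h2.mfderiv_eq, mfderiv_id] at h1
      intro v w hvw
      have h3 : ∀ v : Fin l → ℝ, v = _ := fun v => congrArg (fun L => (L v : Fin l → ℝ)) h1
      rw [h3 v, h3 w]
      exact congrArg (mfderiv 𝓘(ℝ, F) 𝓘(ℝ, Fin l → ℝ) (fun y => R (e y)) _ : F →L[ℝ] _) hvw
    have h4 := LinearMap.finrank_range_of_inj (f := D.toLinearMap) hinj
    refine h4.trans ?_
    rw [𝒢.finrank_orbitSpace, show 𝒢.src (ψ (Φ (a, b₀))) = m from hψ.mem _ haV.1]
    simp [hl]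

end LieGroupoid

/-! ### The Poisson structure along a piece of an orbit -/

namespace SymplecticGroupoid

variable {E F G M : Type*} [NormedAddCommGroup E] [NormedSpace ℝ E] [FiniteDimensional ℝ E]
  [NormedAddCommGroup F] [NormedSpace ℝ F] [FiniteDimensional ℝ F]
  [TopologicalSpace G] [ChartedSpace E G] [IsManifold 𝓘(ℝ, E) ∞ G]
  [TopologicalSpace M] [ChartedSpace F M] [IsManifold 𝓘(ℝ, F) ∞ M] (𝒢 : SymplecticGroupoid E F G M)

variable {𝒢} {m : M} {l j : ℕ}

/-- The orbit parametrisation `θ`, its retraction `ρ` and the Poisson structure near `θ(a₁)`, read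
in a chart of `M`, together with a smooth choice `N a w` of covectors representing the vectors
`dθ(w)`. -/
structure LocalModel (b : 𝒢.toLieGroupoid.Box m l j) (a₁ : Fin l → ℝ) where
  e : PartialEquiv M F
  e_eq : e = extChartAt 𝓘(ℝ, F) (b.θ a₁)
  Z : Set F
  Sh : F → (F →L[ℝ] ℝ) →L[ℝ] F
  A : Set (Fin l → ℝ)
  N : (Fin l → ℝ) → (Fin l → ℝ) →L[ℝ] (F →L[ℝ] ℝ)
  isOpen_Z : IsOpen Z
  Z_subset : Z ⊆ e.target
  contDiffOn_Sh : ContDiffOn ℝ ∞ Sh Z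
  Sh_eq : ∀ y ∈ e.source, e y ∈ Z → ∀ β : F →L[ℝ] ℝ,
    dchart (b.θ a₁) y (𝒢.sharpModel y (β.comp (dchart (b.θ a₁) y))) = Sh (e y) β
  isOpen_A : IsOpen A
  mem_A : a₁ ∈ A
  A_subset : A ⊆ b.A
  θ_mem : ∀ a ∈ A, b.θ a ∈ e.source ∧ e (b.θ a) ∈ Z
  contDiffOn_θ : ContDiffOn ℝ ∞ (e ∘ b.θ) A
  contDiffOn_ρ : ContDiffOn ℝ ∞ (b.ρ ∘ e.symm) Z
  ρ_θ : ∀ a ∈ A, b.ρ (e.symm (e (b.θ a))) = a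
  skew : ∀ z ∈ Z, ∀ α β : F →L[ℝ] ℝ, α (Sh z β) = -β (Sh z α)
  range_Sh : ∀ a ∈ A, (Sh (e (b.θ a))).range = (fderiv ℝ (e ∘ b.θ) a).range
  contDiffOn_N : ContDiffOn ℝ ∞ N A
  Sh_N : ∀ a ∈ A, ∀ w, Sh (e (b.θ a)) (N a w) = fderiv ℝ (e ∘ b.θ) a w

/-- The image of Π♯ along θ is the image of dθ, so T(a) = dρ ∘ Π♯ is onto ℝˡ. With a right inverse
N₁ of T(a₁), the map T(a)N₁ is invertible for `a` near a₁, and N(a) = N₁(T(a)N₁)⁻¹ is a smooth right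
inverse of T(a). Because dρ is injective on the image of dθ, this forces Π♯N(a) = dθ. -/
theorem nonempty_localModel (b : 𝒢.toLieGroupoid.Box m l j) {a₁ : Fin l → ℝ} (ha₁ : a₁ ∈ b.A) :
    Nonempty (LocalModel b a₁) := by
  obtain ⟨Z₀, Sh, hZ₀, hxZ₀, hZ₀t, hSh, hSheq⟩ := 𝒢.exists_smooth_sharp (b.θ a₁)
  obtain ⟨e, he⟩ : ∃ e, e = extChartAt 𝓘(ℝ, F) (b.θ a₁) := ⟨_, rfl⟩
  rw [← he] at hxZ₀ hZ₀t hSheq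
  have hsrc : IsOpen e.source := he ▸ isOpen_extChartAt_source _
  have htar : IsOpen e.target := he ▸ isOpen_extChartAt_target _
  have hx : b.θ a₁ ∈ e.source := he ▸ mem_extChartAt_source _
  have hec : ContinuousOn e e.source := he ▸ continuousOn_extChartAt _
  have hesc : ContinuousOn e.symm e.target := he ▸ continuousOn_extChartAt_symm _
  let Z := Z₀ ∩ (e.target ∩ e.symm ⁻¹' b.WM)
  have hZ : IsOpen Z := hZ₀.inter (hesc.isOpen_inter_preimage htar b.isOpen_WM)
  let A' := b.A ∩ b.θ ⁻¹' (e.source ∩ e ⁻¹' Z)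
  have hA' : IsOpen A' := b.contMDiffOn_θ.continuousOn.isOpen_inter_preimage b.isOpen_A
    (hec.isOpen_inter_preimage hsrc hZ)
  have ha₁' : a₁ ∈ A' := by
    refine ⟨ha₁, hx, hxZ₀, e.map_source hx, ?_⟩
    simp only [Set.mem_preimage, e.left_inv hx]
    exact b.θ_mem a₁ ha₁
  have hθA : ∀ a ∈ A', ContMDiffAt 𝓘(ℝ, Fin l → ℝ) 𝓘(ℝ, F) ∞ b.θ a := fun a ha =>
    b.contMDiffOn_θ.contMDiffAt (b.isOpen_A.mem_nhds ha.1)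
  have hθ : ContDiffOn ℝ ∞ (e ∘ b.θ) A' := fun a ha => by
    rw [he]
    exact (contDiffAt_chart_comp _ (hθA a ha) (he ▸ ha.2.1)).contDiffWithinAt
  have hρ : ContDiffOn ℝ ∞ (b.ρ ∘ e.symm) Z := fun z hz => by
    rw [he]
    refine (contDiffAt_comp_chart_symm _ (he ▸ hz.2.1) ?_).contDiffWithinAt
    rw [← he]
    exact b.contMDiffOn_ρ.contMDiffAt (b.isOpen_WM.mem_nhds hz.2.2)
  have hρθ : ∀ a ∈ A', b.ρ (e.symm (e (b.θ a))) = a := fun a ha => by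
    rw [e.left_inv ha.2.1, b.ρ_θ a ha.1]
  have hdθ : ∀ a ∈ A', ∀ w, fderiv ℝ (e ∘ b.θ) a w = dchart (b.θ a₁) (b.θ a) (dparam b.θ a w) := by
    intro a ha w
    rw [he]
    exact fderiv_chart_comp _ ((hθA a ha).mdifferentiableAt (by simp)) (he ▸ ha.2.1) w
  have hrange : ∀ a ∈ A', (Sh (e (b.θ a))).range = (fderiv ℝ (e ∘ b.θ) a).range := by
    intro a ha
    have hys : b.θ a ∈ (extChartAt 𝓘(ℝ, F) (b.θ a₁)).source := he ▸ ha.2.1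
    ext v
    constructor
    · rintro ⟨β, rfl⟩
      have h1 : 𝒢.sharpModel (b.θ a) (β.comp (dchart (b.θ a₁) (b.θ a))) ∈
          𝒢.orbitSpace (b.θ a) := (𝒢.mem_range_sharpModel_iff _ _).1 ⟨_, rfl⟩
      rw [← b.range_dθ a ha.1] at h1
      obtain ⟨w, hw⟩ := h1
      refine ⟨w, ?_⟩
      have h2 := hSheq _ ha.2.1 ha.2.2.1 β
      change fderiv ℝ (e ∘ b.θ) a w = Sh (e (b.θ a)) β
      rw [← h2, ← hw]
      exact hdθ a ha w
    · rintro ⟨w, rfl⟩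
      have h1 : dparam b.θ a w ∈ 𝒢.orbitSpace (b.θ a) := by
        rw [← b.range_dθ a ha.1]; exact ⟨w, rfl⟩
      obtain ⟨γ, hγ⟩ := (𝒢.mem_range_sharpModel_iff _ _).2 h1
      refine ⟨γ.comp (dchartSymm (b.θ a₁) (e (b.θ a))), ?_⟩
      have h2 := hSheq _ ha.2.1 ha.2.2.1 (γ.comp (dchartSymm (b.θ a₁) (e (b.θ a))))
      change Sh (e (b.θ a)) _ = fderiv ℝ (e ∘ b.θ) a w
      rw [← h2, hdθ a ha w, ← hγ]
      congr 2
      ext v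
      simp only [ContinuousLinearMap.comp_apply]
      rw [he, dchartSymm_dchart _ hys]
  have hρθd : ∀ a ∈ A', ∀ w, fderiv ℝ (b.ρ ∘ e.symm) (e (b.θ a)) (fderiv ℝ (e ∘ b.θ) a w) = w := by
    intro a ha w
    have h1 := fderiv_comp a (g := b.ρ ∘ e.symm) (f := e ∘ b.θ)
      ((hρ.contDiffAt (hZ.mem_nhds ha.2.2)).differentiableAt (by simp))
      ((hθ.contDiffAt (hA'.mem_nhds ha)).differentiableAt (by simp))
    have h2 : (b.ρ ∘ e.symm) ∘ (e ∘ b.θ) =ᶠ[𝓝 a] id := by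
      filter_upwards [hA'.mem_nhds ha] with a ha using hρθ a ha
    rw [h2.fderiv_eq, fderiv_id] at h1
    exact (congrArg (fun L => L w) h1).symm
  let T : (Fin l → ℝ) → (F →L[ℝ] ℝ) →L[ℝ] (Fin l → ℝ) := fun a =>
    (fderiv ℝ (b.ρ ∘ e.symm) (e (b.θ a))).comp (Sh (e (b.θ a)))
  have hT : ContDiffOn ℝ ∞ T A' := by
    have h1 : ContDiffOn ℝ ∞ (fderiv ℝ (b.ρ ∘ e.symm)) Z := hρ.fderiv_of_isOpen hZ (by simp)
    exact (h1.comp hθ fun a ha => ha.2.2).clm_comp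
      ((hSh.comp hθ fun a ha => ha.2.2.1))
  have hTs : Function.Surjective (T a₁) := by
    intro w
    have h1 : fderiv ℝ (e ∘ b.θ) a₁ w ∈ (Sh (e (b.θ a₁))).range := by
      rw [hrange a₁ ha₁']; exact ⟨w, rfl⟩
    obtain ⟨β, hβ⟩ := h1
    refine ⟨β, ?_⟩
    change fderiv ℝ (b.ρ ∘ e.symm) (e (b.θ a₁)) (Sh (e (b.θ a₁)) β) = w
    rw [← hρθd a₁ ha₁' w]
    exact congrArg _ hβ
  obtain ⟨N₀, hN₀⟩ := (T a₁).toLinearMap.exists_rightInverse_of_surjective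
    (LinearMap.range_eq_top.2 hTs)
  let N₁ : (Fin l → ℝ) →L[ℝ] (F →L[ℝ] ℝ) := LinearMap.toContinuousLinearMap N₀
  have hTN₁ : (T a₁).comp N₁ = ContinuousLinearMap.id ℝ _ := by
    ext1 w
    exact LinearMap.congr_fun hN₀ w
  have hTN : ContDiffOn ℝ ∞ (fun a => (T a).comp N₁) A' := hT.clm_comp contDiffOn_const
  let A := A' ∩ (fun a => (T a).comp N₁) ⁻¹' Set.range
    ((↑) : ((Fin l → ℝ) ≃L[ℝ] (Fin l → ℝ)) → (Fin l → ℝ) →L[ℝ] (Fin l → ℝ))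
  have hA : IsOpen A := hTN.continuousOn.isOpen_inter_preimage hA'
    (ContinuousLinearEquiv.isOpen)
  refine ⟨⟨e, he, Z, Sh, A, fun a => N₁.comp ((T a).comp N₁).inverse, hZ, fun z hz => hz.2.1,
    hSh.mono Set.inter_subset_left, fun y hy hyZ => hSheq y hy hyZ.1, hA,
    ⟨ha₁', ?_⟩, fun a ha => ha.1.1, fun a ha => ha.1.2, hθ.mono Set.inter_subset_left, hρ,
    fun a ha => hρθ a ha.1, ?_, fun a ha => hrange a ha.1, ?_, ?_⟩⟩
  · exact ⟨ContinuousLinearEquiv.refl ℝ _, hTN₁.symm⟩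
  · intro z hz α β
    have hy := e.map_target hz.2.1
    have hzy := e.right_inv hz.2.1
    have h1 := hSheq _ hy (hzy.symm ▸ hz.1)
    rw [hzy] at h1
    rw [← h1, ← h1]
    exact 𝒢.sharpModel_skew _ (α.comp (dchart (b.θ a₁) _)) (β.comp (dchart (b.θ a₁) _))
  · refine contDiffOn_const.clm_comp fun a ha => ContDiffAt.contDiffWithinAt ?_
    obtain ⟨ee, hee⟩ := ha.2
    refine ContDiffAt.comp a (g := ContinuousLinearMap.inverse) ?_
      (hTN.contDiffAt (hA'.mem_nhds ha.1))
    exact ContinuousLinearMap.IsInvertible.contDiffAt_map_inverse ⟨ee, hee⟩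
  · intro a ha w
    obtain ⟨ee, hee⟩ := ha.2
    have h1 : Sh (e (b.θ a)) (N₁ (((T a).comp N₁).inverse w)) ∈ (fderiv ℝ (e ∘ b.θ) a).range := by
      rw [← hrange a ha.1]; exact ⟨_, rfl⟩
    obtain ⟨v, hv⟩ := h1
    have h2 : T a (N₁ (((T a).comp N₁).inverse w)) = w := by
      have h3 : ((T a).comp N₁) (((T a).comp N₁).inverse w) = w := by
        have h4 : (ee : (Fin l → ℝ) →L[ℝ] (Fin l → ℝ)) = (T a).comp N₁ := hee
        rw [← h4, ContinuousLinearMap.inverse_equiv]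
        exact ee.apply_symm_apply w
      exact h3
    have h3 : v = w := by
      rw [← hρθd a ha.1 v, ← h2]
      exact congrArg _ hv
    exact hv.symm.trans (congrArg (fun v => fderiv ℝ (e ∘ b.θ) a v) h3)

end SymplecticGroupoid

/-! ### A Gronwall criterion for vanishing -/

section Gronwall

variable {F : Type*} [NormedAddCommGroup F] [NormedSpace ℝ F]

/-- A function on an interval whose derivative is bounded by a multiple of its norm vanishes
identically if it vanishes at one point. -/
theorem eqOn_zero_of_norm_deriv_le {s : Set ℝ} (hs : s.OrdConnected) {δ δ' : ℝ → F} {K : ℝ}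
    {t₀ : ℝ} (ht₀ : t₀ ∈ s) (h0 : δ t₀ = 0) (hδ : ∀ t ∈ s, HasDerivWithinAt δ (δ' t) s t)
    (hK : ∀ t ∈ s, ‖δ' t‖ ≤ K * ‖δ t‖) : ∀ t ∈ s, δ t = 0 := by
  intro t ht
  rcases le_total t₀ t with h | h
  · have hsub : Set.Icc t₀ t ⊆ s := hs.out ht₀ ht
    refine eq_zero_of_abs_deriv_le_mul_abs_self_of_eq_zero_right (f' := δ') (K := K)
      (fun x hx => ((hδ x (hsub hx)).mono hsub).continuousWithinAt) (fun x hx => ?_) h0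
      (fun x hx => hK x (hsub ⟨hx.1, hx.2.le⟩)) t ⟨h, le_rfl⟩
    refine ((hδ x (hsub ⟨hx.1, hx.2.le⟩)).mono hsub).mono_of_mem_nhdsWithin ?_
    exact mem_nhdsGE_iff_exists_Icc_subset.2 ⟨t, hx.2, Set.Icc_subset_Icc_left hx.1⟩
  · have hsub : Set.Icc t t₀ ⊆ s := hs.out ht ht₀
    have hsub' : ∀ x ∈ Set.Icc (-t₀) (-t), -x ∈ Set.Icc t t₀ := fun x hx =>
      ⟨by linarith [hx.2], by linarith [hx.1]⟩
    have hd : ∀ x ∈ Set.Icc (-t₀) (-t), HasDerivWithinAt (fun x => δ (-x)) (-δ' (-x))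
        (Set.Icc (-t₀) (-t)) x := by
      intro x hx
      have h1 := ((hδ (-x) (hsub (hsub' x hx))).mono hsub).scomp x
        ((hasDerivWithinAt_id x _).neg) (hsub')
      simpa [Function.comp_def] using h1
    have := eq_zero_of_abs_deriv_le_mul_abs_self_of_eq_zero_right (f := fun x => δ (-x))
      (f' := fun x => -δ' (-x)) (K := K)
      (fun x hx => (hd x hx).continuousWithinAt) (fun x hx => ?_) (by simpa using h0)
      (fun x hx => by
        rw [norm_neg]
        exact hK _ (hsub (hsub' x ⟨hx.1, hx.2.le⟩))) (-t) ⟨neg_le_neg h, le_rfl⟩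
    · simpa using this
    · refine (hd x ⟨hx.1, hx.2.le⟩).mono_of_mem_nhdsWithin ?_
      exact mem_nhdsGE_iff_exists_Icc_subset.2 ⟨-t, hx.2, Set.Icc_subset_Icc_left hx.1⟩

end Gronwall

/-! ### Symplectic leaves lie in orbits -/

namespace SymplecticGroupoid

variable {E F G M : Type*} [NormedAddCommGroup E] [NormedSpace ℝ E] [FiniteDimensional ℝ E]
  [NormedAddCommGroup F] [NormedSpace ℝ F] [FiniteDimensional ℝ F]
  [TopologicalSpace G] [ChartedSpace E G] [IsManifold 𝓘(ℝ, E) ∞ G]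
  [TopologicalSpace M] [ChartedSpace F M] [IsManifold 𝓘(ℝ, F) ∞ M] (𝒢 : SymplecticGroupoid E F G M)

variable {𝒢} {m : M} {l j : ℕ}

namespace LocalModel

variable {b : 𝒢.toLieGroupoid.Box m l j} {a₁ : Fin l → ℝ} (c : LocalModel b a₁)

theorem mem_source {y : M} (hy : y ∈ c.e.source) :
    y ∈ (extChartAt 𝓘(ℝ, F) (b.θ a₁)).source := c.e_eq ▸ hy

/-- The Hamiltonian vector field in the chart. -/
theorem dchart_hamiltonianField {f : M → ℝ} (hf : ContMDiff 𝓘(ℝ, F) 𝓘(ℝ, ℝ) ∞ f) {y : M}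
    (hy : y ∈ c.e.source) (hyZ : c.e y ∈ c.Z) :
    dchart (E := F) (b.θ a₁) y (𝒢.hamiltonianField f y) =
      c.Sh (c.e y) (fderiv ℝ (f ∘ c.e.symm) (c.e y)) := by
  rw [← c.Sh_eq y hy hyZ]
  congr 1
  change 𝒢.sharpModel y (mfderiv 𝓘(ℝ, F) 𝓘(ℝ, ℝ) f y : F →L[ℝ] ℝ) = _
  congr 1
  refine ContinuousLinearMap.ext fun (v : F) => ?_
  rw [c.e_eq]
  have h := mfderiv_eq_fderiv_comp_dchart (E := F) (P := ℝ) (b.θ a₁) (c.mem_source hy)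
    ((hf y).mdifferentiableAt (by simp)) v
  exact h

/-- Integral curves of a Hamiltonian vector field, read in the chart. -/
theorem hasDerivWithinAt_chart {f : M → ℝ} (hf : ContMDiff 𝓘(ℝ, F) 𝓘(ℝ, ℝ) ∞ f) {γ : ℝ → M}
    {s : Set ℝ} {t : ℝ} (hγ : IsMIntegralCurveOn γ (𝒢.hamiltonianField f) s) (ht : t ∈ s)
    (hy : γ t ∈ c.e.source) (hyZ : c.e (γ t) ∈ c.Z) :
    HasDerivWithinAt (c.e ∘ γ) (c.Sh (c.e (γ t)) (fderiv ℝ (f ∘ c.e.symm) (c.e (γ t)))) s t := by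
  have h1 := (((contMDiffAt_extChart (b.θ a₁) (c.mem_source hy)).mdifferentiableAt
    (by simp)).hasMFDerivAt).comp_hasMFDerivWithinAt t (hγ t ht)
  have h2 : HasFDerivWithinAt (extChartAt 𝓘(ℝ, F) (b.θ a₁) ∘ γ) ((dchart (E := F) (b.θ a₁) (γ t)).comp
    ((1 : ℝ →L[ℝ] ℝ).smulRight (𝒢.hamiltonianField f (γ t) : F))) s t :=
    hasMFDerivWithinAt_iff_hasFDerivWithinAt.1 h1
  have h3 := h2.hasDerivWithinAt
  have h4 := c.dchart_hamiltonianField hf hy hyZ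
  rw [← h4, c.e_eq]
  convert h3 using 1
  exact congrArg (dchart (E := F) (b.θ a₁) (γ t))
    (one_smul ℝ (𝒢.hamiltonianField f (γ t) : F)).symm

theorem fderiv_ρ_fderiv_θ {a : Fin l → ℝ} (ha : a ∈ c.A) (w : Fin l → ℝ) :
    fderiv ℝ (b.ρ ∘ c.e.symm) (c.e (b.θ a)) (fderiv ℝ (c.e ∘ b.θ) a w) = w := by
  have h1 := fderiv_comp a (g := b.ρ ∘ c.e.symm) (f := c.e ∘ b.θ)
    ((c.contDiffOn_ρ.contDiffAt (c.isOpen_Z.mem_nhds (c.θ_mem a ha).2)).differentiableAt (by simp))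
    ((c.contDiffOn_θ.contDiffAt (c.isOpen_A.mem_nhds ha)).differentiableAt (by simp))
  have h2 : (b.ρ ∘ c.e.symm) ∘ (c.e ∘ b.θ) =ᶠ[𝓝 a] id := by
    filter_upwards [c.isOpen_A.mem_nhds ha] with a ha using c.ρ_θ a ha
  rw [h2.fderiv_eq, fderiv_id] at h1
  exact (congrArg (fun L => L w) h1).symm

/-- A Hamiltonian trajectory which meets the piece `θ(A)` of the orbit stays in it for a short
time. -/
theorem eventually_mem_image {f : M → ℝ} (hf : ContMDiff 𝓘(ℝ, F) 𝓘(ℝ, ℝ) ∞ f) {γ : ℝ → M}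
    {s : Set ℝ} (hs : s.OrdConnected) {t₀ : ℝ} (ht₀ : t₀ ∈ s)
    (hγ : IsMIntegralCurveOn γ (𝒢.hamiltonianField f) s) (h₀ : γ t₀ = b.θ a₁) :
    ∀ᶠ t in 𝓝[s] t₀, γ t ∈ b.θ '' c.A := by
  set θ' := c.e ∘ b.θ with hθ'
  set ρ' := b.ρ ∘ c.e.symm with hρ'
  have hZθ : ∀ a ∈ c.A, θ' a ∈ c.Z := fun a ha => (c.θ_mem a ha).2
  let Z₁ := c.Z ∩ ρ' ⁻¹' c.A
  have hZ₁ : IsOpen Z₁ := c.contDiffOn_ρ.continuousOn.isOpen_inter_preimage c.isOpen_Z c.isOpen_A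
  have hz₀ : θ' a₁ ∈ Z₁ := by
    refine ⟨hZθ a₁ c.mem_A, ?_⟩
    change b.ρ (c.e.symm (c.e (b.θ a₁))) ∈ c.A
    rw [c.ρ_θ a₁ c.mem_A]
    exact c.mem_A
  let X : F → F := fun z => c.Sh z (fderiv ℝ (f ∘ c.e.symm) z)
  -- The deviation δ = z − θ'(ρ'(z)) from the orbit piece has derivative V(z) along the trajectory.
  -- Since X is tangent to the piece, V vanishes on it, so |V(z)| = |V(z) − V(θ'(ρ'(z)))| ≤ K|δ| by
  -- a Lipschitz bound. As δ starts at 0, it stays 0.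
  let V : F → F := fun z => X z - fderiv ℝ θ' (ρ' z) (fderiv ℝ ρ' z (X z))
  have hfZ : ContDiffOn ℝ ∞ (f ∘ c.e.symm) c.Z := fun z hz => by
    rw [c.e_eq]
    exact (contDiffAt_comp_chart_symm _ (c.e_eq ▸ c.Z_subset hz) (hf _)).contDiffWithinAt
  have hX : ContDiffOn ℝ ∞ X c.Z :=
    c.contDiffOn_Sh.clm_apply (hfZ.fderiv_of_isOpen c.isOpen_Z (by simp))
  have hV : ContDiffOn ℝ ∞ V Z₁ := by
    refine (hX.mono Set.inter_subset_left).sub (ContDiffOn.clm_apply ?_ (ContDiffOn.clm_apply ?_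
      (hX.mono Set.inter_subset_left)))
    · exact (c.contDiffOn_θ.fderiv_of_isOpen c.isOpen_A (by simp)).comp
        (c.contDiffOn_ρ.mono Set.inter_subset_left) fun z hz => hz.2
    · exact (c.contDiffOn_ρ.fderiv_of_isOpen c.isOpen_Z (by simp)).mono Set.inter_subset_left
  have hV0 : ∀ a ∈ c.A, V (θ' a) = 0 := by
    intro a ha
    have h1 : X (θ' a) ∈ (c.Sh (θ' a)).range := ⟨_, rfl⟩
    rw [hθ', Function.comp_apply, c.range_Sh a ha] at h1
    obtain ⟨w, hw⟩ := h1
    have hw' : fderiv ℝ θ' a w = X (θ' a) := hw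
    have h2 : ρ' (θ' a) = a := c.ρ_θ a ha
    simp only [V, h2, ← hw']
    rw [show fderiv ℝ ρ' (θ' a) (fderiv ℝ θ' a w) = w from c.fderiv_ρ_fderiv_θ ha w, sub_self]
  obtain ⟨K, T, hT, hK⟩ := ((hV.contDiffAt (hZ₁.mem_nhds hz₀)).of_le
    (by simp : (1 : WithTop ℕ∞) ≤ ∞)).exists_lipschitzOnWith
  have hcont : ContinuousWithinAt γ s t₀ := (hγ t₀ ht₀).continuousWithinAt
  have hsrc : IsOpen c.e.source := c.e_eq ▸ isOpen_extChartAt_source _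
  have hec : ContinuousAt c.e (γ t₀) := by
    rw [c.e_eq, h₀]; exact continuousAt_extChartAt _
  have hzc : Filter.Tendsto (fun t => c.e (γ t)) (𝓝[s] t₀) (𝓝 (θ' a₁)) := by
    have := hec.comp_continuousWithinAt hcont
    rw [ContinuousWithinAt, Function.comp_apply, h₀] at this
    exact this
  have hρc : ContinuousAt ρ' (θ' a₁) :=
    (c.contDiffOn_ρ.contDiffAt (c.isOpen_Z.mem_nhds hz₀.1)).continuousAt
  have hρ₀ : ρ' (θ' a₁) = a₁ := c.ρ_θ a₁ c.mem_A
  have hθρ : Filter.Tendsto (fun t => θ' (ρ' (c.e (γ t)))) (𝓝[s] t₀) (𝓝 (θ' a₁)) := by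
    have h1 : ContinuousAt θ' (ρ' (θ' a₁)) := by
      rw [hρ₀]
      exact (c.contDiffOn_θ.contDiffAt (c.isOpen_A.mem_nhds c.mem_A)).continuousAt
    have h2 := (h1.tendsto.comp hρc.tendsto).comp hzc
    rwa [hρ₀] at h2
  have hev : ∀ᶠ t in 𝓝[s] t₀, γ t ∈ c.e.source ∧ c.e (γ t) ∈ Z₁ ∧ c.e (γ t) ∈ T ∧
      θ' (ρ' (c.e (γ t))) ∈ T := by
    filter_upwards [hcont.preimage_mem_nhdsWithin (hsrc.mem_nhds
      (by rw [h₀]; exact (c.θ_mem a₁ c.mem_A).1)), hzc (hZ₁.mem_nhds hz₀), hzc hT, hθρ hT] with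
      t h1 h2 h3 h4 using ⟨h1, h2, h3, h4⟩
  obtain ⟨ε, hε, hsub⟩ := Metric.mem_nhdsWithin_iff.1 hev
  have hball : (Metric.ball t₀ ε ∩ s).OrdConnected := by
    refine Set.OrdConnected.inter ?_ hs
    exact (convex_ball t₀ ε).ordConnected
  have key := eqOn_zero_of_norm_deriv_le (s := Metric.ball t₀ ε ∩ s) hball
    (δ := fun t => c.e (γ t) - θ' (ρ' (c.e (γ t)))) (δ' := fun t => V (c.e (γ t))) (K := K)
    (t₀ := t₀) ⟨Metric.mem_ball_self hε, ht₀⟩ ?_ ?_ ?_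
  · filter_upwards [inter_mem_nhdsWithin s (Metric.ball_mem_nhds t₀ hε)] with t ht
    have ht' := hsub ⟨ht.2, ht.1⟩
    refine ⟨ρ' (c.e (γ t)), ht'.2.1.2, ?_⟩
    have h1 := sub_eq_zero.1 (key t ⟨ht.2, ht.1⟩)
    exact (c.e.injOn ht'.1 (c.θ_mem _ ht'.2.1.2).1 h1).symm
  · rw [h₀]
    change θ' a₁ - θ' (ρ' (θ' a₁)) = 0
    rw [hρ₀, sub_self]
  · rintro t ⟨htb, hts⟩
    obtain ⟨h1, h2, h3, h4⟩ := hsub ⟨htb, hts⟩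
    have hd := (c.hasDerivWithinAt_chart hf hγ hts h1 h2.1).mono
      (Set.inter_subset_right (s := Metric.ball t₀ ε))
    have h5 : HasFDerivAt ρ' (fderiv ℝ ρ' (c.e (γ t))) (c.e (γ t)) :=
      ((c.contDiffOn_ρ.contDiffAt (c.isOpen_Z.mem_nhds h2.1)).differentiableAt
        (by simp)).hasFDerivAt
    have h6 : HasFDerivAt θ' (fderiv ℝ θ' (ρ' (c.e (γ t)))) (ρ' (c.e (γ t))) :=
      ((c.contDiffOn_θ.contDiffAt (c.isOpen_A.mem_nhds h2.2)).differentiableAt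
        (by simp)).hasFDerivAt
    exact hd.sub (h6.comp_hasDerivWithinAt t (h5.comp_hasDerivWithinAt t hd))
  · rintro t ⟨htb, hts⟩
    obtain ⟨h1, h2, h3, h4⟩ := hsub ⟨htb, hts⟩
    have h5 := hK.dist_le_mul _ h3 _ h4
    rwa [hV0 _ h2.2, dist_zero_right, dist_eq_norm] at h5

end LocalModel

variable (𝒢)

/-- A symplectic leaf is contained in an orbit. -/
theorem exists_arrow_of_sameLeaf {x y : M} (h : 𝒢.SameLeaf x y) :
    ∃ g, 𝒢.src g = x ∧ 𝒢.tgt g = y := by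
  have hsymm : ∀ {x y : M}, (∃ g, 𝒢.src g = x ∧ 𝒢.tgt g = y) → ∃ g, 𝒢.src g = y ∧ 𝒢.tgt g = x :=
    fun ⟨g, h1, h2⟩ => ⟨𝒢.inv g, by rw [𝒢.src_inv, h2], by rw [𝒢.tgt_inv, h1]⟩
  have htrans : ∀ {x y z : M}, (∃ g, 𝒢.src g = x ∧ 𝒢.tgt g = y) →
      (∃ g, 𝒢.src g = y ∧ 𝒢.tgt g = z) → ∃ g, 𝒢.src g = x ∧ 𝒢.tgt g = z := by
    rintro x y z ⟨g, h1, h2⟩ ⟨k, h3, h4⟩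
    exact ⟨𝒢.mul k g, by rw [𝒢.src_mul _ _ (h3.trans h2.symm), h1],
      by rw [𝒢.tgt_mul _ _ (h3.trans h2.symm), h4]⟩
  induction h with
  | refl x => exact ⟨𝒢.unit x, 𝒢.src_unit x, 𝒢.tgt_unit x⟩
  | symm x y _ ih => exact hsymm ih
  | trans x y z _ _ ih1 ih2 => exact htrans ih1 ih2
  | rel x y h =>
    obtain ⟨f, γ, hf, hγ, rfl, rfl⟩ := h
    -- Lying in one orbit is an equivalence relation on times which holds near each time, hence on
    -- all of [0, 1] by connectedness.
    refine isPreconnected_Icc.induction₂ (s := Set.Icc (0 : ℝ) 1)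
      (fun u v => ∃ g, 𝒢.src g = γ u ∧ 𝒢.tgt g = γ v) ?_ (fun _ _ _ _ _ _ => htrans)
      (fun _ _ _ _ => hsymm) (Set.left_mem_Icc.2 zero_le_one) (Set.right_mem_Icc.2 zero_le_one)
    intro t₀ ht₀
    obtain ⟨b, hb⟩ := 𝒢.exists_box (𝒢.unit (γ t₀))
    have hP := b.param.ret_mem _ hb rfl
    have hθ : b.θ (b.P (𝒢.unit (γ t₀))).1 = γ t₀ := by
      rw [← b.tgt_Ψ _ hP.1 _ hP.2, b.param.param_ret _ hb rfl, 𝒢.tgt_unit]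
    obtain ⟨c⟩ := nonempty_localModel b hP.1
    filter_upwards [c.eventually_mem_image hf Set.ordConnected_Icc ht₀ hγ hθ.symm] with t ht
    obtain ⟨a, ha, hat⟩ := ht
    obtain ⟨b₀, hb₀⟩ := b.nonempty_B
    refine ⟨b.Ψ (a, b₀), ?_, ?_⟩
    · exact (b.param.mem (a, b₀) ⟨c.A_subset ha, hb₀⟩ :).trans (𝒢.src_unit _)
    · rw [b.tgt_Ψ _ (c.A_subset ha) _ hb₀, hat]

end SymplecticGroupoid

/-! ### Pieces of orbits lie in symplectic leaves -/

/-- A smooth function on an open set agrees near a compact subset with a smooth global function. -/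
theorem exists_contMDiff_eqOn_nhds {F M : Type*} [NormedAddCommGroup F] [NormedSpace ℝ F]
    [FiniteDimensional ℝ F] [TopologicalSpace M] [T2Space M] [SecondCountableTopology M]
    [ChartedSpace F M] [IsManifold 𝓘(ℝ, F) ∞ M] {K O : Set M} (hK : IsCompact K) (hO : IsOpen O)
    (hKO : K ⊆ O) {f : M → ℝ} (hf : ContMDiffOn 𝓘(ℝ, F) 𝓘(ℝ, ℝ) ∞ f O) :
    ∃ g : M → ℝ, ContMDiff 𝓘(ℝ, F) 𝓘(ℝ, ℝ) ∞ g ∧ ∀ x ∈ K, g =ᶠ[𝓝 x] f := by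
  have : LocallyCompactSpace M := Manifold.locallyCompact_of_finiteDimensional 𝓘(ℝ, F)
  have : SigmaCompactSpace M := inferInstance
  obtain ⟨K', hK', hKK', hK'O⟩ := exists_compact_between hK hO hKO
  obtain ⟨χ, h1, h0, -⟩ := exists_contMDiffMap_one_nhds_of_subset_interior (n := ⊤) 𝓘(ℝ, F)
    hK.isClosed hKK'
  refine ⟨fun x => χ x * f x, fun x => ?_, fun x hx => ?_⟩
  · by_cases hx : x ∈ O
    · exact (χ.contMDiff x).mul (hf.contMDiffAt (hO.mem_nhds hx))
    · have : (fun x => χ x * f x) =ᶠ[𝓝 x] fun _ => 0 := by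
        filter_upwards [hK'.isClosed.isOpen_compl.mem_nhds fun h => hx (hK'O h)] with y hy
        rw [h0 y hy, zero_mul]
      exact contMDiffAt_const.congr_of_eventuallyEq this
  · filter_upwards [Filter.Eventually.filter_mono (nhds_le_nhdsSet hx) h1] with y hy
    rw [hy, one_mul]

namespace SymplecticGroupoid

variable {E F G M : Type*} [NormedAddCommGroup E] [NormedSpace ℝ E] [FiniteDimensional ℝ E]
  [NormedAddCommGroup F] [NormedSpace ℝ F] [FiniteDimensional ℝ F]
  [TopologicalSpace G] [ChartedSpace E G] [IsManifold 𝓘(ℝ, E) ∞ G]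
  [TopologicalSpace M] [ChartedSpace F M] [IsManifold 𝓘(ℝ, F) ∞ M] {𝒢 : SymplecticGroupoid E F G M}

variable {m : M} {l j : ℕ} {b : 𝒢.toLieGroupoid.Box m l j} {a₁ : Fin l → ℝ}

theorem LocalModel.fderiv_θ_eq (c : LocalModel b a₁) {a : Fin l → ℝ} (ha : a ∈ c.A)
    (w : Fin l → ℝ) :
    fderiv ℝ (c.e ∘ b.θ) a w = dchart (b.θ a₁) (b.θ a) (dparam (E := F) b.θ a w) := by
  rw [c.e_eq]
  exact fderiv_chart_comp _ ((b.contMDiffOn_θ.contMDiffAt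
    (b.isOpen_A.mem_nhds (c.A_subset ha))).mdifferentiableAt (by simp))
    (c.mem_source (c.θ_mem a ha).1) w

/-- A function, defined near the image of a segment in `θ(A)`, whose Hamiltonian vector field is
tangent to the segment. -/
theorem LocalModel.exists_hamiltonian (c : LocalModel b a₁) {w : Fin l → ℝ} (hw : w ≠ 0) :
    ∃ (Z : Set F) (f : F → ℝ), IsOpen Z ∧ Z ⊆ c.Z ∧ ContDiffOn ℝ ∞ f Z ∧
      ∀ τ : ℝ, a₁ + τ • w ∈ c.A → c.e (b.θ (a₁ + τ • w)) ∈ Z ∧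
        fderiv ℝ f (c.e (b.θ (a₁ + τ • w))) = c.N (a₁ + τ • w) w := by
  obtain ⟨φ, hφ⟩ := SeparatingDual.exists_eq_one (R := ℝ) hw
  set θ' := c.e ∘ b.θ with hθ'
  set ρ' := b.ρ ∘ c.e.symm with hρ'
  -- `p` projects to the line a₁ + ℝw by means of a functional φ with φ(w) = 1. The function z ↦
  -- α(z)(z − θ'(p z)) vanishes along the segment, and its differential there is N(w) minus a
  -- multiple of N(w)(dθ w), which is 0 by skew-symmetry of the Poisson structure.
  let p : F → (Fin l → ℝ) := fun z => a₁ + φ (ρ' z - a₁) • w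
  have hp : ContDiffOn ℝ ∞ p c.Z :=
    contDiffOn_const.add ((φ.contDiff.comp_contDiffOn
      (c.contDiffOn_ρ.sub contDiffOn_const)).smul contDiffOn_const)
  let Z := c.Z ∩ p ⁻¹' c.A
  have hZ : IsOpen Z := hp.continuousOn.isOpen_inter_preimage c.isOpen_Z c.isOpen_A
  let α : F → F →L[ℝ] ℝ := fun z => c.N (p z) w
  let q : F → F := fun z => z - θ' (p z)
  have hpZ : ContDiffOn ℝ ∞ p Z := hp.mono Set.inter_subset_left
  have hα : ContDiffOn ℝ ∞ α Z :=
    (c.contDiffOn_N.comp hpZ fun z hz => hz.2).clm_apply contDiffOn_const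
  have hq : ContDiffOn ℝ ∞ q Z := contDiffOn_id.sub (c.contDiffOn_θ.comp hpZ fun z hz => hz.2)
  refine ⟨Z, fun z => α z (q z), hZ, Set.inter_subset_left, hα.clm_apply hq, fun τ hτ => ?_⟩
  set a := a₁ + τ • w with ha
  have hpa : p (θ' a) = a := by
    have : ρ' (θ' a) = a := c.ρ_θ a hτ
    simp only [p, this]
    rw [ha, add_sub_cancel_left, map_smul, hφ, smul_eq_mul, mul_one]
  have hz : θ' a ∈ Z := ⟨(c.θ_mem a hτ).2, by rw [Set.mem_preimage, hpa]; exact hτ⟩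
  refine ⟨hz, ?_⟩
  change fderiv ℝ (fun z => α z (q z)) (θ' a) = c.N a w
  have hαd : DifferentiableAt ℝ α (θ' a) :=
    (hα.contDiffAt (hZ.mem_nhds hz)).differentiableAt (by simp)
  have hqd : DifferentiableAt ℝ q (θ' a) :=
    (hq.contDiffAt (hZ.mem_nhds hz)).differentiableAt (by simp)
  have hpd : HasFDerivAt p ((φ.comp (fderiv ℝ ρ' (θ' a))).smulRight w) (θ' a) := by
    have h1 : HasFDerivAt ρ' (fderiv ℝ ρ' (θ' a)) (θ' a) :=
      ((c.contDiffOn_ρ.contDiffAt (c.isOpen_Z.mem_nhds hz.1)).differentiableAt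
        (by simp)).hasFDerivAt
    have h2 := ((φ.hasFDerivAt.comp (θ' a) (h1.sub_const a₁)).smul_const w).const_add a₁
    exact h2
  have hθd : HasFDerivAt θ' (fderiv ℝ θ' a) (p (θ' a)) := by
    rw [hpa]
    exact ((c.contDiffOn_θ.contDiffAt (c.isOpen_A.mem_nhds hτ)).differentiableAt
      (by simp)).hasFDerivAt
  have hqd' := (hasFDerivAt_id (𝕜 := ℝ) (θ' a)).sub (hθd.comp (θ' a) hpd)
  have hq0 : q (θ' a) = 0 := by simp only [q, hpa, sub_self]
  have hα0 : α (θ' a) = c.N a w := by simp only [α, hpa]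
  have hself : c.N a w (fderiv ℝ θ' a w) = 0 := by
    have h1 := c.skew (θ' a) hz.1 (c.N a w) (c.N a w)
    rw [← c.Sh_N a hτ w]
    change (c.N a w) (c.Sh (θ' a) (c.N a w)) = 0
    linarith
  rw [fderiv_clm_apply hαd hqd, hq0, hα0]
  ext v
  have h3 : fderiv ℝ q (θ' a) v = v - fderiv ℝ θ' a (φ (fderiv ℝ ρ' (θ' a) v) • w) := by
    have := hqd'.fderiv
    rw [show fderiv ℝ q (θ' a) = _ from this]
    rfl
  simp [h3, hself]

/-- The segment itself is a trajectory: the Hamiltonian constructed near it has differential N(w)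
along it, and Π♯N(w) = dθ(w). Compactness of the segment allows the Hamiltonian to be extended to
`M` by a cut-off. -/
theorem sameLeaf_of_segment [T2Space M] [SecondCountableTopology M] (c : LocalModel b a₁)
    {w : Fin l → ℝ} (hw : ∀ τ ∈ Set.Icc (0 : ℝ) 1, a₁ + τ • w ∈ c.A) :
    𝒢.SameLeaf (b.θ a₁) (b.θ (a₁ + w)) := by
  rcases eq_or_ne w 0 with rfl | hw0
  · rw [add_zero]; exact Relation.EqvGen.refl _
  obtain ⟨Z, f, hZ, hZc, hf, hfN⟩ := c.exists_hamiltonian hw0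
  let γ : ℝ → M := fun τ => b.θ (a₁ + τ • w)
  have hline : ContDiff ℝ ∞ fun τ : ℝ => a₁ + τ • w := by fun_prop
  have hγ : ∀ τ ∈ Set.Icc (0 : ℝ) 1, MDifferentiableAt 𝓘(ℝ, Fin l → ℝ) 𝓘(ℝ, F) b.θ (a₁ + τ • w) :=
    fun τ hτ => (b.contMDiffOn_θ.contMDiffAt
      (b.isOpen_A.mem_nhds (c.A_subset (hw τ hτ)))).mdifferentiableAt (by simp)
  have hγc : ContinuousOn γ (Set.Icc 0 1) := b.contMDiffOn_θ.continuousOn.comp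
    hline.continuous.continuousOn fun τ hτ => c.A_subset (hw τ hτ)
  have hsrc : IsOpen c.e.source := c.e_eq ▸ isOpen_extChartAt_source _
  have hec : ContinuousOn c.e c.e.source := c.e_eq ▸ continuousOn_extChartAt _
  obtain ⟨g, hg, hgf⟩ := exists_contMDiff_eqOn_nhds (F := F) (f := f ∘ c.e)
    (isCompact_Icc.image_of_continuousOn hγc)
    (hec.isOpen_inter_preimage hsrc hZ) (by
      rintro _ ⟨τ, hτ, rfl⟩
      exact ⟨(c.θ_mem _ (hw τ hτ)).1, (hfN τ (hw τ hτ)).1⟩) (by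
      intro y hy
      have h1 : ContMDiffAt 𝓘(ℝ, F) 𝓘(ℝ, ℝ) ∞ f (c.e y) :=
        (hf.contDiffAt (hZ.mem_nhds hy.2)).contMDiffAt
      refine (h1.comp y ?_).contMDiffWithinAt
      rw [c.e_eq]
      exact contMDiffAt_extChart _ (c.mem_source hy.1))
  refine Relation.EqvGen.rel _ _ ⟨g, γ, hg, fun τ hτ => ?_, by simp [γ], by simp [γ]⟩
  have hwτ := hw τ hτ
  have hys := (c.θ_mem _ hwτ).1
  have hyZ := (c.θ_mem _ hwτ).2
  have hham : (𝒢.hamiltonianField g (γ τ) : F) = dparam (E := F) b.θ (a₁ + τ • w) w := by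
    apply injective_dchart (b.θ a₁) (c.mem_source hys)
    rw [← c.fderiv_θ_eq hwτ, c.dchart_hamiltonianField hg hys hyZ, ← c.Sh_N _ hwτ]
    congr 1
    rw [← (hfN τ hwτ).2]
    apply Filter.EventuallyEq.fderiv_eq
    have h1 : ContinuousAt c.e.symm (c.e (γ τ)) := by
      rw [c.e_eq]
      exact continuousAt_extChartAt_symm'' (c.e_eq ▸ c.e.map_source hys)
    have h2 : c.e.symm (c.e (γ τ)) = γ τ := c.e.left_inv hys
    rw [ContinuousAt, h2] at h1
    filter_upwards [h1.eventually (hgf (γ τ) ⟨τ, hτ, rfl⟩), c.isOpen_Z.mem_nhds hyZ] with z hz hzZ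
    rw [Function.comp_apply, hz, Function.comp_apply, c.e.right_inv (c.Z_subset hzZ)]
  have h1 := (hγ τ hτ).hasMFDerivAt.comp_hasMFDerivWithinAt (s := Set.Icc (0 : ℝ) 1) τ
    ((hline.contDiffAt.differentiableAt (by simp)).hasFDerivAt.hasFDerivWithinAt.hasMFDerivWithinAt)
  have h2 : (((1 : ℝ →L[ℝ] ℝ).smulRight (𝒢.hamiltonianField g (γ τ) : F)) : ℝ →L[ℝ] F) =
      (dparam b.θ (a₁ + τ • w)).comp (fderiv ℝ (fun τ : ℝ => a₁ + τ • w) τ) := by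
    have h3 : HasDerivAt (fun τ : ℝ => a₁ + τ • w) w τ := by
      simpa using ((hasDerivAt_id τ).smul_const w).const_add a₁
    ext
    rw [hham, ContinuousLinearMap.comp_apply,
      show fderiv ℝ (fun τ : ℝ => a₁ + τ • w) τ 1 = w from
        (fderiv_apply_one_eq_deriv).trans h3.deriv]
    simp
  exact h1.congr_mfderiv h2.symm

/-- Near every point of `b.A` radial segments do the job; convexity makes `b.A` connected, so the
relation spreads over the whole box. -/
theorem sameLeaf_θ [T2Space M] [SecondCountableTopology M] (b : 𝒢.toLieGroupoid.Box m l j)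
    {a a' : Fin l → ℝ} (ha : a ∈ b.A) (ha' : a' ∈ b.A) : 𝒢.SameLeaf (b.θ a) (b.θ a') := by
  refine b.convex_A.isPreconnected.induction₂ (fun a a' => 𝒢.SameLeaf (b.θ a) (b.θ a')) ?_
    (fun _ _ _ _ _ _ h h' => h.trans _ _ _ h') (fun _ _ _ _ h => h.symm) ha ha'
  intro a₁ ha₁
  obtain ⟨c⟩ := nonempty_localModel b ha₁
  obtain ⟨ε, hε, hball⟩ := Metric.isOpen_iff.1 c.isOpen_A a₁ c.mem_A
  filter_upwards [mem_nhdsWithin_of_mem_nhds (Metric.ball_mem_nhds a₁ hε)] with a ha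
  have := sameLeaf_of_segment c (w := a - a₁) fun τ hτ => hball ?_
  · simpa using this
  · rw [mem_ball_iff_norm] at ha ⊢
    rw [add_sub_cancel_left, norm_smul, Real.norm_of_nonneg hτ.1]
    exact (mul_le_of_le_one_left (norm_nonneg _) hτ.2).trans_lt ha

end SymplecticGroupoid

/-! ### Orbits and countable covers by boxes -/

namespace LieGroupoid

variable {E F G M : Type*} [NormedAddCommGroup E] [NormedSpace ℝ E]
  [NormedAddCommGroup F] [NormedSpace ℝ F] [TopologicalSpace G] [ChartedSpace E G]
  [TopologicalSpace M] [ChartedSpace F M] (𝒢 : LieGroupoid E F G M)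

/-- The orbit of a point. -/
def orbit (m : M) : Set M := {y | ∃ h, 𝒢.src h = m ∧ 𝒢.tgt h = y}

theorem mem_orbit_self (m : M) : m ∈ 𝒢.orbit m := ⟨𝒢.unit m, 𝒢.src_unit m, 𝒢.tgt_unit m⟩

theorem tgt_mem_orbit (h : G) : 𝒢.tgt h ∈ 𝒢.orbit (𝒢.src h) := ⟨h, rfl, rfl⟩

theorem orbit_eq_of_mem {m x : M} (hx : x ∈ 𝒢.orbit m) : 𝒢.orbit x = 𝒢.orbit m := by
  obtain ⟨g, hg, hg'⟩ := hx
  ext y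
  constructor
  · rintro ⟨h, h1, h2⟩
    exact ⟨𝒢.mul h g, by rw [𝒢.src_mul _ _ (h1.trans hg'.symm), hg],
      by rw [𝒢.tgt_mul _ _ (h1.trans hg'.symm), h2]⟩
  · rintro ⟨h, h1, h2⟩
    have h3 : 𝒢.src h = 𝒢.tgt (𝒢.inv g) := by rw [𝒢.tgt_inv, h1, hg]
    exact ⟨𝒢.mul h (𝒢.inv g), by rw [𝒢.src_mul _ _ h3, 𝒢.src_inv, hg'],
      by rw [𝒢.tgt_mul _ _ h3, h2]⟩

theorem finrank_orbitSpace_of_mem_orbit [FiniteDimensional ℝ E] [FiniteDimensional ℝ F]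
    [IsManifold 𝓘(ℝ, F) ∞ M] {m y : M}
    (hy : y ∈ 𝒢.orbit m) :
    Module.finrank ℝ (𝒢.orbitSpace y) = Module.finrank ℝ (𝒢.orbitSpace m) := by
  obtain ⟨g, rfl, rfl⟩ := hy
  exact 𝒢.finrank_orbitSpace g

namespace Box

variable {𝒢} {m : M} {l j : ℕ} (b : 𝒢.Box m l j)

theorem injOn_θ : Set.InjOn b.θ b.A := fun a ha a' ha' h => by
  rw [← b.ρ_θ a ha, h, b.ρ_θ a' ha']

theorem src_Ψ {a : Fin l → ℝ} {c : Fin j → ℝ} (ha : a ∈ b.A) (hc : c ∈ b.B) :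
    𝒢.src (b.Ψ (a, c)) = m := b.param.mem (a, c) ⟨ha, hc⟩

theorem θ_mem_orbit {a : Fin l → ℝ} (ha : a ∈ b.A) : b.θ a ∈ 𝒢.orbit m := by
  obtain ⟨c, hc⟩ := b.nonempty_B
  exact ⟨b.Ψ (a, c), b.src_Ψ ha hc, b.tgt_Ψ a ha c hc⟩

/-- The differential of the retraction, as a linear map between the model spaces. -/
noncomputable def dρ (y : M) : F →L[ℝ] (Fin l → ℝ) := mfderiv 𝓘(ℝ, F) 𝓘(ℝ, Fin l → ℝ) b.ρ y

theorem dρ_dθ {a : Fin l → ℝ} (ha : a ∈ b.A) (w : Fin l → ℝ) :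
    b.dρ (b.θ a) (dparam b.θ a w) = w := by
  have h1 := mfderiv_comp a ((b.contMDiffOn_ρ.contMDiffAt (b.isOpen_WM.mem_nhds
    (b.θ_mem a ha))).mdifferentiableAt (by simp))
    ((b.contMDiffOn_θ.contMDiffAt (b.isOpen_A.mem_nhds ha)).mdifferentiableAt (by simp))
  have h2 : b.ρ ∘ b.θ =ᶠ[𝓝 a] id := by
    filter_upwards [b.isOpen_A.mem_nhds ha] with a ha using b.ρ_θ a ha
  rw [h2.mfderiv_eq, mfderiv_id] at h1
  exact (congrArg (fun L => (L w : Fin l → ℝ)) h1).symm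

theorem injective_dθ {a : Fin l → ℝ} (ha : a ∈ b.A) :
    Function.Injective (dparam (E := F) b.θ a) := fun v w h => by
  rw [← b.dρ_dθ ha v, h, b.dρ_dθ ha w]

/-- A map into the orbit whose differential is tangent to the orbit, compared with `θ`. -/
theorem dparam_eq_comp {k : ℕ} {φ : (Fin k → ℝ) → M} {u : Fin k → ℝ}
    (hφ : MDifferentiableAt 𝓘(ℝ, Fin k → ℝ) 𝓘(ℝ, F) φ u)
    (hr : (dparam φ u : (Fin k → ℝ) →L[ℝ] F).range ≤ 𝒢.orbitSpace (φ u))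
    (hu : φ u ∈ b.θ '' b.A) :
    DifferentiableAt ℝ (b.ρ ∘ φ) u ∧
      (dparam φ u : (Fin k → ℝ) →L[ℝ] F) =
        (dparam b.θ (b.ρ (φ u))).comp (fderiv ℝ (b.ρ ∘ φ) u) := by
  obtain ⟨a, ha, hau⟩ := hu
  have hρ : MDifferentiableAt 𝓘(ℝ, F) 𝓘(ℝ, Fin l → ℝ) b.ρ (φ u) := by
    rw [← hau]
    exact (b.contMDiffOn_ρ.contMDiffAt (b.isOpen_WM.mem_nhds
      (b.θ_mem a ha))).mdifferentiableAt (by simp)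
  refine ⟨(hρ.comp u hφ).differentiableAt, ContinuousLinearMap.ext fun v => ?_⟩
  have h1 : dparam φ u v ∈ (dparam b.θ a : (Fin l → ℝ) →L[ℝ] F).range := by
    rw [b.range_dθ a ha, hau]
    exact hr ⟨v, rfl⟩
  obtain ⟨w, hw⟩ := h1
  have hw' : dparam b.θ a w = dparam φ u v := hw
  have h2 : (fderiv ℝ (b.ρ ∘ φ) u : (Fin k → ℝ) →L[ℝ] (Fin l → ℝ)) v =
      b.dρ (φ u) (dparam φ u v) := by
    have h3 := mfderiv_comp u hρ hφ
    rw [mfderiv_eq_fderiv] at h3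
    exact congrArg (fun L => (L v : Fin l → ℝ)) h3
  rw [ContinuousLinearMap.comp_apply, h2, ← hw', ← hau, b.ρ_θ a ha, b.dρ_dθ ha]

end Box

/-- Countably many boxes cover a source fibre. -/
theorem exists_box_cover [FiniteDimensional ℝ E] [FiniteDimensional ℝ F] [IsManifold 𝓘(ℝ, F) ∞ M]
    [SecondCountableTopology G] (m : M) :
    ∃ b : ℕ → 𝒢.Box m (Module.finrank ℝ (𝒢.orbitSpace m))
      (Module.finrank ℝ E - Module.finrank ℝ F - Module.finrank ℝ (𝒢.orbitSpace m)),
      ∀ h, 𝒢.src h = m → ∃ i, h ∈ (b i).W := by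
  have key : ∀ h, 𝒢.src h = m → ∃ b : 𝒢.Box m (Module.finrank ℝ (𝒢.orbitSpace m))
      (Module.finrank ℝ E - Module.finrank ℝ F - Module.finrank ℝ (𝒢.orbitSpace m)),
      h ∈ b.W := by
    rintro h rfl
    exact 𝒢.exists_box h
  have : Nonempty (𝒢.Box m (Module.finrank ℝ (𝒢.orbitSpace m))
      (Module.finrank ℝ E - Module.finrank ℝ F - Module.finrank ℝ (𝒢.orbitSpace m))) :=
    let ⟨b, _⟩ := key (𝒢.unit m) (𝒢.src_unit m); ⟨b⟩
  choose! b hb using key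
  obtain ⟨t, ht, htc, hcov⟩ := TopologicalSpace.countable_cover_nhdsWithin
    (s := 𝒢.src ⁻¹' {m}) (f := fun h => (b h).W)
    fun h hh => mem_nhdsWithin_of_mem_nhds ((b h).param.isOpen_nhd.mem_nhds (hb h hh))
  have hne : t.Nonempty := by
    obtain ⟨i, hi, -⟩ := Set.mem_iUnion₂.1 (hcov (𝒢.src_unit m : 𝒢.unit m ∈ 𝒢.src ⁻¹' {m}))
    exact ⟨i, hi⟩
  obtain ⟨f, rfl⟩ := htc.exists_eq_range hne
  refine ⟨fun i => b (f i), fun h hh => ?_⟩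
  obtain ⟨_, ⟨i, rfl⟩, hi⟩ := Set.mem_iUnion₂.1 (hcov hh)
  exact ⟨i, hi⟩

theorem exists_mem_image_θ {m : M} {l j : ℕ} {b : ℕ → 𝒢.Box m l j}
    (hb : ∀ h, 𝒢.src h = m → ∃ i, h ∈ (b i).W) {y : M} (hy : y ∈ 𝒢.orbit m) :
    ∃ i, y ∈ (b i).θ '' (b i).A := by
  obtain ⟨h, hh, rfl⟩ := hy
  obtain ⟨i, hi⟩ := hb h hh
  have h1 := (b i).param.ret_mem h hi hh
  exact ⟨i, ((b i).P h).1, h1.1, by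
    rw [← (b i).tgt_Ψ _ h1.1 _ h1.2, (b i).param.param_ret h hi hh]⟩

end LieGroupoid

/-! ### The Liouville density -/

namespace SymplecticGroupoid

variable {E F G M : Type*} [NormedAddCommGroup E] [NormedSpace ℝ E] [FiniteDimensional ℝ E]
  [NormedAddCommGroup F] [NormedSpace ℝ F] [FiniteDimensional ℝ F]
  [TopologicalSpace G] [ChartedSpace E G] [IsManifold 𝓘(ℝ, E) ∞ G]
  [TopologicalSpace M] [ChartedSpace F M] [IsManifold 𝓘(ℝ, F) ∞ M] (𝒢 : SymplecticGroupoid E F G M)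

/-- The matrix of the leafwise symplectic form in the parametrisation `φ`. -/
noncomputable def leafMatrix {k : ℕ} (φ : (Fin k → ℝ) → M) (u : Fin k → ℝ) :
    Matrix (Fin k) (Fin k) ℝ :=
  Matrix.of fun i j => 𝒢.leafForm (φ u) (dparam (E := F) φ u (Pi.single i 1))
    (dparam (E := F) φ u (Pi.single j 1))

/-- The density of the Liouville measure in the parametrisation `φ`. -/
noncomputable def leafDensity {k : ℕ} (φ : (Fin k → ℝ) → M) (u : Fin k → ℝ) : ℝ :=
  (k / 2).factorial * √(𝒢.leafMatrix φ u).det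

/-- This is the change of basis for a bilinear form. Since `leafForm` is not bilinear by definition,
linearity in the first slot is obtained from covectors α_p representing the vectors dθ(e_p). -/
theorem leafMatrix_comp {k l : ℕ} {φ : (Fin k → ℝ) → M} {θ : (Fin l → ℝ) → M} {u : Fin k → ℝ}
    {a : Fin l → ℝ} (h : φ u = θ a)
    (hθ : (dparam θ a : (Fin l → ℝ) →L[ℝ] F).range ≤ 𝒢.orbitSpace (θ a))
    (T : (Fin k → ℝ) →L[ℝ] (Fin l → ℝ))
    (hT : (dparam φ u : (Fin k → ℝ) →L[ℝ] F) = (dparam θ a).comp T) :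
    𝒢.leafMatrix φ u = (LinearMap.toMatrix' T.toLinearMap).transpose * 𝒢.leafMatrix θ a *
      LinearMap.toMatrix' T.toLinearMap := by
  have hmem : ∀ v, dparam (E := F) θ a v ∈ 𝒢.orbitSpace (θ a) := fun v => hθ ⟨v, rfl⟩
  choose α hα using fun p : Fin l =>
    (𝒢.mem_range_sharpModel_iff (θ a) _).2 (hmem (Pi.single p 1))
  have hexp : ∀ i, T (Pi.single i 1) = ∑ p, LinearMap.toMatrix' T.toLinearMap p i •
      (Pi.single p 1 : Fin l → ℝ) := by
    intro i
    ext q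
    simp [LinearMap.toMatrix'_apply, Finset.sum_apply, Pi.single_apply]
  have hd : ∀ i, dparam (E := F) φ u (Pi.single i 1) = ∑ p,
      LinearMap.toMatrix' T.toLinearMap p i • dparam (E := F) θ a (Pi.single p 1) := by
    intro i
    rw [hT, ContinuousLinearMap.comp_apply, hexp, map_sum]
    simp only [map_smul]
  have hsharp : ∀ (s : Finset (Fin l)) (c : Fin l → ℝ), 𝒢.sharpModel (θ a) (∑ p ∈ s, c p • α p) =
      ∑ p ∈ s, c p • dparam (E := F) θ a (Pi.single p 1) := by
    intro s c
    induction s using Finset.induction_on with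
    | empty =>
      have := 𝒢.sharpModel_smul (θ a) 0 0
      simpa using this
    | insert p s hp ih =>
      rw [Finset.sum_insert hp, Finset.sum_insert hp, sharpModel_add, sharpModel_smul, ih, hα]
  ext i j
  have h1 : 𝒢.leafMatrix φ u i j = (∑ p, LinearMap.toMatrix' T.toLinearMap p i • α p)
      (dparam (E := F) φ u (Pi.single j 1)) := by
    change 𝒢.leafForm (φ u) _ _ = _
    rw [h]
    refine 𝒢.leafForm_eq (θ a) _ _ _ ?_ ?_
    · rw [hsharp, hd]
    · rw [hT]
      exact hmem _
  have h2 : ∀ p q, 𝒢.leafMatrix θ a p q = α p (dparam (E := F) θ a (Pi.single q 1)) :=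
    fun p q => 𝒢.leafForm_eq (θ a) _ _ _ (hα p) (hmem _)
  rw [h1, hd]
  simp only [Matrix.mul_apply, Matrix.transpose_apply, h2, map_sum, map_smul, smul_eq_mul,
    FunLike.coe_sum, Finset.sum_apply, FunLike.coe_smul, Pi.smul_apply]
  refine Finset.sum_congr rfl fun q _ => ?_
  rw [mul_comm]

/-- The factor |det T| is what the change of variables formula produces, so the measure of the
density does not depend on the parametrisation. -/
theorem leafDensity_comp {k : ℕ} {φ θ : (Fin k → ℝ) → M} {u a : Fin k → ℝ} (h : φ u = θ a)
    (hθ : (dparam θ a : (Fin k → ℝ) →L[ℝ] F).range ≤ 𝒢.orbitSpace (θ a))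
    (T : (Fin k → ℝ) →L[ℝ] (Fin k → ℝ))
    (hT : (dparam φ u : (Fin k → ℝ) →L[ℝ] F) = (dparam θ a).comp T) :
    𝒢.leafDensity φ u = |T.det| * 𝒢.leafDensity θ a := by
  have h1 : (LinearMap.toMatrix' T.toLinearMap).det = T.det := LinearMap.det_toMatrix' _
  rw [leafDensity, leafDensity, 𝒢.leafMatrix_comp h hθ T hT, Matrix.det_mul, Matrix.det_mul,
    Matrix.det_transpose, h1,
    show T.det * (𝒢.leafMatrix θ a).det * T.det = T.det ^ 2 * (𝒢.leafMatrix θ a).det by ring,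
    Real.sqrt_mul (sq_nonneg _), Real.sqrt_sq_eq_abs]
  ring

/-- The leafwise symplectic form is nondegenerate, so leaves are even-dimensional. -/
theorem even_and_det_leafMatrix_pos {k : ℕ} {φ : (Fin k → ℝ) → M} {u : Fin k → ℝ}
    (hi : Function.Injective (dparam (E := F) φ u))
    (hr : (dparam φ u : (Fin k → ℝ) →L[ℝ] F).range = 𝒢.orbitSpace (φ u)) :
    Even k ∧ 0 < (𝒢.leafMatrix φ u).det := by
  have hmem : ∀ v, dparam (E := F) φ u v ∈ 𝒢.orbitSpace (φ u) := fun v => hr ▸ ⟨v, rfl⟩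
  have hform : ∀ v w, ∀ α, 𝒢.sharpModel (φ u) α = dparam (E := F) φ u v →
      𝒢.leafForm (φ u) (dparam (E := F) φ u v) (dparam (E := F) φ u w) =
        α (dparam (E := F) φ u w) := fun v w α hα => 𝒢.leafForm_eq (φ u) α _ _ hα (hmem w)
  choose α hα using fun p : Fin k =>
    (𝒢.mem_range_sharpModel_iff (φ u) _).2 (hmem (Pi.single p 1))
  have hent : ∀ p q, 𝒢.leafMatrix φ u p q = α p (dparam (E := F) φ u (Pi.single q 1)) :=
    fun p q => hform _ _ _ (hα p)
  apply det_pos_of_transpose_eq_neg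
  · ext p q
    rw [Matrix.transpose_apply, Matrix.neg_apply, hent, hent, ← hα, ← hα, sharpModel_skew]
  · intro h0
    obtain ⟨x, hx, hx0⟩ := Matrix.exists_mulVec_eq_zero_iff.2 h0
    apply hx
    apply hi
    rw [map_zero]
    have hxs : ∑ q, x q • (Pi.single q 1 : Fin k → ℝ) = x := by
      ext i; simp [Finset.sum_apply, Pi.single_apply]
    have h1 : ∀ p, α p (dparam (E := F) φ u x) = 0 := by
      intro p
      have := congrFun hx0 p
      rw [Matrix.mulVec, dotProduct] at this
      simp only [hent] at this
      rw [← hxs, map_sum, map_sum]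
      simpa [mul_comm] using this
    -- For x in the kernel of the matrix, a covector β with Π♯β = dφ(x) vanishes on the tangent
    -- space of the leaf. Then γ(dφ x) = −β(Π♯γ) = 0 for every γ, so dφ(x) = 0.
    obtain ⟨β, hβ⟩ := (𝒢.mem_range_sharpModel_iff (φ u) _).2 (hmem x)
    have h2 : ∀ v, β (dparam (E := F) φ u v) = 0 := by
      intro v
      have hv : ∑ q, v q • (Pi.single q 1 : Fin k → ℝ) = v := by
        ext i; simp [Finset.sum_apply, Pi.single_apply]
      rw [← hv, map_sum, map_sum]
      refine Finset.sum_eq_zero fun p _ => ?_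
      rw [map_smul, map_smul, ← hα p, sharpModel_skew, hβ, h1]
      simp
    rw [← hβ]
    by_contra hne
    obtain ⟨γ, hγ⟩ := SeparatingDual.exists_eq_one (R := ℝ) hne
    rw [sharpModel_skew] at hγ
    have hγ' : 𝒢.sharpModel (φ u) γ ∈ 𝒢.orbitSpace (φ u) :=
      (𝒢.mem_range_sharpModel_iff _ _).1 ⟨γ, rfl⟩
    rw [← hr] at hγ'
    obtain ⟨v, hv⟩ := hγ'
    have hv' : dparam φ u v = 𝒢.sharpModel (φ u) γ := hv
    rw [← hv', h2] at hγ
    simp at hγ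

theorem leafDensity_pos {k : ℕ} {φ : (Fin k → ℝ) → M} {u : Fin k → ℝ}
    (hi : Function.Injective (dparam (E := F) φ u))
    (hr : (dparam φ u : (Fin k → ℝ) →L[ℝ] F).range = 𝒢.orbitSpace (φ u)) :
    0 < 𝒢.leafDensity φ u := by
  have := (𝒢.even_and_det_leafMatrix_pos hi hr).2
  exact mul_pos (by positivity) (Real.sqrt_pos.2 this)

variable {𝒢}

/-- In a local model the entries of the matrix are N(e_p)(dθ e_q), which are smooth, and the square
root is smooth because the determinant is positive. -/
theorem contDiffOn_leafDensity {m : M} {l j : ℕ} (b : 𝒢.toLieGroupoid.Box m l j) :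
    ContDiffOn ℝ ∞ (𝒢.leafDensity b.θ) b.A := by
  intro a₁ ha₁
  obtain ⟨c⟩ := nonempty_localModel b ha₁
  have hent : ∀ a ∈ c.A, 𝒢.leafMatrix b.θ a = Matrix.of fun p q =>
      c.N a (Pi.single p 1) (fderiv ℝ (c.e ∘ b.θ) a (Pi.single q 1)) := by
    intro a ha
    have haA := c.A_subset ha
    ext p q
    change 𝒢.leafForm (b.θ a) _ _ = c.N a (Pi.single p 1) _
    rw [c.fderiv_θ_eq ha]
    refine 𝒢.leafForm_eq (b.θ a) ((c.N a (Pi.single p 1)).comp (dchart (b.θ a₁) (b.θ a))) _ _ ?_ ?_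
    · apply injective_dchart (b.θ a₁) (c.mem_source (c.θ_mem a ha).1)
      rw [c.Sh_eq _ (c.θ_mem a ha).1 (c.θ_mem a ha).2, c.Sh_N a ha, c.fderiv_θ_eq ha]
    · rw [← b.range_dθ a haA]; exact ⟨_, rfl⟩
  have hdet : ContDiffOn ℝ ∞ (fun a => (𝒢.leafMatrix b.θ a).det) c.A := by
    refine ContDiffOn.congr (f := fun a => (Matrix.of fun p q => c.N a (Pi.single p 1)
      (fderiv ℝ (c.e ∘ b.θ) a (Pi.single q 1))).det) ?_ fun a ha => by rw [hent a ha]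
    simp only [Matrix.det_apply, Matrix.of_apply]
    refine ContDiffOn.sum fun σ _ => ContDiffOn.const_smul _ (contDiffOn_prod fun i _ => ?_)
    exact ((c.contDiffOn_N.clm_apply contDiffOn_const).clm_apply
      ((c.contDiffOn_θ.fderiv_of_isOpen c.isOpen_A (by simp)).clm_apply contDiffOn_const))
  have hpos : (𝒢.leafMatrix b.θ a₁).det ≠ 0 :=
    (𝒢.even_and_det_leafMatrix_pos (b.injective_dθ ha₁) (b.range_dθ a₁ ha₁)).2.ne'
  have h1 := (hdet.contDiffAt (c.isOpen_A.mem_nhds c.mem_A)).sqrt hpos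
  exact (contDiffAt_const.mul h1).contDiffWithinAt

end SymplecticGroupoid

theorem restrict_map_apply_of_continuousOn {X Y : Type*} [TopologicalSpace X] [MeasurableSpace X]
    [OpensMeasurableSpace X] [TopologicalSpace Y] [MeasurableSpace Y] [BorelSpace Y]
    (μ : Measure X) {φ : X → Y} {U : Set X} (hU : MeasurableSet U) (hφ : ContinuousOn φ U)
    {C : Set Y} (hC : MeasurableSet C) : ((μ.restrict U).map φ) C = μ (U ∩ φ ⁻¹' C) := by
  rw [Measure.map_apply_of_aemeasurable (hφ.aemeasurable hU) hC, Measure.restrict_apply' hU,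
    Set.inter_comm]

/-! ### Liouville measures of leaves and of orbits -/

namespace SymplecticGroupoid

variable {E F G M : Type*} [NormedAddCommGroup E] [NormedSpace ℝ E] [FiniteDimensional ℝ E]
  [NormedAddCommGroup F] [NormedSpace ℝ F] [FiniteDimensional ℝ F]
  [TopologicalSpace G] [ChartedSpace E G] [IsManifold 𝓘(ℝ, E) ∞ G]
  [TopologicalSpace M] [ChartedSpace F M] [IsManifold 𝓘(ℝ, F) ∞ M] (𝒢 : SymplecticGroupoid E F G M)

theorem dparam_range_of_isPatch {S : Set M} {k : ℕ} {U : Set (Fin k → ℝ)} {φ : (Fin k → ℝ) → M}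
    (h : IsPatch (E := F) S (fun y => Set.range (𝒢.sharp y)) k U φ) {u : Fin k → ℝ} (hu : u ∈ U) :
    (dparam φ u : (Fin k → ℝ) →L[ℝ] F).range = 𝒢.orbitSpace (φ u) := by
  have h1 := h.range_mfderiv u hu
  rw [𝒢.range_sharp] at h1
  exact SetLike.ext' h1

theorem finrank_orbitSpace_of_isPatch {S : Set M} {k : ℕ} {U : Set (Fin k → ℝ)}
    {φ : (Fin k → ℝ) → M} (h : IsPatch (E := F) S (fun y => Set.range (𝒢.sharp y)) k U φ)
    {u : Fin k → ℝ} (hu : u ∈ U) : Module.finrank ℝ (𝒢.orbitSpace (φ u)) = k := by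
  rw [← 𝒢.dparam_range_of_isPatch h hu]
  have h1 : Function.Injective (dparam (E := F) φ u).toLinearMap := h.injective_mfderiv u hu
  rw [LinearMap.finrank_range_of_inj h1]
  simp

theorem isPatch_θ {m : M} {l j : ℕ} (b : 𝒢.toLieGroupoid.Box m l j) :
    IsPatch (E := F) (𝒢.orbit m) (fun y => Set.range (𝒢.sharp y)) l b.A b.θ where
  isOpen := b.isOpen_A
  contMDiffOn := b.contMDiffOn_θ
  injOn := b.injOn_θ
  mem _ hu := b.θ_mem_orbit hu
  injective_mfderiv _ hu := b.injective_dθ hu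
  range_mfderiv u hu := by
    rw [𝒢.range_sharp, ← b.range_dθ u hu]
    rfl

variable [MeasurableSpace M]

/-- The Liouville measure of the image of a parametrisation of a piece of a leaf. -/
noncomputable def patchMeasure {k : ℕ} (U : Set (Fin k → ℝ)) (φ : (Fin k → ℝ) → M) : Measure M :=
  ((volume.withDensity fun u => ENNReal.ofReal (𝒢.leafDensity φ u)).restrict U).map φ

variable [BorelSpace M]

theorem patchMeasure_apply {k : ℕ} {U : Set (Fin k → ℝ)} {φ : (Fin k → ℝ) → M} (hU : IsOpen U)
    (hφ : ContinuousOn φ U) {C : Set M} (hC : MeasurableSet C) :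
    𝒢.patchMeasure U φ C = ∫⁻ u in U ∩ φ ⁻¹' C, ENNReal.ofReal (𝒢.leafDensity φ u) := by
  rw [patchMeasure, restrict_map_apply_of_continuousOn _ hU.measurableSet hφ hC,
    withDensity_apply _ (measurableSet_inter_preimage_of_continuousOn hφ hU.measurableSet hC)]

variable [T2Space M] [SecondCountableTopology M]

theorem patchMeasure_image {S : Set M} {k : ℕ} {U : Set (Fin k → ℝ)} {φ : (Fin k → ℝ) → M}
    {D : (y : M) → Set (TangentSpace 𝓘(ℝ, F) y)} (h : IsPatch (E := F) S D k U φ)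
    {A : Set (Fin k → ℝ)} (hAU : A ⊆ U) (hA : MeasurableSet A) :
    𝒢.patchMeasure U φ (φ '' A) = ∫⁻ u in A, ENNReal.ofReal (𝒢.leafDensity φ u) := by
  rw [𝒢.patchMeasure_apply h.isOpen h.contMDiffOn.continuousOn (measurableSet_image_of_injOn (E := F)
    h.contMDiffOn.continuousOn h.injOn hA hAU)]
  congr 2
  ext u
  constructor
  · rintro ⟨hu, v, hv, hvu⟩
    rwa [← h.injOn (hAU hv) hu hvu]
  · exact fun hu => ⟨hAU hu, u, hu, rfl⟩

/-- Different parametrisations define the same measure. -/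
theorem patchMeasure_eq {m : M} {k j : ℕ} {U : Set (Fin k → ℝ)} {φ : (Fin k → ℝ) → M}
    (h : IsPatch (E := F) (𝒢.orbit m) (fun y => Set.range (𝒢.sharp y)) k U φ)
    (b : 𝒢.toLieGroupoid.Box m k j) {C : Set M} (hC : MeasurableSet C) (hCφ : C ⊆ φ '' U)
    (hCθ : C ⊆ b.θ '' b.A) : 𝒢.patchMeasure U φ C = 𝒢.patchMeasure b.A b.θ C := by
  rw [𝒢.patchMeasure_apply h.isOpen h.contMDiffOn.continuousOn hC,
    𝒢.patchMeasure_apply b.isOpen_A b.contMDiffOn_θ.continuousOn hC]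
  set B := U ∩ φ ⁻¹' C with hB
  have hBm : MeasurableSet B := measurableSet_inter_preimage_of_continuousOn
    h.contMDiffOn.continuousOn h.isOpen.measurableSet hC
  have hθρ : ∀ u ∈ B, b.θ (b.ρ (φ u)) = φ u ∧ b.ρ (φ u) ∈ b.A := by
    intro u hu
    obtain ⟨a, ha, hau⟩ := hCθ hu.2
    rw [← hau, b.ρ_θ a ha]
    exact ⟨rfl, ha⟩
  have himg : b.A ∩ b.θ ⁻¹' C = (b.ρ ∘ φ) '' B := by
    ext a
    constructor
    · rintro ⟨ha, haC⟩
      obtain ⟨u, hu, hua⟩ := hCφ haC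
      refine ⟨u, ⟨hu, by rw [Set.mem_preimage, hua]; exact haC⟩, ?_⟩
      rw [Function.comp_apply, hua, b.ρ_θ a ha]
    · rintro ⟨u, hu, rfl⟩
      exact ⟨(hθρ u hu).2, by
        rw [Set.mem_preimage, Function.comp_apply, (hθρ u hu).1]; exact hu.2⟩
  have hcomp : ∀ u ∈ B, _ := fun u hu => b.dparam_eq_comp
    ((h.contMDiffOn.contMDiffAt (h.isOpen.mem_nhds hu.1)).mdifferentiableAt (by simp))
    (𝒢.dparam_range_of_isPatch h hu.1).le (hCθ hu.2)
  rw [himg, lintegral_image_eq_lintegral_abs_det_fderiv_mul volume hBm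
    (fun u hu => (hcomp u hu).1.hasFDerivAt.hasFDerivWithinAt) ?_]
  · refine setLIntegral_congr_fun hBm fun u hu => ?_
    rw [← ENNReal.ofReal_mul (abs_nonneg _)]
    congr 1
    exact 𝒢.leafDensity_comp (hθρ u hu).1.symm (b.range_dθ _ (hθρ u hu).2).le _ (hcomp u hu).2
  · intro u hu v hv huv
    apply h.injOn hu.1 hv.1
    rw [← (hθρ u hu).1, ← (hθρ v hv).1]
    exact congrArg b.θ huv

/-- The Liouville measures of all the leaves in an orbit, as one measure. -/
structure IsOrbitMeasure (ν : Measure M) (m : M) : Prop where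
  support : ν (𝒢.orbit m)ᶜ = 0
  density : ∀ (k : ℕ) (U : Set (Fin k → ℝ)) (φ : (Fin k → ℝ) → M),
    IsPatch (E := F) (𝒢.orbit m) (fun y => Set.range (𝒢.sharp y)) k U φ →
    ∀ A ⊆ U, MeasurableSet A → ν (φ '' A) = ∫⁻ u in A, ENNReal.ofReal (𝒢.leafDensity φ u)

theorem measurableSet_image_θ {m : M} {l j : ℕ} (b : 𝒢.toLieGroupoid.Box m l j) :
    MeasurableSet (b.θ '' b.A) :=
  measurableSet_image_of_injOn (E := F) b.contMDiffOn_θ.continuousOn b.injOn_θ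
    b.isOpen_A.measurableSet subset_rfl

/-- Countably many boxes cover the orbit, and their Liouville measures agree on overlaps by
independence of the parametrisation. Each box lies over one leaf, so the glued measure restricts to
the Liouville measure of every leaf. -/
theorem exists_orbitMeasure [SecondCountableTopology G] (m : M) :
    ∃ ν : Measure M, 𝒢.IsOrbitMeasure ν m := by
  obtain ⟨b, hb⟩ := 𝒢.exists_box_cover m
  have hS : ∀ i, MeasurableSet ((b i).θ '' (b i).A) := fun i => 𝒢.measurableSet_image_θ (b i)
  have hcov : 𝒢.orbit m ⊆ ⋃ i, (b i).θ '' (b i).A := fun y hy =>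
    Set.mem_iUnion.2 (𝒢.exists_mem_image_θ hb hy)
  obtain ⟨ν, hν0, hν⟩ := exists_measure_glue (fun i => (b i).θ '' (b i).A) hS
    (fun i => 𝒢.patchMeasure (b i).A (b i).θ)
    fun i i' C hC h1 h2 => 𝒢.patchMeasure_eq (𝒢.isPatch_θ (b i)) (b i') hC h1 h2
  refine ⟨ν, ?_, ?_⟩
  · refine measure_mono_null (Set.compl_subset_compl.2 (Set.iUnion_subset fun i => ?_)) hν0
    rintro _ ⟨a, ha, rfl⟩
    exact (b i).θ_mem_orbit ha
  · intro k U φ hφ A hAU hA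
    rcases U.eq_empty_or_nonempty with rfl | ⟨u, hu⟩
    · rw [Set.subset_empty_iff.1 hAU]; simp
    -- A nonempty patch has the dimension of the orbit, so it can be compared with the boxes.
    have hk : Module.finrank ℝ (𝒢.orbitSpace m) = k := by
      rw [← 𝒢.finrank_orbitSpace_of_isPatch hφ hu,
        𝒢.finrank_orbitSpace_of_mem_orbit (hφ.mem u hu)]
    subst hk
    rw [← 𝒢.patchMeasure_image hφ hAU hA]
    refine measure_eq_of_forall_subset_cover _ hS (measurableSet_image_of_injOn (E := F)
      hφ.contMDiffOn.continuousOn hφ.injOn hA hAU) ?_ fun i C hC h1 h2 => ?_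
    · rintro _ ⟨v, hv, rfl⟩
      exact hcov (hφ.mem v (hAU hv))
    · rw [hν i C hC h1]
      exact (𝒢.patchMeasure_eq hφ (b i) hC (h2.trans (Set.image_mono hAU)) h1).symm

theorem isOrbitMeasure_of_mem_orbit {ν : Measure M} {m x : M} (h : 𝒢.IsOrbitMeasure ν m)
    (hx : x ∈ 𝒢.orbit m) : 𝒢.IsOrbitMeasure ν x := by
  have hO := 𝒢.orbit_eq_of_mem hx
  refine ⟨?_, ?_⟩
  · rw [show 𝒢.orbit x = 𝒢.orbit m from hO]; exact h.support
  · rw [show 𝒢.orbit x = 𝒢.orbit m from hO]; exact h.density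

theorem IsOrbitMeasure.restrict_image_θ {ν : Measure M} {m : M} (h : 𝒢.IsOrbitMeasure ν m)
    {l j : ℕ} (b : 𝒢.toLieGroupoid.Box m l j) :
    ν.restrict (b.θ '' b.A) = 𝒢.patchMeasure b.A b.θ := by
  ext C hC
  rw [Measure.restrict_apply hC, 𝒢.patchMeasure_apply b.isOpen_A b.contMDiffOn_θ.continuousOn hC,
    ← h.density l b.A b.θ (𝒢.isPatch_θ b) _ Set.inter_subset_left
    (measurableSet_inter_preimage_of_continuousOn b.contMDiffOn_θ.continuousOn
      b.isOpen_A.measurableSet hC)]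
  congr 1
  rw [Set.image_inter_preimage, Set.inter_comm]

theorem leaf_subset_orbit (x : M) : 𝒢.leaf x ⊆ 𝒢.orbit x :=
  fun _ hy => 𝒢.exists_arrow_of_sameLeaf hy

theorem image_θ_subset_leaf {m : M} {l j : ℕ} (b : 𝒢.toLieGroupoid.Box m l j) {x y : M}
    (hy : y ∈ 𝒢.leaf x) (hyA : y ∈ b.θ '' b.A) : b.θ '' b.A ⊆ 𝒢.leaf x := by
  obtain ⟨a, ha, rfl⟩ := hyA
  rintro _ ⟨a', ha', rfl⟩
  exact Relation.EqvGen.trans _ _ _ hy (sameLeaf_θ b ha ha')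

theorem mem_leaf_self (x : M) : x ∈ 𝒢.leaf x := Relation.EqvGen.refl x

/-- A leaf is a countable union of pieces parametrised by boxes. -/
theorem exists_leaf_cover [SecondCountableTopology G] (x : M) :
    ∃ b : ℕ → 𝒢.toLieGroupoid.Box x (Module.finrank ℝ (𝒢.orbitSpace x))
      (Module.finrank ℝ E - Module.finrank ℝ F - Module.finrank ℝ (𝒢.orbitSpace x)),
      (∀ h, 𝒢.src h = x → ∃ i, h ∈ (b i).W) ∧
      𝒢.leaf x = ⋃ i : {i // (b i).θ '' (b i).A ⊆ 𝒢.leaf x}, (b i).θ '' (b i).A := by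
  obtain ⟨b, hb⟩ := 𝒢.exists_box_cover x
  refine ⟨b, hb, subset_antisymm (fun y hy => ?_) (Set.iUnion_subset fun i => i.2)⟩
  obtain ⟨i, hi⟩ := 𝒢.exists_mem_image_θ hb (𝒢.leaf_subset_orbit x hy)
  exact Set.mem_iUnion.2 ⟨⟨i, 𝒢.image_θ_subset_leaf _ hy hi⟩, hi⟩

theorem measurableSet_leaf [SecondCountableTopology G] (x : M) : MeasurableSet (𝒢.leaf x) := by
  obtain ⟨b, -, hb⟩ := 𝒢.exists_leaf_cover x
  rw [hb]
  exact MeasurableSet.iUnion fun i => 𝒢.measurableSet_image_θ _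

theorem isPatch_mono {S S' : Set M} {D : (y : M) → Set (TangentSpace 𝓘(ℝ, F) y)} {k : ℕ}
    {U : Set (Fin k → ℝ)} {φ : (Fin k → ℝ) → M} (h : IsPatch (E := F) S D k U φ)
    (hS : ∀ u ∈ U, φ u ∈ S') : IsPatch (E := F) S' D k U φ :=
  ⟨h.isOpen, h.contMDiffOn, h.injOn, hS, h.injective_mfderiv, h.range_mfderiv⟩

theorem leafDensity_two_mul (n : ℕ) (φ : (Fin (2 * n) → ℝ) → M) (u : Fin (2 * n) → ℝ) :
    𝒢.leafDensity φ u = n.factorial * Real.sqrt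
      (Matrix.det (Matrix.of fun i j : Fin (2 * n) => 𝒢.leafForm (φ u)
        (mfderiv 𝓘(ℝ, Fin (2 * n) → ℝ) 𝓘(ℝ, F) φ u (Pi.single i (1 : ℝ) : Fin (2 * n) → ℝ))
        (mfderiv 𝓘(ℝ, Fin (2 * n) → ℝ) 𝓘(ℝ, F) φ u (Pi.single j (1 : ℝ) : Fin (2 * n) → ℝ)))) := by
  rw [leafDensity, Nat.mul_div_cancel_left n two_pos]
  rfl

theorem IsOrbitMeasure.isLiouvilleMeasure [SecondCountableTopology G] {ν : Measure M} {m x : M}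
    (h : 𝒢.IsOrbitMeasure ν m) (hx : x ∈ 𝒢.orbit m) :
    𝒢.IsLiouvilleMeasure (ν.restrict (𝒢.leaf x)) x := by
  have hν := 𝒢.isOrbitMeasure_of_mem_orbit h hx
  refine ⟨?_, ?_⟩
  · rw [Measure.restrict_apply (𝒢.measurableSet_leaf x).compl]; simp
  · intro n U φ hφ A hAU hA
    have hAx : φ '' A ⊆ 𝒢.leaf x := by
      rintro _ ⟨u, hu, rfl⟩; exact hφ.mem u (hAU hu)
    rw [Measure.restrict_eq_self _ hAx, hν.density _ U φ
      (isPatch_mono hφ fun u hu => 𝒢.leaf_subset_orbit x (hφ.mem u hu)) A hAU hA]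
    simp only [leafDensity_two_mul]

/-- The Liouville measure of a leaf is unique. -/
theorem IsLiouvilleMeasure.unique [SecondCountableTopology G] {x : M} {ν ν' : Measure M}
    (h : 𝒢.IsLiouvilleMeasure ν x) (h' : 𝒢.IsLiouvilleMeasure ν' x) : ν = ν' := by
  -- `IsLiouvilleMeasure` tests only patches of dimension `2 * n`, so the boxes qualify as patches
  -- only once the leaf is known to be even-dimensional.
  have hev : Even (Module.finrank ℝ (𝒢.orbitSpace x)) := by
    obtain ⟨b, hb⟩ := 𝒢.exists_box_cover x
    obtain ⟨i, a, ha, -⟩ := 𝒢.exists_mem_image_θ hb (𝒢.mem_orbit_self x)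
    exact (𝒢.even_and_det_leafMatrix_pos ((b i).injective_dθ ha) ((b i).range_dθ a ha)).1
  obtain ⟨n, hn⟩ := even_iff_exists_two_mul.1 hev
  have hcov := 𝒢.exists_leaf_cover x
  rw [hn] at hcov
  obtain ⟨b, -, hb⟩ := hcov
  ext C hC
  have hm := 𝒢.measurableSet_leaf x
  have key : ν (C ∩ 𝒢.leaf x) = ν' (C ∩ 𝒢.leaf x) := by
    refine measure_eq_of_forall_subset_cover
      (fun i : {i // (b i).θ '' (b i).A ⊆ 𝒢.leaf x} => (b i).θ '' (b i).A)
      (fun i => 𝒢.measurableSet_image_θ _) (hC.inter hm)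
      (Set.inter_subset_right.trans hb.subset) fun i D hD h1 _ => ?_
    have hp : IsPatch (E := F) (𝒢.leaf x) (fun y => Set.range (𝒢.sharp y)) (2 * n) (b i).A
        (b i).θ := isPatch_mono (𝒢.isPatch_θ (b i)) fun u hu => i.2 ⟨u, hu, rfl⟩
    have hD' : D = (b i).θ '' ((b i).A ∩ (b i).θ ⁻¹' D) := by
      rw [Set.image_inter_preimage, Set.inter_eq_right.2 h1]
    have hDm := measurableSet_inter_preimage_of_continuousOn (b i).contMDiffOn_θ.continuousOn
      (b i).isOpen_A.measurableSet hD
    rw [hD', h.density n _ _ hp _ Set.inter_subset_left hDm,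
      h'.density n _ _ hp _ Set.inter_subset_left hDm]
  have h0 : ν (C \ 𝒢.leaf x) = 0 := measure_mono_null (fun y hy => hy.2) h.support
  have h0' : ν' (C \ 𝒢.leaf x) = 0 := measure_mono_null (fun y hy => hy.2) h'.support
  rw [← measure_inter_add_sdiff C hm, ← measure_inter_add_sdiff (μ := ν') C hm, key, h0, h0']

end SymplecticGroupoid

/-! ### Isotropy groups, conjugation and torsor measures -/

theorem inv_eq_self_of_isHaarMeasure {H : Type*} [Group H] [TopologicalSpace H]
    [IsTopologicalGroup H] [LocallyCompactSpace H] [SecondCountableTopology H] [MeasurableSpace H]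
    [BorelSpace H] (η : Measure H) [η.IsHaarMeasure] [η.IsMulRightInvariant] : η.inv = η := by
  have hfin : IsFiniteMeasureOnCompacts η.inv := by
    refine ⟨fun K hK => ?_⟩
    rw [Measure.inv_apply]
    exact hK.inv.measure_lt_top
  let c : ENNReal := Measure.haarScalarFactor η.inv η
  -- Inversion turns right invariance of η into left invariance of `η.inv`, so the two are
  -- proportional. Inverting twice gives c² = 1, whence c = 1.
  have hc : η.inv = c • η := Measure.isMulLeftInvariant_eq_smul η.inv η
  have h2 : η.inv.inv = (c * c) • η := by
    rw [hc, Measure.inv_def, Measure.map_smul, ← Measure.inv_def, hc, smul_smul]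
  rw [Measure.inv_inv] at h2
  obtain ⟨K, hK, hKn⟩ : ∃ K : Set H, IsCompact K ∧ (interior K).Nonempty := by
    obtain ⟨K, hK, h1⟩ := exists_compact_mem_nhds (1 : H)
    exact ⟨K, hK, 1, mem_interior_iff_mem_nhds.2 h1⟩
  have hK0 : η K ≠ 0 := (Measure.measure_pos_of_nonempty_interior _ hKn).ne'
  have h3 : c * c = 1 := by
    have h4 := congrArg (fun μ : Measure H => μ K) h2
    simp only [Measure.smul_apply, smul_eq_mul] at h4
    rw [← ENNReal.mul_left_inj hK0 hK.measure_lt_top.ne, ← h4, one_mul]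
  have h4 : c = 1 := by
    rw [← sq] at h3
    exact (ENNReal.pow_right_strictMono two_ne_zero).injective (by simpa using h3)
  rw [hc, h4, one_smul]

namespace LieGroupoid

variable {E F G M : Type*} [NormedAddCommGroup E] [NormedSpace ℝ E]
  [NormedAddCommGroup F] [NormedSpace ℝ F] [TopologicalSpace G] [ChartedSpace E G]
  [TopologicalSpace M] [ChartedSpace F M] (𝒢 : LieGroupoid E F G M)

section Isotropy

variable (x : M)

theorem Isotropy.continuous_val : Continuous (Subtype.val : 𝒢.Isotropy x → G) :=
  continuous_subtype_val

instance : IsTopologicalGroup (𝒢.Isotropy x) where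
  continuous_mul := by
    refine Continuous.subtype_mk (f := fun p : 𝒢.Isotropy x × 𝒢.Isotropy x => 𝒢.mul p.1.1 p.2.1)
      ?_ _
    exact 𝒢.contMDiffOn_mul.continuousOn.comp_continuous
      (f := fun p : 𝒢.Isotropy x × 𝒢.Isotropy x => (p.1.1, p.2.1))
      (((Isotropy.continuous_val 𝒢 x).comp continuous_fst).prodMk
        ((Isotropy.continuous_val 𝒢 x).comp continuous_snd))
      fun p => p.1.2.1.trans p.2.2.2.symm
  continuous_inv := by
    refine Continuous.subtype_mk (f := fun p : 𝒢.Isotropy x => 𝒢.inv p.1) ?_ _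
    exact 𝒢.contMDiff_inv.continuous.comp (Isotropy.continuous_val 𝒢 x)

instance [SecondCountableTopology G] : SecondCountableTopology (𝒢.Isotropy x) :=
  TopologicalSpace.Subtype.secondCountableTopology {g : G | 𝒢.src g = x ∧ 𝒢.tgt g = x}

theorem isClosed_isotropy [T1Space M] (x y : M) : IsClosed {g | 𝒢.src g = x ∧ 𝒢.tgt g = y} :=
  (isClosed_singleton.preimage 𝒢.contMDiff_src.continuous).inter
    (isClosed_singleton.preimage 𝒢.contMDiff_tgt.continuous)

instance [FiniteDimensional ℝ E] [T1Space M] : LocallyCompactSpace (𝒢.Isotropy x) := by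
  have : LocallyCompactSpace G := Manifold.locallyCompact_of_finiteDimensional 𝓘(ℝ, E)
  exact (𝒢.isClosed_isotropy x x).isClosedEmbedding_subtypeVal.locallyCompactSpace

end Isotropy

/-- The isomorphism of isotropy groups defined by conjugation with an arrow from `x` to `y`. -/
def conjEquiv {x y : M} (g : G) (hs : 𝒢.src g = x) (ht : 𝒢.tgt g = y) :
    𝒢.Isotropy x ≃ₜ* 𝒢.Isotropy y where
  toFun k := ⟨𝒢.mul (𝒢.mul g k.1) (𝒢.inv g), by
    subst hs ht; exact (𝒢.conj g k).2⟩
  invFun k := ⟨𝒢.mul (𝒢.mul (𝒢.inv g) k.1) g, by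
    have h₁ : 𝒢.src (𝒢.inv g) = 𝒢.tgt k.1 := by rw [𝒢.src_inv, ht, k.2.2]
    have h₂ : 𝒢.src (𝒢.mul (𝒢.inv g) k.1) = 𝒢.tgt g := by rw [𝒢.src_mul _ _ h₁, ht, k.2.1]
    exact ⟨by rw [𝒢.src_mul _ _ h₂, hs], by rw [𝒢.tgt_mul _ _ h₂, 𝒢.tgt_mul _ _ h₁, 𝒢.tgt_inv, hs]⟩⟩
  left_inv k := Subtype.ext (by
    have h₁ : 𝒢.src g = 𝒢.tgt k.1 := by rw [hs, k.2.2]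
    have h₂ : 𝒢.src k.1 = 𝒢.tgt (𝒢.inv g) := by rw [𝒢.tgt_inv, hs, k.2.1]
    have h₃ : 𝒢.src g = 𝒢.tgt (𝒢.mul k.1 (𝒢.inv g)) := by rw [𝒢.tgt_mul _ _ h₂, h₁]
    change 𝒢.mul (𝒢.mul (𝒢.inv g) (𝒢.mul (𝒢.mul g k.1) (𝒢.inv g))) g = k.1
    rw [𝒢.mul_assoc g k.1 _ h₁ h₂, 𝒢.inv_mul_mul _ _ h₃, 𝒢.mul_inv_mul _ _ (by rw [hs, k.2.1])])
  right_inv k := Subtype.ext (by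
    have h₁ : 𝒢.tgt g = 𝒢.tgt k.1 := by rw [ht, k.2.2]
    have h₂ : 𝒢.src k.1 = 𝒢.tgt g := by rw [ht, k.2.1]
    have h₃ : 𝒢.src (𝒢.inv g) = 𝒢.tgt k.1 := by rw [𝒢.src_inv, h₁]
    have h₄ : 𝒢.src g = 𝒢.tgt (𝒢.mul (𝒢.inv g) k.1) := by rw [𝒢.tgt_mul _ _ h₃, 𝒢.tgt_inv]
    have h₅ : 𝒢.src (𝒢.mul (𝒢.inv g) k.1) = 𝒢.tgt g := by rw [𝒢.src_mul _ _ h₃, h₂]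
    change 𝒢.mul (𝒢.mul g (𝒢.mul (𝒢.mul (𝒢.inv g) k.1) g)) (𝒢.inv g) = k.1
    rw [← 𝒢.mul_assoc g _ g h₄ h₅, 𝒢.mul_mul_inv' _ _ h₁, 𝒢.mul_mul_inv _ _ h₂])
  map_mul' k k' := Subtype.ext (by
    have h₁ : 𝒢.src g = 𝒢.tgt k.1 := by rw [hs, k.2.2]
    have h₁' : 𝒢.src g = 𝒢.tgt k'.1 := by rw [hs, k'.2.2]
    have h₂ : 𝒢.src k.1 = 𝒢.tgt k'.1 := by rw [k.2.1, k'.2.2]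
    have h₃ : 𝒢.src k'.1 = 𝒢.tgt (𝒢.inv g) := by rw [𝒢.tgt_inv, hs, k'.2.1]
    have h₃' : 𝒢.src k.1 = 𝒢.tgt (𝒢.inv g) := by rw [𝒢.tgt_inv, hs, k.2.1]
    have h₄ : 𝒢.src (𝒢.mul g k.1) = 𝒢.tgt (𝒢.inv g) := by rw [𝒢.src_mul _ _ h₁, h₃']
    have h₅ : 𝒢.src (𝒢.inv g) = 𝒢.tgt (𝒢.mul g k'.1) := by rw [𝒢.tgt_mul _ _ h₁', 𝒢.src_inv]
    have h₆ : 𝒢.src (𝒢.mul g k'.1) = 𝒢.tgt (𝒢.inv g) := by rw [𝒢.src_mul _ _ h₁', h₃]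
    change 𝒢.mul (𝒢.mul g (𝒢.mul k.1 k'.1)) (𝒢.inv g) = 𝒢.mul (𝒢.mul (𝒢.mul g k.1) (𝒢.inv g))
      (𝒢.mul (𝒢.mul g k'.1) (𝒢.inv g))
    rw [𝒢.mul_assoc _ _ _ h₄ (by rw [𝒢.tgt_mul _ _ h₆, h₅]), ← 𝒢.mul_assoc (𝒢.inv g) _ _ h₅ h₆,
      𝒢.inv_mul_mul _ _ h₁', 𝒢.mul_assoc g _ _ (by rw [𝒢.tgt_mul _ _ h₂, h₁])
      (by rw [𝒢.src_mul _ _ h₂, h₃]), 𝒢.mul_assoc _ _ _ h₂ h₃,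
      𝒢.mul_assoc g _ _ h₁ (by rw [𝒢.tgt_mul _ _ h₃, h₂])])
  continuous_toFun := by
    have h := Isotropy.continuous_val 𝒢 x
    refine Continuous.subtype_mk (f := fun k : 𝒢.Isotropy x => 𝒢.mul (𝒢.mul g k.1) (𝒢.inv g)) ?_ _
    have h1 : Continuous fun k : 𝒢.Isotropy x => 𝒢.mul g k.1 :=
      𝒢.contMDiffOn_mul.continuousOn.comp_continuous (f := fun k : 𝒢.Isotropy x => (g, k.1))
        (continuous_const.prodMk h) fun k => hs.trans k.2.2.symm
    refine 𝒢.contMDiffOn_mul.continuousOn.comp_continuous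
      (f := fun k : 𝒢.Isotropy x => (𝒢.mul g k.1, 𝒢.inv g)) (h1.prodMk continuous_const) fun k => ?_
    change 𝒢.src (𝒢.mul g k.1) = 𝒢.tgt (𝒢.inv g)
    rw [𝒢.src_mul _ _ (hs.trans k.2.2.symm), 𝒢.tgt_inv, hs, k.2.1]
  continuous_invFun := by
    have h := Isotropy.continuous_val 𝒢 y
    refine Continuous.subtype_mk (f := fun k : 𝒢.Isotropy y => 𝒢.mul (𝒢.mul (𝒢.inv g) k.1) g) ?_ _
    have h0 : ∀ k : 𝒢.Isotropy y, 𝒢.src (𝒢.inv g) = 𝒢.tgt k.1 := fun k => by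
      rw [𝒢.src_inv, ht, k.2.2]
    have h1 : Continuous fun k : 𝒢.Isotropy y => 𝒢.mul (𝒢.inv g) k.1 :=
      𝒢.contMDiffOn_mul.continuousOn.comp_continuous (f := fun k : 𝒢.Isotropy y => (𝒢.inv g, k.1))
        (continuous_const.prodMk h) h0
    refine 𝒢.contMDiffOn_mul.continuousOn.comp_continuous
      (f := fun k : 𝒢.Isotropy y => (𝒢.mul (𝒢.inv g) k.1, g)) (h1.prodMk continuous_const) fun k => ?_
    change 𝒢.src (𝒢.mul (𝒢.inv g) k.1) = 𝒢.tgt g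
    rw [𝒢.src_mul _ _ (h0 k), ht, k.2.1]

theorem conjEquiv_val {x y : M} (g : G) (hs : 𝒢.src g = x) (ht : 𝒢.tgt g = y) (k : 𝒢.Isotropy x) :
    (𝒢.conjEquiv g hs ht k).1 = 𝒢.mul (𝒢.mul g k.1) (𝒢.inv g) := rfl

/-- Conjugation with a composite arrow. -/
theorem conjEquiv_mul_apply {x y z : M} (g h : G) (hs : 𝒢.src h = x) (ht : 𝒢.tgt h = y)
    (gs : 𝒢.src g = y) (gt : 𝒢.tgt g = z) (hgs : 𝒢.src (𝒢.mul g h) = x)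
    (hgt : 𝒢.tgt (𝒢.mul g h) = z) (k : 𝒢.Isotropy x) :
    𝒢.conjEquiv (𝒢.mul g h) hgs hgt k = 𝒢.conjEquiv g gs gt (𝒢.conjEquiv h hs ht k) := by
  apply Subtype.ext
  have h₁ : 𝒢.src g = 𝒢.tgt h := gs.trans ht.symm
  have h₂ : 𝒢.src h = 𝒢.tgt k.1 := hs.trans k.2.2.symm
  have h₃ : 𝒢.src k.1 = 𝒢.tgt (𝒢.inv h) := by rw [𝒢.tgt_inv, hs, k.2.1]
  have h₄ : 𝒢.src (𝒢.inv h) = 𝒢.tgt (𝒢.inv g) := by rw [𝒢.tgt_inv, 𝒢.src_inv, h₁]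
  have h₅ : 𝒢.src (𝒢.mul h k.1) = 𝒢.tgt (𝒢.inv h) := by rw [𝒢.src_mul _ _ h₂, h₃]
  have h₆ : 𝒢.src g = 𝒢.tgt (𝒢.mul h k.1) := by rw [𝒢.tgt_mul _ _ h₂, h₁]
  simp only [conjEquiv_val]
  rw [𝒢.inv_mul_rev _ _ h₁, 𝒢.mul_assoc g h _ h₁ h₂, ← 𝒢.mul_assoc _ (𝒢.inv h) _
    (by rw [𝒢.src_mul _ _ h₆, h₅]) h₄, 𝒢.mul_assoc g _ _ h₆ h₅]

theorem conjEquiv_isotropy {x : M} (a k : 𝒢.Isotropy x) :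
    𝒢.conjEquiv a.1 a.2.1 a.2.2 k = a * k * a⁻¹ := rfl

theorem conjEquiv_symm {x y : M} (g : G) (hs : 𝒢.src g = x) (ht : 𝒢.tgt g = y)
    (k : 𝒢.Isotropy y) : (𝒢.conjEquiv g hs ht).symm k =
      𝒢.conjEquiv (𝒢.inv g) ((𝒢.src_inv g).trans ht) ((𝒢.tgt_inv g).trans hs) k := by
  apply Subtype.ext
  rw [conjEquiv_val, 𝒢.inv_inv]
  rfl

section Torsor

variable [MeasurableSpace G] [BorelSpace G] [SecondCountableTopology G]

theorem measurable_conjEquiv {x y : M} (g : G) (hs : 𝒢.src g = x) (ht : 𝒢.tgt g = y) :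
    Measurable (𝒢.conjEquiv g hs ht) := (𝒢.conjEquiv g hs ht).continuous_toFun.measurable

theorem measurable_conjEquiv_symm {x y : M} (g : G) (hs : 𝒢.src g = x) (ht : 𝒢.tgt g = y) :
    Measurable (𝒢.conjEquiv g hs ht).symm := (𝒢.conjEquiv g hs ht).continuous_invFun.measurable

theorem continuous_mul_left {x : M} (g : G) (hg : 𝒢.src g = x) :
    Continuous fun k : 𝒢.Isotropy x => 𝒢.mul g k.1 :=
  𝒢.contMDiffOn_mul.continuousOn.comp_continuous (f := fun k : 𝒢.Isotropy x => (g, k.1))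
    (continuous_const.prodMk (Isotropy.continuous_val 𝒢 x)) fun k => hg.trans k.2.2.symm

theorem continuous_mul_right {x : M} (g : G) (hg : 𝒢.tgt g = x) :
    Continuous fun k : 𝒢.Isotropy x => 𝒢.mul k.1 g :=
  𝒢.contMDiffOn_mul.continuousOn.comp_continuous (f := fun k : 𝒢.Isotropy x => (k.1, g))
    ((Isotropy.continuous_val 𝒢 x).prodMk continuous_const) fun k => k.2.1.trans hg.symm

/-- The measure on the fibres of `t : s⁻¹(m) → M` does not depend on the arrow used to define it. -/
theorem rightTorsorMeasure_eq_map {η : (x : M) → Measure (𝒢.Isotropy x)} {m y : M} (g : G)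
    (hs : 𝒢.src g = m) (ht : 𝒢.tgt g = y) [(η y).IsMulRightInvariant] :
    𝒢.rightTorsorMeasure η m y = (η y).map fun k => 𝒢.mul k.1 g := by
  have H : ∃ h, 𝒢.src h = m ∧ 𝒢.tgt h = y := ⟨g, hs, ht⟩
  rw [rightTorsorMeasure, dif_pos H]
  obtain ⟨h1, h2⟩ := H.choose_spec
  set h := H.choose
  have hgh : 𝒢.src h = 𝒢.tgt (𝒢.inv g) := by rw [𝒢.tgt_inv, h1, hs]
  -- The two arrows differ by κ = hg⁻¹ in the isotropy group at `y`; then kh = (kκ)g, and right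
  -- translation by κ preserves η_y.
  let κ : 𝒢.Isotropy y := ⟨𝒢.mul h (𝒢.inv g), by rw [𝒢.src_mul _ _ hgh, 𝒢.src_inv, ht],
    by rw [𝒢.tgt_mul _ _ hgh, h2]⟩
  have hκ : (fun k : 𝒢.Isotropy y => 𝒢.mul k.1 h) =
      (fun k : 𝒢.Isotropy y => 𝒢.mul k.1 g) ∘ (fun k => k * κ) := by
    funext k
    change _ = 𝒢.mul (𝒢.mul k.1 (𝒢.mul h (𝒢.inv g))) g
    rw [𝒢.mul_assoc _ _ _ (k.2.1.trans κ.2.2.symm) (κ.2.1.trans ht.symm),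
      𝒢.mul_inv_mul _ _ (h1.trans hs.symm)]
  rw [hκ, ← Measure.map_map (𝒢.continuous_mul_right g ht).measurable (measurable_mul_const κ),
    map_mul_right_eq_self]

theorem rightTorsorMeasure_of_notMem {η : (x : M) → Measure (𝒢.Isotropy x)} {m y : M}
    (h : y ∉ 𝒢.orbit m) : 𝒢.rightTorsorMeasure η m y = 0 := dif_neg h

end Torsor

end LieGroupoid

/-! ### Haar measures that are compatible along the leaves -/

namespace SymplecticGroupoid

variable {E F G M : Type*} [NormedAddCommGroup E] [NormedSpace ℝ E] [FiniteDimensional ℝ E]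
  [NormedAddCommGroup F] [NormedSpace ℝ F]
  [TopologicalSpace G] [ChartedSpace E G] [SecondCountableTopology G]
  [TopologicalSpace M] [ChartedSpace F M] (𝒢 : SymplecticGroupoid E F G M)
  [MeasurableSpace G] [BorelSpace G]

variable {𝒢} {η : (x : M) → Measure (𝒢.Isotropy x)}

theorem IsIsotropyHaar.map_conjEquiv (h : 𝒢.IsIsotropyHaar η) {x y : M} (hxy : 𝒢.SameLeaf x y)
    (g : G) (hs : 𝒢.src g = x) (ht : 𝒢.tgt g = y) :
    (η x).map (𝒢.conjEquiv g hs ht) = η y := by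
  subst hs ht
  exact h.map_conj g hxy

/-- For `y` in a leaf, the measures on the fibres `s⁻¹(m) ∩ t⁻¹(y)` are images of one and the same
Haar measure on the isotropy group at `m`. -/
theorem IsIsotropyHaar.exists_haar [T1Space M] (h : 𝒢.IsIsotropyHaar η) {m x : M}
    (hx : x ∈ 𝒢.orbit m) :
    ∃ η' : Measure (𝒢.Isotropy m), η'.IsHaarMeasure ∧ ∀ g, 𝒢.src g = m → 𝒢.tgt g ∈ 𝒢.leaf x →
      𝒢.rightTorsorMeasure η m (𝒢.tgt g) = η'.map fun k => 𝒢.mul g k.1 := by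
  obtain ⟨g₀, hs₀, ht₀⟩ := hx
  have := h.haar
  have := h.right_invariant
  -- The measure η' is η_x brought to `m` by g₀. For g ending in the leaf of `x`, the measure at
  -- t(g) is the conjugate of η_x by gg₀⁻¹, hence of η' by g; and (gκg⁻¹)g = gκ turns right
  -- multiplication by g into left multiplication.
  refine ⟨(η x).map (𝒢.conjEquiv g₀ hs₀ ht₀).symm, inferInstance, fun g hs hg => ?_⟩
  have hc : 𝒢.src g = 𝒢.tgt (𝒢.inv g₀) := by rw [𝒢.tgt_inv, hs, hs₀]
  have h1 := h.map_conjEquiv hg (𝒢.mul g (𝒢.inv g₀)) (by rw [𝒢.src_mul _ _ hc, 𝒢.src_inv, ht₀])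
    (𝒢.tgt_mul _ _ hc)
  rw [𝒢.rightTorsorMeasure_eq_map g hs rfl, ← h1, Measure.map_map
    (𝒢.continuous_mul_right g rfl).measurable (𝒢.measurable_conjEquiv _ _ _),
    Measure.map_map (𝒢.continuous_mul_left g hs).measurable
    (𝒢.measurable_conjEquiv_symm g₀ hs₀ ht₀)]
  congr 1
  funext k
  have hsk := ((𝒢.conjEquiv g₀ hs₀ ht₀).symm k).2
  change 𝒢.mul (𝒢.conjEquiv _ _ _ k).1 g = 𝒢.mul g ((𝒢.conjEquiv g₀ hs₀ ht₀).symm k).1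
  rw [𝒢.conjEquiv_mul_apply g (𝒢.inv g₀) ((𝒢.src_inv _).trans ht₀) ((𝒢.tgt_inv _).trans hs₀) hs rfl,
    ← 𝒢.conjEquiv_symm g₀ hs₀ ht₀, LieGroupoid.conjEquiv_val, 𝒢.mul_inv_mul]
  rw [𝒢.src_mul _ _ (hs.trans hsk.2.symm), hsk.1, hs]

/-- Bi-invariant Haar measures can be chosen compatibly along the leaves. -/
theorem exists_isIsotropyHaar [T1Space M]
    (harrow : ∀ {x y : M}, 𝒢.SameLeaf x y → ∃ g, 𝒢.src g = x ∧ 𝒢.tgt g = y)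
    (hG : 𝒢.toLieGroupoid.IsotropyUnimodular) :
    ∃ η : (x : M) → Measure (𝒢.Isotropy x), 𝒢.IsIsotropyHaar η := by
  let S : Setoid M := ⟨𝒢.SameLeaf, Relation.EqvGen.refl, Relation.EqvGen.symm _ _,
    Relation.EqvGen.trans _ _ _⟩
  -- `p x` is a chosen point of the leaf of `x`; the arrows `a x` from it to `x` carry one Haar
  -- measure to the whole leaf.
  let p : M → M := fun x => (Quotient.mk S x).out
  have hp : ∀ x, 𝒢.SameLeaf (p x) x := fun x => Quotient.exact (Quotient.out_eq (Quotient.mk S x))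
  have hpp : ∀ x y, 𝒢.SameLeaf x y → p x = p y := fun x y h =>
    congrArg Quotient.out (Quotient.sound (s := S) h)
  choose a has hat using fun x => harrow (hp x)
  let η : (x : M) → Measure (𝒢.Isotropy x) := fun x =>
    (Measure.haar : Measure (𝒢.Isotropy (p x))).map (𝒢.conjEquiv (a x) (has x) (hat x))
  have hη : ∀ x, (η x).IsHaarMeasure := fun x => inferInstance
  refine ⟨η, hη, fun x => hG x _ (hη x), fun g hg => ?_⟩
  obtain ⟨y, hy⟩ : ∃ y, 𝒢.tgt g = y := ⟨_, rfl⟩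
  obtain ⟨x, hx⟩ : ∃ x, 𝒢.src g = x := ⟨_, rfl⟩
  suffices H : (η x).map (𝒢.conjEquiv g hx hy) = η y by
    subst hx hy; exact H
  rw [hx, hy] at hg
  -- transport to the representative of the leaf
  have key : ∀ z (hz : p y = z) (b : G) (hbs : 𝒢.src b = z) (hbt : 𝒢.tgt b = y),
      η y = (Measure.haar : Measure (𝒢.Isotropy z)).map (𝒢.conjEquiv b hbs hbt) := by
    rintro _ rfl b hbs hbt
    have hinv := hG (p y) Measure.haar inferInstance
    have hc : 𝒢.src (𝒢.inv (a y)) = 𝒢.tgt b := by rw [𝒢.src_inv, hat, hbt]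
    -- Two arrows from `p y` to `y` differ by an isotropy element κ. Conjugation by κ is a left
    -- followed by a right translation, and both preserve Haar measure by unimodularity.
    let κ : 𝒢.Isotropy (p y) := ⟨𝒢.mul (𝒢.inv (a y)) b, by rw [𝒢.src_mul _ _ hc, hbs],
      by rw [𝒢.tgt_mul _ _ hc, 𝒢.tgt_inv, has]⟩
    have hκ : (𝒢.conjEquiv b hbs hbt : 𝒢.Isotropy (p y) → 𝒢.Isotropy y) =
        (𝒢.conjEquiv (a y) (has y) (hat y)) ∘ (fun k => k * κ⁻¹) ∘ (fun k => κ * k) := by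
      funext k
      have e1 : (𝒢.conjEquiv κ.1 κ.2.1 κ.2.2 k) = κ * k * κ⁻¹ := 𝒢.conjEquiv_isotropy κ k
      change _ = 𝒢.conjEquiv (a y) (has y) (hat y) (κ * k * κ⁻¹)
      have hb : 𝒢.mul (a y) κ.1 = b := 𝒢.mul_mul_inv' _ _ ((hat y).trans hbt.symm)
      have hac : 𝒢.src (a y) = 𝒢.tgt κ.1 := (has y).trans κ.2.2.symm
      rw [← e1, ← 𝒢.conjEquiv_mul_apply (a y) κ.1 κ.2.1 κ.2.2 (has y) (hat y)
        (by rw [𝒢.src_mul _ _ hac, κ.2.1]) (by rw [𝒢.tgt_mul _ _ hac, hat])]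
      apply Subtype.ext
      simp only [LieGroupoid.conjEquiv_val, hb]
    rw [hκ, ← Measure.map_map (𝒢.measurable_conjEquiv _ _ _)
      ((measurable_mul_const _).comp (measurable_const_mul _)),
      ← Measure.map_map (measurable_mul_const _) (measurable_const_mul _),
      map_mul_left_eq_self, map_mul_right_eq_self]
  have hc : 𝒢.src g = 𝒢.tgt (a x) := by rw [hx, hat]
  rw [key (p x) (hpp y x (Relation.EqvGen.symm _ _ hg)) (𝒢.mul g (a x))
    (by rw [𝒢.src_mul _ _ hc, has]) (by rw [𝒢.tgt_mul _ _ hc, hy])]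
  rw [Measure.map_map (𝒢.measurable_conjEquiv _ _ _)
    (𝒢.measurable_conjEquiv _ _ _)]
  congr 1
  funext k
  exact (𝒢.conjEquiv_mul_apply g (a x) (has x) (hat x) hx hy _ _ k).symm

end SymplecticGroupoid

/-! ### Charts of isotropy groups and densities on the fibres of t -/

theorem contDiff_det {j : ℕ} :
    ContDiff ℝ ∞ fun L : (Fin j → ℝ) →L[ℝ] (Fin j → ℝ) => L.det := by
  have h1 : ∀ L : (Fin j → ℝ) →L[ℝ] (Fin j → ℝ), L.det =
      (Matrix.of fun i k => L (Pi.single k 1) i).det := by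
    intro L
    change LinearMap.det L.toLinearMap = _
    rw [← LinearMap.det_toMatrix']
    congr 1
  simp only [h1, Matrix.det_apply, Matrix.of_apply]
  refine ContDiff.sum fun σ _ => ContDiff.const_smul _ (contDiff_prod fun i _ => ?_)
  exact contDiff_pi.1 (contDiff_id.clm_apply contDiff_const) _

namespace LieGroupoid

variable {E F G M : Type*} [NormedAddCommGroup E] [NormedSpace ℝ E]
  [NormedAddCommGroup F] [NormedSpace ℝ F] [TopologicalSpace G] [ChartedSpace E G]
  [TopologicalSpace M] [ChartedSpace F M] (𝒢 : LieGroupoid E F G M)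

/-- A smooth chart of the isotropy group at `m` around the unit. -/
structure IsotropyChart (m : M) (j : ℕ) where
  B : Set (Fin j → ℝ)
  κ : (Fin j → ℝ) → 𝒢.Isotropy m
  W : Set G
  r : G → (Fin j → ℝ)
  isOpen_B : IsOpen B
  isOpen_W : IsOpen W
  unit_mem : 𝒢.unit m ∈ W
  contMDiffOn_κ : ContMDiffOn 𝓘(ℝ, Fin j → ℝ) 𝓘(ℝ, E) ∞ (fun c => (κ c).1) B
  contMDiffOn_r : ContMDiffOn 𝓘(ℝ, E) 𝓘(ℝ, Fin j → ℝ) ∞ r W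
  κ_mem : ∀ c ∈ B, (κ c).1 ∈ W
  r_κ : ∀ c ∈ B, r (κ c).1 = c
  r_mem : ∀ k : 𝒢.Isotropy m, k.1 ∈ W → r k.1 ∈ B
  κ_r : ∀ k : 𝒢.Isotropy m, k.1 ∈ W → κ (r k.1) = k

theorem exists_box_of_src [FiniteDimensional ℝ E] [FiniteDimensional ℝ F]
    [IsManifold 𝓘(ℝ, F) ∞ M] {m : M} (h : G) (hh : 𝒢.src h = m) :
    ∃ b : 𝒢.Box m (Module.finrank ℝ (𝒢.orbitSpace m))
      (Module.finrank ℝ E - Module.finrank ℝ F - Module.finrank ℝ (𝒢.orbitSpace m)),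
      h ∈ b.W := by
  subst hh
  exact 𝒢.exists_box h

-- On the slice a = a₀ of a box through the unit, t is constant with value θ(a₀) = m, so the slice
-- lies in the isotropy group. Off `b.B` the chart takes the default value 1.
variable {𝒢} in
open Classical in
theorem Box.nonempty_isotropyChart {m : M} {l j : ℕ} (b : 𝒢.Box m l j) (hb : 𝒢.unit m ∈ b.W) :
    Nonempty (𝒢.IsotropyChart m j) := by
  have hP := b.param.ret_mem _ hb (𝒢.src_unit m)
  have hΨ := b.param.param_ret _ hb (𝒢.src_unit m)
  set a₀ := (b.P (𝒢.unit m)).1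
  have hθ : b.θ a₀ = m := by
    rw [← b.tgt_Ψ _ hP.1 _ hP.2]
    change 𝒢.tgt (b.Ψ (b.P (𝒢.unit m))) = m
    rw [hΨ, 𝒢.tgt_unit]
  let κ : (Fin j → ℝ) → 𝒢.Isotropy m := fun c => if hc : c ∈ b.B then
    ⟨b.Ψ (a₀, c), b.src_Ψ hP.1 hc, (b.tgt_Ψ _ hP.1 c hc).trans hθ⟩ else 1
  have hκ : ∀ c ∈ b.B, (κ c).1 = b.Ψ (a₀, c) := fun c hc =>
    congrArg Subtype.val (dif_pos hc)
  have hmem : ∀ c ∈ b.B, (a₀, c) ∈ b.A ×ˢ b.B := fun c hc => ⟨hP.1, hc⟩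
  have hk : ∀ k : 𝒢.Isotropy m, k.1 ∈ b.W → (b.P k.1).2 ∈ b.B ∧ b.Ψ (a₀, (b.P k.1).2) = k.1 := by
    intro k hkW
    have h1 := b.param.ret_mem _ hkW k.2.1
    have h2 := b.param.param_ret _ hkW k.2.1
    refine ⟨h1.2, ?_⟩
    have h3 : (b.P k.1).1 = a₀ := by
      apply b.injOn_θ h1.1 hP.1
      rw [hθ, ← b.tgt_Ψ _ h1.1 _ h1.2]
      change 𝒢.tgt (b.Ψ (b.P k.1)) = m
      rw [h2, k.2.2]
    rw [← h3]
    exact h2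
  refine ⟨⟨b.B, κ, b.W, fun g => (b.P g).2, b.isOpen_B, b.param.isOpen_nhd, hb, ?_, ?_, ?_, ?_,
    fun k hkW => (hk k hkW).1, fun k hkW => Subtype.ext ?_⟩⟩
  · refine ContMDiffOn.congr (f := fun c => b.Ψ (a₀, c)) ?_ hκ
    exact b.param.contMDiffOn.comp (t := b.A ×ˢ b.B)
      (contDiff_const.prodMk contDiff_id).contMDiff.contMDiffOn hmem
  · intro g hg
    exact (contDiff_snd.contMDiff.contMDiffAt.comp_contMDiffWithinAt g
      (b.param.contMDiffOn_ret g hg))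
  · exact fun c hc => by rw [hκ c hc]; exact b.param.mem_nhd _ (hmem c hc)
  · exact fun c hc => by rw [hκ c hc, b.param.ret_param _ (hmem c hc)]
  · rw [hκ _ (hk k hkW).1, (hk k hkW).2]

namespace IsotropyChart

variable {𝒢} {m : M} {j : ℕ} (q : 𝒢.IsotropyChart m j)

/-- The density of Haar measure in the parametrisation `f` of a fibre of `t : s⁻¹(m) → M`. -/
noncomputable def jac (f : (Fin j → ℝ) → G) (c : Fin j → ℝ) : ℝ :=
  |(fderiv ℝ (fun c' => q.r (𝒢.mul (𝒢.inv (f c)) (f c'))) c).det|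

/-- `f` is a smooth map from the open set `U` to a fibre of `t : s⁻¹(m) → M`. -/
structure IsFibreMap (m y : M) (U : Set (Fin j → ℝ)) (f : (Fin j → ℝ) → G) : Prop where
  isOpen : IsOpen U
  contMDiffOn : ContMDiffOn 𝓘(ℝ, Fin j → ℝ) 𝓘(ℝ, E) ∞ f U
  src_eq : ∀ c ∈ U, 𝒢.src (f c) = m
  tgt_eq : ∀ c ∈ U, 𝒢.tgt (f c) = y

theorem isFibreMap_κ : IsFibreMap (𝒢 := 𝒢) m m q.B fun c => (q.κ c).1 :=
  ⟨q.isOpen_B, q.contMDiffOn_κ, fun c _ => (q.κ c).2.1, fun c _ => (q.κ c).2.2⟩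

/-- The difference of two points of a fibre of `t : s⁻¹(m) → M`. -/
def diff {y : M} {g h : G} (hg : 𝒢.src g = m ∧ 𝒢.tgt g = y) (hh : 𝒢.src h = m ∧ 𝒢.tgt h = y) :
    𝒢.Isotropy m :=
  ⟨𝒢.mul (𝒢.inv g) h, by rw [𝒢.src_mul _ _ (by rw [𝒢.src_inv, hg.2, hh.2]), hh.1],
    by rw [𝒢.tgt_mul _ _ (by rw [𝒢.src_inv, hg.2, hh.2]), 𝒢.tgt_inv, hg.1]⟩

theorem contMDiffOn_mul_const_left {f : (Fin j → ℝ) → G} {y : M} {U : Set (Fin j → ℝ)}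
    (hf : IsFibreMap (𝒢 := 𝒢) m y U f) {g : G} (hg : 𝒢.src g = y) :
    ContMDiffOn 𝓘(ℝ, Fin j → ℝ) 𝓘(ℝ, E) ∞ (fun c => 𝒢.mul g (f c)) U :=
  𝒢.contMDiffOn_mul_comp contMDiffOn_const hf.contMDiffOn fun c hc => hg.trans (hf.tgt_eq c hc).symm

theorem differentiableAt_r_mul {f : (Fin j → ℝ) → G} {y : M} {U : Set (Fin j → ℝ)}
    (hf : IsFibreMap (𝒢 := 𝒢) m y U f) {g : G} (hg : 𝒢.src g = y) {c : Fin j → ℝ} (hc : c ∈ U)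
    (hW : 𝒢.mul g (f c) ∈ q.W) : DifferentiableAt ℝ (fun c' => q.r (𝒢.mul g (f c'))) c := by
  have h1 := (contMDiffOn_mul_const_left hf hg).contMDiffAt (hf.isOpen.mem_nhds hc)
  have h2 := q.contMDiffOn_r.contMDiffAt (q.isOpen_W.mem_nhds hW)
  exact ((h2.comp c h1).contDiffAt).differentiableAt (by simp)

theorem eventually_mul_mem {f : (Fin j → ℝ) → G} {y : M} {U : Set (Fin j → ℝ)}
    (hf : IsFibreMap (𝒢 := 𝒢) m y U f) {g : G} (hg : 𝒢.src g = y) {c : Fin j → ℝ} (hc : c ∈ U)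
    (hW : 𝒢.mul g (f c) ∈ q.W) : ∀ᶠ c' in 𝓝 c, c' ∈ U ∧ 𝒢.mul g (f c') ∈ q.W := by
  have h1 := ((contMDiffOn_mul_const_left hf hg).contMDiffAt (hf.isOpen.mem_nhds hc)).continuousAt
  filter_upwards [hf.isOpen.mem_nhds hc, h1.preimage_mem_nhds (q.isOpen_W.mem_nhds hW)] with c' h2
    h3 using ⟨h2, h3⟩

theorem inv_mul_self_mem {g : G} (hg : 𝒢.src g = m) : 𝒢.mul (𝒢.inv g) g ∈ q.W := by
  rw [𝒢.inv_mul, hg]; exact q.unit_mem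

/-- Transformation of the density under left translations. -/
theorem jac_eq {f f₁ : (Fin j → ℝ) → G} {y y₁ : M} {U U₁ : Set (Fin j → ℝ)}
    (hf : IsFibreMap (𝒢 := 𝒢) m y U f) (hf₁ : IsFibreMap (𝒢 := 𝒢) m y₁ U₁ f₁) {g : G}
    (hgs : 𝒢.src g = y₁) {σ : (Fin j → ℝ) → (Fin j → ℝ)} {c : Fin j → ℝ}
    (hc : c ∈ U₁) (hσ : DifferentiableAt ℝ σ c)
    (h : ∀ᶠ c' in 𝓝 c, σ c' ∈ U ∧ f (σ c') = 𝒢.mul g (f₁ c')) :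
    q.jac f₁ c = q.jac f (σ c) * |(fderiv ℝ σ c).det| := by
  obtain ⟨hσU, hfc⟩ := h.self_of_nhds
  -- The translation cancels: (gf₁(c))⁻¹(gf₁(c')) = f₁(c)⁻¹f₁(c'). Hence only the chain rule for σ
  -- contributes.
  have h1 : (fun c' => q.r (𝒢.mul (𝒢.inv (f₁ c)) (f₁ c'))) =ᶠ[𝓝 c]
      (fun c' => q.r (𝒢.mul (𝒢.inv (f (σ c))) (f c'))) ∘ σ := by
    filter_upwards [h, hf₁.isOpen.mem_nhds hc] with c' hc' hc'U
    have e1 : 𝒢.src g = 𝒢.tgt (f₁ c) := hgs.trans (hf₁.tgt_eq c hc).symm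
    have e2 : 𝒢.src g = 𝒢.tgt (f₁ c') := hgs.trans (hf₁.tgt_eq c' hc'U).symm
    rw [Function.comp_apply, hc'.2, hfc, 𝒢.inv_mul_rev _ _ e1, 𝒢.mul_assoc _ _ _ (by
      rw [𝒢.src_inv, 𝒢.tgt_inv, e1]) (by rw [𝒢.src_inv, 𝒢.tgt_mul _ _ e2]),
      𝒢.inv_mul_mul _ _ e2]
  have hd : DifferentiableAt ℝ (fun c' => q.r (𝒢.mul (𝒢.inv (f (σ c))) (f c'))) (σ c) :=
    q.differentiableAt_r_mul hf (by rw [𝒢.src_inv, hf.tgt_eq _ hσU]) hσU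
      (q.inv_mul_self_mem (hf.src_eq _ hσU))
  rw [jac, h1.fderiv_eq, fderiv_comp c hd hσ, jac, ← abs_mul]
  congr 1
  exact LinearMap.det_comp _ _

/-- The map c' ↦ r(f(c)⁻¹f(c')) whose Jacobian defines the density has the differentiable left
inverse c' ↦ p(f(c)κ(c')), so its derivative at `c` is invertible. -/
theorem jac_pos {f : (Fin j → ℝ) → G} {y : M} {U : Set (Fin j → ℝ)}
    (hf : IsFibreMap (𝒢 := 𝒢) m y U f) {p : G → (Fin j → ℝ)} {c : Fin j → ℝ} (hc : c ∈ U)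
    (hp : ContMDiffAt 𝓘(ℝ, E) 𝓘(ℝ, Fin j → ℝ) ∞ p (f c)) (hpf : ∀ c ∈ U, p (f c) = c) :
    0 < q.jac f c := by
  have hfc : 𝒢.src (f c) = m ∧ 𝒢.tgt (f c) = y := ⟨hf.src_eq c hc, hf.tgt_eq c hc⟩
  have hg : 𝒢.src (𝒢.inv (f c)) = y := by rw [𝒢.src_inv, hfc.2]
  have hmem := q.inv_mul_self_mem hfc.1
  have hd := q.differentiableAt_r_mul hf hg hc hmem
  set T : (Fin j → ℝ) → (Fin j → ℝ) := fun c' => q.r (𝒢.mul (𝒢.inv (f c)) (f c')) with hT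
  have hTκ : ∀ᶠ c' in 𝓝 c, 𝒢.mul (f c) (q.κ (T c')).1 = f c' := by
    filter_upwards [q.eventually_mul_mem hf hg hc hmem] with c' hc'
    have h1 := q.κ_r (diff hfc ⟨hf.src_eq c' hc'.1, hf.tgt_eq c' hc'.1⟩) hc'.2
    rw [show T c' = q.r (diff hfc ⟨hf.src_eq c' hc'.1, hf.tgt_eq c' hc'.1⟩).1 from rfl, h1]
    exact 𝒢.mul_mul_inv' _ _ (hfc.2.trans (hf.tgt_eq c' hc'.1).symm)
  have hTc : T c ∈ q.B := q.r_mem (diff hfc hfc) hmem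
  have hS : DifferentiableAt ℝ (fun c' => p (𝒢.mul (f c) (q.κ c').1)) (T c) := by
    have h1 := (contMDiffOn_mul_const_left q.isFibreMap_κ hfc.1).contMDiffAt
      (q.isOpen_B.mem_nhds hTc)
    rw [← hTκ.self_of_nhds] at hp
    exact ((hp.comp (T c) h1).contDiffAt).differentiableAt (by simp)
  have hid : (fun c' => p (𝒢.mul (f c) (q.κ c').1)) ∘ T =ᶠ[𝓝 c] id := by
    filter_upwards [hTκ, hf.isOpen.mem_nhds hc] with c' h1 h2
    rw [Function.comp_apply, h1, hpf c' h2, id]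
  have h2 := fderiv_comp c hS hd
  rw [hid.fderiv_eq, fderiv_id] at h2
  have h3 : (1 : ℝ) = (fderiv ℝ (fun c' => p (𝒢.mul (f c) (q.κ c').1)) (T c)).det *
      (fderiv ℝ T c).det := by
    have := congrArg ContinuousLinearMap.det h2
    rw [show (ContinuousLinearMap.id ℝ (Fin j → ℝ)).det = 1 from LinearMap.det_id] at this
    rw [this]
    exact LinearMap.det_comp _ _
  refine abs_pos.2 fun h0 => ?_
  rw [show (fderiv ℝ T c).det = 0 from h0, mul_zero] at h3
  exact one_ne_zero h3

/-- The density depends smoothly on parameters. -/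
theorem contDiffOn_jac {P : Type*} [NormedAddCommGroup P] [NormedSpace ℝ P] {A : Set P}
    {B : Set (Fin j → ℝ)} (hA : IsOpen A) (hB : IsOpen B) {Ψ : P × (Fin j → ℝ) → G} {θ : P → M}
    (hΨ : ContMDiffOn 𝓘(ℝ, P × (Fin j → ℝ)) 𝓘(ℝ, E) ∞ Ψ (A ×ˢ B))
    (hs : ∀ a ∈ A, ∀ c ∈ B, 𝒢.src (Ψ (a, c)) = m) (ht : ∀ a ∈ A, ∀ c ∈ B, 𝒢.tgt (Ψ (a, c)) = θ a)
    (hpos : ∀ a ∈ A, ∀ c ∈ B, 0 < q.jac (fun c => Ψ (a, c)) c) :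
    ContDiffOn ℝ ∞ (fun p : P × (Fin j → ℝ) => q.jac (fun c => Ψ (p.1, c)) p.2) (A ×ˢ B) := by
  rintro ⟨a, c⟩ ⟨ha, hc⟩
  let O : Set ((P × (Fin j → ℝ)) × (Fin j → ℝ)) := (A ×ˢ B) ×ˢ B
  have hO : IsOpen O := (hA.prod hB).prod hB
  let d : (P × (Fin j → ℝ)) × (Fin j → ℝ) → G := fun p =>
    𝒢.mul (𝒢.inv (Ψ (p.1.1, p.1.2))) (Ψ (p.1.1, p.2))
  have hd : ContMDiffOn 𝓘(ℝ, (P × (Fin j → ℝ)) × (Fin j → ℝ)) 𝓘(ℝ, E) ∞ d O := by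
    refine 𝒢.contMDiffOn_mul_comp (φ := fun p : (P × (Fin j → ℝ)) × (Fin j → ℝ) =>
      𝒢.inv (Ψ (p.1.1, p.1.2))) (ψ := fun p => Ψ (p.1.1, p.2)) ?_ ?_ ?_
    · refine 𝒢.contMDiff_inv.comp_contMDiffOn (hΨ.comp (t := A ×ˢ B)
        (f := fun p : (P × (Fin j → ℝ)) × (Fin j → ℝ) => (p.1.1, p.1.2)) ?_ fun p hp => hp.1)
      exact ContDiff.contMDiff (by fun_prop) |>.contMDiffOn
    · refine hΨ.comp (t := A ×ˢ B)
        (f := fun p : (P × (Fin j → ℝ)) × (Fin j → ℝ) => (p.1.1, p.2)) ?_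
        fun p hp => ⟨hp.1.1, hp.2⟩
      exact ContDiff.contMDiff (by fun_prop) |>.contMDiffOn
    · intro p hp
      rw [𝒢.src_inv, ht _ hp.1.1 _ hp.1.2, ht _ hp.1.1 _ hp.2]
  have hpt : ((a, c), c) ∈ O := ⟨⟨ha, hc⟩, hc⟩
  have hr : ContDiffAt ℝ ∞ (q.r ∘ d) ((a, c), c) :=
    ((q.contMDiffOn_r.contMDiffAt (q.isOpen_W.mem_nhds
      (q.inv_mul_self_mem (hs a ha c hc)))).comp ((a, c), c)
      (hd.contMDiffAt (hO.mem_nhds hpt))).contDiffAt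
  have hD : ContDiffAt ℝ ∞ (fun p : P × (Fin j → ℝ) => fderiv ℝ (fun c' => q.r (d (p, c'))) p.2)
      (a, c) :=
    ContDiffAt.fderiv (f := fun p c' => q.r (d (p, c'))) (g := Prod.snd) (n := ∞) hr
      contDiffAt_snd (by simp)
  have hdet : ContDiffAt ℝ ∞ (fun p : P × (Fin j → ℝ) =>
      (fderiv ℝ (fun c' => q.r (d (p, c'))) p.2).det) (a, c) :=
    contDiff_det.contDiffAt.comp (a, c) hD
  -- Positivity of the density keeps the determinant away from 0, where the absolute value would not
  -- be smooth.
  have hne : (fderiv ℝ (fun c' => q.r (d ((a, c), c'))) c).det ≠ 0 := abs_pos.1 (hpos a ha c hc)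
  exact (hdet.abs hne).contDiffWithinAt

theorem jac_κ_pos {c : Fin j → ℝ} (hc : c ∈ q.B) : 0 < q.jac (fun c => (q.κ c).1) c :=
  q.jac_pos q.isFibreMap_κ hc (q.contMDiffOn_r.contMDiffAt (q.isOpen_W.mem_nhds (q.κ_mem c hc)))
    q.r_κ

theorem contDiffOn_jac_κ : ContDiffOn ℝ ∞ (q.jac fun c => (q.κ c).1) q.B := by
  -- The real parameter is a dummy on which nothing depends.
  have h := q.contDiffOn_jac (P := ℝ) (A := Set.univ) (B := q.B) isOpen_univ q.isOpen_B
    (Ψ := fun p => (q.κ p.2).1) (θ := fun _ => m)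
    (q.contMDiffOn_κ.comp (t := q.B) contDiff_snd.contMDiff.contMDiffOn fun p hp => hp.2)
    (fun _ _ c _ => (q.κ c).2.1) (fun _ _ c _ => (q.κ c).2.2) (fun _ _ c hc => q.jac_κ_pos hc)
  exact h.comp (f := fun c => ((0 : ℝ), c)) (by fun_prop) fun c hc => ⟨Set.mem_univ _, hc⟩

end IsotropyChart

end LieGroupoid

/-! ### Haar measure has a smooth density -/

namespace LieGroupoid

variable {E F G M : Type*} [NormedAddCommGroup E] [NormedSpace ℝ E] [FiniteDimensional ℝ E]
  [NormedAddCommGroup F] [NormedSpace ℝ F]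
  [TopologicalSpace G] [ChartedSpace E G] [SecondCountableTopology G] [MeasurableSpace G]
  [BorelSpace G]
  [TopologicalSpace M] [T1Space M] [ChartedSpace F M] {𝒢 : LieGroupoid E F G M}

namespace IsotropyChart

variable {m : M} {j : ℕ} (q : 𝒢.IsotropyChart m j)

/-- The domain of an isotropy chart. -/
def dom : Set (𝒢.Isotropy m) := {k | k.1 ∈ q.W}

theorem isOpen_dom : IsOpen q.dom := q.isOpen_W.preimage (Isotropy.continuous_val 𝒢 m)

theorem continuousOn_κ : ContinuousOn q.κ q.B :=
  Topology.IsInducing.subtypeVal.continuousOn_iff.2 q.contMDiffOn_κ.continuousOn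

theorem continuousOn_r_val : ContinuousOn (fun k : 𝒢.Isotropy m => q.r k.1) q.dom :=
  q.contMDiffOn_r.continuousOn.comp (Isotropy.continuous_val 𝒢 m).continuousOn fun _ hk => hk

theorem one_mem_dom : (1 : 𝒢.Isotropy m) ∈ q.dom := q.unit_mem

/-- Haar measure near the unit. -/
noncomputable def localHaar : Measure (𝒢.Isotropy m) :=
  ((volume.withDensity fun c => ENNReal.ofReal (q.jac (fun c => (q.κ c).1) c)).restrict q.B).map q.κ

theorem localHaar_apply {C : Set (𝒢.Isotropy m)} (hC : MeasurableSet C) :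
    q.localHaar C = ∫⁻ c in q.B ∩ q.κ ⁻¹' C, ENNReal.ofReal (q.jac (fun c => (q.κ c).1) c) := by
  rw [localHaar, restrict_map_apply_of_continuousOn _ q.isOpen_B.measurableSet q.continuousOn_κ hC,
    withDensity_apply _ (measurableSet_inter_preimage_of_continuousOn q.continuousOn_κ
      q.isOpen_B.measurableSet hC)]

/-- Write left translation by `g` in the chart as a map σ and change variables: by `jac_eq` the
density absorbs exactly |det dσ|. Both sets have to lie in the chart for σ and its inverse to make
sense. -/
theorem localHaar_preimage_mul (g : 𝒢.Isotropy m) {C : Set (𝒢.Isotropy m)} (hC : MeasurableSet C)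
    (h : C ⊆ q.dom) (hg : (fun k => g * k) ⁻¹' C ⊆ q.dom) :
    q.localHaar ((fun k => g * k) ⁻¹' C) = q.localHaar C := by
  have hC' : MeasurableSet ((fun k => g * k) ⁻¹' C) := measurable_const_mul g hC
  rw [q.localHaar_apply hC', q.localHaar_apply hC]
  set D := q.B ∩ q.κ ⁻¹' ((fun k => g * k) ⁻¹' C) with hD
  have hDm : MeasurableSet D := measurableSet_inter_preimage_of_continuousOn q.continuousOn_κ
    q.isOpen_B.measurableSet hC'
  let σ : (Fin j → ℝ) → (Fin j → ℝ) := fun c => q.r (𝒢.mul g.1 (q.κ c).1)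
  have hσκ : ∀ c, 𝒢.mul g.1 (q.κ c).1 ∈ q.W → σ c ∈ q.B ∧ q.κ (σ c) = g * q.κ c := fun c hc =>
    ⟨q.r_mem (g * q.κ c) hc, q.κ_r (g * q.κ c) hc⟩
  have hDW : ∀ c ∈ D, 𝒢.mul g.1 (q.κ c).1 ∈ q.W := fun c hc => h hc.2
  have himg : q.B ∩ q.κ ⁻¹' C = σ '' D := by
    ext c
    constructor
    · rintro ⟨hc, hcC⟩
      have h1 : g⁻¹ * q.κ c ∈ (fun k => g * k) ⁻¹' C := by
        rw [Set.mem_preimage, mul_inv_cancel_left]; exact hcC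
      have h2 : (g⁻¹ * q.κ c).1 ∈ q.W := hg h1
      have h3 := q.κ_r _ h2
      refine ⟨q.r (g⁻¹ * q.κ c).1, ⟨q.r_mem _ h2, by rw [Set.mem_preimage, h3]; exact h1⟩, ?_⟩
      change q.r (g * q.κ (q.r (g⁻¹ * q.κ c).1)).1 = c
      rw [h3, mul_inv_cancel_left, q.r_κ c hc]
    · rintro ⟨c, hc, rfl⟩
      obtain ⟨h1, h2⟩ := hσκ c (hDW c hc)
      exact ⟨h1, by rw [Set.mem_preimage, h2]; exact hc.2⟩
  have hσd : ∀ c ∈ D, DifferentiableAt ℝ σ c := fun c hc =>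
    q.differentiableAt_r_mul q.isFibreMap_κ g.2.1 hc.1 (hDW c hc)
  rw [himg, lintegral_image_eq_lintegral_abs_det_fderiv_mul volume hDm
    (fun c hc => (hσd c hc).hasFDerivAt.hasFDerivWithinAt) ?_]
  · refine setLIntegral_congr_fun hDm fun c hc => ?_
    rw [← ENNReal.ofReal_mul (abs_nonneg _)]
    congr 1
    rw [mul_comm]
    refine q.jac_eq q.isFibreMap_κ q.isFibreMap_κ g.2.1 hc.1 (hσd c hc) ?_
    filter_upwards [q.eventually_mul_mem q.isFibreMap_κ g.2.1 hc.1 (hDW c hc)] with c' hc'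
    obtain ⟨h1, h2⟩ := hσκ c' hc'.2
    exact ⟨h1, congrArg Subtype.val h2⟩
  · intro c hc c' hc' hcc
    have h1 := (hσκ c (hDW c hc)).2
    rw [hcc, (hσκ c' (hDW c' hc')).2] at h1
    have h2 := mul_left_cancel h1
    rw [← q.r_κ c hc.1, ← h2, q.r_κ c' hc'.1]

/-- The local Haar measure extends to a left-invariant measure. -/
theorem exists_isMulLeftInvariant : ∃ ν : Measure (𝒢.Isotropy m), ν.IsMulLeftInvariant ∧
    ∀ C ⊆ q.dom, MeasurableSet C → ν C = q.localHaar C := by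
  obtain ⟨t, htc, hcov⟩ := TopologicalSpace.countable_cover_nhds
    (f := fun g : 𝒢.Isotropy m => (fun k => g⁻¹ * k) ⁻¹' q.dom) fun g =>
      (q.isOpen_dom.preimage (continuous_const_mul g⁻¹)).mem_nhds (by
        rw [Set.mem_preimage, inv_mul_cancel]; exact q.one_mem_dom)
  have : Countable t := htc.to_subtype
  have hcov' : Set.univ ⊆ ⋃ g : t, (fun k => (g : 𝒢.Isotropy m)⁻¹ * k) ⁻¹' q.dom := by
    rw [← hcov, Set.biUnion_eq_iUnion]
  have hS : ∀ g : t, MeasurableSet ((fun k => (g : 𝒢.Isotropy m)⁻¹ * k) ⁻¹' q.dom) := fun g =>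
    measurable_const_mul _ q.isOpen_dom.measurableSet
  -- two translates agree on the intersection of their domains
  have hcompat : ∀ (g h : 𝒢.Isotropy m) (C : Set (𝒢.Isotropy m)), MeasurableSet C →
      (fun k => g * k) ⁻¹' C ⊆ q.dom → (fun k => h * k) ⁻¹' C ⊆ q.dom →
      q.localHaar ((fun k => g * k) ⁻¹' C) = q.localHaar ((fun k => h * k) ⁻¹' C) := by
    intro g h C hC hg hh
    have e : (fun k => g * k) ⁻¹' C = (fun k => (h⁻¹ * g) * k) ⁻¹' ((fun k => h * k) ⁻¹' C) := by
      ext k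
      have h1 : h * (h⁻¹ * g * k) = g * k := by group
      simp only [Set.mem_preimage, h1]
    rw [e]
    exact q.localHaar_preimage_mul _ (measurable_const_mul h hC) hh (e ▸ hg)
  have hpre : ∀ (g : 𝒢.Isotropy m) (C : Set (𝒢.Isotropy m)),
      C ⊆ (fun k => g⁻¹ * k) ⁻¹' q.dom ↔ (fun k => g * k) ⁻¹' C ⊆ q.dom := by
    intro g C
    constructor
    · intro h k hk
      have := h hk
      rwa [Set.mem_preimage, inv_mul_cancel_left] at this
    · intro h k hk
      apply h
      rwa [Set.mem_preimage, mul_inv_cancel_left]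
  obtain ⟨ν, -, hν⟩ := exists_measure_glue _ hS
    (fun g : t => q.localHaar.map fun k => (g : 𝒢.Isotropy m) * k) (by
      intro g h C hC h1 h2
      rw [Measure.map_apply (measurable_const_mul _) hC,
        Measure.map_apply (measurable_const_mul _) hC]
      exact hcompat g h C hC ((hpre _ _).1 h1) ((hpre _ _).1 h2))
  -- The glued measure is computed by any translate that fits into the chart, not only by those in
  -- the countable cover; left invariance follows at once.
  have key : ∀ (g : 𝒢.Isotropy m) (C : Set (𝒢.Isotropy m)), MeasurableSet C →
      (fun k => g * k) ⁻¹' C ⊆ q.dom → ν C = q.localHaar ((fun k => g * k) ⁻¹' C) := by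
    intro g C hC hg
    rw [← Measure.map_apply (measurable_const_mul g) hC]
    refine measure_eq_of_forall_subset_cover _ hS hC ((Set.subset_univ _).trans hcov')
      fun i D hD h1 h2 => ?_
    rw [hν i D hD h1, Measure.map_apply (measurable_const_mul _) hD,
      Measure.map_apply (measurable_const_mul _) hD]
    exact hcompat i g D hD ((hpre _ _).1 h1) ((Set.preimage_mono h2).trans hg)
  refine ⟨ν, ⟨fun h => ?_⟩, fun C hCd hC => ?_⟩
  · ext C hC
    refine measure_eq_of_forall_subset_cover _ hS hC ((Set.subset_univ _).trans hcov')
      fun i D hD h1 _ => ?_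
    have e : (fun k => (h⁻¹ * i) * k) ⁻¹' ((fun k => h * k) ⁻¹' D) =
        (fun k => (i : 𝒢.Isotropy m) * k) ⁻¹' D := by
      ext k
      have h1 : h * (h⁻¹ * i * k) = i * k := by group
      simp only [Set.mem_preimage, h1]
    have h2 := (hpre _ _).1 h1
    rw [Measure.map_apply (measurable_const_mul _) hD, key i D hD h2,
      key (h⁻¹ * i) _ (measurable_const_mul _ hD) (e ▸ h2), e]
  · have h1 : (fun k => (1 : 𝒢.Isotropy m) * k) ⁻¹' C = C := by simp
    rw [key 1 C hC (h1.symm ▸ hCd), h1]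

/-- A left-invariant measure is a Haar measure once a single compact set with nonempty interior has
finite positive measure. The image of a compact neighbourhood in the chart qualifies, since the
density is continuous and positive. -/
theorem exists_isHaarMeasure : ∃ ν : Measure (𝒢.Isotropy m), ν.IsHaarMeasure ∧
    ∀ C ⊆ q.dom, MeasurableSet C → ν C = q.localHaar C := by
  obtain ⟨ν, hν, hνC⟩ := q.exists_isMulLeftInvariant
  refine ⟨ν, ?_, hνC⟩
  have hr1 : q.r (1 : 𝒢.Isotropy m).1 ∈ q.B := q.r_mem 1 q.one_mem_dom
  have hκr1 : q.κ (q.r (1 : 𝒢.Isotropy m).1) = 1 := q.κ_r 1 q.one_mem_dom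
  obtain ⟨Q, hQ, hQB⟩ := exists_compact_subset q.isOpen_B hr1
  set K := q.κ '' Q with hK
  have hKc : IsCompact K := hQ.image_of_continuousOn (q.continuousOn_κ.mono hQB.2)
  have hQK : q.B ∩ q.κ ⁻¹' K = Q := by
    ext c
    constructor
    · rintro ⟨hc, c', hc', h⟩
      rw [← q.r_κ c hc, ← h, q.r_κ c' (hQB.2 hc')]
      exact hc'
    · exact fun hc => ⟨hQB.2 hc, c, hc, rfl⟩
  have hKd : K ⊆ q.dom := by
    rintro _ ⟨c, hc, rfl⟩
    exact q.κ_mem c (hQB.2 hc)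
  -- `G` is not assumed to be Hausdorff, so measurability is read off from the retraction and not
  -- from compactness.
  have hKm : MeasurableSet K := by
    have h1 : K = q.dom ∩ (fun k : 𝒢.Isotropy m => q.r k.1) ⁻¹' Q := by
      ext k
      constructor
      · rintro ⟨c, hc, rfl⟩
        refine ⟨hKd ⟨c, hc, rfl⟩, ?_⟩
        rw [Set.mem_preimage, q.r_κ c (hQB.2 hc)]
        exact hc
      · rintro ⟨hk, hkQ⟩
        exact ⟨_, hkQ, q.κ_r k hk⟩
    rw [h1]
    exact measurableSet_inter_preimage_of_continuousOn q.continuousOn_r_val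
      q.isOpen_dom.measurableSet hQ.measurableSet
  have hKν : ν K = ∫⁻ c in Q, ENNReal.ofReal (q.jac (fun c => (q.κ c).1) c) := by
    rw [hνC K hKd hKm, q.localHaar_apply hKm, hQK]
  have hjc : ContinuousOn (q.jac fun c => (q.κ c).1) q.B := q.contDiffOn_jac_κ.continuousOn
  refine Measure.isHaarMeasure_of_isCompact_nonempty_interior ν K hKc ?_ ?_ ?_
  · refine ⟨1, mem_interior.2 ⟨q.dom ∩ (fun k : 𝒢.Isotropy m => q.r k.1) ⁻¹' interior Q, ?_, ?_,
      q.one_mem_dom, hQB.1⟩⟩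
    · rintro k ⟨hk, hkQ⟩
      exact ⟨_, interior_subset hkQ, q.κ_r k hk⟩
    · exact q.continuousOn_r_val.isOpen_inter_preimage q.isOpen_dom isOpen_interior
  · rw [hKν]
    intro h0
    rw [lintegral_eq_zero_iff' ((hjc.mono hQB.2).aemeasurable hQ.measurableSet).ennreal_ofReal] at h0
    have h1 : volume Q = 0 := by
      rw [Filter.EventuallyEq, ae_restrict_iff' hQ.measurableSet] at h0
      refine measure_mono_null (fun c hc => ?_) h0
      simp only [Set.mem_compl_iff, Set.mem_ofPred_eq, Classical.not_imp]
      exact ⟨hc, (ENNReal.ofReal_pos.2 (q.jac_κ_pos (hQB.2 hc))).ne'⟩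
    exact (Measure.measure_pos_of_mem_nhds volume (mem_interior_iff_mem_nhds.1 hQB.1)).ne' h1
  · rw [hKν]
    have h1 : IntegrableOn (q.jac fun c => (q.κ c).1) Q := (hjc.mono hQB.2).integrableOn_compact hQ
    exact h1.lintegral_lt_top.ne

/-- Haar measure has a smooth density. -/
theorem exists_haar_eq (η : Measure (𝒢.Isotropy m)) [η.IsHaarMeasure] : ∃ s : ℝ, 0 < s ∧
    ∀ C ⊆ q.dom, MeasurableSet C → η C =
      ∫⁻ c in q.B ∩ q.κ ⁻¹' C, ENNReal.ofReal (s * q.jac (fun c => (q.κ c).1) c) := by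
  obtain ⟨ν, hν, hνC⟩ := q.exists_isHaarMeasure
  have h := Measure.isMulLeftInvariant_eq_smul η ν
  refine ⟨Measure.haarScalarFactor η ν,
    NNReal.coe_pos.2 (Measure.haarScalarFactor_pos_of_isHaarMeasure η ν), fun C hCd hC => ?_⟩
  refine (congrArg (fun ξ : Measure (𝒢.Isotropy m) => ξ C) h).trans ?_
  rw [Measure.smul_apply, hνC C hCd hC, q.localHaar_apply hC]
  simp only [ENNReal.ofReal_mul NNReal.zero_le_coe, ENNReal.ofReal_coe_nnreal]
  rw [lintegral_const_mul' _ _ ENNReal.coe_ne_top]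
  rfl

/-- The image of Haar measure in a parametrisation `f` of a fibre of `t : s⁻¹(m) → M`. -/
theorem exists_map_haar_eq (η : Measure (𝒢.Isotropy m)) [η.IsHaarMeasure] : ∃ s : ℝ, 0 < s ∧
    ∀ (y : M) (U : Set (Fin j → ℝ)) (f : (Fin j → ℝ) → G), IsFibreMap (𝒢 := 𝒢) m y U f →
    Set.InjOn f U → ∀ g₀, 𝒢.src g₀ = m → 𝒢.tgt g₀ = y → ∀ D ⊆ U, MeasurableSet D →
      (η.map fun k => 𝒢.mul g₀ k.1) (f '' D) = ∫⁻ c in D, ENNReal.ofReal (s * q.jac f c) := by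
  obtain ⟨s, hs, hη⟩ := q.exists_haar_eq η
  refine ⟨s, hs, fun y U f hf hi g₀ hg₀ hgt₀ D hDU hD => ?_⟩
  have hfc := hf.contMDiffOn.continuousOn
  have him : ∀ A ⊆ U, MeasurableSet A → MeasurableSet (f '' A) := fun A hA hAm =>
    measurableSet_image_of_injOn (E := E) hfc hi hAm hA
  obtain ⟨lam, hlam⟩ := exists_pullback_measure (η.map fun k => 𝒢.mul g₀ k.1)
    hf.isOpen.measurableSet hi him
  have hfm : ∀ c ∈ U, 𝒢.src (f c) = m ∧ 𝒢.tgt (f c) = y := fun c hc =>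
    ⟨hf.src_eq c hc, hf.tgt_eq c hc⟩
  -- The points of the fibre which left translation by f(c₁)⁻¹ brings into the chart around the
  -- unit. Countably many such sets cover `U`, so the formula need only be checked inside one.
  let O : (Fin j → ℝ) → Set (Fin j → ℝ) := fun c₁ =>
    U ∩ (fun c => 𝒢.mul (𝒢.inv (f c₁)) (f c)) ⁻¹' q.W
  have hO : ∀ c₁ ∈ U, IsOpen (O c₁) := fun c₁ hc₁ =>
    (contMDiffOn_mul_const_left hf (g := 𝒢.inv (f c₁))
      (by rw [𝒢.src_inv, hf.tgt_eq c₁ hc₁])).continuousOn.isOpen_inter_preimage hf.isOpen q.isOpen_W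
  obtain ⟨t, htU, htc, hcov⟩ := TopologicalSpace.countable_cover_nhdsWithin (s := U) (f := O)
    fun c hc => mem_nhdsWithin_of_mem_nhds ((hO c hc).mem_nhds
      ⟨hc, q.inv_mul_self_mem (hf.src_eq c hc)⟩)
  have : Countable t := htc.to_subtype
  rw [← hlam D hDU hD, ← withDensity_apply _ hD]
  refine measure_eq_of_forall_subset_cover (fun c : t => O c)
    (fun c => (hO c (htU c.2)).measurableSet) hD ?_ fun c₁ C hC h1 h2 => ?_
  · rw [← Set.biUnion_eq_iUnion (s := t) (t := fun c _ => O c)]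
    exact hDU.trans hcov
  obtain ⟨c₁, hc₁t⟩ := c₁
  have hc₁ := htU hc₁t
  have hCU : C ⊆ U := h2.trans hDU
  rw [hlam C hCU hC, withDensity_apply _ hC, Measure.map_apply
    (𝒢.continuous_mul_left g₀ hg₀).measurable (him C hCU hC)]
  -- replace the arrow `g₀` by `f c₁`
  let κ₀ : 𝒢.Isotropy m := diff (𝒢 := 𝒢) (hfm c₁ hc₁) ⟨hg₀, hgt₀⟩
  have hpre : (fun k : 𝒢.Isotropy m => 𝒢.mul g₀ k.1) ⁻¹' (f '' C) = (fun k => κ₀ * k) ⁻¹'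
      ((fun k : 𝒢.Isotropy m => 𝒢.mul (f c₁) k.1) ⁻¹' (f '' C)) := by
    ext k
    have e1 : 𝒢.mul (f c₁) (κ₀ * k).1 = 𝒢.mul g₀ k.1 := by
      change 𝒢.mul (f c₁) (𝒢.mul (𝒢.mul (𝒢.inv (f c₁)) g₀) k.1) = _
      rw [← 𝒢.mul_assoc (f c₁) (𝒢.mul (𝒢.inv (f c₁)) g₀) k.1 ((hfm c₁ hc₁).1.trans κ₀.2.2.symm)
          (κ₀.2.1.trans k.2.2.symm),
        𝒢.mul_mul_inv' _ _ ((hfm c₁ hc₁).2.trans hgt₀.symm)]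
    rw [Set.mem_preimage, Set.mem_preimage, Set.mem_preimage, e1]
  set C₁ := (fun k : 𝒢.Isotropy m => 𝒢.mul (f c₁) k.1) ⁻¹' (f '' C) with hC₁
  have hC₁m : MeasurableSet C₁ :=
    (𝒢.continuous_mul_left (f c₁) (hfm c₁ hc₁).1).measurable (him C hCU hC)
  have hd : ∀ c (hc : c ∈ U), ∀ k : 𝒢.Isotropy m, f c = 𝒢.mul (f c₁) k.1 ↔
      k = diff (𝒢 := 𝒢) (hfm c₁ hc₁) (hfm c hc) := by
    intro c hc k
    constructor
    · intro h
      apply Subtype.ext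
      change k.1 = 𝒢.mul (𝒢.inv (f c₁)) (f c)
      rw [h, 𝒢.inv_mul_mul _ _ ((hfm c₁ hc₁).1.trans k.2.2.symm)]
    · rintro rfl
      exact (𝒢.mul_mul_inv' _ _ ((hfm c₁ hc₁).2.trans (hfm c hc).2.symm)).symm
  have hC₁d : C₁ ⊆ q.dom := by
    rintro k ⟨c, hc, hck⟩
    rw [(hd c (hCU hc) k).1 hck]
    exact (h1 hc).2
  rw [hpre, measure_preimage_mul, hη C₁ hC₁d hC₁m]
  have hg : 𝒢.src (𝒢.inv (f c₁)) = y := by rw [𝒢.src_inv, (hfm c₁ hc₁).2]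
  let τ : (Fin j → ℝ) → (Fin j → ℝ) := fun c => q.r (𝒢.mul (𝒢.inv (f c₁)) (f c))
  have hτ : ∀ c ∈ O c₁, τ c ∈ q.B ∧ (q.κ (τ c)).1 = 𝒢.mul (𝒢.inv (f c₁)) (f c) := fun c hc =>
    ⟨q.r_mem (diff (𝒢 := 𝒢) (hfm c₁ hc₁) (hfm c hc.1)) hc.2,
      congrArg Subtype.val (q.κ_r (diff (𝒢 := 𝒢) (hfm c₁ hc₁) (hfm c hc.1)) hc.2)⟩
  have himg : q.B ∩ q.κ ⁻¹' C₁ = τ '' C := by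
    ext b
    constructor
    · rintro ⟨hb, c, hc, hcb⟩
      refine ⟨c, hc, ?_⟩
      have := (hd c (hCU hc) _).1 hcb
      rw [← q.r_κ b hb, this]
      rfl
    · rintro ⟨c, hc, rfl⟩
      obtain ⟨h3, h4⟩ := hτ c (h1 hc)
      refine ⟨h3, c, hc, ?_⟩
      change f c = 𝒢.mul (f c₁) (q.κ (τ c)).1
      rw [h4, 𝒢.mul_mul_inv' _ _ ((hfm c₁ hc₁).2.trans (hfm c (hCU hc)).2.symm)]
  have hτd : ∀ c ∈ C, DifferentiableAt ℝ τ c := fun c hc =>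
    q.differentiableAt_r_mul hf hg (hCU hc) (h1 hc).2
  rw [himg, lintegral_image_eq_lintegral_abs_det_fderiv_mul volume hC
    (fun c hc => (hτd c hc).hasFDerivAt.hasFDerivWithinAt) ?_]
  · refine setLIntegral_congr_fun hC fun c hc => ?_
    rw [← ENNReal.ofReal_mul (abs_nonneg _)]
    congr 1
    rw [q.jac_eq q.isFibreMap_κ hf hg (hCU hc) (hτd c hc) (by
      filter_upwards [(hO c₁ hc₁).mem_nhds (h1 hc)] with c' hc' using hτ c' hc')]
    ring
  · intro c hc c' hc' h
    have e1 := (hτ c (h1 hc)).2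
    rw [h, (hτ c' (h1 hc')).2] at e1
    apply hi (hCU hc) (hCU hc')
    have e2 := congrArg (𝒢.mul (f c₁)) e1
    rw [𝒢.mul_mul_inv' _ _ ((hfm c₁ hc₁).2.trans (hfm c (hCU hc)).2.symm),
      𝒢.mul_mul_inv' _ _ ((hfm c₁ hc₁).2.trans (hfm c' (hCU hc')).2.symm)] at e2
    exact e2.symm

end IsotropyChart

end LieGroupoid

/-! ### Canonical measures as integrals over orbits -/

namespace LieGroupoid

variable {E F G M : Type*} [NormedAddCommGroup E] [NormedSpace ℝ E]
  [NormedAddCommGroup F] [NormedSpace ℝ F] [TopologicalSpace G] [ChartedSpace E G]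
  [TopologicalSpace M] [T1Space M] [ChartedSpace F M] (𝒢 : LieGroupoid E F G M)
  [SecondCountableTopology G] [MeasurableSpace G] [BorelSpace G]

theorem rightTorsorMeasure_compl_eq_zero (η : (x : M) → Measure (𝒢.Isotropy x)) (m y : M) :
    𝒢.rightTorsorMeasure η m y {g | 𝒢.src g = m ∧ 𝒢.tgt g = y}ᶜ = 0 := by
  by_cases H : ∃ h, 𝒢.src h = m ∧ 𝒢.tgt h = y
  · rw [rightTorsorMeasure, dif_pos H]
    obtain ⟨h1, h2⟩ := H.choose_spec
    rw [Measure.map_apply (𝒢.continuous_mul_right H.choose h2).measurable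
      (𝒢.isClosed_isotropy m y).measurableSet.compl]
    convert measure_empty (μ := η y)
    ext k
    have hk : 𝒢.src k.1 = 𝒢.tgt H.choose := k.2.1.trans h2.symm
    simp [𝒢.src_mul _ _ hk, 𝒢.tgt_mul _ _ hk, h1, k.2.2]
  · rw [rightTorsorMeasure, dif_neg H]; rfl

theorem rightTorsorMeasure_eq_zero (η : (x : M) → Measure (𝒢.Isotropy x)) {m y : M} {C : Set G}
    (hC : ∀ g ∈ C, 𝒢.src g = m → 𝒢.tgt g ≠ y) : 𝒢.rightTorsorMeasure η m y C = 0 :=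
  measure_mono_null (fun g hg (h : 𝒢.src g = m ∧ 𝒢.tgt g = y) => hC g hg h.1 h.2) (𝒢.rightTorsorMeasure_compl_eq_zero η m y)

end LieGroupoid

namespace SymplecticGroupoid

variable {E F G M : Type*} [NormedAddCommGroup E] [NormedSpace ℝ E] [FiniteDimensional ℝ E]
  [NormedAddCommGroup F] [NormedSpace ℝ F] [FiniteDimensional ℝ F]
  [TopologicalSpace G] [SecondCountableTopology G] [ChartedSpace E G] [IsManifold 𝓘(ℝ, E) ∞ G]
  [MeasurableSpace G] [BorelSpace G]
  [TopologicalSpace M] [T2Space M] [SecondCountableTopology M] [ChartedSpace F M]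
  [IsManifold 𝓘(ℝ, F) ∞ M] [MeasurableSpace M] [BorelSpace M] (𝒢 : SymplecticGroupoid E F G M)
  {η : (x : M) → Measure (𝒢.Isotropy x)}

/-- The measures induced on the fibres of `t` over a box come from one Haar measure. -/
theorem IsIsotropyHaar.exists_haar_box (h : 𝒢.IsIsotropyHaar η) {m : M} {l j : ℕ}
    (b : 𝒢.toLieGroupoid.Box m l j) :
    ∃ η' : Measure (𝒢.Isotropy m), η'.IsHaarMeasure ∧ ∀ a ∈ b.A, ∀ c ∈ b.B,
      𝒢.rightTorsorMeasure η m (b.θ a) = η'.map fun k => 𝒢.mul (b.Ψ (a, c)) k.1 := by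
  rcases b.A.eq_empty_or_nonempty with hA | ⟨a₁, ha₁⟩
  · have := h.haar m
    exact ⟨η m, inferInstance, by simp [hA]⟩
  obtain ⟨η', hη', H⟩ := h.exists_haar (b.θ_mem_orbit ha₁)
  refine ⟨η', hη', fun a ha c hc => ?_⟩
  have ht := b.tgt_Ψ a ha c hc
  rw [← ht]
  refine H _ (b.src_Ψ ha hc) ?_
  rw [ht]
  exact 𝒢.image_θ_subset_leaf b (𝒢.mem_leaf_self _) ⟨a₁, ha₁, rfl⟩ ⟨a, ha, rfl⟩

/-- Along the continuous section y ↦ Ψ(ρ(y), c) these measures are images of one fixed Haar measure,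
hence depend measurably on `y`. This is what `Measure.bind` requires. -/
theorem IsIsotropyHaar.measurable_rightTorsorMeasure_box (h : 𝒢.IsIsotropyHaar η) {m : M}
    {l j : ℕ} (b : 𝒢.toLieGroupoid.Box m l j) :
    Measurable fun y : b.θ '' b.A => 𝒢.rightTorsorMeasure η m y := by
  obtain ⟨η', hη', H⟩ := h.exists_haar_box 𝒢 b
  obtain ⟨c, hc⟩ := b.nonempty_B
  have hρ : ∀ y : b.θ '' b.A, b.ρ y ∈ b.A ∧ b.θ (b.ρ y) = y := by
    rintro ⟨_, a, ha, rfl⟩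
    rw [b.ρ_θ a ha]
    exact ⟨ha, rfl⟩
  have hρc : Continuous fun y : b.θ '' b.A => b.ρ y :=
    b.contMDiffOn_ρ.continuousOn.comp_continuous continuous_subtype_val fun y => by
      rw [← (hρ y).2]; exact b.θ_mem _ (hρ y).1
  have hΨ : Continuous fun y : b.θ '' b.A => b.Ψ (b.ρ y, c) :=
    b.param.continuousOn.comp_continuous (f := fun y : b.θ '' b.A => (b.ρ y, c))
      (hρc.prodMk continuous_const) fun y => ⟨(hρ y).1, hc⟩
  have hf : Continuous fun p : (b.θ '' b.A) × 𝒢.Isotropy m =>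
      𝒢.mul (b.Ψ (b.ρ p.1, c)) p.2.1 :=
    𝒢.contMDiffOn_mul.continuousOn.comp_continuous
      (f := fun p : (b.θ '' b.A) × 𝒢.Isotropy m => (b.Ψ (b.ρ p.1, c), p.2.1))
      ((hΨ.comp continuous_fst).prodMk
        ((LieGroupoid.Isotropy.continuous_val 𝒢.toLieGroupoid m).comp continuous_snd))
      fun p => (b.src_Ψ (hρ p.1).1 hc).trans p.2.2.2.symm
  refine Measure.measurable_of_measurable_coe _ fun C hC => ?_
  have h1 := measurable_measure_prodMk_left (ν := η') (hf.measurable hC)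
  convert h1 using 2 with y
  rw [← (hρ y).2, H _ (hρ y).1 c hc, Measure.map_apply (𝒢.continuous_mul_left _
    (b.src_Ψ (hρ y).1 hc)).measurable hC]
  rfl

variable {ν : Measure M} {m : M}

theorem IsOrbitMeasure.unique {ν' : Measure M} (h : 𝒢.IsOrbitMeasure ν m)
    (h' : 𝒢.IsOrbitMeasure ν' m) : ν = ν' := by
  obtain ⟨b, hb⟩ := 𝒢.exists_box_cover m
  have hcov : 𝒢.orbit m ⊆ ⋃ i, (b i).θ '' (b i).A := fun y hy =>
    Set.mem_iUnion.2 (𝒢.exists_mem_image_θ hb hy)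
  have hS : ∀ i, MeasurableSet ((b i).θ '' (b i).A) := fun i => 𝒢.measurableSet_image_θ (b i)
  have e : 𝒢.orbit m = ⋃ i, (b i).θ '' (b i).A := hcov.antisymm (Set.iUnion_subset fun i => by
    rintro _ ⟨a, ha, rfl⟩
    exact (b i).θ_mem_orbit ha)
  have hm : MeasurableSet (𝒢.orbit m) := e ▸ MeasurableSet.iUnion hS
  ext C hC
  have key : ν (C ∩ 𝒢.orbit m) = ν' (C ∩ 𝒢.orbit m) := by
    refine measure_eq_of_forall_subset_cover _ hS (hC.inter hm)
      (Set.inter_subset_right.trans hcov) fun i D hD h1 _ => ?_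
    rw [← Measure.restrict_eq_self ν h1, ← Measure.restrict_eq_self ν' h1,
      h.restrict_image_θ 𝒢 (b i), h'.restrict_image_θ 𝒢 (b i)]
  have h0 : ν (C \ 𝒢.orbit m) = 0 := measure_mono_null (fun y hy => hy.2) h.support
  have h0' : ν' (C \ 𝒢.orbit m) = 0 := measure_mono_null (fun y hy => hy.2) h'.support
  rw [← measure_inter_add_sdiff C hm, ← measure_inter_add_sdiff (μ := ν') C hm, key, h0, h0']

theorem IsOrbitMeasure.aemeasurable_rightTorsorMeasure (hν : 𝒢.IsOrbitMeasure ν m)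
    (h : 𝒢.IsIsotropyHaar η) : AEMeasurable (𝒢.rightTorsorMeasure η m) ν := by
  obtain ⟨b, hb⟩ := 𝒢.exists_box_cover m
  have e : ν.restrict (⋃ i, (b i).θ '' (b i).A) = ν := by
    refine Measure.restrict_eq_self_of_ae_mem (measure_mono_null (fun y hy (hy' : y ∈ 𝒢.orbit m) => hy ?_)
      hν.support)
    exact Set.mem_iUnion.2 (𝒢.exists_mem_image_θ hb hy')
  rw [← e, aemeasurable_iUnion_iff]
  exact fun i => aemeasurable_restrict_of_measurable_subtype (𝒢.measurableSet_image_θ (b i))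
    (h.measurable_rightTorsorMeasure_box 𝒢 (b i))

/-- The measure of all the leaves in the orbit of `m`. -/
noncomputable def orbitMeasure (m : M) : Measure M := (𝒢.exists_orbitMeasure m).choose

theorem isOrbitMeasure_orbitMeasure (m : M) : 𝒢.IsOrbitMeasure (𝒢.orbitMeasure m) m :=
  (𝒢.exists_orbitMeasure m).choose_spec

theorem orbitMeasure_eq_of_mem {m x : M} (hx : x ∈ 𝒢.orbit m) :
    𝒢.orbitMeasure x = 𝒢.orbitMeasure m :=
  (𝒢.isOrbitMeasure_orbitMeasure x).unique 𝒢
    (𝒢.isOrbitMeasure_of_mem_orbit (𝒢.isOrbitMeasure_orbitMeasure m) hx)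

/-- The measure on the source fibre at `m` defined by Haar measures on the isotropy groups. -/
noncomputable def canonicalMeasure (η : (x : M) → Measure (𝒢.Isotropy x)) (m : M) : Measure G :=
  (𝒢.orbitMeasure m).bind (𝒢.rightTorsorMeasure η m)

variable {𝒢}

theorem IsIsotropyHaar.canonicalMeasure_apply (h : 𝒢.IsIsotropyHaar η) (m : M) {C : Set G}
    (hC : MeasurableSet C) : 𝒢.canonicalMeasure η m C =
      ∫⁻ y, 𝒢.rightTorsorMeasure η m y C ∂(𝒢.orbitMeasure m) :=
  Measure.bind_apply hC ((𝒢.isOrbitMeasure_orbitMeasure m).aemeasurable_rightTorsorMeasure 𝒢 h)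

theorem IsIsotropyHaar.canonicalMeasure_support (h : 𝒢.IsIsotropyHaar η) (m : M) :
    𝒢.canonicalMeasure η m {g | 𝒢.src g ≠ m} = 0 := by
  have hm : MeasurableSet {g | 𝒢.src g ≠ m} :=
    (measurableSet_singleton m).compl.preimage 𝒢.contMDiff_src.continuous.measurable
  rw [h.canonicalMeasure_apply m hm, lintegral_eq_zero_of_ae_eq_zero]
  exact Filter.Eventually.of_forall fun y => 𝒢.rightTorsorMeasure_eq_zero η
    fun g hg hg' => (hg hg').elim

theorem measurableSet_tgt_preimage_leaf (x : M) : MeasurableSet (𝒢.tgt ⁻¹' 𝒢.leaf x) :=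
  (𝒢.measurableSet_leaf x).preimage 𝒢.contMDiff_tgt.continuous.measurable

/-- The canonical measure over one leaf. -/
theorem IsIsotropyHaar.canonicalMeasure_apply_leaf (h : 𝒢.IsIsotropyHaar η) (m x : M) {C : Set G}
    (hC : MeasurableSet C) (hx : C ⊆ 𝒢.tgt ⁻¹' 𝒢.leaf x) : 𝒢.canonicalMeasure η m C =
      ∫⁻ y in 𝒢.leaf x, 𝒢.rightTorsorMeasure η m y C ∂(𝒢.orbitMeasure m) := by
  rw [h.canonicalMeasure_apply m hC, ← lintegral_indicator (𝒢.measurableSet_leaf x)]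
  refine lintegral_congr fun y => ?_
  by_cases hy : y ∈ 𝒢.leaf x
  · rw [Set.indicator_of_mem hy]
  · rw [Set.indicator_of_notMem hy]
    exact 𝒢.rightTorsorMeasure_eq_zero η fun g hg _ hgy => hy (hgy ▸ hx hg)

/-- Each of the countably many boxes lies over a single leaf, so an orbit has only countably many
leaves. Hence prescribing a measure leaf by leaf, as `IsCanonicalRight` does, determines it. -/
theorem exists_countable_leaf_cover (m : M) :
    ∃ x : ℕ → M, 𝒢.src ⁻¹' {m} ⊆ ⋃ i, 𝒢.tgt ⁻¹' 𝒢.leaf (x i) := by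
  obtain ⟨b, hb⟩ := 𝒢.exists_box_cover m
  classical
  refine ⟨fun i => if H : (b i).A.Nonempty then (b i).θ H.some else m, fun g hg => ?_⟩
  obtain ⟨i, hi⟩ := 𝒢.exists_mem_image_θ hb (y := 𝒢.tgt g) ⟨g, hg, rfl⟩
  refine Set.mem_iUnion.2 ⟨i, ?_⟩
  have H : (b i).A.Nonempty := Set.image_nonempty.1 ⟨_, hi⟩
  simp only [Set.mem_preimage, dif_pos H]
  exact 𝒢.image_θ_subset_leaf (b i) (𝒢.mem_leaf_self _) ⟨_, H.some_mem, rfl⟩ hi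

/-- Measures on a source fibre can be compared over the leaves. -/
theorem measure_eq_of_leaves {μ μ' : Measure G} (hμ : μ {g | 𝒢.src g ≠ m} = 0)
    (hμ' : μ' {g | 𝒢.src g ≠ m} = 0) (h : ∀ x C, MeasurableSet C → C ⊆ 𝒢.tgt ⁻¹' 𝒢.leaf x →
      μ C = μ' C) : μ = μ' := by
  obtain ⟨x, hx⟩ := exists_countable_leaf_cover (𝒢 := 𝒢) m
  have hm : MeasurableSet (𝒢.src ⁻¹' {m}) :=
    (measurableSet_singleton m).preimage 𝒢.contMDiff_src.continuous.measurable
  ext C hC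
  have key : μ (C ∩ 𝒢.src ⁻¹' {m}) = μ' (C ∩ 𝒢.src ⁻¹' {m}) :=
    measure_eq_of_forall_subset_cover _ (fun i => measurableSet_tgt_preimage_leaf (x i))
      (hC.inter hm) (Set.inter_subset_right.trans hx) fun i D hD h1 _ => h (x i) D hD h1
  have h0 : μ (C \ 𝒢.src ⁻¹' {m}) = 0 := measure_mono_null (fun y hy => hy.2) hμ
  have h0' : μ' (C \ 𝒢.src ⁻¹' {m}) = 0 := measure_mono_null (fun y hy => hy.2) hμ'
  rw [← measure_inter_add_sdiff C hm, ← measure_inter_add_sdiff (μ := μ') C hm, key, h0, h0']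

/-- Liouville measures are unique and are restrictions of the orbit measure, so the leafwise
formulas combine to one integral. A leaf outside the orbit of `m` contributes 0 on both sides. -/
theorem isCanonicalRight_iff {μ : M → Measure G} :
    𝒢.IsCanonicalRight μ ↔ ∃ η, 𝒢.IsIsotropyHaar η ∧ μ = 𝒢.canonicalMeasure η := by
  constructor
  · rintro ⟨η, vol, h, hvol, hμ⟩
    refine ⟨η, h, funext fun m => ?_⟩
    refine measure_eq_of_leaves (hμ m).1 (h.canonicalMeasure_support m) fun x C hC hCx => ?_
    rw [(hμ m).2 x C hC hCx, h.canonicalMeasure_apply_leaf m x hC hCx]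
    by_cases hx : x ∈ 𝒢.orbit m
    · rw [(hvol x).unique 𝒢 ((𝒢.isOrbitMeasure_orbitMeasure m).isLiouvilleMeasure 𝒢 hx)]
    · have h0 : ∀ y, 𝒢.rightTorsorMeasure η m y C = 0 := fun y =>
        𝒢.rightTorsorMeasure_eq_zero η fun g hg hgm _ => hx (by
          have h1 : x ∈ 𝒢.orbit (𝒢.tgt g) :=
            𝒢.leaf_subset_orbit _ (Relation.EqvGen.symm _ _ (hCx hg))
          rwa [𝒢.orbit_eq_of_mem ⟨g, hgm, rfl⟩] at h1)
      simp [h0]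
  · rintro ⟨η, h, rfl⟩
    refine ⟨η, fun x => (𝒢.orbitMeasure x).restrict (𝒢.leaf x), h, fun x =>
      (𝒢.isOrbitMeasure_orbitMeasure x).isLiouvilleMeasure 𝒢 (𝒢.mem_orbit_self x), fun m =>
      ⟨h.canonicalMeasure_support m, fun x C hC hCx => ?_⟩⟩
    rw [h.canonicalMeasure_apply_leaf m x hC hCx]
    beta_reduce
    by_cases hx : x ∈ 𝒢.orbit m
    · rw [𝒢.orbitMeasure_eq_of_mem hx]
    · have h0 : ∀ y, 𝒢.rightTorsorMeasure η m y C = 0 := fun y =>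
        𝒢.rightTorsorMeasure_eq_zero η fun g hg hgm _ => hx (by
          have h1 : x ∈ 𝒢.orbit (𝒢.tgt g) :=
            𝒢.leaf_subset_orbit _ (Relation.EqvGen.symm _ _ (hCx hg))
          rwa [𝒢.orbit_eq_of_mem ⟨g, hgm, rfl⟩] at h1)
      simp [h0]

theorem exists_isCanonicalRight (hG : 𝒢.toLieGroupoid.IsotropyUnimodular) :
    ∃ μ, 𝒢.IsCanonicalRight μ := by
  obtain ⟨η, h⟩ := 𝒢.exists_isIsotropyHaar 𝒢.exists_arrow_of_sameLeaf hG
  exact ⟨_, isCanonicalRight_iff.2 ⟨η, h, rfl⟩⟩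

/-- Canonical measures are invariant under right translations. -/
theorem IsIsotropyHaar.canonicalMeasure_invariant (h : 𝒢.IsIsotropyHaar η) (g : G) (A : Set G)
    (hA : MeasurableSet A) :
    𝒢.canonicalMeasure η (𝒢.tgt g) {h | 𝒢.src h = 𝒢.tgt g ∧ 𝒢.mul h g ∈ A} =
      𝒢.canonicalMeasure η (𝒢.src g) A := by
  have hS : MeasurableSet {h | 𝒢.src h = 𝒢.tgt g} :=
    (measurableSet_singleton _).preimage 𝒢.contMDiff_src.continuous.measurable
  have hA' : MeasurableSet {h | 𝒢.src h = 𝒢.tgt g ∧ 𝒢.mul h g ∈ A} :=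
    measurableSet_inter_preimage_of_continuousOn (S := {h | 𝒢.src h = 𝒢.tgt g})
      (𝒢.continuousOn_mul_comp continuousOn_id continuousOn_const fun u hu => hu) hS hA
  rw [h.canonicalMeasure_apply _ hA', h.canonicalMeasure_apply _ hA,
    𝒢.orbitMeasure_eq_of_mem (𝒢.tgt_mem_orbit g)]
  refine lintegral_congr fun y => ?_
  have := h.right_invariant
  by_cases hy : y ∈ 𝒢.orbit (𝒢.tgt g)
  · obtain ⟨k, hk, hk'⟩ := hy
    have h1 : 𝒢.src (𝒢.mul k g) = 𝒢.src g := 𝒢.src_mul _ _ hk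
    have h2 : 𝒢.tgt (𝒢.mul k g) = y := (𝒢.tgt_mul _ _ hk).trans hk'
    -- The arrow k serves as reference at t(g) and kg at s(g), and (ak)g = a(kg). The base point y
    -- and the orbit measure are the same on both sides.
    rw [𝒢.rightTorsorMeasure_eq_map k hk hk', 𝒢.rightTorsorMeasure_eq_map _ h1 h2,
      Measure.map_apply (𝒢.continuous_mul_right k hk').measurable hA',
      Measure.map_apply (𝒢.continuous_mul_right _ h2).measurable hA]
    congr 1
    ext a
    have h3 : 𝒢.src a.1 = 𝒢.tgt k := a.2.1.trans hk'.symm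
    simp only [Set.mem_preimage, Set.mem_ofPred_eq, 𝒢.src_mul _ _ h3, hk, true_and,
      𝒢.mul_assoc _ _ _ h3 hk]
  · have hy' : y ∉ 𝒢.orbit (𝒢.src g) := by
      rwa [← 𝒢.orbit_eq_of_mem (𝒢.tgt_mem_orbit g)]
    rw [𝒢.rightTorsorMeasure_of_notMem hy, 𝒢.rightTorsorMeasure_of_notMem hy']
    rfl

end SymplecticGroupoid

/-! ### Uniqueness up to a Casimir function -/

theorem eq_of_nnreal_smul_haar_eq {H : Type*} [Group H] [TopologicalSpace H]
    [LocallyCompactSpace H] [MeasurableSpace H] [BorelSpace H] (η : Measure H)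
    [η.IsHaarMeasure] {a b : NNReal} (h : a • η = b • η) : a = b := by
  obtain ⟨K, hK⟩ : Nonempty (TopologicalSpace.PositiveCompacts H) := inferInstance
  have h1 : η K ≠ 0 := (Measure.measure_pos_of_nonempty_interior η hK).ne'
  have h2 := congrArg (fun ξ : Measure H => ξ K) h
  simp only [Measure.smul_apply, ENNReal.smul_def, smul_eq_mul] at h2
  exact ENNReal.coe_inj.1 ((ENNReal.mul_left_inj h1 K.isCompact.measure_lt_top.ne).1 h2)

namespace SymplecticGroupoid

variable {E F G M : Type*} [NormedAddCommGroup E] [NormedSpace ℝ E] [FiniteDimensional ℝ E]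
  [NormedAddCommGroup F] [NormedSpace ℝ F] [FiniteDimensional ℝ F]
  [TopologicalSpace G] [SecondCountableTopology G] [ChartedSpace E G] [IsManifold 𝓘(ℝ, E) ∞ G]
  [MeasurableSpace G] [BorelSpace G]
  [TopologicalSpace M] [T2Space M] [SecondCountableTopology M] [ChartedSpace F M]
  [IsManifold 𝓘(ℝ, F) ∞ M] [MeasurableSpace M] [BorelSpace M] {𝒢 : SymplecticGroupoid E F G M}
  {η η' : (x : M) → Measure (𝒢.Isotropy x)}

/-- Haar measures on one group differ by a positive factor. Conjugation by an arrow inside a leaf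
carries both choices along, so the factor is the same at the two ends. -/
theorem IsIsotropyHaar.exists_casimir (h : 𝒢.IsIsotropyHaar η) (h' : 𝒢.IsIsotropyHaar η') :
    ∃ c, 𝒢.IsPosCasimir c ∧ ∀ x, η' x = ENNReal.ofReal (c x) • η x := by
  have := h.haar
  have := h'.haar
  let c : M → NNReal := fun x => Measure.haarScalarFactor (η' x) (η x)
  have hc : ∀ x, η' x = c x • η x := fun x => Measure.isMulLeftInvariant_eq_smul (η' x) (η x)
  refine ⟨fun x => c x, ⟨fun x => NNReal.coe_pos.2
    (Measure.haarScalarFactor_pos_of_isHaarMeasure (η' x) (η x)), fun x y hxy => ?_⟩, fun x => ?_⟩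
  · obtain ⟨g, hs, ht⟩ := 𝒢.exists_arrow_of_sameLeaf hxy
    have h1 : c x • η y = c y • η y := by
      rw [← hc y, ← h'.map_conjEquiv hxy g hs ht, hc x, Measure.map_smul,
        h.map_conjEquiv hxy g hs ht]
    exact congrArg _ (eq_of_nnreal_smul_haar_eq _ h1)
  · rw [ENNReal.ofReal_coe_nnreal]
    exact hc x

theorem IsIsotropyHaar.smul (h : 𝒢.IsIsotropyHaar η) {c : M → ℝ} (hc : 𝒢.IsPosCasimir c) :
    𝒢.IsIsotropyHaar fun x => ENNReal.ofReal (c x) • η x where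
  haar x := by
    have := h.haar x
    exact Measure.IsHaarMeasure.smul _ (ENNReal.ofReal_pos.2 (hc.pos x)).ne' ENNReal.ofReal_ne_top
  right_invariant x := by
    have := h.right_invariant x
    infer_instance
  map_conj g hg := by
    rw [Measure.map_smul, h.map_conj g hg, hc.const _ _ hg]

theorem rightTorsorMeasure_smul (c : M → ENNReal) (m y : M) :
    𝒢.rightTorsorMeasure (fun x => c x • η x) m y = c y • 𝒢.rightTorsorMeasure η m y := by
  unfold LieGroupoid.rightTorsorMeasure
  split_ifs with H
  · rw [Measure.map_smul]
  · rw [smul_zero]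

/-- Over one leaf c ∘ t is constant. Working leaf by leaf also avoids any measurability of `c`,
which a Casimir function need not have. -/
theorem IsIsotropyHaar.canonicalMeasure_smul (h : 𝒢.IsIsotropyHaar η) {c : M → ℝ}
    (hc : 𝒢.IsPosCasimir c) (m : M) :
    𝒢.canonicalMeasure (fun x => ENNReal.ofReal (c x) • η x) m =
      (𝒢.canonicalMeasure η m).withDensity fun g => ENNReal.ofReal (c (𝒢.tgt g)) := by
  refine measure_eq_of_leaves ((h.smul hc).canonicalMeasure_support m)
    (withDensity_absolutelyContinuous _ _ (h.canonicalMeasure_support m)) fun x C hC hCx => ?_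
  rw [(h.smul hc).canonicalMeasure_apply m hC, withDensity_apply _ hC]
  have h1 : ∫⁻ g in C, ENNReal.ofReal (c (𝒢.tgt g)) ∂𝒢.canonicalMeasure η m =
      ∫⁻ _ in C, ENNReal.ofReal (c x) ∂𝒢.canonicalMeasure η m :=
    setLIntegral_congr_fun hC fun g hg => by rw [hc.const _ _ (hCx hg)]
  rw [h1, setLIntegral_const, h.canonicalMeasure_apply m hC,
    ← lintegral_const_mul' _ _ ENNReal.ofReal_ne_top]
  refine lintegral_congr fun y => ?_
  rw [rightTorsorMeasure_smul, Measure.smul_apply, smul_eq_mul]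
  by_cases hy : y ∈ 𝒢.leaf x
  · rw [hc.const _ _ hy]
  · rw [𝒢.rightTorsorMeasure_eq_zero η fun g hg _ hgy => hy (by
      rw [← hgy]; exact hCx hg), mul_zero, mul_zero]

/-- Canonical measures are unique up to a Casimir function. -/
theorem IsCanonicalRight.iff_casimir {μ μ' : M → Measure G} (hμ : 𝒢.IsCanonicalRight μ) :
    𝒢.IsCanonicalRight μ' ↔ ∃ c, 𝒢.IsPosCasimir c ∧
      ∀ m, μ' m = (μ m).withDensity fun g => ENNReal.ofReal (c (𝒢.tgt g)) := by
  obtain ⟨η, h, rfl⟩ := isCanonicalRight_iff.1 hμ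
  constructor
  · intro hμ'
    obtain ⟨η', h', rfl⟩ := isCanonicalRight_iff.1 hμ'
    obtain ⟨c, hc, hη⟩ := h.exists_casimir h'
    obtain rfl : η' = fun x => ENNReal.ofReal (c x) • η x := funext hη
    exact ⟨c, hc, fun m => h.canonicalMeasure_smul hc m⟩
  · rintro ⟨c, hc, hμ'⟩
    exact isCanonicalRight_iff.2 ⟨_, h.smul hc, funext fun m => by
      rw [hμ' m, h.canonicalMeasure_smul hc m]⟩

end SymplecticGroupoid

/-! ### Densities of canonical measures in boxes -/

namespace LieGroupoid.Box

variable {E F G M : Type*} [NormedAddCommGroup E] [NormedSpace ℝ E]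
  [NormedAddCommGroup F] [NormedSpace ℝ F]
  [TopologicalSpace G] [ChartedSpace E G] [TopologicalSpace M] [ChartedSpace F M]
  {𝒢 : LieGroupoid E F G M} {m : M} {l j : ℕ} (b : 𝒢.Box m l j)

theorem isFibreMap_Ψ {a : Fin l → ℝ} (ha : a ∈ b.A) :
    IsotropyChart.IsFibreMap (𝒢 := 𝒢) m (b.θ a) b.B fun c => b.Ψ (a, c) where
  isOpen := b.isOpen_B
  contMDiffOn := b.param.contMDiffOn.comp (t := b.A ×ˢ b.B)
    (contDiff_const.prodMk contDiff_id).contMDiff.contMDiffOn fun _ hc => ⟨ha, hc⟩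
  src_eq _ hc := b.src_Ψ ha hc
  tgt_eq c hc := b.tgt_Ψ a ha c hc

theorem jac_pos (q : 𝒢.IsotropyChart m j) {a : Fin l → ℝ} (ha : a ∈ b.A) {c : Fin j → ℝ}
    (hc : c ∈ b.B) : 0 < q.jac (fun c => b.Ψ (a, c)) c := by
  refine q.jac_pos (b.isFibreMap_Ψ ha) (p := fun g => (b.P g).2) hc ?_ fun c hc => ?_
  · have h1 := b.param.contMDiffOn_ret.contMDiffAt
      (b.param.isOpen_nhd.mem_nhds (b.param.mem_nhd (a, c) ⟨ha, hc⟩))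
    exact contDiff_snd.contMDiff.contMDiffAt.comp _ h1
  · rw [b.param.ret_param (a, c) ⟨ha, hc⟩]

theorem contDiffOn_jac (q : 𝒢.IsotropyChart m j) : ContDiffOn ℝ ∞
    (fun p : (Fin l → ℝ) × (Fin j → ℝ) => q.jac (fun c => b.Ψ (p.1, c)) p.2) (b.A ×ˢ b.B) :=
  q.contDiffOn_jac b.isOpen_A b.isOpen_B b.param.contMDiffOn (fun _ ha _ hc => b.src_Ψ ha hc)
    b.tgt_Ψ fun _ ha _ hc => b.jac_pos q ha hc

end LieGroupoid.Box

namespace SymplecticGroupoid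

variable {E F G M : Type*} [NormedAddCommGroup E] [NormedSpace ℝ E] [FiniteDimensional ℝ E]
  [NormedAddCommGroup F] [NormedSpace ℝ F] [FiniteDimensional ℝ F]
  [TopologicalSpace G] [SecondCountableTopology G] [ChartedSpace E G] [IsManifold 𝓘(ℝ, E) ∞ G]
  [MeasurableSpace G] [BorelSpace G]
  [TopologicalSpace M] [T2Space M] [SecondCountableTopology M] [ChartedSpace F M]
  [IsManifold 𝓘(ℝ, F) ∞ M] [MeasurableSpace M] [BorelSpace M] {𝒢 : SymplecticGroupoid E F G M}
  {η : (x : M) → Measure (𝒢.Isotropy x)} {m : M} {l j : ℕ}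

/-- The fibres over a box carry translates of a single Haar measure, so one constant `s` serves for
all `a`. The part of Ψ(D) over θ(a) is the slice of `D` at `a`. -/
theorem IsIsotropyHaar.rightTorsorMeasure_image_Ψ (h : 𝒢.IsIsotropyHaar η)
    (b : 𝒢.toLieGroupoid.Box m l j) (q : 𝒢.toLieGroupoid.IsotropyChart m j) :
    ∃ s : ℝ, 0 < s ∧ ∀ D ⊆ b.A ×ˢ b.B, MeasurableSet D → ∀ a ∈ b.A,
      𝒢.rightTorsorMeasure η m (b.θ a) (b.Ψ '' D) =
        ∫⁻ c in Prod.mk a ⁻¹' D, ENNReal.ofReal (s * q.jac (fun c => b.Ψ (a, c)) c) := by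
  obtain ⟨η', hη', H⟩ := h.exists_haar_box 𝒢 b
  obtain ⟨s, hs, hq⟩ := q.exists_map_haar_eq η'
  obtain ⟨c₁, hc₁⟩ := b.nonempty_B
  refine ⟨s, hs, fun D hD hDm a ha => ?_⟩
  have hi : Set.InjOn (fun c => b.Ψ (a, c)) b.B := fun c hc c' hc' hcc =>
    congrArg Prod.snd (b.param.injOn (Set.mk_mem_prod ha hc) (Set.mk_mem_prod ha hc') hcc)
  rw [← hq (b.θ a) b.B _ (b.isFibreMap_Ψ ha) hi (b.Ψ (a, c₁)) (b.src_Ψ ha hc₁)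
    (b.tgt_Ψ a ha c₁ hc₁) (Prod.mk a ⁻¹' D) (fun c hc => (hD hc).2) (measurable_prodMk_left hDm), ← H a ha c₁ hc₁]
  have hT : MeasurableSet (𝒢.tgt ⁻¹' {b.θ a}) :=
    (measurableSet_singleton _).preimage 𝒢.contMDiff_tgt.continuous.measurable
  rw [← measure_inter_add_sdiff _ hT, 𝒢.rightTorsorMeasure_eq_zero η (C := b.Ψ '' D \ 𝒢.tgt ⁻¹' {b.θ a})
    (fun g hg _ hgy => hg.2 hgy), add_zero]
  congr 1
  ext g
  constructor
  · rintro ⟨⟨⟨a', c⟩, hac, rfl⟩, hg⟩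
    have h1 : b.θ a' = b.θ a := by
      rw [← b.tgt_Ψ a' (hD hac).1 c (hD hac).2]; exact hg
    obtain rfl := b.injOn_θ (hD hac).1 ha h1
    exact ⟨c, hac, rfl⟩
  · rintro ⟨c, hc, rfl⟩
    exact ⟨⟨(a, c), hc, rfl⟩, b.tgt_Ψ a ha c (hD hc).2⟩

/-- Tonelli in the coordinates (a, c): the Liouville density in `a` is multiplied by the Haar
density in `c`. Both are smooth and positive. -/
theorem IsIsotropyHaar.canonicalMeasure_image_Ψ (h : 𝒢.IsIsotropyHaar η)
    (b : 𝒢.toLieGroupoid.Box m l j) (q : 𝒢.toLieGroupoid.IsotropyChart m j) :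
    ∃ s : ℝ, 0 < s ∧ ∀ D ⊆ b.A ×ˢ b.B, MeasurableSet D →
      𝒢.canonicalMeasure η m (b.Ψ '' D) = ∫⁻ p in D,
        ENNReal.ofReal (𝒢.leafDensity b.θ p.1 * (s * q.jac (fun c => b.Ψ (p.1, c)) p.2)) := by
  obtain ⟨s, hs, hK⟩ := h.rightTorsorMeasure_image_Ψ b q
  refine ⟨s, hs, fun D hD hDm => ?_⟩
  have hDm' : MeasurableSet (b.Ψ '' D) :=
    measurableSet_image_of_injOn (E := E) b.param.continuousOn b.param.injOn hDm hD
  have hν := 𝒢.isOrbitMeasure_orbitMeasure m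
  set ν := 𝒢.orbitMeasure m
  have hθm := 𝒢.measurableSet_image_θ b
  have hθ : AEMeasurable b.θ (volume.restrict b.A) :=
    b.contMDiffOn_θ.continuousOn.aemeasurable b.isOpen_A.measurableSet
  have hδ : AEMeasurable (fun a => ENNReal.ofReal (𝒢.leafDensity b.θ a)) (volume.restrict b.A) :=
    ((𝒢.contDiffOn_leafDensity b).continuousOn.aemeasurable b.isOpen_A.measurableSet).ennreal_ofReal
  let J : (Fin l → ℝ) × (Fin j → ℝ) → ENNReal := fun p =>
    ENNReal.ofReal (s * q.jac (fun c => b.Ψ (p.1, c)) p.2)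
  have hJ : AEMeasurable J (volume.restrict D) :=
    (((contDiffOn_const.mul (b.contDiffOn_jac q)).continuousOn.mono hD).aemeasurable
      hDm).ennreal_ofReal
  have hJ' : AEMeasurable (D.indicator J) (volume.prod volume) :=
    (aemeasurable_indicator_iff hDm).2 hJ
  have hJa : ∀ a, ∫⁻ c, D.indicator J (a, c) = ∫⁻ c in Prod.mk a ⁻¹' D, J (a, c) := fun a => by
    rw [← lintegral_indicator (measurable_prodMk_left hDm)]
    rfl
  -- the left-hand side as an integral over the box
  have e1 : 𝒢.canonicalMeasure η m (b.Ψ '' D) =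
      ∫⁻ a in b.A, ENNReal.ofReal (𝒢.leafDensity b.θ a) * ∫⁻ c, D.indicator J (a, c) := by
    have hKm : AEMeasurable (fun y => 𝒢.rightTorsorMeasure η m y (b.Ψ '' D)) ν :=
      (Measure.measurable_coe hDm').comp_aemeasurable (hν.aemeasurable_rightTorsorMeasure 𝒢 h)
    have h1 : ∀ᵐ a ∂(volume.withDensity fun a => ENNReal.ofReal (𝒢.leafDensity b.θ a)).restrict b.A,
        𝒢.rightTorsorMeasure η m (b.θ a) (b.Ψ '' D) = ∫⁻ c, D.indicator J (a, c) := by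
      refine (ae_restrict_iff' b.isOpen_A.measurableSet).2 (Filter.Eventually.of_forall fun a ha => ?_)
      rw [hK D hD hDm a ha, hJa a]
    have h2 : 𝒢.canonicalMeasure η m (b.Ψ '' D) =
        ∫⁻ y in b.θ '' b.A, 𝒢.rightTorsorMeasure η m y (b.Ψ '' D) ∂ν := by
      rw [h.canonicalMeasure_apply m hDm', ← lintegral_indicator hθm]
      refine lintegral_congr fun y => ?_
      by_cases hy : y ∈ b.θ '' b.A
      · rw [Set.indicator_of_mem hy]
      · rw [Set.indicator_of_notMem hy]
        refine 𝒢.rightTorsorMeasure_eq_zero η ?_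
        rintro _ ⟨⟨a, c⟩, hp, rfl⟩ _ hgy
        exact hy ⟨a, (hD hp).1, by rw [← hgy, b.tgt_Ψ a (hD hp).1 c (hD hp).2]⟩
    have hρ := hν.restrict_image_θ 𝒢 b
    have hKm' := hKm.restrict (s := b.θ '' b.A)
    rw [h2]
    rw [hρ, patchMeasure] at hKm' ⊢
    have hθ' : AEMeasurable b.θ
        ((volume.withDensity fun a => ENNReal.ofReal (𝒢.leafDensity b.θ a)).restrict b.A) :=
      b.contMDiffOn_θ.continuousOn.aemeasurable b.isOpen_A.measurableSet
    rw [lintegral_map' hKm' hθ', lintegral_congr_ae h1,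
      restrict_withDensity b.isOpen_A.measurableSet,
      lintegral_withDensity_eq_lintegral_mul₀ hδ hJ'.lintegral_prod_right'.restrict]
    rfl
  have e2 : ∀ p ∈ D, ENNReal.ofReal (𝒢.leafDensity b.θ p.1 *
      (s * q.jac (fun c => b.Ψ (p.1, c)) p.2)) =
      ENNReal.ofReal (𝒢.leafDensity b.θ p.1) * J p := fun p hp => ENNReal.ofReal_mul
    (𝒢.leafDensity_pos (b.injective_dθ (hD hp).1) (b.range_dθ _ (hD hp).1)).le
  rw [e1, setLIntegral_congr_fun hDm e2, ← lintegral_indicator hDm, Measure.volume_eq_prod,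
    lintegral_prod, ← lintegral_indicator b.isOpen_A.measurableSet]
  · refine lintegral_congr fun a => ?_
    by_cases ha : a ∈ b.A
    · rw [Set.indicator_of_mem ha, ← lintegral_const_mul' _ _ ENNReal.ofReal_ne_top]
      refine lintegral_congr fun c => ?_
      by_cases hp : (a, c) ∈ D
      · rw [Set.indicator_of_mem hp, Set.indicator_of_mem hp]
      · rw [Set.indicator_of_notMem hp, Set.indicator_of_notMem hp, mul_zero]
    · rw [Set.indicator_of_notMem ha]
      symm
      refine lintegral_eq_zero_of_ae_eq_zero (Filter.Eventually.of_forall fun c => ?_)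
      exact Set.indicator_of_notMem (fun hp => ha (hD hp).1) _
  · refine (aemeasurable_indicator_iff hDm).2 (AEMeasurable.mul ?_ hJ)
    exact (((𝒢.contDiffOn_leafDensity b).continuousOn.comp continuousOn_fst
      fun p hp => (hD hp).1).aemeasurable hDm).ennreal_ofReal

end SymplecticGroupoid

/-! ### Change of parametrisation and smoothness on the fibres -/

section

variable {E F N M X : Type*} [NormedAddCommGroup E] [NormedSpace ℝ E] [FiniteDimensional ℝ E]
  [NormedAddCommGroup F] [NormedSpace ℝ F] [FiniteDimensional ℝ F]
  [NormedAddCommGroup X] [NormedSpace ℝ X] [FiniteDimensional ℝ X] [MeasurableSpace X]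
  [BorelSpace X]
  [TopologicalSpace N] [ChartedSpace E N] [MeasurableSpace N]
  [TopologicalSpace M] [ChartedSpace F M] [IsManifold 𝓘(ℝ, F) ∞ M]

/-- Boxes are parametrised by a product space and patches by ℝᵏ. A linear isomorphism between the
two changes Lebesgue measure by a constant only. -/
theorem exists_setLIntegral_image_symm {k : ℕ} (lam : Measure X) [lam.IsAddHaarMeasure]
    (L : X ≃L[ℝ] (Fin k → ℝ)) : ∃ c : ℝ, 0 < c ∧ ∀ (f : X → ENNReal) (B : Set (Fin k → ℝ)),
      ∫⁻ x in L.symm '' B, f x ∂lam = ENNReal.ofReal c * ∫⁻ v in B, f (L.symm v) := by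
  have h := Measure.isAddLeftInvariant_eq_smul lam ((volume : Measure (Fin k → ℝ)).map L.symm)
  refine ⟨_, NNReal.coe_pos.2 (Measure.addHaarScalarFactor_pos_of_isAddHaarMeasure lam
    ((volume : Measure (Fin k → ℝ)).map L.symm)), fun f B => ?_⟩
  have hL : MeasurableEmbedding L.symm := L.symm.toHomeomorph.measurableEmbedding
  rw [ENNReal.ofReal_coe_nnreal]
  conv_lhs => rw [h]
  rw [Measure.restrict_smul, lintegral_smul_measure, hL.restrict_map, hL.lintegral_map,
    L.symm.injective.preimage_image]
  rfl

/-- A measure which has a smooth density in one parametrisation of a fibre of a submersion has one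
in all others. -/
theorem exists_density_of_isLocalParam {p : N → M}
    (hp : Manifold.IsSubmersion 𝓘(ℝ, E) 𝓘(ℝ, F) ∞ p) {x : M} {O : Set X} {Ψ : X → N} {W : Set N}
    {P : N → X} (hΨ : IsLocalParam (E := E) (p ⁻¹' {x}) O Ψ W P)
    (hX : Module.finrank ℝ X = Module.finrank ℝ E - Module.finrank ℝ F)
    (lam : Measure X) [lam.IsAddHaarMeasure] {δ : X → ℝ} (hδ : ContDiffOn ℝ ∞ δ O)
    (hδp : ∀ y ∈ O, 0 < δ y) {μ : Measure N}
    (hμ : ∀ D ⊆ O, MeasurableSet D → μ (Ψ '' D) = ∫⁻ y in D, ENNReal.ofReal (δ y) ∂lam)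
    {k : ℕ} {U : Set (Fin k → ℝ)} {φ : (Fin k → ℝ) → N} (hφ : IsPatch (E := E) (p ⁻¹' {x})
      (fun g => {v | mfderiv 𝓘(ℝ, E) 𝓘(ℝ, F) p g v = 0}) k U φ) {u₀ : Fin k → ℝ} (hu₀ : u₀ ∈ U)
    (hW : φ u₀ ∈ W) : ∃ V ⊆ U, IsOpen V ∧ u₀ ∈ V ∧ ∃ ρ : (Fin k → ℝ) → ℝ, ContDiffOn ℝ ∞ ρ V ∧
      (∀ v ∈ V, 0 < ρ v) ∧
      ∀ A ⊆ V, MeasurableSet A → μ (φ '' A) = ∫⁻ u in A, ENNReal.ofReal (ρ u) := by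
  have hφc := hφ.contMDiffOn.continuousOn
  have hV : IsOpen (U ∩ φ ⁻¹' W) := hφc.isOpen_inter_preimage hφ.isOpen hΨ.isOpen_nhd
  set V := U ∩ φ ⁻¹' W with hVdef
  have hτO : ∀ u ∈ V, P (φ u) ∈ O := fun u hu => hΨ.ret_mem _ hu.2 (hφ.mem u hu.1)
  have hΨτ : ∀ u ∈ V, Ψ (P (φ u)) = φ u := fun u hu => hΨ.param_ret _ hu.2 (hφ.mem u hu.1)
  have hτ : ContDiffOn ℝ ∞ (fun u => P (φ u)) V := contMDiffOn_iff_contDiffOn.1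
    (hΨ.contMDiffOn_ret.comp (hφ.contMDiffOn.mono Set.inter_subset_left) fun u hu => hu.2)
  have hkX : Module.finrank ℝ X = Module.finrank ℝ (Fin k → ℝ) := by
    have h1 : Module.finrank ℝ (dparam (E := E) φ u₀).range = Module.finrank ℝ (Fin k → ℝ) :=
      LinearMap.finrank_range_of_inj (f := (dparam (E := E) φ u₀).toLinearMap)
        (hφ.injective_mfderiv u₀ hu₀)
    have h2 := finrank_ker_mfderiv_of_isSubmersion hp (φ u₀)
    let D : E →L[ℝ] F := mfderiv 𝓘(ℝ, E) 𝓘(ℝ, F) p (φ u₀)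
    change Module.finrank ℝ D.ker = _ at h2
    have h3 : (dparam (E := E) φ u₀).range = D.ker := SetLike.ext' (hφ.range_mfderiv u₀ hu₀)
    rw [hX, ← h1, h3, h2]
  let L : X ≃L[ℝ] (Fin k → ℝ) := ContinuousLinearEquiv.ofFinrankEq hkX
  -- The change of coordinates between the two parametrisations, as a map of ℝᵏ. Since φ = Ψ ∘ L⁻¹ ∘
  -- T is an immersion, the derivative of T is injective, so its determinant does not vanish.
  let T : (Fin k → ℝ) → (Fin k → ℝ) := fun u => L (P (φ u))
  have hT : ContDiffOn ℝ ∞ T V := L.contDiff.comp_contDiffOn hτ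
  have hTd : ∀ u ∈ V, DifferentiableAt ℝ T u := fun u hu =>
    (hT.contDiffAt (hV.mem_nhds hu)).differentiableAt (by simp)
  have hdet : ∀ u ∈ V, (fderiv ℝ T u).det ≠ 0 := by
    intro u hu
    have hinj : Function.Injective (fderiv ℝ T u) := by
      have e1 : φ =ᶠ[𝓝 u] (fun v => Ψ (L.symm v)) ∘ T := by
        filter_upwards [hV.mem_nhds hu] with v hv
        simp [T, hΨτ v hv]
      have hO : L.symm (T u) ∈ O := by simpa [T] using hτO u hu
      have hΨL : MDifferentiableAt 𝓘(ℝ, Fin k → ℝ) 𝓘(ℝ, E) (fun v => Ψ (L.symm v)) (T u) :=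
        (hΨ.mdifferentiableAt hO).comp (T u) L.symm.differentiableAt.mdifferentiableAt
      have e2 := mfderiv_comp u hΨL (hTd u hu).mdifferentiableAt
      rw [← e1.mfderiv_eq, mfderiv_eq_fderiv] at e2
      intro v w hvw
      apply hφ.injective_mfderiv u hu.1
      rw [e2]
      exact congrArg (mfderiv 𝓘(ℝ, Fin k → ℝ) 𝓘(ℝ, E) (fun v => Ψ (L.symm v)) (T u)) hvw
    intro h0
    have h1 := LinearMap.bot_lt_ker_of_det_eq_zero (f := (fderiv ℝ T u).toLinearMap) h0
    rw [LinearMap.ker_eq_bot.2 hinj] at h1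
    exact lt_irrefl _ h1
  obtain ⟨c, hc, hcL⟩ := exists_setLIntegral_image_symm lam L
  refine ⟨V, Set.inter_subset_left, hV, ⟨hu₀, hW⟩,
    fun u => c * (|(fderiv ℝ T u).det| * δ (P (φ u))), ?_, fun v hv => ?_, fun A hAV hA => ?_⟩
  · refine contDiffOn_const.mul (ContDiffOn.mul ?_ (hδ.comp hτ hτO))
    have h1 : ContDiffOn ℝ ∞ (fun u => (fderiv ℝ T u).det) V :=
      contDiff_det.comp_contDiffOn (hT.fderiv_of_isOpen hV (by simp))
    exact fun u hu => (h1 u hu).abs (hdet u hu)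
  · exact mul_pos hc (mul_pos (abs_pos.2 (hdet v hv)) (hδp _ (hτO v hv)))
  · have hTi : Set.InjOn T A := fun u hu v hv huv => by
      apply hφ.injOn (hAV hu).1 (hAV hv).1
      rw [← hΨτ u (hAV hu), ← hΨτ v (hAV hv), L.injective huv]
    have hTA : MeasurableSet (T '' A) :=
      hA.image_of_continuousOn_injOn (hT.continuousOn.mono hAV) hTi
    have e1 : φ '' A = Ψ '' (L.symm '' (T '' A)) := by
      rw [Set.image_image, Set.image_image]
      refine Set.image_congr fun u hu => ?_
      simp [T, hΨτ u (hAV hu)]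
    have hLT : MeasurableSet (L.symm '' (T '' A)) :=
      L.symm.toHomeomorph.measurableEmbedding.measurableSet_image.2 hTA
    rw [e1, hμ _ ?_ hLT, hcL,
      lintegral_image_eq_lintegral_abs_det_fderiv_mul volume hA
        (fun u hu => (hTd u (hAV hu)).hasFDerivAt.hasFDerivWithinAt) hTi,
      ← lintegral_const_mul' _ _ ENNReal.ofReal_ne_top]
    · refine setLIntegral_congr_fun hA fun u hu => ?_
      simp only [T, L.symm_apply_apply]
      rw [ENNReal.ofReal_mul hc.le, ENNReal.ofReal_mul (abs_nonneg _)]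
    · rintro _ ⟨_, ⟨u, hu, rfl⟩, rfl⟩
      simpa [T] using hτO u (hAV hu)

end

namespace SymplecticGroupoid

variable {E F G M : Type*} [NormedAddCommGroup E] [NormedSpace ℝ E] [FiniteDimensional ℝ E]
  [NormedAddCommGroup F] [NormedSpace ℝ F] [FiniteDimensional ℝ F]
  [TopologicalSpace G] [SecondCountableTopology G] [ChartedSpace E G] [IsManifold 𝓘(ℝ, E) ∞ G]
  [MeasurableSpace G] [BorelSpace G]
  [TopologicalSpace M] [T2Space M] [SecondCountableTopology M] [ChartedSpace F M]
  [IsManifold 𝓘(ℝ, F) ∞ M] [MeasurableSpace M] [BorelSpace M] {𝒢 : SymplecticGroupoid E F G M}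
  {η : (x : M) → Measure (𝒢.Isotropy x)}

/-- The product densities in boxes are transferred to the given patch, and the resulting local
densities are glued by `exists_smooth_density`. -/
theorem IsIsotropyHaar.isSmoothOnFibres (h : 𝒢.IsIsotropyHaar η) :
    LieGroupoid.IsSmoothOnFibres (E := E) (F := F) 𝒢.src (𝒢.canonicalMeasure η) := by
  refine ⟨h.canonicalMeasure_support, fun m k U φ hφ => ?_⟩
  obtain ⟨lam, hlam⟩ := exists_pullback_measure (𝒢.canonicalMeasure η m)
    hφ.isOpen.measurableSet hφ.injOn fun A hA hAm =>
      measurableSet_image_of_injOn (E := E) hφ.contMDiffOn.continuousOn hφ.injOn hAm hA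
  obtain ⟨ρ, hρ, hρp, hρA⟩ := exists_smooth_density lam (U := U) fun u hu => by
    obtain ⟨b₁, hb₁⟩ := 𝒢.exists_box_of_src (𝒢.unit m) (𝒢.src_unit m)
    obtain ⟨q⟩ := b₁.nonempty_isotropyChart hb₁
    obtain ⟨b, hb⟩ := 𝒢.exists_box_of_src (φ u) (hφ.mem u hu)
    obtain ⟨s, hs, hμ⟩ := h.canonicalMeasure_image_Ψ b q
    -- Truncated subtraction: this inequality is needed for l + (k − l) = k.
    have hl : Module.finrank ℝ (𝒢.orbitSpace m) ≤ Module.finrank ℝ E - Module.finrank ℝ F := by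
      rw [← 𝒢.finrank_ker_dsrc (𝒢.unit m)]
      have h1 := Submodule.finrank_map_le (𝒢.dtgt (𝒢.unit m)).toLinearMap (𝒢.dsrc (𝒢.unit m)).ker
      exact h1
    have : (volume : Measure ((Fin (Module.finrank ℝ (𝒢.orbitSpace m)) → ℝ) ×
        (Fin (Module.finrank ℝ E - Module.finrank ℝ F -
          Module.finrank ℝ (𝒢.orbitSpace m)) → ℝ))).IsAddHaarMeasure :=
      Measure.prod.instIsAddHaarMeasure _ _
    have key := exists_density_of_isLocalParam 𝒢.isSubmersion_src b.param
      (by rw [Module.finrank_prod]; simp; omega) volume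
      (((𝒢.contDiffOn_leafDensity b).comp contDiffOn_fst fun p hp => hp.1).mul
        (contDiffOn_const.mul (b.contDiffOn_jac q)))
      (fun p hp => mul_pos (𝒢.leafDensity_pos (b.injective_dθ hp.1) (b.range_dθ _ hp.1))
        (mul_pos hs (b.jac_pos q hp.1 hp.2))) hμ hφ hu hb
    obtain ⟨V, hVU, hV, huV, ρ, hρ, hρp, hA⟩ := key
    exact ⟨V, hV, huV, ρ, hρ, hρp, fun A hAV hAm => by
      rw [hlam A (hAV.trans hVU) hAm, hA A hAV hAm]⟩
  exact ⟨ρ, hρ, hρp, fun A hA hAm => by rw [← hlam A hA hAm, hρA A hA hAm]⟩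

end SymplecticGroupoid

/-! ### Smoothness along the orbits -/

namespace LieGroupoid

variable {E F G M : Type*} [NormedAddCommGroup E] [NormedSpace ℝ E] [FiniteDimensional ℝ E]
  [NormedAddCommGroup F] [NormedSpace ℝ F] [FiniteDimensional ℝ F]
  [TopologicalSpace G] [SecondCountableTopology G] [ChartedSpace E G]
  [MeasurableSpace G] [BorelSpace G]
  [TopologicalSpace M] [T2Space M] [ChartedSpace F M] [IsManifold 𝓘(ℝ, F) ∞ M]

theorem isPatch_of_isLocalParam {p : G → M} (hp : Manifold.IsSubmersion 𝓘(ℝ, E) 𝓘(ℝ, F) ∞ p)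
    {x : M} {k : ℕ} {U : Set (Fin k → ℝ)} {ψ : (Fin k → ℝ) → G} {W : Set G} {r : G → (Fin k → ℝ)}
    (hψ : IsLocalParam (E := E) (p ⁻¹' {x}) U ψ W r)
    (hk : k = Module.finrank ℝ E - Module.finrank ℝ F) :
    IsPatch (E := E) (p ⁻¹' {x}) (fun g => {v | mfderiv 𝓘(ℝ, E) 𝓘(ℝ, F) p g v = 0}) k U ψ where
  isOpen := hψ.isOpen_dom
  contMDiffOn := hψ.contMDiffOn
  injOn := hψ.injOn
  mem := hψ.mem
  injective_mfderiv _ hu := hψ.injective_mfderiv hu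
  range_mfderiv u hu := by
    have h1 := range_mfderiv_of_isLocalParam_fibre hp hψ (by simpa using hk) hu
    exact congrArg (fun S : Submodule ℝ E => (S : Set E)) h1

variable (𝒢 : LieGroupoid E F G M) {μ : M → Measure G}

theorem IsSmoothOnFibres.measure_image_lt_top {p : G → M}
    (hμ : IsSmoothOnFibres (E := E) (F := F) p μ) {m : M} {k : ℕ} {U Q : Set (Fin k → ℝ)}
    {φ : (Fin k → ℝ) → G} (hφ : IsPatch (E := E) (p ⁻¹' {m})
      (fun g => {v | mfderiv 𝓘(ℝ, E) 𝓘(ℝ, F) p g v = 0}) k U φ) (hQ : IsCompact Q) (hQU : Q ⊆ U) :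
    μ m (φ '' Q) < ⊤ := by
  obtain ⟨ρ, hρ, -, h⟩ := hμ.density m k U φ hφ
  rw [h Q hQU hQ.measurableSet]
  exact ((hρ.continuousOn.mono hQU).integrableOn_compact hQ).lintegral_lt_top

theorem measurableSet_src_fibre (m : M) : MeasurableSet (𝒢.src ⁻¹' {m}) :=
  (isClosed_singleton.preimage 𝒢.contMDiff_src.continuous).measurableSet

/-- Right invariance, for integrals. -/
theorem integral_tgt_eq_of_invariant (hμ : ∀ m, μ m {g | 𝒢.src g ≠ m} = 0)
    (hinv : ∀ (g : G) (A : Set G), MeasurableSet A →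
      μ (𝒢.tgt g) {h | 𝒢.src h = 𝒢.tgt g ∧ 𝒢.mul h g ∈ A} = μ (𝒢.src g) A)
    {f : G → ℝ} (hf : Continuous f) (g : G) :
    ∫ h, f h ∂(μ (𝒢.tgt g)) = ∫ h, f (𝒢.mul h (𝒢.inv g)) ∂(μ (𝒢.src g)) := by
  set S := 𝒢.src ⁻¹' {𝒢.src g} with hS
  have hSm : MeasurableSet S := 𝒢.measurableSet_src_fibre _
  have hr : (μ (𝒢.src g)).restrict S = μ (𝒢.src g) := Measure.restrict_eq_self_of_ae_mem (hμ _)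
  have hc : ContinuousOn (fun h => 𝒢.mul h (𝒢.inv g)) S :=
    𝒢.continuousOn_mul_comp continuousOn_id continuousOn_const fun u hu =>
      (show 𝒢.src u = _ from hu).trans (𝒢.tgt_inv g).symm
  have hae : AEMeasurable (fun h => 𝒢.mul h (𝒢.inv g)) (μ (𝒢.src g)) := by
    rw [← hr]; exact hc.aemeasurable hSm
  have key : (μ (𝒢.src g)).map (fun h => 𝒢.mul h (𝒢.inv g)) = μ (𝒢.tgt g) := by
    ext A hA
    have h1 := hinv (𝒢.inv g) A hA
    rw [𝒢.tgt_inv, 𝒢.src_inv] at h1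
    rw [← hr, restrict_map_apply_of_continuousOn _ hSm hc hA, ← h1]
    rfl
  rw [← key, integral_map hae hf.aestronglyMeasurable]

theorem contDiffOn_mul_inv {k l : ℕ} {m : M} {U : Set (Fin k → ℝ)} {ψ : (Fin k → ℝ) → G}
    {W : Set G} {r : G → (Fin k → ℝ)} (hψ : IsLocalParam (E := E) (𝒢.src ⁻¹' {m}) U ψ W r)
    {U' : Set (Fin l → ℝ)} {ψ' : (Fin l → ℝ) → G} {W' : Set G} {r' : G → (Fin l → ℝ)}
    (hψ' : IsLocalParam (E := E) (𝒢.src ⁻¹' {m}) U' ψ' W' r')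
    {f : G → ℝ} (hf : ContMDiff 𝓘(ℝ, E) 𝓘(ℝ, ℝ) ∞ f) :
    ContDiffOn ℝ ∞ (fun p : (Fin k → ℝ) × (Fin l → ℝ) => f (𝒢.mul (ψ' p.2) (𝒢.inv (ψ p.1))))
      (U ×ˢ U') := by
  rw [← contMDiffOn_iff_contDiffOn]
  refine hf.comp_contMDiffOn (𝒢.contMDiffOn_mul_comp ?_ ?_ fun p hp => ?_)
  · exact hψ'.contMDiffOn.comp (t := U') contDiff_snd.contMDiff.contMDiffOn fun p hp => hp.2
  · exact 𝒢.contMDiff_inv.comp_contMDiffOn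
      (hψ.contMDiffOn.comp (t := U) contDiff_fst.contMDiff.contMDiffOn fun p hp => hp.1)
  · rw [𝒢.tgt_inv, show 𝒢.src (ψ p.1) = m from hψ.mem _ hp.1]
    exact hψ'.mem _ hp.2

/-- The arrows `h` for which `h g⁻¹` meets a compact set are in a compact set, when `g` is. -/
theorem exists_isCompact_mul {k : ℕ} {m : M} {ψ : (Fin k → ℝ) → G} {K : Set G} (hK : IsCompact K)
    {Q : Set (Fin k → ℝ)} (hQ : IsCompact Q) (hψ : ContinuousOn ψ Q)
    (hm : ∀ u ∈ Q, 𝒢.src (ψ u) = m) :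
    ∃ C, IsCompact C ∧ C ⊆ 𝒢.src ⁻¹' {m} ∧ ∀ u ∈ Q, ∀ h, 𝒢.src h = m →
      𝒢.mul h (𝒢.inv (ψ u)) ∈ K → h ∈ C := by
  have : CompactSpace (K ×ˢ Q) := isCompact_iff_compactSpace.1 (hK.prod hQ)
  have h1 : Continuous fun p : (K ×ˢ Q : Set (G × (Fin k → ℝ))) => p.1.1 :=
    continuous_fst.comp continuous_subtype_val
  have h2 : Continuous fun p : (K ×ˢ Q : Set (G × (Fin k → ℝ))) => ψ p.1.2 :=
    hψ.comp_continuous (continuous_snd.comp continuous_subtype_val) fun p => p.2.2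
  -- If k = hψ(u)⁻¹ lies in `K`, then h = kψ(u); so the compact set is the image of the composable
  -- pairs in K × Q. These form a closed subset because `M` is Hausdorff.
  let Z : Set (K ×ˢ Q : Set (G × (Fin k → ℝ))) := {p | 𝒢.src p.1.1 = 𝒢.tgt (ψ p.1.2)}
  have hZ : IsCompact Z := (isClosed_eq (𝒢.contMDiff_src.continuous.comp h1)
    (𝒢.contMDiff_tgt.continuous.comp h2)).isCompact
  have hc : ContinuousOn (fun p : (K ×ˢ Q : Set (G × (Fin k → ℝ))) => 𝒢.mul p.1.1 (ψ p.1.2)) Z :=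
    𝒢.continuousOn_mul_comp h1.continuousOn h2.continuousOn fun p hp => hp
  refine ⟨_, hZ.image_of_continuousOn hc, ?_, fun u hu h hh hhK => ?_⟩
  · rintro _ ⟨p, hp, rfl⟩
    exact (𝒢.src_mul _ _ hp).trans (hm _ p.2.2)
  · have h3 : 𝒢.src h = 𝒢.tgt (𝒢.inv (ψ u)) := by rw [𝒢.tgt_inv, hh, hm u hu]
    refine ⟨⟨(_, u), hhK, hu⟩, ?_, 𝒢.mul_inv_mul h (ψ u) (hh.trans (hm u hu).symm)⟩
    change 𝒢.src (𝒢.mul h (𝒢.inv (ψ u))) = 𝒢.tgt (ψ u)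
    rw [𝒢.src_mul _ _ h3, 𝒢.src_inv]

/-- Smoothness of the integrals over small pieces of a source fibre. -/
theorem contDiffOn_setIntegral_mul_inv (hμ : IsSmoothOnFibres (E := E) (F := F) 𝒢.src μ) {m : M}
    {k : ℕ} (hk : k = Module.finrank ℝ E - Module.finrank ℝ F) {U : Set (Fin k → ℝ)}
    {ψ : (Fin k → ℝ) → G} {W : Set G} {r : G → (Fin k → ℝ)}
    (hψ : IsLocalParam (E := E) (𝒢.src ⁻¹' {m}) U ψ W r)
    {U' : Set (Fin k → ℝ)} {ψ' : (Fin k → ℝ) → G} {W' : Set G} {r' : G → (Fin k → ℝ)}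
    (hψ' : IsLocalParam (E := E) (𝒢.src ⁻¹' {m}) U' ψ' W' r')
    {f : G → ℝ} (hf : ContMDiff 𝓘(ℝ, E) 𝓘(ℝ, ℝ) ∞ f) {Q : Set (Fin k → ℝ)} (hQ : IsCompact Q)
    (hQU : Q ⊆ U') {S : Set G} (hS : MeasurableSet S) (hSQ : S ⊆ ψ' '' Q) :
    ContDiffOn ℝ ∞ (fun u => ∫ h in S, f (𝒢.mul h (𝒢.inv (ψ u))) ∂(μ m)) U ∧
      ∀ u ∈ U, IntegrableOn (fun h => f (𝒢.mul h (𝒢.inv (ψ u)))) S (μ m) := by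
  have hψr : ∀ h ∈ S, r' h ∈ Q ∧ ψ' (r' h) = h := by
    intro h hh
    obtain ⟨v, hv, rfl⟩ := hSQ hh
    rw [hψ'.ret_param v (hQU hv)]
    exact ⟨hv, rfl⟩
  have hSW : S ⊆ W' := fun h hh => by
    rw [← (hψr h hh).2]; exact hψ'.mem_nhd _ (hQU (hψr h hh).1)
  have hr : AEMeasurable r' ((μ m).restrict S) :=
    (hψ'.contMDiffOn_ret.continuousOn.mono hSW).aemeasurable hS
  -- Moves the integral over `S` to a compactly carried finite measure on ℝᵏ, where smooth
  -- dependence on the parameter `u` is available.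
  set ν := ((μ m).restrict S).map r' with hν
  have hfin : IsFiniteMeasure ((μ m).restrict S) := by
    refine isFiniteMeasure_restrict.2 (lt_of_le_of_lt (measure_mono hSQ)
      (hμ.measure_image_lt_top (isPatch_of_isLocalParam 𝒢.isSubmersion_src hψ' hk) hQ hQU)).ne
  have hνQ : ν Qᶜ = 0 := by
    rw [hν, Measure.map_apply_of_aemeasurable hr hQ.measurableSet.compl,
      Measure.restrict_apply' hS]
    convert measure_empty (μ := μ m)
    ext h
    simp only [Set.mem_inter_iff, Set.mem_preimage, Set.mem_compl_iff, Set.mem_empty_iff_false,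
      iff_false, not_and]
    exact fun h1 h2 => h1 (hψr h h2).1
  have hνr : ν.restrict Q = ν := Measure.restrict_eq_self_of_ae_mem hνQ
  have hc := 𝒢.contDiffOn_mul_inv hψ hψ' hf
  have hcu : ∀ u ∈ U, ContinuousOn (fun v => f (𝒢.mul (ψ' v) (𝒢.inv (ψ u)))) Q := fun u hu =>
    hc.continuousOn.comp (f := fun v => (u, v)) (by fun_prop) fun v hv => ⟨hu, hQU hv⟩
  have hi : ∀ u ∈ U, Integrable (fun v => f (𝒢.mul (ψ' v) (𝒢.inv (ψ u)))) ν := fun u hu => by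
    rw [← hνr]; exact (hcu u hu).integrableOn_compact hQ
  refine ⟨(contDiffOn_integral_param hψ.isOpen_dom hQ hψ'.isOpen_dom hQU ν hνQ hc).congr
    fun u hu => ?_, fun u hu => ?_⟩
  · rw [integral_map hr (hi u hu).aestronglyMeasurable]
    exact setIntegral_congr_fun hS fun h hh => by rw [(hψr h hh).2]
  · have h1 := (integrable_map_measure (hi u hu).aestronglyMeasurable hr).1 (hi u hu)
    exact (integrableOn_congr_fun (fun h hh => by
      simp only [Function.comp_apply, (hψr h hh).2]) hS).1 h1

/-- For `u` near `u₀` only arrows in a fixed compact subset of the fibre contribute, and this subset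
is covered by finitely many parametrised pieces. -/
theorem contDiffOn_integral_mul_inv (hμ : IsSmoothOnFibres (E := E) (F := F) 𝒢.src μ) {m : M}
    {U : Set (Fin (Module.finrank ℝ E - Module.finrank ℝ F) → ℝ)}
    {ψ : (Fin (Module.finrank ℝ E - Module.finrank ℝ F) → ℝ) → G} {W : Set G}
    {r : G → (Fin (Module.finrank ℝ E - Module.finrank ℝ F) → ℝ)}
    (hψ : IsLocalParam (E := E) (𝒢.src ⁻¹' {m}) U ψ W r)
    {f : G → ℝ} (hf : ContMDiff 𝓘(ℝ, E) 𝓘(ℝ, ℝ) ∞ f) (hfc : HasCompactSupport f) :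
    ContDiffOn ℝ ∞ (fun u => ∫ h, f (𝒢.mul h (𝒢.inv (ψ u))) ∂(μ m)) U := by
  intro u₀ hu₀
  obtain ⟨Q, hQ, hu₀Q, hQU⟩ := exists_compact_subset hψ.isOpen_dom hu₀
  obtain ⟨C, hC, hCm, hCK⟩ := 𝒢.exists_isCompact_mul (m := m) hfc hQ (hψ.continuousOn.mono hQU)
    fun u hu => hψ.mem u (hQU hu)
  -- The property is required of all measurable subsets of `S`, so that it passes to unions: the
  -- overlap of two pieces can be removed from one of them.
  have key : ∃ S, C ⊆ S ∧ MeasurableSet S ∧ ∀ S' ⊆ S, MeasurableSet S' →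
      ContDiffOn ℝ ∞ (fun u => ∫ h in S', f (𝒢.mul h (𝒢.inv (ψ u))) ∂(μ m)) U ∧
      ∀ u ∈ U, IntegrableOn (fun h => f (𝒢.mul h (𝒢.inv (ψ u)))) S' (μ m) := by
    refine hC.induction_on (p := fun C => ∃ S, C ⊆ S ∧ MeasurableSet S ∧ ∀ S' ⊆ S,
      MeasurableSet S' →
      ContDiffOn ℝ ∞ (fun u => ∫ h in S', f (𝒢.mul h (𝒢.inv (ψ u))) ∂(μ m)) U ∧
      ∀ u ∈ U, IntegrableOn (fun h => f (𝒢.mul h (𝒢.inv (ψ u)))) S' (μ m)) ?_ ?_ ?_ ?_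
    · refine ⟨∅, subset_rfl, MeasurableSet.empty, fun S' hS' _ => ?_⟩
      rw [Set.subset_empty_iff.1 hS']
      simp [contDiffOn_const]
    · rintro C₁ C₂ h12 ⟨S, hS, h⟩
      exact ⟨S, h12.trans hS, h⟩
    · rintro C₁ C₂ ⟨S₁, h1, hm1, H1⟩ ⟨S₂, h2, hm2, H2⟩
      refine ⟨S₁ ∪ S₂, Set.union_subset_union h1 h2, hm1.union hm2, fun S' hS' hm' => ?_⟩
      have a1 := H1 (S' ∩ S₁) Set.inter_subset_right (hm'.inter hm1)
      have a2 := H2 (S' \ S₁) (fun h hh => (hS' hh.1).resolve_left hh.2) (hm'.diff hm1)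
      have e : S' = S' ∩ S₁ ∪ S' \ S₁ := (Set.inter_union_sdiff S' S₁).symm
      refine ⟨(a1.1.add a2.1).congr fun u hu => ?_, fun u hu => ?_⟩
      · conv_lhs => rw [e]
        exact setIntegral_union (Set.disjoint_sdiff_inter.symm) (hm'.diff hm1) (a1.2 u hu)
          (a2.2 u hu)
      · rw [e]
        exact (a1.2 u hu).union (a2.2 u hu)
    · intro h hh
      have hhm : 𝒢.src h = m := hCm hh
      subst hhm
      obtain ⟨U', ψ', W', r', hψ', hW'⟩ := exists_isLocalParam_fibre 𝒢.isSubmersion_src h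
      obtain ⟨Q', hQ', hhQ', hQU'⟩ := exists_compact_subset hψ'.isOpen_dom (hψ'.ret_mem h hW' rfl)
      have hO : IsOpen (W' ∩ r' ⁻¹' interior Q') :=
        hψ'.contMDiffOn_ret.continuousOn.isOpen_inter_preimage hψ'.isOpen_nhd isOpen_interior
      refine ⟨C ∩ (W' ∩ r' ⁻¹' interior Q'), Filter.inter_mem self_mem_nhdsWithin
        (mem_nhdsWithin_of_mem_nhds (hO.mem_nhds ⟨hW', hhQ'⟩)),
        𝒢.src ⁻¹' {𝒢.src h} ∩ (W' ∩ r' ⁻¹' interior Q'), Set.inter_subset_inter_left _ hCm,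
        (𝒢.measurableSet_src_fibre _).inter hO.measurableSet, fun S' hS' hm' => ?_⟩
      refine 𝒢.contDiffOn_setIntegral_mul_inv hμ rfl hψ hψ' hf hQ' hQU' hm' fun a ha => ?_
      obtain ⟨h1, h2, h3⟩ := hS' ha
      exact ⟨r' a, interior_subset h3, hψ'.param_ret a h2 h1⟩
  obtain ⟨S, hCS, hS, H⟩ := key
  have h1 := ((H S subset_rfl hS).1.contDiffAt (hψ.isOpen_dom.mem_nhds hu₀))
  refine (h1.congr_of_eventuallyEq ?_).contDiffWithinAt
  filter_upwards [isOpen_interior.mem_nhds hu₀Q] with u hu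
  symm
  refine setIntegral_eq_integral_of_ae_compl_eq_zero ?_
  have h2 : ∀ᵐ h ∂(μ m), 𝒢.src h = m := hμ.support m
  filter_upwards [h2] with h hh hhS
  by_contra hne
  exact hhS (hCS (hCK u (interior_subset hu) h hh (subset_tsupport f hne)))

/-- Smooth invariant measures on the source fibres form a right Haar measure. -/
theorem isRightHaar_of_invariant (hμ : IsSmoothOnFibres (E := E) (F := F) 𝒢.src μ)
    (hinv : ∀ (g : G) (A : Set G), MeasurableSet A →
      μ (𝒢.tgt g) {h | 𝒢.src h = 𝒢.tgt g ∧ 𝒢.mul h g ∈ A} = μ (𝒢.src g) A) :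
    𝒢.IsRightHaar μ := by
  refine ⟨hμ, hinv, fun f hf hfc m g₀ hg₀ => ?_⟩
  obtain rfl : 𝒢.src g₀ = m := hg₀
  obtain ⟨U, ψ, W, r, hψ, hW⟩ := exists_isLocalParam_fibre 𝒢.isSubmersion_src g₀
  have h1 := 𝒢.contDiffOn_integral_mul_inv hμ hψ hf hfc
  have h2 : ContMDiffAt 𝓘(ℝ, E) 𝓘(ℝ, ℝ) ∞
      ((fun u => ∫ h, f (𝒢.mul h (𝒢.inv (ψ u))) ∂(μ (𝒢.src g₀))) ∘ r) g₀ :=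
    (h1.contDiffAt (hψ.isOpen_dom.mem_nhds (hψ.ret_mem g₀ hW rfl))).contMDiffAt.comp g₀
      (hψ.contMDiffOn_ret.contMDiffAt (hψ.isOpen_nhd.mem_nhds hW))
  -- Right invariance replaces the varying domain of integration s⁻¹(t(g)) by the fixed fibre
  -- s⁻¹(m), moving the dependence on g into the integrand f(hg⁻¹).
  have hF : ∀ g ∈ W, g ∈ 𝒢.src ⁻¹' {𝒢.src g₀} → ∫ h, f h ∂(μ (𝒢.tgt g)) =
      ((fun u => ∫ h, f (𝒢.mul h (𝒢.inv (ψ u))) ∂(μ (𝒢.src g₀))) ∘ r) g := by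
    intro g hg hgs
    rw [𝒢.integral_tgt_eq_of_invariant hμ.support hinv hf.continuous g,
      Function.comp_apply, hψ.param_ret g hg hgs, show 𝒢.src g = _ from hgs]
  refine h2.contMDiffWithinAt.congr_of_eventuallyEq ?_ (hF g₀ hW rfl)
  filter_upwards [self_mem_nhdsWithin, mem_nhdsWithin_of_mem_nhds (hψ.isOpen_nhd.mem_nhds hW)] with
    g h3 h4 using hF g h4 h3

end LieGroupoid

/-! ### Inversion -/

namespace LieGroupoid

section Inversion

variable {E F G M : Type*} [NormedAddCommGroup E] [NormedSpace ℝ E]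
  [NormedAddCommGroup F] [NormedSpace ℝ F]
  [TopologicalSpace G] [ChartedSpace E G] [MeasurableSpace G] [BorelSpace G]
  [TopologicalSpace M] [ChartedSpace F M] (𝒢 : LieGroupoid E F G M)

/-- Inversion as a homeomorphism. -/
def invHomeomorph : G ≃ₜ G where
  toFun := 𝒢.inv
  invFun := 𝒢.inv
  left_inv := 𝒢.inv_inv
  right_inv := 𝒢.inv_inv
  continuous_toFun := 𝒢.contMDiff_inv.continuous
  continuous_invFun := 𝒢.contMDiff_inv.continuous

/-- Inversion as an isomorphism of measurable spaces. -/
def invMeasurableEquiv : G ≃ᵐ G := 𝒢.invHomeomorph.toMeasurableEquiv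

theorem map_inv_apply (μ : Measure G) (A : Set G) : μ.map 𝒢.inv A = μ (𝒢.inv ⁻¹' A) :=
  𝒢.invMeasurableEquiv.map_apply A

theorem preimage_inv_inv (A : Set G) : 𝒢.inv ⁻¹' (𝒢.inv ⁻¹' A) = A := by
  ext g
  rw [Set.mem_preimage, Set.mem_preimage, 𝒢.inv_inv]

theorem measurableSet_preimage_inv {A : Set G} (hA : MeasurableSet A) :
    MeasurableSet (𝒢.inv ⁻¹' A) := 𝒢.invMeasurableEquiv.measurable hA

theorem map_inv_map_inv (μ : Measure G) : (μ.map 𝒢.inv).map 𝒢.inv = μ := by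
  ext A _
  rw [𝒢.map_inv_apply, 𝒢.map_inv_apply, 𝒢.preimage_inv_inv]

theorem map_inv_withDensity (μ : Measure G) (f : G → ENNReal) :
    (μ.withDensity f).map 𝒢.inv = (μ.map 𝒢.inv).withDensity fun g => f (𝒢.inv g) := by
  ext A hA
  rw [𝒢.map_inv_apply, withDensity_apply _ (𝒢.measurableSet_preimage_inv hA),
    withDensity_apply _ hA]
  change _ = ∫⁻ g in A, f (𝒢.inv g) ∂(μ.map 𝒢.invMeasurableEquiv)
  rw [𝒢.invMeasurableEquiv.restrict_map, lintegral_map_equiv]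
  exact lintegral_congr fun g => by rw [show 𝒢.invMeasurableEquiv g = 𝒢.inv g from rfl, 𝒢.inv_inv]

/-- From s ∘ inv = t and inv ∘ inv = id, the differential of inversion maps ker dt isomorphically
onto ker ds. -/
theorem isPatch_inv {m : M} {k : ℕ} {U : Set (Fin k → ℝ)} {φ : (Fin k → ℝ) → G}
    (h : IsPatch (E := E) (𝒢.tgt ⁻¹' {m}) (fun g => {v | mfderiv 𝓘(ℝ, E) 𝓘(ℝ, F) 𝒢.tgt g v = 0})
      k U φ) :
    IsPatch (E := E) (𝒢.src ⁻¹' {m}) (fun g => {v | mfderiv 𝓘(ℝ, E) 𝓘(ℝ, F) 𝒢.src g v = 0})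
      k U fun u => 𝒢.inv (φ u) := by
  have hinv : ∀ g, MDifferentiableAt 𝓘(ℝ, E) 𝓘(ℝ, E) 𝒢.inv g := fun g =>
    (𝒢.contMDiff_inv g).mdifferentiableAt (by simp)
  let D : (g : G) → E →L[ℝ] E := fun g => mfderiv 𝓘(ℝ, E) 𝓘(ℝ, E) 𝒢.inv g
  have hDs : ∀ (g : G) (v : E), 𝒢.dsrc (𝒢.inv g) (D g v) = 𝒢.dtgt g v := by
    intro g v
    have h1 := mfderiv_comp g (𝒢.mdifferentiableAt_src (𝒢.inv g)) (hinv g)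
    rw [show 𝒢.src ∘ 𝒢.inv = 𝒢.tgt from funext 𝒢.src_inv] at h1
    exact (congrArg (fun L : E →L[ℝ] F => L v) h1).symm
  have hDD : ∀ (g : G) (v : E), D (𝒢.inv g) (D g v) = v := by
    intro g v
    have h1 := mfderiv_comp g (hinv (𝒢.inv g)) (hinv g)
    rw [show 𝒢.inv ∘ 𝒢.inv = id from funext 𝒢.inv_inv, mfderiv_id] at h1
    exact (congrArg (fun L : E →L[ℝ] E => L v) h1).symm
  have hφ : ∀ u ∈ U, ∀ w : Fin k → ℝ, mfderiv 𝓘(ℝ, Fin k → ℝ) 𝓘(ℝ, E) (fun u => 𝒢.inv (φ u)) u w =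
      D (φ u) (dparam (E := E) φ u w) := by
    intro u hu w
    have h1 := mfderiv_comp u (hinv (φ u))
      ((h.contMDiffOn.contMDiffAt (h.isOpen.mem_nhds hu)).mdifferentiableAt (by simp))
    exact congrArg (fun L : (Fin k → ℝ) →L[ℝ] E => L w) h1
  refine ⟨h.isOpen, 𝒢.contMDiff_inv.comp_contMDiffOn h.contMDiffOn, fun u hu v hv huv => ?_,
    fun u hu => (𝒢.src_inv _).trans (h.mem u hu), fun u hu v w hvw => ?_, fun u hu => ?_⟩
  · exact h.injOn hu hv (𝒢.invHomeomorph.injective huv)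
  · apply h.injective_mfderiv u hu
    have h1 := congrArg (D (𝒢.inv (φ u))) ((hφ u hu v).symm.trans (hvw.trans (hφ u hu w)))
    rw [hDD, hDD] at h1
    exact h1
  · have h1 := h.range_mfderiv u hu
    ext v
    constructor
    · rintro ⟨w, rfl⟩
      rw [hφ u hu w]
      have h2 : dparam (E := E) φ u w ∈ {v : E | 𝒢.dtgt (φ u) v = 0} := by
        change _ ∈ {v | mfderiv 𝓘(ℝ, E) 𝓘(ℝ, F) 𝒢.tgt (φ u) v = 0}
        rw [← h1]
        exact ⟨w, rfl⟩
      exact (hDs _ _).trans h2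
    · intro hv
      have h4 := hDD (𝒢.inv (φ u)) v
      rw [𝒢.inv_inv] at h4
      have h2 : D (𝒢.inv (φ u)) v ∈ {v | mfderiv 𝓘(ℝ, E) 𝓘(ℝ, F) 𝒢.tgt (φ u) v = 0} :=
        (hDs (φ u) (D (𝒢.inv (φ u)) v)).symm.trans ((congrArg _ h4).trans hv)
      rw [← h1] at h2
      obtain ⟨w, hw⟩ := h2
      exact ⟨w, (hφ u hu w).trans ((congrArg (D (φ u)) hw).trans h4)⟩

/-- Inversion takes right Haar measures to left Haar measures. -/
theorem IsRightHaar.map_inv {μ : M → Measure G} (hμ : 𝒢.IsRightHaar μ) :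
    𝒢.IsLeftHaar fun m => (μ m).map 𝒢.inv := by
  refine ⟨⟨fun m => ?_, fun m k U φ hφ => ?_⟩, fun g A hA => ?_, fun f hf hfc m => ?_⟩
  · rw [𝒢.map_inv_apply]
    convert hμ.smooth_fibres.support m using 2
    ext g
    rw [Set.mem_preimage, Set.mem_ofPred_eq, 𝒢.tgt_inv]
    rfl
  · obtain ⟨ρ, hρ, hp, h⟩ := hμ.smooth_fibres.density m k U _ (𝒢.isPatch_inv hφ)
    refine ⟨ρ, hρ, hp, fun A hA hAm => ?_⟩
    rw [← h A hA hAm, 𝒢.map_inv_apply, ← Set.image_image 𝒢.inv φ A]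
    exact congrArg _ (𝒢.invHomeomorph.toEquiv.image_eq_preimage_symm (φ '' A)).symm
  · have h := hμ.invariant (𝒢.inv g) _ (𝒢.measurableSet_preimage_inv hA)
    rw [𝒢.tgt_inv, 𝒢.src_inv] at h
    rw [𝒢.map_inv_apply, 𝒢.map_inv_apply, ← h]
    congr 1
    ext a
    simp only [Set.mem_preimage, Set.mem_ofPred_eq, 𝒢.tgt_inv]
    refine and_congr_right fun ha => ?_
    rw [𝒢.inv_mul_rev _ _ (by rw [ha, 𝒢.tgt_inv]), 𝒢.inv_inv]
  · have h := hμ.smooth_along (fun g => f (𝒢.inv g)) (hf.comp 𝒢.contMDiff_inv)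
      (hfc.comp_homeomorph 𝒢.invHomeomorph) m
    refine (h.comp (t := 𝒢.src ⁻¹' {m}) 𝒢.contMDiff_inv.contMDiffOn (s := 𝒢.tgt ⁻¹' {m})
      fun g hg => (𝒢.src_inv g).trans hg).congr fun g hg => ?_
    rw [Function.comp_apply, 𝒢.tgt_inv]
    exact integral_map_equiv 𝒢.invMeasurableEquiv f

end Inversion

section Torsor

variable {E F G M : Type*} [NormedAddCommGroup E] [NormedSpace ℝ E] [FiniteDimensional ℝ E]
  [NormedAddCommGroup F] [NormedSpace ℝ F]
  [TopologicalSpace G] [SecondCountableTopology G] [ChartedSpace E G] [MeasurableSpace G]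
  [BorelSpace G] [TopologicalSpace M] [T1Space M] [ChartedSpace F M] (𝒢 : LieGroupoid E F G M)

/-- Inversion sends kh⁻¹ to hk⁻¹, and replacing k⁻¹ by k costs nothing because a bi-invariant Haar
measure is inversion invariant. -/
theorem map_inv_rightTorsorMeasure {η : (x : M) → Measure (𝒢.Isotropy x)} (m y : M)
    [(η y).IsHaarMeasure] [(η y).IsMulRightInvariant] :
    (𝒢.rightTorsorMeasure η m y).map 𝒢.inv = 𝒢.leftTorsorMeasure η m y := by
  by_cases H : ∃ h, 𝒢.src h = y ∧ 𝒢.tgt h = m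
  · obtain ⟨h1, h2⟩ := H.choose_spec
    rw [leftTorsorMeasure, dif_pos H]
    set h := H.choose
    have ht : 𝒢.tgt (𝒢.inv h) = y := (𝒢.tgt_inv h).trans h1
    have hm : Measurable 𝒢.inv := 𝒢.invMeasurableEquiv.measurable
    rw [𝒢.rightTorsorMeasure_eq_map (𝒢.inv h) ((𝒢.src_inv h).trans h2) ht,
      Measure.map_map hm (𝒢.continuous_mul_right _ ht).measurable]
    conv_rhs => rw [← inv_eq_self_of_isHaarMeasure (η y), Measure.inv]
    rw [Measure.map_map (𝒢.continuous_mul_left h h1).measurable measurable_inv]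
    congr 1
    funext k
    change 𝒢.inv (𝒢.mul k.1 (𝒢.inv h)) = 𝒢.mul h (𝒢.inv k.1)
    rw [𝒢.inv_mul_rev _ _ (k.2.1.trans ht.symm), 𝒢.inv_inv]
  · rw [leftTorsorMeasure, dif_neg H, rightTorsorMeasure, dif_neg, Measure.map_zero]
    rintro ⟨h, h1, h2⟩
    exact H ⟨𝒢.inv h, (𝒢.src_inv h).trans h2, (𝒢.tgt_inv h).trans h1⟩

end Torsor

end LieGroupoid

/-! ### The Haar property, and transfer to the target fibres -/

namespace SymplecticGroupoid

variable {E F G M : Type*} [NormedAddCommGroup E] [NormedSpace ℝ E] [FiniteDimensional ℝ E]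
  [NormedAddCommGroup F] [NormedSpace ℝ F] [FiniteDimensional ℝ F]
  [TopologicalSpace G] [SecondCountableTopology G] [ChartedSpace E G] [IsManifold 𝓘(ℝ, E) ∞ G]
  [MeasurableSpace G] [BorelSpace G]
  [TopologicalSpace M] [T2Space M] [SecondCountableTopology M] [ChartedSpace F M]
  [IsManifold 𝓘(ℝ, F) ∞ M] [MeasurableSpace M] [BorelSpace M] {𝒢 : SymplecticGroupoid E F G M}

theorem IsCanonicalRight.isRightHaar {μ : M → Measure G} (hμ : 𝒢.IsCanonicalRight μ) :
    𝒢.IsRightHaar μ := by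
  obtain ⟨η, h, rfl⟩ := isCanonicalRight_iff.1 hμ
  exact 𝒢.isRightHaar_of_invariant h.isSmoothOnFibres h.canonicalMeasure_invariant

theorem IsCanonicalRight.map_inv {μ : M → Measure G} (hμ : 𝒢.IsCanonicalRight μ) :
    𝒢.IsCanonicalLeft fun m => (μ m).map 𝒢.inv := by
  obtain ⟨η, vol, h, hvol, H⟩ := hμ
  refine ⟨η, vol, h, hvol, fun m => ⟨?_, fun x A hA hAx => ?_⟩⟩
  · rw [𝒢.map_inv_apply]
    convert (H m).1 using 2
    ext g
    rw [Set.mem_preimage, Set.mem_ofPred_eq, 𝒢.tgt_inv]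
    rfl
  · rw [𝒢.map_inv_apply, (H m).2 x _ (𝒢.measurableSet_preimage_inv hA) fun g hg => by
      have h1 := hAx hg
      rwa [Set.mem_preimage, 𝒢.src_inv] at h1]
    refine lintegral_congr fun y => ?_
    have := h.haar y
    have := h.right_invariant y
    rw [← 𝒢.map_inv_rightTorsorMeasure, 𝒢.map_inv_apply]

theorem IsCanonicalLeft.map_inv {ν : M → Measure G} (hν : 𝒢.IsCanonicalLeft ν) :
    𝒢.IsCanonicalRight fun m => (ν m).map 𝒢.inv := by
  obtain ⟨η, vol, h, hvol, H⟩ := hν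
  refine ⟨η, vol, h, hvol, fun m => ⟨?_, fun x A hA hAx => ?_⟩⟩
  · rw [𝒢.map_inv_apply]
    convert (H m).1 using 2
    ext g
    rw [Set.mem_preimage, Set.mem_ofPred_eq, 𝒢.src_inv]
    rfl
  · rw [𝒢.map_inv_apply, (H m).2 x _ (𝒢.measurableSet_preimage_inv hA) fun g hg => by
      have h1 := hAx hg
      rwa [Set.mem_preimage, 𝒢.tgt_inv] at h1]
    refine lintegral_congr fun y => ?_
    have := h.haar y
    have := h.right_invariant y
    rw [← 𝒢.map_inv_rightTorsorMeasure, 𝒢.map_inv_apply, 𝒢.preimage_inv_inv]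

theorem isCanonicalLeft_iff {ν : M → Measure G} :
    𝒢.IsCanonicalLeft ν ↔ 𝒢.IsCanonicalRight fun m => (ν m).map 𝒢.inv := by
  refine ⟨IsCanonicalLeft.map_inv, fun h => ?_⟩
  have h1 := h.map_inv
  simp only [𝒢.map_inv_map_inv] at h1
  exact h1

theorem IsCanonicalLeft.isLeftHaar {ν : M → Measure G} (hν : 𝒢.IsCanonicalLeft ν) :
    𝒢.IsLeftHaar ν := by
  have h1 := hν.map_inv.isRightHaar.map_inv
  simp only [𝒢.map_inv_map_inv] at h1
  exact h1

theorem IsCanonicalLeft.iff_casimir {ν ν' : M → Measure G} (hν : 𝒢.IsCanonicalLeft ν) :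
    𝒢.IsCanonicalLeft ν' ↔ ∃ c, 𝒢.IsPosCasimir c ∧
      ∀ m, ν' m = (ν m).withDensity fun g => ENNReal.ofReal (c (𝒢.src g)) := by
  rw [isCanonicalLeft_iff, hν.map_inv.iff_casimir]
  refine exists_congr fun c => and_congr_right fun _ => forall_congr' fun m => ?_
  have e : (fun g => ENNReal.ofReal (c (𝒢.tgt g))) =
      fun g => ENNReal.ofReal (c (𝒢.src (𝒢.inv g))) := by
    funext g
    rw [𝒢.src_inv]
  rw [e, ← 𝒢.map_inv_withDensity _ fun g => ENNReal.ofReal (c (𝒢.src g))]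
  constructor
  · intro h
    have h1 := congrArg (Measure.map 𝒢.inv) h
    rwa [𝒢.map_inv_map_inv, 𝒢.map_inv_map_inv] at h1
  · exact congrArg _

end SymplecticGroupoid

theorem mainTheorem8 {E F G M : Type*}
    [NormedAddCommGroup E] [NormedSpace ℝ E] [FiniteDimensional ℝ E]
    [NormedAddCommGroup F] [NormedSpace ℝ F] [FiniteDimensional ℝ F]
    [TopologicalSpace G] [SecondCountableTopology G] [ChartedSpace E G]
    [IsManifold 𝓘(ℝ, E) ∞ G] [MeasurableSpace G] [BorelSpace G]
    [TopologicalSpace M] [T2Space M] [SecondCountableTopology M] [ChartedSpace F M]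
    [IsManifold 𝓘(ℝ, F) ∞ M] [MeasurableSpace M] [BorelSpace M]
    (𝒢 : SymplecticGroupoid E F G M) (hG : 𝒢.toLieGroupoid.IsotropyUnimodular) :
    -- right Haar measures on the source fibres
    ((∃ μ, 𝒢.IsCanonicalRight μ) ∧
      (∀ μ, 𝒢.IsCanonicalRight μ → 𝒢.toLieGroupoid.IsRightHaar μ) ∧
      (∀ μ, 𝒢.IsCanonicalRight μ → ∀ μ', 𝒢.IsCanonicalRight μ' ↔
        ∃ c, 𝒢.IsPosCasimir c ∧
          ∀ m, μ' m = (μ m).withDensity (fun g => ENNReal.ofReal (c (𝒢.tgt g))))) ∧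
    -- left Haar measures on the target fibres
    ((∃ ν, 𝒢.IsCanonicalLeft ν) ∧
      (∀ ν, 𝒢.IsCanonicalLeft ν → 𝒢.toLieGroupoid.IsLeftHaar ν) ∧
      (∀ ν, 𝒢.IsCanonicalLeft ν → ∀ ν', 𝒢.IsCanonicalLeft ν' ↔
        ∃ c, 𝒢.IsPosCasimir c ∧
          ∀ m, ν' m = (ν m).withDensity (fun g => ENNReal.ofReal (c (𝒢.src g))))) ∧
    -- the two are exchanged by inversion
    (∀ μ, 𝒢.IsCanonicalRight μ → 𝒢.IsCanonicalLeft (fun m => (μ m).map 𝒢.inv)) := by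

  refine ⟨⟨SymplecticGroupoid.exists_isCanonicalRight hG, fun μ hμ => hμ.isRightHaar,
    fun μ hμ μ' => hμ.iff_casimir⟩, ⟨?_, fun ν hν => hν.isLeftHaar,
    fun ν hν ν' => hν.iff_casimir⟩, fun μ hμ => hμ.map_inv⟩
  obtain ⟨μ, hμ⟩ := SymplecticGroupoid.exists_isCanonicalRight hG
  exact ⟨_, hμ.map_inv⟩
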